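/- For a positive integer $n$ let $r_3(n)$ be the number of ordered triples of positive integers $(x_1,x_2,x_3)$ with $x_1^3+x_2^3+x_3^3=n$. For integers $q\ge 1$ and $a$ let $\rho(q,a)$ be the number of solutions modulo $q$ of $l_1^3+l_2^3+l_3^3\equiv a \pmod q$. For real $x,Q$ put $$V(x,Q)=\sum_{q\le Q}\sum_{a=1}^{q}\Big|\sum_{\substack{n\le x\\ n\equiv a\,(\mathrm{mod}\, q)}} r_3(n)-\Gamma\big(\tfrac43\big)^3x\,\frac{\rho(q,a)}{q^3}\Big|^2 .$$ With $e(t)=e^{2\pi i t}$ let $S(q,c)=\sum_{m=1}^q e(cm^3/q)$, and let $$A_1=\Gamma\big(\tfrac43\big)^6\sum_{q=1}^\infty\frac1{q^6}\sum_{\substack{c=1\\(c,q)=1}}^q|S(q,c)|^6,\qquad A_2=-\tfrac95\,\Gamma\big(\tfrac43\big)^6\,\zeta\big(-\tfrac23\big)\,D_0\big(-\tfrac53\big),$$ where $$D_0(s)=\prod_{p\ne3}\Big(1+\frac1{p^{s+7}}\sum_{c=1}^{p-1}|S(p,c)|^6+\frac{p-1}{p^{2s+7}}-\frac1{p^{3s+7}}\Big)\cdot\Big(1+\frac1{3^{2s+14}}\sum_{\substack{c=1\\(c,3)=1}}^{9}|S(9,c)|^6-\frac1{3^{3s+7}}\Big),$$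 the product being over the primes $p\neq 3$. Let $$U_0(x,Q)=V(x,Q)-Q\sum_{n\le x}r_3(n)^2+A_1Qx-A_2Q^{5/3}x^{1/3},$$ and let $$A^+=\limsup_{x\to\infty}\frac{\log\sum_{n\le x}r_3(n)^2}{\log x},\qquad A^-=\liminf_{x\to\infty}\frac{\log\sum_{n\le x}r_3(n)^2}{\log x}.$$ **Theorem 1.** The series defining $A_1$ and the Euler product defining $D_0(-5/3)$ converge (absolutely). Let $\varepsilon>0$ and $0<\delta<\frac13$. Then for all sufficiently large real $x$ and all real $Q$ with $x^{1/2}\log x\le Q\le x$, $$U_0(x,Q)\ll x^{\frac{10}{9}+\frac23A^++\varepsilon}+Q^{2-\delta}x^{\delta}.$$ Moreover, if $A^-=A^+$ (that is, if $\lim_{x\to\infty}\log\big(\sum_{n\le x}r_3(n)^2\big)/\log x$ exists), then for all such $x$ and $Q$ $$U_0(x,Q)\ll x^{\frac{10}{9}+\varepsilon}\Big(\sum_{n\le x}r_3(n)^2\Big)^{\frac23}+Q^{2-\delta}x^{\delta}.$$ The implied constants, and how large $x$ has to be, depend only on $\varepsilon$ and $\delta$. -/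

import Mathlib

open Real Filter Finset

noncomputable section

namespace CubeVariance

/-- `r₃(n)`: the number of ordered representations of `n` as a sum of three positive cubes
(each of the three cube roots is at most `n`, so the search box loses nothing). -/
def r3 (n : ℕ) : ℕ :=
  ((Icc 1 n ×ˢ Icc 1 n ×ˢ Icc 1 n).filter
    fun t : ℕ × ℕ × ℕ => t.1 ^ 3 + t.2.1 ^ 3 + t.2.2 ^ 3 = n).card

/-- `∑_{n ≤ x} r₃(n)²`. -/
def r3SqSum (x : ℝ) : ℝ := ∑ n ∈ Icc 1 ⌊x⌋₊, (r3 n : ℝ) ^ 2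

/-- `Υ(x; q, a)`: the sum of `r₃(n)` over `n ≤ x` with `n ≡ a (mod q)`. -/
def upsilon (x : ℝ) (q a : ℕ) : ℝ :=
  ∑ n ∈ (Icc 1 ⌊x⌋₊).filter (fun n => n ≡ a [MOD q]), (r3 n : ℝ)

/-- `ρ(q, a)`: the number of solutions modulo `q` of `l₁³ + l₂³ + l₃³ ≡ a (mod q)`. -/
def rho (q a : ℕ) : ℕ :=
  ((range q ×ˢ range q ×ˢ range q).filter
    fun l : ℕ × ℕ × ℕ => l.1 ^ 3 + l.2.1 ^ 3 + l.2.2 ^ 3 ≡ a [MOD q]).card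

/-- The variance
`V(x, Q) = ∑_{q ≤ Q} ∑_{a = 1}^q |Υ(x; q, a) - Γ(4/3)³ x ρ(q, a) q⁻³|²`. -/
def V (x Q : ℝ) : ℝ :=
  ∑ q ∈ Icc 1 ⌊Q⌋₊, ∑ a ∈ Icc 1 q,
    |upsilon x q a - Gamma (4 / 3) ^ 3 * x * (rho q a : ℝ) / (q : ℝ) ^ 3| ^ 2

/-- The additive character `e(t) = exp(2πit)`. -/
def e (t : ℝ) : ℂ := Complex.exp (2 * (π : ℂ) * Complex.I * (t : ℂ))

/-- The cubic Gauss sum `S(q, c) = ∑_{m = 1}^q e(c m³ / q)`. -/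
def S (q c : ℕ) : ℂ := ∑ m ∈ Icc 1 q, e ((c : ℝ) * (m : ℝ) ^ 3 / (q : ℝ))

/-- The sum of `|S(q, c)|⁶` over `1 ≤ c ≤ q` with `(c, q) = 1`. -/
def gaussMoment (q : ℕ) : ℝ :=
  ∑ c ∈ (Icc 1 q).filter (fun c => c.Coprime q), ‖S q c‖ ^ 6

/-- The general term `q⁻⁶ ∑_{(c, q) = 1} |S(q, c)|⁶` of the series in `A₁`
(it vanishes at `q = 0`, where the inner sum is empty). -/
def A1Term (q : ℕ) : ℝ := 1 / (q : ℝ) ^ 6 * gaussMoment q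

/-- `A₁ = Γ(4/3)⁶ ∑_{q ≥ 1} q⁻⁶ ∑_{(c, q) = 1} |S(q, c)|⁶`. -/
def A1 : ℝ := Gamma (4 / 3) ^ 6 * ∑' q : ℕ, A1Term q

/-- The Euler factor of `D₀(s)` at a prime `p ≠ 3`. -/
def D0Factor (s : ℂ) (p : ℕ) : ℂ :=
  1 + 1 / (p : ℂ) ^ (s + 7) * (∑ c ∈ Icc 1 (p - 1), ((‖S p c‖ ^ 6 : ℝ) : ℂ))
    + ((p : ℂ) - 1) / (p : ℂ) ^ (2 * s + 7) - 1 / (p : ℂ) ^ (3 * s + 7)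

/-- The Euler factor of `D₀(s)` at the prime `3`. -/
def D0Factor3 (s : ℂ) : ℂ :=
  1 + 1 / (3 : ℂ) ^ (2 * s + 14)
      * (∑ c ∈ (Icc 1 9).filter (fun c => c.Coprime 3), ((‖S 9 c‖ ^ 6 : ℝ) : ℂ))
    - 1 / (3 : ℂ) ^ (3 * s + 7)

/-- The Euler product `D₀(s)`. -/
def D0 (s : ℂ) : ℂ :=
  (∏' p : {p : ℕ // p.Prime ∧ p ≠ 3}, D0Factor s p) * D0Factor3 s

/-- `A₂ = -(9/5) Γ(4/3)⁶ ζ(-2/3) D₀(-5/3)`, as a complex number. -/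
def A2 : ℂ :=
  -(9 / 5) * ((Gamma (4 / 3) ^ 6 : ℝ) : ℂ) * riemannZeta (-2 / 3) * D0 (-5 / 3)

/-- `U₀(x, Q) = V(x, Q) - Q ∑_{n ≤ x} r₃(n)² + A₁ Q x - A₂ Q^{5/3} x^{1/3}`. -/
def U0 (x Q : ℝ) : ℂ :=
  ((V x Q - Q * r3SqSum x + A1 * Q * x : ℝ) : ℂ)
    - A2 * ((Q ^ (5 / 3 : ℝ) * x ^ (1 / 3 : ℝ) : ℝ) : ℂ)

/-- The upper exponent `A⁺ = limsup_{x → ∞} log (∑_{n ≤ x} r₃(n)²) / log x`. The quotient lies in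
`[0, 2]` for `x ≥ 3`, because `1 ≤ ∑_{n ≤ x} r₃(n)² ≤ (∑_{n ≤ x} r₃(n))² ≤ x²` there, so this is a
genuine limsup of a bounded function. -/
def upperExponent : ℝ :=
  limsup (fun x : ℝ => Real.log (r3SqSum x) / Real.log x) atTop

/-- The lower exponent `A⁻ = liminf_{x → ∞} log (∑_{n ≤ x} r₃(n)²) / log x`. -/
def lowerExponent : ℝ :=
  liminf (fun x : ℝ => Real.log (r3SqSum x) / Real.log x) atTop

end CubeVariance

end

noncomputable section

namespace CubeVariance

/-! ### Additive characters and Fourier analysis on residue classes -/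

/-! Write `R` for the mean square of `r₃` up to `x`. After squaring out, a modulus `q` contributes
`R`, twice the off-diagonal pairs `m < n` with `q ∣ n - m`, a density term, and a cross term between
density and error. Summed over `q ≤ Q`, the off-diagonal part counts divisors of `n - m` up to `Q`.
It equals the count of all divisors minus the count of those beyond `Q`; the latter are written `n -
m = q h` and indexed by the complementary divisor `h < x / Q` (`sum_dvd_switch`). These `h` are
small moduli, for which representations in residue classes are counted as lattice points
(`sum_En_sq_le`). The full divisor sum `divSum` does not depend on `Q` and is never evaluated: it is
eliminated by comparison with a short range of moduli, where the variance itself is small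
(`Scale.V_two_mul_avgLen_le`).

A sharp cut-off `n - m > Q h` would permit partial summation in one variable only. Hence `Q` runs
over `K` consecutive integers, which turns the cut-off into the ramp `trap`; partial summation then
applies in both variables and leaves products of two error terms in progressions. Monotonicity of
the variance in `Q` removes the averaging at a cost of about `K R`. With `x = y³` and `R = w⁶ y`,
the switched error is about `y⁷ w² / K` for `h` up to `w²`, and `K ≈ y³ / w²` makes both equal to
`y⁴ w⁴ = x^(10/9) R^(2/3)`. That is the second estimate of the theorem; the first follows on
inserting `R ≤ x^(A⁺ + ε)`.

Cross terms and the short range are treated on the Fourier side. Parseval and reduction of fractions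
express them through the error of the exponential sum at `c / d`. Denominators `d ≤ w²` use the
lattice point count, larger ones the `large_sieve`.

The main term `Phi` is governed by `Gsum`, the divisor sum of `A1Term`. Sorting by divisors `d`
brings in `PP (x / (M d))`, whose elementary expansion gives the linear term and quantities
independent of `M`, and leaves the remainder `J`. Since `A1Term = bA * kA` with `bA` carried by
cubes (`gA_eq`), the sum of the remainders is a sum of `J (1 / (m³ Y))` over `m`, which is an
integral up to a small error. This yields `Q^(5/3) x^(1/3)`: the integral `intJ` is `9/5 ζ(-2/3)` by
analytic continuation of a Mellin transform (`intJ_eq`), and the series of `kA n n^(2/3)` is the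
Euler product `D₀(-5/3)` (`D0_eq`). -/

lemma e_add (s t : ℝ) : e (s + t) = e s * e t := by
  unfold e; rw [← Complex.exp_add]; push_cast; ring_nf

lemma e_intCast (n : ℤ) : e n = 1 := by
  unfold e
  rw [Complex.exp_eq_one_iff]
  exact ⟨n, by push_cast; ring⟩

lemma e_zero : e 0 = 1 := by simpa using e_intCast 0

lemma e_add_int (t : ℝ) (n : ℤ) : e (t + n) = e t := by rw [e_add, e_intCast, mul_one]

lemma conj_e (t : ℝ) : (starRingEnd ℂ) (e t) = e (-t) := by
  unfold e
  rw [← Complex.exp_conj]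
  congr 1
  simp only [map_mul, Complex.conj_ofReal, Complex.conj_I, map_ofNat]
  push_cast; ring

lemma e_natCast_mul (n : ℕ) (t : ℝ) : e (n * t) = e t ^ n := by
  unfold e
  rw [← Complex.exp_nat_mul]; push_cast; ring_nf

lemma e_eq_one_iff (t : ℝ) : e t = 1 ↔ ∃ n : ℤ, t = n := by
  constructor
  · intro h
    unfold e at h
    rw [Complex.exp_eq_one_iff] at h
    obtain ⟨n, hn⟩ := h
    refine ⟨n, ?_⟩
    have hI : (2 * (π : ℂ) * Complex.I) ≠ 0 := Complex.two_pi_I_ne_zero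
    have : (2 * (π : ℂ) * Complex.I) * (t : ℂ) = (2 * (π : ℂ) * Complex.I) * (n : ℂ) := by
      rw [hn]; ring
    exact_mod_cast mul_left_cancel₀ hI this
  · rintro ⟨n, rfl⟩; exact e_intCast n

lemma e_congr {q : ℕ} (hq : 0 < q) {a b : ℤ} (h : (q : ℤ) ∣ a - b) :
    e ((a : ℝ) / q) = e ((b : ℝ) / q) := by
  obtain ⟨k, hk⟩ := h
  have : (a : ℝ) / q = (b : ℝ) / q + (k : ℤ) := by
    have : (a : ℝ) = b + q * k := by
      have : a = b + q * k := by linarith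
      exact_mod_cast this
    rw [this]; field_simp
  rw [this, e_add_int]

lemma e_congr_nat {q : ℕ} (hq : 0 < q) {a b : ℕ} (h : a ≡ b [MOD q]) (c : ℕ) :
    e ((c : ℝ) * a / q) = e ((c : ℝ) * b / q) := by
  have := e_congr hq (a := c * a) (b := c * b) (by
    have h1 : (q : ℤ) ∣ (a : ℤ) - b := (Nat.modEq_iff_dvd.1 h.symm)
    rw [← mul_sub]; exact Dvd.dvd.mul_left h1 _)
  simpa using this

lemma sum_Icc_one_eq_sum_range {M : Type*} [AddCommMonoid M] (q : ℕ) (f : ℕ → M)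
    (h : f q = f 0) : ∑ c ∈ Icc 1 q, f c = ∑ c ∈ range q, f c := by
  rcases Nat.eq_zero_or_pos q with rfl | hq
  · simp
  · obtain ⟨k, rfl⟩ : ∃ k, q = k + 1 := ⟨q - 1, by omega⟩
    rw [Finset.sum_range_succ', ← h, ← Finset.sum_range_succ (fun c => f (c + 1)),
      Finset.range_eq_Ico, Finset.sum_Ico_add' f 0 (k + 1) 1]
    rfl

/-- Orthogonality of the additive characters modulo `q`. -/
lemma sum_e_div (q : ℕ) (hq : 0 < q) (t : ℤ) :
    ∑ c ∈ Icc 1 q, e ((c : ℝ) * t / q) = if (q : ℤ) ∣ t then (q : ℂ) else 0 := by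
  have hq' : (q : ℝ) ≠ 0 := by positivity
  have hpow : ∀ c : ℕ, e ((c : ℝ) * t / q) = e ((t : ℝ) / q) ^ c := by
    intro c; rw [← e_natCast_mul]; ring_nf
  have hone : e ((t : ℝ) / q) ^ q = 1 := by
    rw [← e_natCast_mul, mul_div_cancel₀ _ hq', e_intCast]
  rw [sum_Icc_one_eq_sum_range q _ (by rw [hpow, hpow, hone, pow_zero])]
  simp_rw [hpow]
  split_ifs with h
  · have : e ((t : ℝ) / q) = 1 := by
      rw [e_eq_one_iff]
      obtain ⟨k, rfl⟩ := h
      exact ⟨k, by push_cast; field_simp⟩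
    simp [this]
  · have : e ((t : ℝ) / q) ≠ 1 := by
      rw [Ne, e_eq_one_iff]
      rintro ⟨n, hn⟩
      apply h
      refine ⟨n, ?_⟩
      rw [div_eq_iff hq'] at hn
      have : t = n * q := by exact_mod_cast hn
      rw [this]; ring
    rw [geom_sum_eq this, hone, sub_self, zero_div]

/-- The Fourier transform on `ℤ/q`, residues represented by `1, …, q`. -/
def hat (q : ℕ) (F : ℕ → ℝ) (c : ℕ) : ℂ := ∑ a ∈ Icc 1 q, (F a : ℂ) * e ((c : ℝ) * a / q)

lemma dvd_sub_iff_eq {q a b : ℕ} (ha : a ∈ Icc 1 q) (hb : b ∈ Icc 1 q) :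
    (q : ℤ) ∣ (a : ℤ) - b ↔ a = b := by
  rw [mem_Icc] at ha hb
  constructor
  · rintro ⟨k, hk⟩
    have h1 : (a : ℤ) - b < q := by omega
    have h2 : -(q : ℤ) < (a : ℤ) - b := by omega
    rw [hk] at h1 h2
    have hq : (0 : ℤ) < q := by omega
    have : k < 1 := by nlinarith
    have : -1 < k := by nlinarith
    have : k = 0 := by omega
    subst this; omega
  · rintro rfl; simp

/-- Orthogonality collapses the double sum to its diagonal. The bilinear form, not only the square,
is needed for `crossSum`. -/
lemma parseval (q : ℕ) (hq : 0 < q) (F G : ℕ → ℝ) :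
    ∑ c ∈ Icc 1 q, hat q F c * (starRingEnd ℂ) (hat q G c)
      = q * ∑ a ∈ Icc 1 q, ((F a * G a : ℝ) : ℂ) := by
  unfold hat
  simp_rw [map_sum, map_mul, conj_e, Complex.conj_ofReal, Finset.sum_mul_sum]
  rw [Finset.sum_comm]
  rw [Finset.mul_sum]
  refine Finset.sum_congr rfl fun a ha => ?_
  rw [Finset.sum_comm]
  have : ∀ b ∈ Icc 1 q, ∑ c ∈ Icc 1 q, (F a : ℂ) * e ((c : ℝ) * a / q) *
      ((G b : ℂ) * e (-((c : ℝ) * b / q))) = if b = a then (q : ℂ) * ((F a * G a : ℝ) : ℂ) else 0 := by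
    intro b hb
    have h1 : ∀ c ∈ Icc 1 q, (F a : ℂ) * e ((c : ℝ) * a / q) *
      ((G b : ℂ) * e (-((c : ℝ) * b / q))) = (F a * G b : ℂ) *
        e ((c : ℝ) * ((a - b : ℤ) : ℝ) / q) := by
      intro c _
      rw [show (c : ℝ) * ((a - b : ℤ) : ℝ) / q = (c : ℝ) * a / q + -((c : ℝ) * b / q) by
        push_cast; ring, e_add]
      ring
    rw [Finset.sum_congr rfl h1, ← Finset.mul_sum, sum_e_div q hq]
    by_cases hab : b = a
    · subst hab; simp; ring
    · have := (dvd_sub_iff_eq ha hb).not.2 (fun h => hab h.symm)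
      rw [if_neg this, if_neg hab, mul_zero]
  rw [Finset.sum_congr rfl this, Finset.sum_ite_eq', if_pos ha]

lemma parseval_sq (q : ℕ) (hq : 0 < q) (F : ℕ → ℝ) :
    ∑ a ∈ Icc 1 q, F a ^ 2 = 1 / q * ∑ c ∈ Icc 1 q, ‖hat q F c‖ ^ 2 := by
  have h := parseval q hq F F
  simp_rw [Complex.mul_conj, Complex.normSq_eq_norm_sq] at h
  have hq' : (q : ℝ) ≠ 0 := by positivity
  have h2 : ∑ c ∈ Icc 1 q, ‖hat q F c‖ ^ 2 = q * ∑ a ∈ Icc 1 q, F a * F a := by exact_mod_cast h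
  rw [h2]; field_simp

/-- Every natural number has exactly one representative among `1, …, q`. -/
lemma sum_Icc_ite_modEq {M : Type*} [AddCommMonoid M] {q : ℕ} (hq : 0 < q) (n : ℕ)
    (f : ℕ → M) (hf : ∀ a b, a ≡ b [MOD q] → f a = f b) :
    ∑ a ∈ Icc 1 q, (if n ≡ a [MOD q] then f a else 0) = f n := by
  -- Residues are represented by `1, …, q`, so the zero class has representative `q`.
  set a₀ := if n % q = 0 then q else n % q with ha₀
  have hlt := Nat.mod_lt n hq
  have hmem : a₀ ∈ Icc 1 q := by
    rw [mem_Icc, ha₀]; split_ifs <;> omega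
  have hmod : n ≡ a₀ [MOD q] := by
    rw [ha₀]; split_ifs with h
    · simp [Nat.ModEq, h]
    · exact (Nat.mod_modEq n q).symm
  rw [Finset.sum_eq_single_of_mem a₀ hmem]
  · rw [if_pos hmod, hf _ _ hmod.symm]
  · intro b hb hne
    rw [if_neg]
    intro hnb
    apply hne
    have : b ≡ a₀ [MOD q] := hnb.symm.trans hmod
    exact (dvd_sub_iff_eq hb hmem).1 (Nat.modEq_iff_dvd.1 this.symm)

/-- Each object lies in exactly one residue class, so summing over classes restores the exponential
sum over the objects. Serves `upsilon`, `rho` and the count of cube roots. -/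
lemma hat_count {ι : Type*} (q : ℕ) (hq : 0 < q) (s : Finset ι) (φ : ι → ℕ) (w : ι → ℝ) (c : ℕ) :
    hat q (fun a => ∑ i ∈ s.filter (fun i => φ i ≡ a [MOD q]), w i) c
      = ∑ i ∈ s, (w i : ℂ) * e ((c : ℝ) * φ i / q) := by
  unfold hat
  simp_rw [Finset.sum_filter]
  push_cast
  simp_rw [Finset.sum_mul]
  rw [Finset.sum_comm]
  refine Finset.sum_congr rfl fun i _ => ?_
  rw [← sum_Icc_ite_modEq hq (φ i) (fun a => (w i : ℂ) * e ((c : ℝ) * a / q))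
    (fun a b h => by rw [e_congr_nat hq h])]
  refine Finset.sum_congr rfl fun a _ => ?_
  split_ifs <;> simp

/-- The exponential sum `∑_{n ≤ z} r₃(n) e(αn)`. -/
def expSum (z : ℝ) (α : ℝ) : ℂ := ∑ n ∈ Icc 1 ⌊z⌋₊, (r3 n : ℂ) * e (α * n)

lemma hat_upsilon (z : ℝ) (q : ℕ) (hq : 0 < q) (c : ℕ) :
    hat q (upsilon z q) c = expSum z ((c : ℝ) / q) := by
  have := hat_count q hq (Icc 1 ⌊z⌋₊) (fun n => n) (fun n => (r3 n : ℝ)) c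
  unfold upsilon expSum
  rw [this]
  refine Finset.sum_congr rfl fun n _ => ?_
  rw [show (c : ℝ) / q * n = (c : ℝ) * n / q by ring]
  simp

lemma S_eq_range (q c : ℕ) (hq : 0 < q) : S q c = ∑ m ∈ range q, e ((c : ℝ) * (m : ℝ) ^ 3 / q) := by
  unfold S
  apply sum_Icc_one_eq_sum_range
  have := e_congr_nat hq (a := q ^ 3) (b := 0 ^ 3) (by
    simpa using (Nat.modEq_zero_iff_dvd.2 (dvd_pow_self q (by norm_num)))) c
  simpa using this

/-- The three variables are independent and the character is additive, hence the cube. -/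
lemma hat_rho (q : ℕ) (hq : 0 < q) (c : ℕ) :
    hat q (fun a => (rho q a : ℝ)) c = S q c ^ 3 := by
  have := hat_count q hq (range q ×ˢ range q ×ˢ range q)
    (fun l : ℕ × ℕ × ℕ => l.1 ^ 3 + l.2.1 ^ 3 + l.2.2 ^ 3) (fun _ => (1 : ℝ)) c
  have h2 : (fun a => (rho q a : ℝ)) = (fun a => ∑ i ∈ (range q ×ˢ range q ×ˢ range q).filter
      (fun l : ℕ × ℕ × ℕ => l.1 ^ 3 + l.2.1 ^ 3 + l.2.2 ^ 3 ≡ a [MOD q]), (1 : ℝ)) := by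
    funext a; simp [rho]
  rw [h2, this, S_eq_range q c hq]
  rw [Finset.sum_product]
  simp_rw [Finset.sum_product]
  rw [pow_succ, pow_two, mul_assoc, Finset.sum_mul_sum]
  simp_rw [Finset.sum_mul_sum, Finset.mul_sum]
  refine Finset.sum_congr rfl fun a _ => ?_
  refine Finset.sum_congr rfl fun b _ => ?_
  refine Finset.sum_congr rfl fun d _ => ?_
  rw [← e_add, ← e_add]
  push_cast
  rw [one_mul]; congr 1; ring

/-- Grouping the fractions `c / q` by their reduced denominator. -/
lemma sum_Icc_eq_sum_divisors {M : Type*} [AddCommMonoid M] (Ψ : ℕ → ℕ → M)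
    (hΨ : ∀ g d c, 0 < g → 0 < d → Ψ (g * d) (g * c) = Ψ d c) (q : ℕ) (hq : 0 < q) :
    ∑ c ∈ Icc 1 q, Ψ q c
      = ∑ d ∈ q.divisors, ∑ c ∈ (Icc 1 d).filter (fun c => c.Coprime d), Ψ d c := by
  -- `q / gcd (q, c)` is the denominator of `c / q` in lowest terms.
  rw [← Finset.sum_fiberwise_of_maps_to (s := Icc 1 q) (t := q.divisors) (g := fun c => q / q.gcd c)]
  · refine Finset.sum_congr rfl fun d hd => ?_
    obtain ⟨g, rfl⟩ := Nat.dvd_of_mem_divisors hd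
    have hd0 : 0 < d := Nat.pos_of_mul_pos_right hq
    have hg0 : 0 < g := Nat.pos_of_mul_pos_left hq
    symm
    refine Finset.sum_bij (fun c _ => g * c) ?_ ?_ ?_ ?_
    · intro c hc
      simp only [mem_filter, mem_Icc] at hc ⊢
      refine ⟨⟨Nat.mul_pos hg0 hc.1.1, by rw [mul_comm d]; exact Nat.mul_le_mul_left _ hc.1.2⟩, ?_⟩
      rw [mul_comm d g, Nat.gcd_mul_left, Nat.Coprime.gcd_eq_one hc.2.symm, mul_one,
        Nat.mul_div_cancel_left _ hg0]
    · intro a _ b _ h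
      exact Nat.eq_of_mul_eq_mul_left hg0 h
    · intro c hc
      simp only [mem_filter, mem_Icc] at hc
      have hgc : (d * g).gcd c ∣ d * g := Nat.gcd_dvd_left _ _
      have hgg : (d * g).gcd c = g := by
        have h1 := Nat.div_mul_cancel hgc
        rw [hc.2] at h1
        exact Nat.eq_of_mul_eq_mul_left hd0 h1
      obtain ⟨c', hc'⟩ : g ∣ c := by rw [← hgg]; exact Nat.gcd_dvd_right _ _
      subst hc'
      refine ⟨c', ?_, rfl⟩
      simp only [mem_filter, mem_Icc]
      refine ⟨⟨Nat.pos_of_ne_zero (by rintro rfl; simp at hc), ?_⟩, ?_⟩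
      · exact Nat.le_of_mul_le_mul_left (by linarith [hc.1.2, mul_comm d g]) hg0
      · rw [mul_comm d g, Nat.gcd_mul_left] at hgg
        have : d.gcd c' = 1 := Nat.eq_of_mul_eq_mul_left hg0 (by rw [hgg, mul_one])
        exact Nat.Coprime.symm this
    · intro c hc
      rw [mul_comm d g, hΨ g d c hg0 hd0]
  · intro c hc
    exact Nat.mem_divisors.2 ⟨Nat.div_dvd_of_dvd (Nat.gcd_dvd_left _ _), hq.ne'⟩

/-- The normalised Gauss sum `S(q, c) / q`. -/
def sv (q c : ℕ) : ℂ := S q c / q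

lemma sum_range_mul_of_periodic {M : Type*} [AddCommMonoid M] (f : ℕ → M) (d g : ℕ)
    (hf : ∀ m, f (m + d) = f m) : ∑ m ∈ range (g * d), f m = g • ∑ m ∈ range d, f m := by
  have hper : ∀ k m, f (k * d + m) = f m := by
    intro k m
    induction k with
    | zero => simp
    | succ k ih => rw [← ih, ← hf (k * d + m)]; congr 1; ring
  induction g with
  | zero => simp
  | succ g ih =>
    rw [Nat.succ_mul, Finset.sum_range_add, ih, succ_nsmul]
    congr 1
    exact Finset.sum_congr rfl fun m _ => hper g m

/-- The summand has period `d`, so the longer sum is `g` copies of the shorter one. Thus the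
normalised sum depends only on the fraction, as grouping by reduced denominator requires. -/
lemma sv_mul_mul (g d c : ℕ) (hg : 0 < g) (hd : 0 < d) : sv (g * d) (g * c) = sv d c := by
  unfold sv
  rw [S_eq_range _ _ (Nat.mul_pos hg hd), S_eq_range _ _ hd]
  have h1 : ∀ m : ℕ, e (((g * c : ℕ) : ℝ) * (m : ℝ) ^ 3 / ((g * d : ℕ) : ℝ))
      = e ((c : ℝ) * (m : ℝ) ^ 3 / d) := by
    intro m; congr 1; push_cast
    have : (g : ℝ) ≠ 0 := by positivity
    have : (d : ℝ) ≠ 0 := by positivity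
    field_simp
  simp_rw [h1]
  rw [sum_range_mul_of_periodic]
  · have : (g : ℂ) ≠ 0 := by exact_mod_cast hg.ne'
    have : (d : ℂ) ≠ 0 := by exact_mod_cast hd.ne'
    rw [nsmul_eq_mul]; push_cast; field_simp
  · intro m
    have := e_congr_nat hd (a := (m + d) ^ 3) (b := m ^ 3) (by
      apply Nat.ModEq.pow; simp [Nat.ModEq]) c
    simpa using this

/-- `m₀ = Γ(4/3)³`. -/
def m0 : ℝ := Gamma (4 / 3) ^ 3

lemma m0_pos : 0 < m0 := pow_pos (Gamma_pos_of_pos (by norm_num)) 3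

/-- The error term in progressions. -/
def En (z : ℝ) (q a : ℕ) : ℝ := upsilon z q a - m0 * z * (rho q a : ℝ) / (q : ℝ) ^ 3

/-- The density `Γ(4/3)³ ρ(q, a) q⁻³`. -/
def kap (q a : ℕ) : ℝ := m0 * (rho q a : ℝ) / (q : ℝ) ^ 3

/-- The error term for the exponential sum at `c / q`. -/
def Er (z : ℝ) (q c : ℕ) : ℂ := expSum z ((c : ℝ) / q) - m0 * z * sv q c ^ 3

lemma Er_mul_mul (z : ℝ) (g d c : ℕ) (hg : 0 < g) (hd : 0 < d) :
    Er z (g * d) (g * c) = Er z d c := by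
  unfold Er
  rw [sv_mul_mul g d c hg hd]
  congr 2
  have : (g : ℝ) ≠ 0 := by positivity
  have : (d : ℝ) ≠ 0 := by positivity
  push_cast; field_simp

/-! ### Parseval for the densities and the error terms. -/

lemma hat_kap (q : ℕ) (hq : 0 < q) (c : ℕ) : hat q (kap q) c = m0 * sv q c ^ 3 := by
  have h := hat_rho q hq c
  unfold hat at h ⊢
  have hq' : (q : ℂ) ≠ 0 := by exact_mod_cast hq.ne'
  unfold sv
  rw [div_pow, ← h, Finset.sum_div, Finset.mul_sum]
  refine Finset.sum_congr rfl fun a _ => ?_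
  unfold kap; push_cast; ring

lemma En_eq (z : ℝ) (q a : ℕ) : En z q a = upsilon z q a - z * kap q a := by
  unfold En kap; ring

lemma hat_En (z : ℝ) (q : ℕ) (hq : 0 < q) (c : ℕ) : hat q (En z q) c = Er z q c := by
  have h1 := hat_upsilon z q hq c
  have h2 := hat_kap q hq c
  have : hat q (En z q) c = hat q (upsilon z q) c - z * hat q (kap q) c := by
    unfold hat
    rw [Finset.mul_sum, ← Finset.sum_sub_distrib]
    refine Finset.sum_congr rfl fun a _ => ?_
    rw [En_eq]; push_cast; ring
  rw [this, h1, h2]; unfold Er; ring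

/-- `∑_{(c, d) = 1} |Er(z; d, c)|²`. -/
def Dd (z : ℝ) (d : ℕ) : ℝ := ∑ c ∈ (Icc 1 d).filter (fun c => c.Coprime d), ‖Er z d c‖ ^ 2

lemma Dd_nonneg (z : ℝ) (d : ℕ) : 0 ≤ Dd z d := Finset.sum_nonneg fun _ _ => by positivity

lemma A1Term_eq (d : ℕ) :
    A1Term d = ∑ c ∈ (Icc 1 d).filter (fun c => c.Coprime d), ‖sv d c‖ ^ 6 := by
  unfold A1Term gaussMoment sv
  rw [Finset.mul_sum]
  refine Finset.sum_congr rfl fun c _ => ?_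
  rw [norm_div, div_pow, Complex.norm_natCast]; ring

lemma A1Term_nonneg (d : ℕ) : 0 ≤ A1Term d := by
  rw [A1Term_eq]; exact Finset.sum_nonneg fun _ _ => by positivity

/-- `G(q) = ∑_{d ∣ q} g(d)` with `g = A1Term`. -/
def Gsum (q : ℕ) : ℝ := ∑ d ∈ q.divisors, A1Term d

lemma Gsum_nonneg (q : ℕ) : 0 ≤ Gsum q := Finset.sum_nonneg fun _ _ => A1Term_nonneg _

/-- Parseval moves the variance to the frequencies `c / q`. In lowest terms each contribution
depends on its denominator alone, the form in which the large sieve applies. -/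
lemma sum_En_sq (z : ℝ) (q : ℕ) (hq : 0 < q) :
    ∑ a ∈ Icc 1 q, En z q a ^ 2 = 1 / q * ∑ d ∈ q.divisors, Dd z d := by
  rw [parseval_sq q hq]
  congr 1
  rw [Finset.sum_congr rfl fun c _ => by rw [hat_En z q hq c]]
  exact sum_Icc_eq_sum_divisors (fun q c => ‖Er z q c‖ ^ 2)
    (fun g d c hg hd => by rw [Er_mul_mul z g d c hg hd]) q hq

lemma sum_kap_sq (q : ℕ) (hq : 0 < q) :
    ∑ a ∈ Icc 1 q, kap q a ^ 2 = m0 ^ 2 * (Gsum q / q) := by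
  rw [parseval_sq q hq]
  have h1 : ∀ c ∈ Icc 1 q, ‖hat q (kap q) c‖ ^ 2 = m0 ^ 2 * ‖sv q c‖ ^ 6 := by
    intro c _
    rw [hat_kap q hq c, norm_mul, norm_pow, Complex.norm_real, Real.norm_of_nonneg m0_pos.le]; ring
  rw [Finset.sum_congr rfl h1, ← Finset.mul_sum]
  rw [sum_Icc_eq_sum_divisors (fun q c => ‖sv q c‖ ^ 6)
    (fun g d c hg hd => by rw [sv_mul_mul g d c hg hd]) q hq]
  unfold Gsum
  rw [Finset.sum_congr rfl fun d _ => A1Term_eq d]; ring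

/-- Reading `Gsum` as a second moment of solution counts gives it two uses: multiplicativity through
the Chinese remainder theorem, and control of the squared lattice point errors. -/
lemma sum_rho_sq (q : ℕ) (hq : 0 < q) :
    ∑ a ∈ Icc 1 q, (rho q a : ℝ) ^ 2 = q ^ 5 * Gsum q := by
  have h := sum_kap_sq q hq
  have hq' : (q : ℝ) ≠ 0 := by positivity
  have hm := m0_pos.ne'
  have : ∀ a ∈ Icc 1 q, kap q a ^ 2 = m0 ^ 2 / q ^ 6 * (rho q a : ℝ) ^ 2 := by
    intro a _; unfold kap; ring
  rw [Finset.sum_congr rfl this, ← Finset.mul_sum] at h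
  field_simp at h
  linarith

/-- `∑_a κ(q, a) E(z; q, a)`. -/
def crossSum (z : ℝ) (q : ℕ) : ℝ := ∑ a ∈ Icc 1 q, kap q a * En z q a

/-- Parseval followed by Cauchy–Schwarz over `c` for each denominator separately, so that small and
large `d` can later be estimated by different means. -/
lemma abs_crossSum_le (z : ℝ) (q : ℕ) (hq : 0 < q) :
    |crossSum z q| ≤ m0 / q * ∑ d ∈ q.divisors, √(A1Term d) * √(Dd z d) := by
  have hq' : (0 : ℝ) < q := by positivity
  have h := parseval q hq (kap q) (En z q)
  have h1 : ∀ c ∈ Icc 1 q, hat q (kap q) c * (starRingEnd ℂ) (hat q (En z q) c)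
      = m0 * (sv q c ^ 3 * (starRingEnd ℂ) (Er z q c)) := by
    intro c _; rw [hat_kap q hq c, hat_En z q hq c]; ring
  rw [Finset.sum_congr rfl h1, ← Finset.mul_sum,
    sum_Icc_eq_sum_divisors (fun q c => sv q c ^ 3 * (starRingEnd ℂ) (Er z q c))
    (fun g d c hg hd => by rw [sv_mul_mul g d c hg hd, Er_mul_mul z g d c hg hd]) q hq] at h
  have h2 : (q : ℂ) * (crossSum z q : ℂ) = m0 * ∑ d ∈ q.divisors,
      ∑ c ∈ (Icc 1 d).filter (fun c => c.Coprime d), sv d c ^ 3 * (starRingEnd ℂ) (Er z d c) := by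
    rw [h]; unfold crossSum; push_cast; ring
  have h3 : q * |crossSum z q| = m0 * ‖∑ d ∈ q.divisors,
      ∑ c ∈ (Icc 1 d).filter (fun c => c.Coprime d), sv d c ^ 3 * (starRingEnd ℂ) (Er z d c)‖ := by
    have := congrArg norm h2
    simpa [norm_mul, abs_of_pos m0_pos] using this
  have h4 : ‖∑ d ∈ q.divisors,
      ∑ c ∈ (Icc 1 d).filter (fun c => c.Coprime d), sv d c ^ 3 * (starRingEnd ℂ) (Er z d c)‖
      ≤ ∑ d ∈ q.divisors, √(A1Term d) * √(Dd z d) := by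
    refine (norm_sum_le _ _).trans (Finset.sum_le_sum fun d _ => ?_)
    refine (norm_sum_le _ _).trans ?_
    have := Real.sum_mul_le_sqrt_mul_sqrt ((Icc 1 d).filter (fun c => c.Coprime d))
      (fun c => ‖sv d c‖ ^ 3) (fun c => ‖Er z d c‖)
    rw [A1Term_eq, Dd]
    refine le_trans (le_of_eq ?_) (this.trans (le_of_eq ?_))
    · refine Finset.sum_congr rfl fun c _ => ?_
      simp
    · simp_rw [← pow_mul]
  rw [div_mul_eq_mul_div, le_div_iff₀ hq', mul_comm, h3]
  exact mul_le_mul_of_nonneg_left h4 m0_pos.le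

lemma Dd_le (z : ℝ) (d : ℕ) (hd : 0 < d) : Dd z d ≤ d * ∑ a ∈ Icc 1 d, En z d a ^ 2 := by
  rw [sum_En_sq z d hd]
  have hd' : (d : ℝ) ≠ 0 := by positivity
  rw [← mul_assoc, mul_one_div_cancel hd', one_mul]
  exact Finset.single_le_sum (f := fun d => Dd z d) (fun d _ => Dd_nonneg z d)
    (Nat.mem_divisors_self d hd.ne')

lemma V_eq (x Q : ℝ) : V x Q = ∑ q ∈ Icc 1 ⌊Q⌋₊, ∑ a ∈ Icc 1 q, En x q a ^ 2 := by
  unfold V En m0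
  simp_rw [sq_abs]

/-! ### The large sieve inequality -/

/-- The reduced fractions `c / d` in `(0, 1]` with `d ≤ D`. -/
def farey (D : ℕ) : Finset (Σ _ : ℕ, ℕ) :=
  (Icc 1 D).sigma fun d => (Icc 1 d).filter (fun c => c.Coprime d)

lemma mem_farey {D : ℕ} {p : Σ _ : ℕ, ℕ} :
    p ∈ farey D ↔ (1 ≤ p.1 ∧ p.1 ≤ D) ∧ (1 ≤ p.2 ∧ p.2 ≤ p.1) ∧ p.2.Coprime p.1 := by
  simp [farey]

/-- Distinct reduced fractions with denominators up to `D` are at least `1 / D²` apart, so rounding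
up to the grid of step `1 / M` separates them. Concretely, equal roundings force `|c d' - c' d| <
1`, hence equality of the fractions. -/
lemma ceil_farey_injOn {D M : ℕ} (hM : D ^ 2 ≤ M) :
    Set.InjOn (fun p : Σ _ : ℕ, ℕ => ⌈(p.2 : ℝ) / p.1 * M⌉₊) (farey D) := by
  rintro ⟨d, c⟩ hp ⟨d', c'⟩ hp' h
  rw [Finset.mem_coe, mem_farey] at hp hp'
  simp only at hp hp' h
  obtain ⟨⟨hd1, hdD⟩, ⟨hc1, hcd⟩, hco⟩ := hp
  obtain ⟨⟨hd1', hdD'⟩, ⟨hc1', hcd'⟩, hco'⟩ := hp'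
  have hd : (0 : ℝ) < d := by exact_mod_cast hd1
  have hd' : (0 : ℝ) < d' := by exact_mod_cast hd1'
  have hDM : (d : ℝ) * d' ≤ M := by
    have : d * d' ≤ M := le_trans (by rw [pow_two]; exact Nat.mul_le_mul hdD hdD') hM
    exact_mod_cast this
  have hM0 : (0 : ℝ) < M := lt_of_lt_of_le (by positivity) hDM
  have a1 := Nat.le_ceil ((c : ℝ) / d * M)
  have a2 := Nat.ceil_lt_add_one (a := (c : ℝ) / d * M) (by positivity)
  have b1 := Nat.le_ceil ((c' : ℝ) / d' * M)
  have b2 := Nat.ceil_lt_add_one (a := (c' : ℝ) / d' * M) (by positivity)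
  have hk : ((⌈(c : ℝ) / d * M⌉₊ : ℕ) : ℝ) = (⌈(c' : ℝ) / d' * M⌉₊ : ℕ) := by exact_mod_cast h
  have key : |(c : ℝ) * d' - c' * d| < 1 := by
    have e1 : (c : ℝ) / d * M - c' / d' * M = ((c : ℝ) * d' - c' * d) * (M / (d * d')) := by
      field_simp
    have e2 : |(c : ℝ) / d * M - c' / d' * M| < 1 := by rw [abs_lt]; constructor <;> linarith
    rw [e1, abs_mul, abs_of_pos (by positivity : (0 : ℝ) < M / (d * d'))] at e2
    have : 1 ≤ (M : ℝ) / (d * d') := by rw [le_div_iff₀ (by positivity)]; linarith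
    nlinarith [abs_nonneg ((c : ℝ) * d' - c' * d)]
  have heq : c * d' = c' * d := by
    have : |((c * d' : ℕ) : ℤ) - (c' * d : ℕ)| < 1 := by
      have : |((((c * d' : ℕ) : ℤ) - (c' * d : ℕ) : ℤ) : ℝ)| < 1 := by push_cast; exact key
      exact_mod_cast this
    rw [Int.abs_lt_one_iff] at this
    omega
  have h1 : d ∣ d' := by
    have : d ∣ c * d' := ⟨c', by rw [heq]; ring⟩
    exact hco.symm.dvd_of_dvd_mul_left this
  have h2 : d' ∣ d := by
    have : d' ∣ c' * d := ⟨c, by rw [← heq]; ring⟩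
    exact hco'.symm.dvd_of_dvd_mul_left this
  have h3 := Nat.dvd_antisymm h1 h2
  subst h3
  have h4 : c = c' := Nat.eq_of_mul_eq_mul_right hd1 heq
  subst h4
  rfl

lemma ceil_farey_mem {D M : ℕ} (hM : D ^ 2 ≤ M) {p : Σ _ : ℕ, ℕ} (hp : p ∈ farey D) :
    ⌈(p.2 : ℝ) / p.1 * M⌉₊ ∈ Icc 1 M := by
  rw [mem_farey] at hp
  obtain ⟨⟨hd1, hdD⟩, ⟨hc1, hcd⟩, -⟩ := hp
  have hd : (0 : ℝ) < p.1 := by exact_mod_cast hd1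
  have hc : (0 : ℝ) < p.2 := by exact_mod_cast hc1
  have hM0 : 0 < M := lt_of_lt_of_le (pow_pos (lt_of_lt_of_le hd1 hdD) 2) hM
  rw [mem_Icc]
  constructor
  · exact Nat.one_le_iff_ne_zero.2 (Nat.ceil_pos.2 (by positivity)).ne'
  · apply Nat.ceil_le.2
    have : (p.2 : ℝ) / p.1 ≤ 1 := by
      rw [div_le_one hd]; exact_mod_cast hcd
    nlinarith [(Nat.cast_nonneg M : (0 : ℝ) ≤ M)]

/-- The weights in the Taylor expansion of `e`. -/
def taylorWeight (j : ℕ) : ℝ := (2 * π) ^ j / j.factorial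

lemma taylorWeight_nonneg (j : ℕ) : 0 ≤ taylorWeight j := by
  unfold taylorWeight; positivity

lemma sum_taylorWeight_le (J : ℕ) : ∑ j ∈ range J, taylorWeight j ≤ Real.exp (2 * π) :=
  Real.sum_le_exp_of_nonneg (by positivity) J

lemma hasSum_e (t : ℝ) :
    Tendsto (fun J => ∑ j ∈ range J, (2 * (π : ℂ) * Complex.I * t) ^ j / j.factorial) atTop
      (nhds (e t)) := by
  have := (NormedSpace.expSeries_div_hasSum_exp (2 * (π : ℂ) * Complex.I * t)).tendsto_sum_nat
  rwa [← Complex.exp_eq_exp_ℂ] at this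

/-- Each fraction is moved up to a point `k / M` of the grid with `M = N + D²`, and the factor `e (u
n / M)`, `|u| ≤ 1`, is expanded in its Taylor series. The `j`-th term is the transform modulo `M` of
`a n (n / M)^j`, for which Parseval is exact. The Taylor weights sum to at most `exp (2π)`, which
enters once through Cauchy–Schwarz and once through the summation over `j`. -/
theorem large_sieve (a : ℕ → ℝ) (N D : ℕ) :
    ∑ p ∈ farey D, ‖∑ n ∈ Icc 1 N, (a n : ℂ) * e ((p.2 : ℝ) / p.1 * n)‖ ^ 2
      ≤ Real.exp (2 * π) ^ 2 * ((N : ℝ) + (D : ℝ) ^ 2) * ∑ n ∈ Icc 1 N, a n ^ 2 := by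
  set M := N + D ^ 2 with hMdef
  have hM : D ^ 2 ≤ M := by omega
  rcases Nat.eq_zero_or_pos M with hM0 | hM0
  · have hD : D = 0 := by
      have : D ^ 2 = 0 := by omega
      simpa using this
    have hN : N = 0 := by omega
    subst hD hN; simp
  have hMr : (0 : ℝ) < M := by exact_mod_cast hM0
  let k : (Σ _ : ℕ, ℕ) → ℕ := fun p => ⌈(p.2 : ℝ) / p.1 * M⌉₊
  let u : (Σ _ : ℕ, ℕ) → ℝ := fun p => (p.2 : ℝ) / p.1 * M - k p
  have hu : ∀ p : Σ _ : ℕ, ℕ, |u p| ≤ 1 := by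
    intro p
    have a1 := Nat.le_ceil ((p.2 : ℝ) / p.1 * M)
    have a2 := Nat.ceil_lt_add_one (a := (p.2 : ℝ) / p.1 * M) (by positivity)
    rw [abs_le]; constructor <;> simp only [u, k] <;> linarith
  let F : ℕ → ℕ → ℝ := fun j n => if n ≤ N then a n * ((n : ℝ) / M) ^ j else 0
  have hF : ∀ j c, hat M (F j) c
      = ∑ n ∈ Icc 1 N, (a n : ℂ) * ((n : ℂ) / M) ^ j * e ((c : ℝ) * n / M) := by
    intro j c
    unfold hat
    have hsub : Icc 1 N ⊆ Icc 1 M := Icc_subset_Icc_right (by omega)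
    rw [← Finset.sum_subset hsub]
    · refine Finset.sum_congr rfl fun n hn => ?_
      rw [mem_Icc] at hn
      simp only [F, if_pos hn.2]; push_cast; ring
    · intro n hn hn'
      rw [mem_Icc] at hn hn'
      simp only [F]; rw [if_neg (by omega)]; simp
  have hparse : ∀ j, ∑ c ∈ Icc 1 M, ‖hat M (F j) c‖ ^ 2 ≤ M * ∑ n ∈ Icc 1 N, a n ^ 2 := by
    intro j
    have h := parseval_sq M hM0 (F j)
    have h2 : ∑ c ∈ Icc 1 M, ‖hat M (F j) c‖ ^ 2 = M * ∑ n ∈ Icc 1 M, F j n ^ 2 := by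
      rw [h]; field_simp
    rw [h2]
    apply mul_le_mul_of_nonneg_left _ hMr.le
    have hsub : Icc 1 N ⊆ Icc 1 M := Icc_subset_Icc_right (by omega)
    rw [← Finset.sum_subset hsub]
    · refine Finset.sum_le_sum fun n hn => ?_
      rw [mem_Icc] at hn
      simp only [F, if_pos hn.2]
      rw [mul_pow]
      have h1 : ((n : ℝ) / M) ^ j ≤ 1 := by
        apply pow_le_one₀ (by positivity)
        rw [div_le_one hMr]
        exact_mod_cast (by omega : n ≤ M)
      have h2 : (((n : ℝ) / M) ^ j) ^ 2 ≤ 1 := pow_le_one₀ (by positivity) h1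
      nlinarith [sq_nonneg (a n)]
    · intro n hn hn'
      rw [mem_Icc] at hn hn'
      simp only [F]; rw [if_neg (by omega)]; simp
  let A : ℕ → (Σ _ : ℕ, ℕ) → ℂ := fun J p =>
    ∑ j ∈ range J, (2 * (π : ℂ) * Complex.I * u p) ^ j / j.factorial * hat M (F j) (k p)
  have hlim : ∀ p, Tendsto (fun J => A J p) atTop
      (nhds (∑ n ∈ Icc 1 N, (a n : ℂ) * e ((p.2 : ℝ) / p.1 * n))) := by
    intro p
    have h1 : ∀ J, A J p = ∑ n ∈ Icc 1 N, (a n : ℂ) * e ((k p : ℝ) * n / M) *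
        ∑ j ∈ range J, (2 * (π : ℂ) * Complex.I * ((u p * n / M : ℝ) : ℂ)) ^ j / j.factorial := by
      intro J
      simp only [A, hF, Finset.mul_sum]
      rw [Finset.sum_comm]
      refine Finset.sum_congr rfl fun n _ => Finset.sum_congr rfl fun j _ => ?_
      push_cast
      rw [show 2 * (π : ℂ) * Complex.I * (u p * n / M) = (2 * (π : ℂ) * Complex.I * u p) * (n / M) by
        ring, mul_pow]
      ring
    simp_rw [h1]
    apply tendsto_finsetSum
    intro n _
    have h2 := (hasSum_e (u p * n / M)).const_mul ((a n : ℂ) * e ((k p : ℝ) * n / M))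
    have h3 : (a n : ℂ) * e ((k p : ℝ) * n / M) * e (u p * n / M)
        = (a n : ℂ) * e ((p.2 : ℝ) / p.1 * n) := by
      rw [mul_assoc, ← e_add]
      congr 2
      simp only [u]
      field_simp; ring
    rwa [h3] at h2
  have hbound : ∀ J, ∑ p ∈ farey D, ‖A J p‖ ^ 2
      ≤ Real.exp (2 * π) ^ 2 * M * ∑ n ∈ Icc 1 N, a n ^ 2 := by
    intro J
    have h1 : ∀ p ∈ farey D, ‖A J p‖ ^ 2 ≤ Real.exp (2 * π) *
        ∑ j ∈ range J, taylorWeight j * ‖hat M (F j) (k p)‖ ^ 2 := by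
      intro p _
      have h2 : ‖A J p‖ ≤ ∑ j ∈ range J, taylorWeight j * ‖hat M (F j) (k p)‖ := by
        refine (norm_sum_le _ _).trans (Finset.sum_le_sum fun j _ => ?_)
        rw [norm_mul]
        apply mul_le_mul_of_nonneg_right _ (norm_nonneg _)
        rw [norm_div, norm_pow, Complex.norm_natCast]
        unfold taylorWeight
        apply div_le_div_of_nonneg_right _ (by positivity)
        apply pow_le_pow_left₀ (norm_nonneg _)
        simp only [norm_mul, Complex.norm_real, Complex.norm_I, Complex.norm_ofNat, mul_one,
          Real.norm_eq_abs, abs_of_pos Real.pi_pos]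
        nlinarith [hu p, Real.pi_pos]
      -- Cauchy–Schwarz with respect to the Taylor weights.
      have h3 := Finset.sum_sq_le_sum_mul_sum_of_sq_le_mul (range J) (r := fun j =>
        taylorWeight j * ‖hat M (F j) (k p)‖) (f := taylorWeight)
        (g := fun j => taylorWeight j * ‖hat M (F j) (k p)‖ ^ 2)
        (fun j _ => taylorWeight_nonneg j)
        (fun j _ => mul_nonneg (taylorWeight_nonneg j) (by positivity)) (fun j _ => le_of_eq (by ring))
      calc ‖A J p‖ ^ 2 ≤ (∑ j ∈ range J, taylorWeight j * ‖hat M (F j) (k p)‖) ^ 2 :=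
            pow_le_pow_left₀ (norm_nonneg _) h2 2
        _ ≤ _ := h3
        _ ≤ _ := mul_le_mul_of_nonneg_right (sum_taylorWeight_le J)
            (Finset.sum_nonneg fun j _ => mul_nonneg (taylorWeight_nonneg j) (by positivity))
    calc ∑ p ∈ farey D, ‖A J p‖ ^ 2
        ≤ ∑ p ∈ farey D, Real.exp (2 * π) *
          ∑ j ∈ range J, taylorWeight j * ‖hat M (F j) (k p)‖ ^ 2 := Finset.sum_le_sum h1
      _ = Real.exp (2 * π) * ∑ j ∈ range J, taylorWeight j *
          ∑ p ∈ farey D, ‖hat M (F j) (k p)‖ ^ 2 := by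
          rw [← Finset.mul_sum, Finset.sum_comm]; simp_rw [Finset.mul_sum]
      _ ≤ Real.exp (2 * π) * ∑ j ∈ range J, taylorWeight j * (M * ∑ n ∈ Icc 1 N, a n ^ 2) := by
          apply mul_le_mul_of_nonneg_left _ (Real.exp_pos _).le
          refine Finset.sum_le_sum fun j _ => mul_le_mul_of_nonneg_left ?_ (taylorWeight_nonneg j)
          refine le_trans ?_ (hparse j)
          -- Distinct fractions occupy distinct grid points, so the sum is part of the complete sum
          -- in Parseval.
          rw [← Finset.sum_image (f := fun c => ‖hat M (F j) c‖ ^ 2) (g := k)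
            (ceil_farey_injOn hM)]
          apply Finset.sum_le_sum_of_subset_of_nonneg
          · intro c hc
            rw [Finset.mem_image] at hc
            obtain ⟨p, hp, rfl⟩ := hc
            exact ceil_farey_mem hM hp
          · intros; positivity
      _ ≤ Real.exp (2 * π) ^ 2 * M * ∑ n ∈ Icc 1 N, a n ^ 2 := by
          rw [← Finset.sum_mul, pow_two, mul_assoc, mul_assoc]
          apply mul_le_mul_of_nonneg_left _ (Real.exp_pos _).le
          apply mul_le_mul_of_nonneg_right (sum_taylorWeight_le J)
          exact mul_nonneg hMr.le (Finset.sum_nonneg fun n _ => sq_nonneg _)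
  have hMcast : ((N : ℝ) + (D : ℝ) ^ 2) = (M : ℝ) := by rw [hMdef]; push_cast; ring
  rw [hMcast]
  refine le_of_tendsto (tendsto_finsetSum _ fun p _ => ((hlim p).norm.pow 2)) ?_
  exact Filter.Eventually.of_forall hbound

/-- The mean square of the exponential sum over fractions with denominator exactly `d`. -/
def Ld (x : ℝ) (d : ℕ) : ℝ :=
  ∑ c ∈ (Icc 1 d).filter (fun c => c.Coprime d), ‖expSum x ((c : ℝ) / d)‖ ^ 2

lemma Ld_nonneg (z : ℝ) (d : ℕ) : 0 ≤ Ld z d := Finset.sum_nonneg fun _ _ => by positivity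

lemma sum_Ld_le (x : ℝ) (hx : 0 ≤ x) (D : ℕ) :
    ∑ d ∈ Icc 1 D, Ld x d ≤ Real.exp (2 * π) ^ 2 * (x + (D : ℝ) ^ 2) * r3SqSum x := by
  have h := large_sieve (fun n => (r3 n : ℝ)) ⌊x⌋₊ D
  unfold farey at h
  rw [Finset.sum_sigma] at h
  unfold Ld expSum r3SqSum
  simp only [Complex.ofReal_natCast] at h
  refine h.trans ?_
  apply mul_le_mul_of_nonneg_right _ (Finset.sum_nonneg fun _ _ => by positivity)
  apply mul_le_mul_of_nonneg_left _ (by positivity)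
  have := Nat.floor_le hx
  linarith

lemma Dd_le_Ld (x : ℝ) (d : ℕ) : Dd x d ≤ 2 * Ld x d + 2 * m0 ^ 2 * x ^ 2 * A1Term d := by
  unfold Dd Ld
  rw [A1Term_eq, Finset.mul_sum, Finset.mul_sum, ← Finset.sum_add_distrib]
  refine Finset.sum_le_sum fun c _ => ?_
  unfold Er
  have h1 := norm_sub_le (expSum x ((c : ℝ) / d)) (m0 * x * sv d c ^ 3)
  have h2 : ‖(m0 * x * sv d c ^ 3 : ℂ)‖ ^ 2 = m0 ^ 2 * x ^ 2 * ‖sv d c‖ ^ 6 := by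
    simp only [norm_mul, norm_pow, Complex.norm_real, Real.norm_eq_abs, mul_pow, sq_abs]; ring
  have h3 := pow_le_pow_left₀ (norm_nonneg _) h1 2
  nlinarith [sq_nonneg (‖expSum x ((c : ℝ) / d)‖ - ‖(m0 * x * sv d c ^ 3 : ℂ)‖)]

/-! ### Counting lattice points in residue classes -/

open MeasureTheory in
/-- The positive octant of the `ℓ³` ball of radius `y`. -/
def octant (y : ℝ) : Set (Fin 3 → ℝ) := {u | (∀ i, 0 < u i) ∧ ∑ i, u i ^ 3 ≤ y ^ 3}

lemma measurableSet_octant (y : ℝ) : MeasurableSet (octant y) := by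
  have h1 : MeasurableSet {u : Fin 3 → ℝ | ∀ i, 0 < u i} := by
    simp only [Set.ofPred_forall]
    exact MeasurableSet.iInter fun i => measurableSet_lt measurable_const (measurable_pi_apply i)
  have h2 : MeasurableSet {u : Fin 3 → ℝ | ∑ i, u i ^ 3 ≤ y ^ 3} :=
    measurableSet_le (Finset.measurable_sum _ fun i _ => (measurable_pi_apply i).pow_const 3)
      measurable_const
  exact h1.inter h2

-- The eight sign changes carry the octant to disjoint sets that fill the `ℓ³` ball up to the null
-- coordinate hyperplanes. The octant therefore has one eighth of the volume of the ball, which is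
-- `8 Γ(4/3)³ y³` because `Γ(2) = 1`.
open MeasureTheory in
lemma volume_octant (y : ℝ) (hy : 0 ≤ y) : volume (octant y) = ENNReal.ofReal (m0 * y ^ 3) := by
  have hball := volume_sum_rpow_le (ι := Fin 3) (p := 3) (by norm_num) y
  let σ : (Fin 3 → Bool) → (Fin 3 → ℝ) → (Fin 3 → ℝ) := fun ε u i => (if ε i then u i else -u i)
  have hσ : ∀ ε, MeasurePreserving (σ ε) := by
    intro ε
    have : σ ε = fun u i => (fun (i : Fin 3) (t : ℝ) => if ε i then t else -t) i (u i) := rfl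
    rw [this]
    refine volume_preserving_pi (f := fun (i : Fin 3) (t : ℝ) => if ε i then t else -t) fun i => ?_
    by_cases h : ε i
    · simp only [h, if_true]; exact MeasurePreserving.id _
    · simp only [h]; exact Measure.measurePreserving_neg volume
  have hplane : ∀ i : Fin 3, volume {u : Fin 3 → ℝ | u i = 0} = 0 := by
    intro i
    exact Measure.pi_hyperplane (fun _ => volume) i 0
  have hset : {x : Fin 3 → ℝ | (∑ i, |x i| ^ (3 : ℝ)) ^ (1 / (3 : ℝ)) ≤ y}
      =ᵐ[volume] ⋃ ε ∈ (Finset.univ : Finset (Fin 3 → Bool)), σ ε ⁻¹' octant y := by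
    have hne : ∀ᵐ u : Fin 3 → ℝ, ∀ i, u i ≠ 0 := by
      rw [ae_all_iff]; intro i
      rw [ae_iff]; simpa using hplane i
    rw [Filter.eventuallyEq_set]
    filter_upwards [hne] with u hu
    have e1 : (∑ i, |u i| ^ (3 : ℝ)) ^ (1 / (3 : ℝ)) ≤ y ↔ ∑ i, |u i| ^ 3 ≤ y ^ 3 := by
      have h0 : (0 : ℝ) ≤ ∑ i, |u i| ^ (3 : ℝ) := Finset.sum_nonneg fun i _ => by positivity
      have e3 : ∑ i, |u i| ^ (3 : ℝ) = ∑ i, |u i| ^ 3 :=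
        Finset.sum_congr rfl fun i _ => by exact_mod_cast Real.rpow_natCast (|u i|) 3
      rw [← e3]
      constructor
      · intro h
        have := pow_le_pow_left₀ (Real.rpow_nonneg h0 _) h 3
        rwa [← Real.rpow_natCast, ← Real.rpow_mul h0, show (1 / (3 : ℝ)) * ((3 : ℕ) : ℝ) = 1 by
          norm_num, Real.rpow_one] at this
      · intro h
        have := Real.rpow_le_rpow h0 h (by norm_num : (0 : ℝ) ≤ 1 / 3)
        rwa [← Real.rpow_natCast y, ← Real.rpow_mul hy, show ((3 : ℕ) : ℝ) * (1 / 3) = 1 by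
          norm_num, Real.rpow_one] at this
    change (∑ i, |u i| ^ (3 : ℝ)) ^ (1 / (3 : ℝ)) ≤ y ↔ _
    rw [e1]
    simp only [Set.mem_iUnion, Finset.mem_univ, Set.mem_preimage, exists_prop, true_and]
    constructor
    · intro h
      refine ⟨fun i => decide (0 < u i), fun i => ?_, ?_⟩
      · simp only [σ, decide_eq_true_eq]
        split_ifs with hi
        · exact hi
        · have := lt_of_le_of_ne (not_lt.1 hi) (hu i); linarith
      · refine le_trans (le_of_eq (Finset.sum_congr rfl fun i _ => ?_)) h
        simp only [σ, decide_eq_true_eq]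
        split_ifs with hi
        · rw [abs_of_pos hi]
        · rw [abs_of_nonpos (not_lt.1 hi)]
    · rintro ⟨ε, h1, h2⟩
      refine le_trans (le_of_eq (Finset.sum_congr rfl fun i _ => ?_)) h2
      have := h1 i
      simp only [σ] at this ⊢
      split_ifs at this ⊢
      · rw [abs_of_pos this]
      · rw [abs_of_neg (by linarith)]
  rw [measure_congr hset, measure_biUnion_finset] at hball
  · have h1 : ∀ ε ∈ (Finset.univ : Finset (Fin 3 → Bool)), volume (σ ε ⁻¹' octant y)
        = volume (octant y) := fun ε _ =>
      (hσ ε).measure_preimage (measurableSet_octant y).nullMeasurableSet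
    rw [Finset.sum_congr rfl h1, Finset.sum_const] at hball
    have hG : Gamma ((Fintype.card (Fin 3) : ℝ) / 3 + 1) = 1 := by
      simp only [Fintype.card_fin]
      norm_num
    rw [hG] at hball
    have hG2 : ENNReal.ofReal y ^ Fintype.card (Fin 3) * ENNReal.ofReal
        ((2 * Gamma (1 / 3 + 1)) ^ Fintype.card (Fin 3) / 1) = ENNReal.ofReal (8 * (m0 * y ^ 3)) := by
      rw [← ENNReal.ofReal_pow hy, ← ENNReal.ofReal_mul (by positivity)]
      congr 1
      simp only [Fintype.card_fin, m0]
      rw [show (1 / 3 + 1 : ℝ) = 4 / 3 by norm_num]; ring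
    rw [hG2, ENNReal.ofReal_mul (by norm_num)] at hball
    have hc : (Finset.univ : Finset (Fin 3 → Bool)).card = 8 := by simp
    rw [hc, nsmul_eq_mul] at hball
    have h8 : ENNReal.ofReal 8 = ((8 : ℕ) : ENNReal) := by
      rw [← ENNReal.ofReal_natCast]; norm_num
    rw [h8] at hball
    exact (ENNReal.mul_right_inj (by norm_num) (by simp)).1 hball
  · intro ε _ ε' _ hne
    rw [Function.onFun, Set.disjoint_left]
    rintro u ⟨h1, -⟩ ⟨h2, -⟩
    apply hne
    funext i
    have a1 := h1 i
    have a2 := h2 i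
    simp only [σ] at a1 a2
    by_cases h : ε i <;> by_cases h' : ε' i <;> simp only [h, h'] at a1 a2 ⊢ <;>
      simp at a1 a2 <;> linarith
  · intro ε _
    exact (hσ ε).measurable (measurableSet_octant y)

/-- The point of `ℝ³` given by a triple of natural numbers. -/
def pt (t : ℕ × ℕ × ℕ) : Fin 3 → ℝ := ![(t.1 : ℝ), t.2.1, t.2.2]

/-- The positive lattice points `t ≡ l (mod q)` with sum of cubes at most `N`. -/
def latticePts (N q : ℕ) (l : ℕ × ℕ × ℕ) : Finset (ℕ × ℕ × ℕ) :=
  (Icc 1 N ×ˢ Icc 1 N ×ˢ Icc 1 N).filter fun t =>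
    t.1 ^ 3 + t.2.1 ^ 3 + t.2.2 ^ 3 ≤ N ∧
      t.1 ≡ l.1 [MOD q] ∧ t.2.1 ≡ l.2.1 [MOD q] ∧ t.2.2 ≡ l.2.2 [MOD q]

lemma mem_latticePts {N q : ℕ} {l t : ℕ × ℕ × ℕ} : t ∈ latticePts N q l ↔
    (1 ≤ t.1 ∧ 1 ≤ t.2.1 ∧ 1 ≤ t.2.2) ∧ t.1 ^ 3 + t.2.1 ^ 3 + t.2.2 ^ 3 ≤ N ∧
      t.1 ≡ l.1 [MOD q] ∧ t.2.1 ≡ l.2.1 [MOD q] ∧ t.2.2 ≡ l.2.2 [MOD q] := by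
  unfold latticePts
  simp only [mem_filter, mem_product, mem_Icc]
  have h : ∀ n : ℕ, n ≤ n ^ 3 := fun n => Nat.le_self_pow (by norm_num) n
  constructor
  · rintro ⟨⟨h1, h2, h3⟩, h4⟩; exact ⟨⟨h1.1, h2.1, h3.1⟩, h4⟩
  · rintro ⟨⟨h1, h2, h3⟩, h4⟩
    have := h t.1; have := h t.2.1; have := h t.2.2
    exact ⟨⟨⟨h1, by omega⟩, ⟨h2, by omega⟩, ⟨h3, by omega⟩⟩, h4⟩

lemma eq_of_modEq_of_abs_lt {q a b : ℕ} (h : a ≡ b [MOD q]) (hab : |(a : ℝ) - b| < q) : a = b := by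
  have h1 : (q : ℤ) ∣ (a : ℤ) - b := Nat.modEq_iff_dvd.1 h.symm
  have h2 : |(a : ℤ) - b| < q := by
    have : |(((a : ℤ) - b : ℤ) : ℝ)| < q := by push_cast; exact hab
    exact_mod_cast this
  have := Int.eq_zero_of_abs_lt_dvd h1 h2
  omega

lemma card_filter_modEq_le (y : ℝ) (hy : 0 ≤ y) (q : ℕ) (hq : 0 < q) (l : ℕ) :
    (((Icc 1 ⌊y⌋₊).filter (fun n => n ≡ l [MOD q])).card : ℝ) ≤ y / q + 1 := by
  have h := Nat.Ioc_filter_modEq_card 0 ⌊y⌋₊ (r := q) hq l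
  have h0 : (Ioc 0 ⌊y⌋₊) = Icc 1 ⌊y⌋₊ := rfl
  rw [h0] at h
  have hq' : (0 : ℝ) < q := by exact_mod_cast hq
  have hfl := Nat.floor_le hy
  have h2 : ((((Icc 1 ⌊y⌋₊).filter (fun n => n ≡ l [MOD q])).card : ℤ) : ℝ) ≤ y / q + 1 := by
    rw [h]
    push_cast
    apply max_le
    · have a1 := Int.floor_le (((⌊y⌋₊ : ℚ) - l) / q)
      have a2 := Int.lt_floor_add_one (((0 : ℚ) - l) / q)
      have a1' : ((⌊((⌊y⌋₊ : ℚ) - l) / q⌋ : ℤ) : ℝ) ≤ ((⌊y⌋₊ : ℝ) - l) / q := by exact_mod_cast a1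
      have a2' : ((0 : ℝ) - l) / q < ((⌊((0 : ℚ) - l) / q⌋ : ℤ) : ℝ) + 1 := by exact_mod_cast a2
      have : ((⌊y⌋₊ : ℝ) - l) / q - (0 - l) / q ≤ y / q := by
        rw [← sub_div]; gcongr; linarith
      linarith
    · positivity
  exact_mod_cast h2

lemma card_small_le (q : ℕ) (l : ℕ) :
    (((Icc 1 q).filter (fun n => n ≡ l [MOD q])).card : ℝ) ≤ 1 := by
  have : ((Icc 1 q).filter (fun n => n ≡ l [MOD q])).card ≤ 1 := by
    rw [Finset.card_le_one]
    intro a ha b hb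
    rw [mem_filter] at ha hb
    exact (dvd_sub_iff_eq ha.1 hb.1).1 (Nat.modEq_iff_dvd.1 (hb.2.trans ha.2.symm))
  exact_mod_cast this

-- Hang from each point the half-open cube of side `q` below it. Cubes of congruent points are
-- disjoint, and they lie in the octant when all coordinates exceed `q`. Otherwise some coordinate
-- is at most `q`: it has at most one admissible value, and each of the other two has at most `y / q
-- + 1`.
open MeasureTheory in
lemma card_latticePts_le (y : ℝ) (hy : 0 ≤ y) (q : ℕ) (hq : 0 < q) (l : ℕ × ℕ × ℕ) :
    ((latticePts ⌊y ^ 3⌋₊ q l).card : ℝ) ≤ m0 * y ^ 3 / q ^ 3 + 3 * (y / q + 1) ^ 2 := by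
  classical
  have hq' : (0 : ℝ) < q := by exact_mod_cast hq
  set X := latticePts ⌊y ^ 3⌋₊ q l with hX
  have hXy : ∀ t ∈ X, ((t.1 : ℝ) ≤ y ∧ (t.2.1 : ℝ) ≤ y ∧ (t.2.2 : ℝ) ≤ y) ∧
      (t.1 : ℝ) ^ 3 + (t.2.1 : ℝ) ^ 3 + (t.2.2 : ℝ) ^ 3 ≤ y ^ 3 := by
    intro t ht
    rw [hX, mem_latticePts] at ht
    have h1 : ((t.1 ^ 3 + t.2.1 ^ 3 + t.2.2 ^ 3 : ℕ) : ℝ) ≤ y ^ 3 :=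
      (Nat.le_floor_iff (by positivity)).1 ht.2.1
    push_cast at h1
    have p1 : (0 : ℝ) ≤ (t.1 : ℝ) ^ 3 := by positivity
    have p2 : (0 : ℝ) ≤ (t.2.1 : ℝ) ^ 3 := by positivity
    have p3 : (0 : ℝ) ≤ (t.2.2 : ℝ) ^ 3 := by positivity
    refine ⟨⟨?_, ?_, ?_⟩, h1⟩ <;>
      exact le_of_pow_le_pow_left₀ (n := 3) (by norm_num) hy (by linarith)
  let X' := X.filter fun t => q < t.1 ∧ q < t.2.1 ∧ q < t.2.2
  let cell : ℕ × ℕ × ℕ → Set (Fin 3 → ℝ) := fun t =>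
    Set.pi Set.univ fun i => Set.Ioc (pt t i - q) (pt t i)
  have hcell : ∀ t, volume (cell t) = ENNReal.ofReal ((q : ℝ) ^ 3) := by
    intro t
    rw [Real.volume_pi_Ioc, ENNReal.ofReal_pow hq'.le]
    simp
  have hsub : ⋃ t ∈ X', cell t ⊆ octant y := by
    intro u hu
    simp only [Set.mem_iUnion] at hu
    obtain ⟨t, ht, hu⟩ := hu
    rw [mem_filter] at ht
    have hu' : ∀ i, pt t i - q < u i ∧ u i ≤ pt t i := fun i => hu i trivial
    have g1 : (q : ℝ) < t.1 := by exact_mod_cast ht.2.1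
    have g2 : (q : ℝ) < t.2.1 := by exact_mod_cast ht.2.2.1
    have g3 : (q : ℝ) < t.2.2 := by exact_mod_cast ht.2.2.2
    have b1 := hu' 0; have b2 := hu' 1; have b3 := hu' 2
    simp only [pt, Matrix.cons_val] at b1 b2 b3
    constructor
    · intro i; fin_cases i
      · change 0 < u 0; linarith
      · change 0 < u 1; linarith
      · change 0 < u 2; linarith
    · rw [Fin.sum_univ_three]
      have := (hXy t ht.1).2
      have c1 := pow_le_pow_left₀ (by linarith : 0 ≤ u 0) b1.2 3
      have c2 := pow_le_pow_left₀ (by linarith : 0 ≤ u 1) b2.2 3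
      have c3 := pow_le_pow_left₀ (by linarith : 0 ≤ u 2) b3.2 3
      linarith
  have hvol := measure_mono (μ := volume) hsub
  rw [measure_biUnion_finset, Finset.sum_congr rfl fun t _ => hcell t, Finset.sum_const,
    volume_octant y hy, nsmul_eq_mul, ← ENNReal.ofReal_natCast, ← ENNReal.ofReal_mul (by positivity),
    ENNReal.ofReal_le_ofReal_iff (mul_nonneg m0_pos.le (by positivity))] at hvol
  · have hX'card : (X'.card : ℝ) ≤ m0 * y ^ 3 / q ^ 3 := by
      rw [le_div_iff₀ (by positivity)]; exact hvol
    let P : ℕ → Finset ℕ := fun a => (Icc 1 ⌊y⌋₊).filter (fun n => n ≡ a [MOD q])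
    let P0 : ℕ → Finset ℕ := fun a => (Icc 1 q).filter (fun n => n ≡ a [MOD q])
    have hcover : X ⊆ X' ∪ (P0 l.1 ×ˢ P l.2.1 ×ˢ P l.2.2) ∪ (P l.1 ×ˢ P0 l.2.1 ×ˢ P l.2.2)
        ∪ (P l.1 ×ˢ P l.2.1 ×ˢ P0 l.2.2) := by
      intro t ht
      have hb := (hXy t ht).1
      have ht' := ht
      rw [hX, mem_latticePts] at ht'
      have f1 : t.1 ≤ ⌊y⌋₊ := Nat.le_floor hb.1
      have f2 : t.2.1 ≤ ⌊y⌋₊ := Nat.le_floor hb.2.1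
      have f3 : t.2.2 ≤ ⌊y⌋₊ := Nat.le_floor hb.2.2
      simp only [mem_union, mem_product, X', P, P0, mem_filter, mem_Icc]
      obtain ⟨⟨d1, d2, d3⟩, -, m1, m2, m3⟩ := ht'
      by_cases k1 : q < t.1
      · by_cases k2 : q < t.2.1
        · by_cases k3 : q < t.2.2
          · exact Or.inl (Or.inl (Or.inl ⟨ht, k1, k2, k3⟩))
          · exact Or.inr ⟨⟨⟨d1, f1⟩, m1⟩, ⟨⟨d2, f2⟩, m2⟩, ⟨⟨d3, not_lt.1 k3⟩, m3⟩⟩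
        · exact Or.inl (Or.inr ⟨⟨⟨d1, f1⟩, m1⟩, ⟨⟨d2, not_lt.1 k2⟩, m2⟩, ⟨⟨d3, f3⟩, m3⟩⟩)
      · exact Or.inl (Or.inl (Or.inr ⟨⟨⟨d1, not_lt.1 k1⟩, m1⟩, ⟨⟨d2, f2⟩, m2⟩, ⟨⟨d3, f3⟩, m3⟩⟩))
    have hc1 := (Finset.card_le_card hcover).trans ((card_union_le _ _).trans
      (Nat.add_le_add_right ((card_union_le _ _).trans
        (Nat.add_le_add_right (card_union_le _ _) _)) _))
    simp only [card_product] at hc1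
    have hc2 : (X.card : ℝ) ≤ X'.card + (P0 l.1).card * ((P l.2.1).card * (P l.2.2).card)
        + (P l.1).card * ((P0 l.2.1).card * (P l.2.2).card)
        + (P l.1).card * ((P l.2.1).card * (P0 l.2.2).card) := by exact_mod_cast hc1
    have hP : ∀ a, ((P a).card : ℝ) ≤ y / q + 1 := fun a => card_filter_modEq_le y hy q hq a
    have hP0 : ∀ a, ((P0 a).card : ℝ) ≤ 1 := fun a => card_small_le q a
    have hw : 0 ≤ y / q + 1 := by positivity
    have hpair : ∀ a b, ((P a).card : ℝ) * (P b).card ≤ (y / q + 1) ^ 2 := by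
      intro a b; rw [pow_two]
      exact mul_le_mul (hP a) (hP b) (by positivity) hw
    have t1 : ((P0 l.1).card : ℝ) * ((P l.2.1).card * (P l.2.2).card) ≤ (y / q + 1) ^ 2 := by
      have := mul_le_mul (hP0 l.1) (hpair l.2.1 l.2.2) (by positivity) (by norm_num); linarith
    have t2 : ((P l.1).card : ℝ) * ((P0 l.2.1).card * (P l.2.2).card) ≤ (y / q + 1) ^ 2 := by
      have := mul_le_mul (hP0 l.2.1) (hpair l.1 l.2.2) (by positivity) (by norm_num); linarith
    have t3 : ((P l.1).card : ℝ) * ((P l.2.1).card * (P0 l.2.2).card) ≤ (y / q + 1) ^ 2 := by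
      have := mul_le_mul (hP0 l.2.2) (hpair l.1 l.2.1) (by positivity) (by norm_num); linarith
    linarith
  · intro t ht t' ht' hne
    rw [Function.onFun, Set.disjoint_left]
    intro u hu hu'
    apply hne
    have a : ∀ i, pt t i - q < u i ∧ u i ≤ pt t i := fun i => hu i trivial
    have a' : ∀ i, pt t' i - q < u i ∧ u i ≤ pt t' i := fun i => hu' i trivial
    rw [Finset.mem_coe, mem_filter, hX, mem_latticePts] at ht ht'
    have key : ∀ i, |pt t i - pt t' i| < q := by
      intro i; rw [abs_lt]; constructor <;> linarith [a i, a' i, (a i).1, (a i).2, (a' i).1, (a' i).2]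
    have k0 := key 0; have k1 := key 1; have k2 := key 2
    simp only [pt, Matrix.cons_val] at k0 k1 k2
    obtain ⟨-, -, m1, m2, m3⟩ := ht.1
    obtain ⟨-, -, m1', m2', m3'⟩ := ht'.1
    exact Prod.ext (eq_of_modEq_of_abs_lt (m1.trans m1'.symm) k0)
      (Prod.ext (eq_of_modEq_of_abs_lt (m2.trans m2'.symm) k1)
        (eq_of_modEq_of_abs_lt (m3.trans m3'.symm) k2))
  · intro t _
    exact MeasurableSet.univ_pi fun i => measurableSet_Ioc

lemma exists_rep {q l : ℕ} (hl : l < q) {u : ℝ} (hu : (q : ℝ) < u) :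
    ∃ t : ℕ, 1 ≤ t ∧ t ≡ l [MOD q] ∧ (t : ℝ) ≤ u ∧ u < t + q := by
  have hq : (0 : ℝ) < q := by
    have : 0 < q := by omega
    exact_mod_cast this
  have hl' : (l : ℝ) < q := by exact_mod_cast hl
  have h0 : 0 ≤ (u - l) / q := div_nonneg (by linarith) hq.le
  set k := ⌊(u - l) / q⌋₊ with hk
  have h1 := Nat.floor_le h0
  have h2 := Nat.lt_floor_add_one ((u - l) / q)
  rw [← hk] at h1 h2
  rw [le_div_iff₀ hq] at h1
  rw [div_lt_iff₀ hq] at h2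
  refine ⟨l + q * k, ?_, by simp [Nat.ModEq], by push_cast; linarith, by push_cast; linarith⟩
  -- The zero class has least positive member `q`; this is why `u > q` is required.
  rcases Nat.eq_zero_or_pos l with rfl | hl0
  · have : 1 ≤ k := by
      rw [hk]; apply Nat.le_floor
      rw [le_div_iff₀ hq]; push_cast; linarith
    have : 1 * 1 ≤ q * k := Nat.mul_le_mul hl this
    omega
  · omega

-- The cubes now stand above the lattice points. They cover every point of the octant whose
-- coordinates all exceed `q`; the rest lies in three slabs of volume `q y²`.
open MeasureTheory in
lemma le_card_latticePts (y : ℝ) (hy : 0 ≤ y) (q : ℕ) (hq : 0 < q) (l : ℕ × ℕ × ℕ)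
    (hl : l.1 < q ∧ l.2.1 < q ∧ l.2.2 < q) :
    m0 * y ^ 3 / q ^ 3 - 3 * (y / q) ^ 2 ≤ ((latticePts ⌊y ^ 3⌋₊ q l).card : ℝ) := by
  classical
  have hq' : (0 : ℝ) < q := by exact_mod_cast hq
  set X := latticePts ⌊y ^ 3⌋₊ q l with hX
  let cell : ℕ × ℕ × ℕ → Set (Fin 3 → ℝ) := fun t =>
    Set.pi Set.univ fun i => Set.Ico (pt t i) (pt t i + q)
  let slab : Fin 3 → Set (Fin 3 → ℝ) := fun k =>
    Set.pi Set.univ fun i => Set.Ioc 0 (if i = k then (q : ℝ) else y)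
  have hcell : ∀ t, volume (cell t) = ENNReal.ofReal ((q : ℝ) ^ 3) := by
    intro t
    rw [Real.volume_pi_Ico, ENNReal.ofReal_pow hq'.le]
    simp
  have hslab : ∀ k, volume (slab k) = ENNReal.ofReal (q * y ^ 2) := by
    intro k
    rw [Real.volume_pi_Ioc, Fin.prod_univ_three]
    simp only [sub_zero]
    rw [← ENNReal.ofReal_mul (by split_ifs <;> positivity),
      ← ENNReal.ofReal_mul (by split_ifs <;> positivity)]
    congr 1
    fin_cases k <;> simp <;> ring
  have hcover : octant y ⊆ (⋃ t ∈ X, cell t) ∪ (⋃ k ∈ (Finset.univ : Finset (Fin 3)), slab k) := by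
    rintro u ⟨hu0, hu⟩
    have hle : ∀ i, u i ≤ y := by
      intro i
      refine le_of_pow_le_pow_left₀ (n := 3) (by norm_num) hy (le_trans ?_ hu)
      exact Finset.single_le_sum (f := fun i => u i ^ 3) (fun i _ => by have := hu0 i; positivity)
        (Finset.mem_univ i)
    by_cases hbig : ∀ i, (q : ℝ) < u i
    · left
      obtain ⟨t1, p1, m1, a1, b1⟩ := exists_rep hl.1 (hbig 0)
      obtain ⟨t2, p2, m2, a2, b2⟩ := exists_rep hl.2.1 (hbig 1)
      obtain ⟨t3, p3, m3, a3, b3⟩ := exists_rep hl.2.2 (hbig 2)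
      simp only [Set.mem_iUnion]
      refine ⟨(t1, t2, t3), ?_, ?_⟩
      · rw [hX, mem_latticePts]
        refine ⟨⟨p1, p2, p3⟩, ?_, m1, m2, m3⟩
        apply Nat.le_floor
        rw [Fin.sum_univ_three] at hu
        have c1 := pow_le_pow_left₀ (by positivity) a1 3
        have c2 := pow_le_pow_left₀ (by positivity) a2 3
        have c3 := pow_le_pow_left₀ (by positivity) a3 3
        push_cast; linarith
      · intro i _
        fin_cases i
        · exact ⟨a1, b1⟩
        · exact ⟨a2, b2⟩
        · exact ⟨a3, b3⟩
    · right
      push Not at hbig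
      obtain ⟨k, hk⟩ := hbig
      simp only [Set.mem_iUnion, Finset.mem_univ, exists_prop, true_and]
      refine ⟨k, fun i _ => ⟨hu0 i, ?_⟩⟩
      split_ifs with h
      · rw [h]; exact hk
      · exact hle i
  have hvol := (measure_mono (μ := volume) hcover).trans ((measure_union_le _ _).trans
    (add_le_add (measure_biUnion_finset_le _ _) (measure_biUnion_finset_le _ _)))
  rw [Finset.sum_congr rfl fun t _ => hcell t, Finset.sum_congr rfl fun t _ => hslab t,
    Finset.sum_const, Finset.sum_const, volume_octant y hy, nsmul_eq_mul, nsmul_eq_mul,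
    ← ENNReal.ofReal_natCast, ← ENNReal.ofReal_natCast, ← ENNReal.ofReal_mul (by positivity),
    ← ENNReal.ofReal_mul (by positivity), ← ENNReal.ofReal_add (by positivity) (by positivity),
    ENNReal.ofReal_le_ofReal_iff (by positivity)] at hvol
  simp only [Finset.card_univ, Fintype.card_fin] at hvol
  have h3 : m0 * y ^ 3 / q ^ 3 ≤ X.card + 3 * (y / q) ^ 2 := by
    rw [div_le_iff₀ (by positivity)]
    refine hvol.trans (le_of_eq ?_)
    push_cast; field_simp
  linarith

lemma abs_card_latticePts_sub_le (y : ℝ) (hy : 0 ≤ y) (q : ℕ) (hq : 0 < q) (l : ℕ × ℕ × ℕ)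
    (hl : l.1 < q ∧ l.2.1 < q ∧ l.2.2 < q) :
    |((latticePts ⌊y ^ 3⌋₊ q l).card : ℝ) - m0 * y ^ 3 / q ^ 3| ≤ 3 * (y / q + 1) ^ 2 := by
  have h1 := card_latticePts_le y hy q hq l
  have h2 := le_card_latticePts y hy q hq l hl
  have h3 : (y / q) ^ 2 ≤ (y / q + 1) ^ 2 :=
    pow_le_pow_left₀ (by positivity) (by linarith) 2
  rw [abs_le]; constructor <;> linarith

lemma r3_eq_card (n N : ℕ) (h : n ≤ N) : r3 n = ((Icc 1 N ×ˢ Icc 1 N ×ˢ Icc 1 N).filter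
    fun t : ℕ × ℕ × ℕ => t.1 ^ 3 + t.2.1 ^ 3 + t.2.2 ^ 3 = n).card := by
  unfold r3
  congr 1
  ext t
  simp only [mem_filter, mem_product, mem_Icc]
  have hp : ∀ n : ℕ, n ≤ n ^ 3 := fun n => Nat.le_self_pow (by norm_num) n
  have := hp t.1; have := hp t.2.1; have := hp t.2.2
  constructor
  · rintro ⟨⟨h1, h2, h3⟩, h4⟩; exact ⟨⟨⟨h1.1, by omega⟩, ⟨h2.1, by omega⟩, ⟨h3.1, by omega⟩⟩, h4⟩
  · rintro ⟨⟨h1, h2, h3⟩, h4⟩; exact ⟨⟨⟨h1.1, by omega⟩, ⟨h2.1, by omega⟩, ⟨h3.1, by omega⟩⟩, h4⟩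

lemma upsilon_eq_sum_card (z : ℝ) (q a : ℕ) (hq : 0 < q) :
    upsilon z q a = ∑ l ∈ (range q ×ˢ range q ×ˢ range q).filter
      (fun l : ℕ × ℕ × ℕ => l.1 ^ 3 + l.2.1 ^ 3 + l.2.2 ^ 3 ≡ a [MOD q]),
        ((latticePts ⌊z⌋₊ q l).card : ℝ) := by
  classical
  set N := ⌊z⌋₊ with hN
  set T := ((Icc 1 N ×ˢ Icc 1 N ×ˢ Icc 1 N).filter fun t : ℕ × ℕ × ℕ =>
    t.1 ^ 3 + t.2.1 ^ 3 + t.2.2 ^ 3 ≤ N ∧ t.1 ^ 3 + t.2.1 ^ 3 + t.2.2 ^ 3 ≡ a [MOD q]) with hT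
  have h1 : upsilon z q a = (T.card : ℝ) := by
    unfold upsilon
    rw [← hN]
    rw [Finset.card_eq_sum_card_fiberwise (f := fun t : ℕ × ℕ × ℕ =>
      t.1 ^ 3 + t.2.1 ^ 3 + t.2.2 ^ 3) (t := (Icc 1 N).filter (fun n => n ≡ a [MOD q]))]
    · push_cast
      refine Finset.sum_congr rfl fun n hn => ?_
      rw [mem_filter, mem_Icc] at hn
      rw [r3_eq_card n N hn.1.2]
      congr 2
      ext t
      simp only [hT, mem_filter]
      constructor
      · rintro ⟨h1, h2⟩; exact ⟨⟨h1, by omega, by rw [h2]; exact hn.2⟩, h2⟩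
      · rintro ⟨⟨h1, -, -⟩, h2⟩; exact ⟨h1, h2⟩
    · intro t ht
      simp only [hT, Finset.mem_coe, mem_filter, mem_product, mem_Icc] at ht ⊢
      have : 0 < t.1 ^ 3 := pow_pos (by omega) 3
      exact ⟨⟨by omega, ht.2.1⟩, ht.2.2⟩
  rw [h1, Finset.card_eq_sum_card_fiberwise (f := fun t : ℕ × ℕ × ℕ =>
      (t.1 % q, t.2.1 % q, t.2.2 % q)) (t := (range q ×ˢ range q ×ˢ range q).filter
      (fun l : ℕ × ℕ × ℕ => l.1 ^ 3 + l.2.1 ^ 3 + l.2.2 ^ 3 ≡ a [MOD q]))]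
  · push_cast
    refine Finset.sum_congr rfl fun l hl => ?_
    congr 2
    ext t
    simp only [mem_filter, mem_product, mem_range] at hl
    obtain ⟨⟨l1, l2, l3⟩, hla⟩ := hl
    unfold latticePts
    simp only [hT, mem_filter]
    constructor
    · rintro ⟨⟨g1, g2, g3⟩, g4⟩
      refine ⟨g1, g2, ?_⟩
      rw [← g4]
      exact ⟨(Nat.mod_modEq _ _).symm, (Nat.mod_modEq _ _).symm, (Nat.mod_modEq _ _).symm⟩
    · rintro ⟨g1, g2, m1, m2, m3⟩
      refine ⟨⟨g1, g2, ?_⟩, ?_⟩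
      · exact (((m1.pow 3).add (m2.pow 3)).add (m3.pow 3)).trans hla
      · refine Prod.ext ?_ (Prod.ext ?_ ?_)
        · exact Nat.mod_eq_of_modEq m1 l1
        · exact Nat.mod_eq_of_modEq m2 l2
        · exact Nat.mod_eq_of_modEq m3 l3
  · intro t ht
    simp only [hT, Finset.mem_coe, mem_filter, mem_product, mem_range] at ht ⊢
    refine ⟨⟨Nat.mod_lt _ hq, Nat.mod_lt _ hq, Nat.mod_lt _ hq⟩, ?_⟩
    refine Nat.ModEq.trans ?_ ht.2.2
    exact (((Nat.mod_modEq _ _).pow 3).add ((Nat.mod_modEq _ _).pow 3)).add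
      ((Nat.mod_modEq _ _).pow 3)

/-- The class `a` splits into `ρ(q, a)` classes of triples. Their main terms add up exactly to the
expected value, and the lattice point error is uniform over them. -/
lemma abs_En_le (y : ℝ) (hy : 0 ≤ y) (q a : ℕ) (hq : 0 < q) :
    |En (y ^ 3) q a| ≤ rho q a * (3 * (y / q + 1) ^ 2) := by
  unfold En
  rw [upsilon_eq_sum_card _ q a hq]
  have h1 : m0 * y ^ 3 * (rho q a : ℝ) / (q : ℝ) ^ 3 =
      ∑ l ∈ (range q ×ˢ range q ×ˢ range q).filter
      (fun l : ℕ × ℕ × ℕ => l.1 ^ 3 + l.2.1 ^ 3 + l.2.2 ^ 3 ≡ a [MOD q]), m0 * y ^ 3 / q ^ 3 := by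
    rw [Finset.sum_const, nsmul_eq_mul]; unfold rho; ring
  rw [h1, ← Finset.sum_sub_distrib]
  refine (Finset.abs_sum_le_sum_abs _ _).trans ?_
  have h2 : ∀ l ∈ (range q ×ˢ range q ×ˢ range q).filter
      (fun l : ℕ × ℕ × ℕ => l.1 ^ 3 + l.2.1 ^ 3 + l.2.2 ^ 3 ≡ a [MOD q]),
      |((latticePts ⌊y ^ 3⌋₊ q l).card : ℝ) - m0 * y ^ 3 / q ^ 3| ≤ 3 * (y / q + 1) ^ 2 := by
    intro l hl
    simp only [mem_filter, mem_product, mem_range] at hl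
    exact abs_card_latticePts_sub_le y hy q hq l hl.1
  refine (Finset.sum_le_sum h2).trans ?_
  rw [Finset.sum_const, nsmul_eq_mul]; rfl

/-- The sum of `ρ(q, a)²` is `q⁵ Gsum q`. As `Gsum` turns out to be bounded, irregularity of `ρ`
costs only a constant. -/
lemma sum_En_sq_le (z : ℝ) (hz : 0 ≤ z) (q : ℕ) (hq : 0 < q) :
    ∑ a ∈ Icc 1 q, En z q a ^ 2 ≤ 9 * Gsum q * q * (z ^ (1 / 3 : ℝ) + q) ^ 4 := by
  set y := z ^ (1 / 3 : ℝ) with hy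
  have hy0 : 0 ≤ y := Real.rpow_nonneg hz _
  have hyz : y ^ 3 = z := by
    rw [hy, ← Real.rpow_natCast, ← Real.rpow_mul hz]; norm_num
  have hq' : (0 : ℝ) < q := by exact_mod_cast hq
  have h1 : ∀ a ∈ Icc 1 q, En z q a ^ 2 ≤ (rho q a : ℝ) ^ 2 * (9 * (y / q + 1) ^ 4) := by
    intro a _
    have := abs_En_le y hy0 q a hq
    rw [hyz] at this
    rw [← sq_abs]
    refine (pow_le_pow_left₀ (abs_nonneg _) this 2).trans (le_of_eq ?_)
    ring
  refine (Finset.sum_le_sum h1).trans (le_of_eq ?_)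
  rw [← Finset.sum_mul, sum_rho_sq q hq]
  field_simp

/-! ### Multiplicativity of the singular series coefficients -/

/-- The number of representations of `c` as a sum of three cubes in a finite ring. -/
def cubeReps (R : Type*) [CommRing R] [Fintype R] [DecidableEq R] (c : R) : ℕ :=
  ((Finset.univ : Finset (R × R × R)).filter
    fun t => t.1 ^ 3 + t.2.1 ^ 3 + t.2.2 ^ 3 = c).card

lemma cubeReps_prod (R T : Type*) [CommRing R] [Fintype R] [DecidableEq R] [CommRing T] [Fintype T]
    [DecidableEq T] (c : R × T) : cubeReps (R × T) c = cubeReps R c.1 * cubeReps T c.2 := by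
  unfold cubeReps
  rw [← card_product]
  refine Finset.card_bij' (fun t _ => ((t.1.1, t.2.1.1, t.2.2.1), (t.1.2, t.2.1.2, t.2.2.2)))
    (fun s _ => ((s.1.1, s.2.1), (s.1.2.1, s.2.2.1), (s.1.2.2, s.2.2.2))) ?_ ?_ ?_ ?_
  · intro t ht
    simp only [mem_filter, mem_univ, true_and, mem_product] at ht ⊢
    rw [← ht]; simp
  · intro s hs
    simp only [mem_filter, mem_univ, true_and, mem_product] at hs ⊢
    ext <;> simp [hs.1, hs.2]
  · intros; rfl
  · intros; rfl

lemma cubeReps_equiv {R T : Type*} [CommRing R] [Fintype R] [DecidableEq R] [CommRing T] [Fintype T]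
    [DecidableEq T] (f : R ≃+* T) (c : R) : cubeReps T (f c) = cubeReps R c := by
  unfold cubeReps
  symm
  refine Finset.card_bij' (fun t _ => (f t.1, f t.2.1, f t.2.2))
    (fun s _ => (f.symm s.1, f.symm s.2.1, f.symm s.2.2)) ?_ ?_ ?_ ?_
  · intro t ht
    simp only [mem_filter, mem_univ, true_and] at ht ⊢
    rw [← ht]; simp
  · intro t ht
    simp only [mem_filter, mem_univ, true_and] at ht ⊢
    rw [← map_pow, ← map_pow, ← map_pow, ← map_add, ← map_add, ht]; simp
  · intros; simp
  · intros; simp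

lemma rho_eq_cubeReps (q a : ℕ) [NeZero q] : rho q a = cubeReps (ZMod q) (a : ZMod q) := by
  unfold rho cubeReps
  refine Finset.card_bij' (fun t _ => ((t.1 : ZMod q), (t.2.1 : ZMod q), (t.2.2 : ZMod q)))
    (fun s _ => (s.1.val, s.2.1.val, s.2.2.val)) ?_ ?_ ?_ ?_
  · intro t ht
    simp only [mem_filter, mem_univ, true_and] at ht ⊢
    have := (ZMod.natCast_eq_natCast_iff _ _ _).2 ht.2
    push_cast at this; exact this
  · intro s hs
    simp only [mem_filter, mem_univ, true_and, mem_product, mem_range] at hs ⊢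
    refine ⟨⟨ZMod.val_lt _, ZMod.val_lt _, ZMod.val_lt _⟩, ?_⟩
    rw [← ZMod.natCast_eq_natCast_iff]
    push_cast
    simpa using hs
  · intro t ht
    simp only [mem_filter, mem_product, mem_range] at ht
    simp [ZMod.val_natCast, Nat.mod_eq_of_lt ht.1.1, Nat.mod_eq_of_lt ht.1.2.1,
      Nat.mod_eq_of_lt ht.1.2.2]
  · intro s _; simp

lemma sum_Icc_zmod {M : Type*} [AddCommMonoid M] (q : ℕ) [NeZero q] (f : ZMod q → M) :
    ∑ a ∈ Icc 1 q, f (a : ZMod q) = ∑ c : ZMod q, f c := by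
  rw [sum_Icc_one_eq_sum_range q (fun a => f (a : ZMod q)) (by simp)]
  refine Finset.sum_bij' (fun a _ => (a : ZMod q)) (fun c _ => c.val) ?_ ?_ ?_ ?_ ?_
  · intros; simp
  · intro c _; simpa using ZMod.val_lt c
  · intro a ha; rw [mem_range] at ha; simp [ZMod.val_natCast, Nat.mod_eq_of_lt ha]
  · intro c _; simp
  · intros; rfl

lemma Gsum_eq (q : ℕ) [NeZero q] :
    Gsum q = (∑ c : ZMod q, (cubeReps (ZMod q) c : ℝ) ^ 2) / (q : ℝ) ^ 5 := by
  have hq : 0 < q := NeZero.pos q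
  have h := sum_rho_sq q hq
  have hq' : (q : ℝ) ≠ 0 := by positivity
  rw [← sum_Icc_zmod q (fun c => (cubeReps (ZMod q) c : ℝ) ^ 2)]
  simp_rw [← rho_eq_cubeReps]
  rw [h]; field_simp

/-- By the Chinese remainder theorem `ZMod (m * n)` is a product ring, in which representation
counts factorise; so does their second moment. -/
lemma Gsum_mul {m n : ℕ} (h : m.Coprime n) : Gsum (m * n) = Gsum m * Gsum n := by
  rcases Nat.eq_zero_or_pos m with rfl | hm
  · simp [Gsum]
  rcases Nat.eq_zero_or_pos n with rfl | hn
  · simp [Gsum]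
  have : NeZero m := ⟨hm.ne'⟩
  have : NeZero n := ⟨hn.ne'⟩
  have : NeZero (m * n) := ⟨(Nat.mul_pos hm hn).ne'⟩
  rw [Gsum_eq, Gsum_eq, Gsum_eq, div_mul_div_comm, Finset.sum_mul_sum, ← Finset.sum_product']
  congr 1
  · rw [← Equiv.sum_comp (ZMod.chineseRemainder h).symm.toEquiv]
    refine Finset.sum_congr (by ext; simp) fun c _ => ?_
    have h1 := cubeReps_equiv (ZMod.chineseRemainder h).symm c
    rw [← mul_pow, ← Nat.cast_mul, ← cubeReps_prod]
    rw [← h1]; rfl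
  · push_cast; ring

lemma S_one (c : ℕ) : S 1 c = 1 := by
  unfold S
  simp only [Icc_self, sum_singleton]
  have := e_intCast c
  simpa using this

lemma sv_one (c : ℕ) : sv 1 c = 1 := by unfold sv; rw [S_one]; simp

lemma A1Term_one : A1Term 1 = 1 := by
  rw [A1Term_eq]
  simp [sv_one]

lemma A1Term_zero : A1Term 0 = 0 := by simp [A1Term, gaussMoment]

/-- The coefficients `A1Term` as an arithmetic function. -/
def gA : ArithmeticFunction ℝ := ⟨A1Term, A1Term_zero⟩

/-- The divisor sums `Gsum` as an arithmetic function. -/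
def GA : ArithmeticFunction ℝ := ⟨Gsum, by simp [Gsum]⟩

lemma GA_isMultiplicative : GA.IsMultiplicative := by
  refine ⟨?_, fun {m n} h => Gsum_mul h⟩
  change Gsum 1 = 1
  simp [Gsum, A1Term_one]

lemma zeta_mul_gA : (ArithmeticFunction.zeta : ArithmeticFunction ℝ) * gA = GA := by
  ext n
  rw [ArithmeticFunction.coe_zeta_mul_apply]; rfl

/-- Möbius inversion transfers multiplicativity from the divisor sums. -/
lemma gA_isMultiplicative : gA.IsMultiplicative := by
  have : gA = (ArithmeticFunction.moebius : ArithmeticFunction ℝ) * GA := by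
    rw [← zeta_mul_gA, ← mul_assoc, ArithmeticFunction.coe_moebius_mul_coe_zeta, one_mul]
  rw [this]
  exact ArithmeticFunction.isMultiplicative_moebius.intCast.mul GA_isMultiplicative

/-! ### Gauss sums to prime power moduli -/

lemma sum_range_mul_add {M : Type*} [AddCommMonoid M] (A B : ℕ) (f : ℕ → M) :
    ∑ m ∈ range (A * B), f m = ∑ u ∈ range A, ∑ v ∈ range B, f (u + A * v) := by
  rw [Finset.sum_comm]
  induction B with
  | zero => simp
  | succ B ih =>
    rw [Nat.mul_succ, Finset.sum_range_add, ih, Finset.sum_range_succ]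
    congr 1
    exact Finset.sum_congr rfl fun u _ => by rw [add_comm]

/-- Put `m = u + A v`. Since `q` divides `3 A²` and `A³`, the cube is `u³ + 3 u² A v` modulo `q`. As
`3 A / q = t / p`, the sum over `v` is a complete linear sum modulo `p` with frequency `c t u²`,
which vanishes unless `p ∣ u`. The free parameters let one argument cover `p = 3` and `p ≠ 3`. -/
lemma S_reduce {p q A B t c : ℕ} (hp : p.Prime) (hq : 0 < q) (hAB : A * B = q)
    (hA : 3 * A * p = t * q) (ht : t.Coprime p) (hA2 : q ∣ 3 * A ^ 2) (hA3 : q ∣ A ^ 3)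
    (hpB : p ∣ B) (hpA : p ∣ A) (hc : c.Coprime p) :
    S q c = B * ∑ w ∈ range (A / p), e ((c : ℝ) * ((p * w : ℕ) : ℝ) ^ 3 / q) := by
  rw [S_eq_range q c hq, ← hAB, sum_range_mul_add, hAB]
  have hq' : (q : ℝ) ≠ 0 := by positivity
  have hp' : (p : ℝ) ≠ 0 := by exact_mod_cast hp.ne_zero
  obtain ⟨B', hB'⟩ := hpB
  have hinner : ∀ u ∈ range A, ∑ v ∈ range B, e ((c : ℝ) * ((u + A * v : ℕ) : ℝ) ^ 3 / q)
      = if p ∣ u then (B : ℂ) * e ((c : ℝ) * (u : ℝ) ^ 3 / q) else 0 := by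
    intro u _
    have h1 : ∀ v : ℕ, e ((c : ℝ) * ((u + A * v : ℕ) : ℝ) ^ 3 / q)
        = e ((c : ℝ) * (u : ℝ) ^ 3 / q) * e ((v : ℝ) * ((c * t * u ^ 2 : ℕ) : ℤ) / p) := by
      intro v
      have hmod : (u + A * v) ^ 3 ≡ u ^ 3 + 3 * u ^ 2 * A * v [MOD q] := by
        have : (u + A * v) ^ 3 = u ^ 3 + 3 * u ^ 2 * A * v + (3 * A ^ 2 * (u * v ^ 2) + A ^ 3 * v ^ 3) := by
          ring
        rw [this]
        have h0 : q ∣ 3 * A ^ 2 * (u * v ^ 2) + A ^ 3 * v ^ 3 :=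
          dvd_add (Dvd.dvd.mul_right hA2 _) (Dvd.dvd.mul_right hA3 _)
        simpa using (Nat.ModEq.refl (n := q) (u ^ 3 + 3 * u ^ 2 * A * v)).add
          ((Nat.modEq_zero_iff_dvd).2 h0)
      have h2 := e_congr_nat hq hmod c
      have h3 : (3 : ℝ) * A * p = t * q := by exact_mod_cast hA
      have h4 : (c : ℝ) * ((u ^ 3 + 3 * u ^ 2 * A * v : ℕ) : ℝ) / q
          = (c : ℝ) * (u : ℝ) ^ 3 / q + (v : ℝ) * ((c * t * u ^ 2 : ℕ) : ℤ) / p := by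
        push_cast
        field_simp
        linear_combination (c * u ^ 2 * v : ℝ) * h3
      rw [← e_add, ← h4, ← h2]; push_cast; rfl
    simp_rw [h1, ← Finset.mul_sum]
    rw [hB', mul_comm p B', sum_range_mul_of_periodic]
    · rw [← sum_Icc_one_eq_sum_range p, sum_e_div p hp.pos]
      · have hdvd : ((p : ℤ) ∣ ((c * t * u ^ 2 : ℕ) : ℤ)) ↔ p ∣ u := by
          rw [Int.natCast_dvd_natCast]
          constructor
          · intro h
            have h5 : p.Coprime (c * t) := (Nat.Coprime.mul_left hc ht).symm
            exact hp.dvd_of_dvd_pow (h5.dvd_of_dvd_mul_left h)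
          · intro h; exact Dvd.dvd.mul_left (dvd_pow h (by norm_num)) _
        rw [if_congr hdvd rfl rfl]
        split_ifs
        · rw [nsmul_eq_mul]; push_cast; ring
        · simp
      · have := e_intCast ((c * t * u ^ 2 : ℕ) : ℤ)
        rw [Nat.cast_zero, zero_mul, zero_div, e_zero, mul_div_assoc, mul_div_cancel₀ _ hp', this]
    · intro v
      have : ((v + p : ℕ) : ℝ) * ((c * t * u ^ 2 : ℕ) : ℤ) / p
          = (v : ℝ) * ((c * t * u ^ 2 : ℕ) : ℤ) / p + ((c * t * u ^ 2 : ℕ) : ℤ) := by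
        push_cast; field_simp
      rw [this, e_add_int]
  rw [Finset.sum_congr rfl hinner]
  obtain ⟨A', hA'⟩ := hpA
  rw [hA', Nat.mul_div_cancel_left _ hp.pos, Finset.mul_sum, mul_comm p A', ← Finset.sum_filter]
  symm
  refine Finset.sum_bij (fun w _ => p * w) ?_ ?_ ?_ ?_
  · intro w hw
    rw [mem_range] at hw
    simp only [mem_filter, mem_range]
    exact ⟨by rw [mul_comm A' p]; exact Nat.mul_lt_mul_of_pos_left hw hp.pos, dvd_mul_right _ _⟩
  · intro a _ b _ h; exact Nat.eq_of_mul_eq_mul_left hp.pos h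
  · intro u hu
    simp only [mem_filter, mem_range] at hu
    obtain ⟨h1, w, rfl⟩ := hu
    refine ⟨w, ?_, rfl⟩
    rw [mem_range]; rw [mul_comm A' p] at h1
    exact Nat.lt_of_mul_lt_mul_left h1
  · intros; rfl

lemma S_prime_sq {p c : ℕ} (hp : p.Prime) (hp3 : p ≠ 3) (hc : c.Coprime p) : S (p ^ 2) c = p := by
  rw [S_reduce (A := p) (B := p) (t := 3) hp (pow_pos hp.pos 2) (by ring) (by ring)
    ((Nat.coprime_primes Nat.prime_three hp).2 (Ne.symm hp3)) (Dvd.intro_left 3 rfl)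
    (pow_dvd_pow p (by norm_num)) dvd_rfl dvd_rfl hc]
  rw [Nat.div_self hp.pos]
  simp [e_zero]

lemma S_prime_pow_add_three {p c : ℕ} (hp : p.Prime) (hc : c.Coprime p) (k : ℕ) :
    S (p ^ (k + 3)) c = p ^ 2 * S (p ^ k) c := by
  have hp' : (p : ℝ) ≠ 0 := by exact_mod_cast hp.ne_zero
  have key : ∀ w : ℕ, e ((c : ℝ) * ((p * w : ℕ) : ℝ) ^ 3 / ((p ^ (k + 3) : ℕ) : ℝ))
      = e ((c : ℝ) * (w : ℝ) ^ 3 / ((p ^ k : ℕ) : ℝ)) := by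
    intro w; congr 1; push_cast; rw [pow_add]; field_simp
  -- At `p = 3` the coefficient `3` of `u² A v` is itself a power of the prime, so the split is at
  -- `3 ^ (k + 1)` with `t = 1`. For other primes it is at `p ^ (k + 2)` with `t = 3`. Both leave
  -- the factor `p ^ 2`.
  by_cases hp3 : p = 3
  · subst hp3
    rw [S_reduce (A := 3 ^ (k + 1)) (B := 9) (t := 1) hp (pow_pos hp.pos _) (by ring) (by ring)
      (by norm_num) ⟨3 ^ k, by ring⟩ ⟨3 ^ (2 * k), by ring⟩ (by norm_num)
      (dvd_pow_self 3 (by omega)) hc]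
    simp_rw [key]
    rw [pow_succ, Nat.mul_div_cancel _ (by norm_num), ← S_eq_range _ _ (by positivity)]
    norm_num
  · rw [S_reduce (A := p ^ (k + 2)) (B := p) (t := 3) hp (pow_pos hp.pos _) (by ring) (by ring)
      ((Nat.coprime_primes Nat.prime_three hp).2 (Ne.symm hp3)) ⟨3 * p ^ (k + 1), by ring⟩
      ⟨p ^ (2 * k + 3), by ring⟩ dvd_rfl (dvd_pow_self p (by omega)) hc]
    simp_rw [key]
    rw [pow_succ, Nat.mul_div_cancel _ hp.pos, pow_succ, mul_comm (p ^ k) p,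
      sum_range_mul_of_periodic, ← S_eq_range _ _ (pow_pos hp.pos _), nsmul_eq_mul]
    · ring
    · intro m
      have := e_congr_nat (pow_pos hp.pos k) (a := (m + p ^ k) ^ 3) (b := m ^ 3) (by
        apply Nat.ModEq.pow; simp [Nat.ModEq]) c
      simpa using this

lemma S_periodic {q : ℕ} (hq : 0 < q) {a b : ℕ} (h : a ≡ b [MOD q]) : S q a = S q b := by
  unfold S
  refine Finset.sum_congr rfl fun m _ => ?_
  have := e_congr_nat hq h (m ^ 3)
  rw [mul_comm (a : ℝ), mul_comm (b : ℝ)]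
  simpa using this

lemma sv_prime_pow_add_three {p c : ℕ} (hp : p.Prime) (hc : c.Coprime p) (k : ℕ) :
    ‖sv (p ^ (k + 3)) c‖ ^ 6 = (p : ℝ) ^ (-6 : ℤ) * ‖sv (p ^ k) c‖ ^ 6 := by
  have hp' : (p : ℂ) ≠ 0 := by exact_mod_cast hp.ne_zero
  have hpr : (p : ℝ) ≠ 0 := by exact_mod_cast hp.ne_zero
  have : sv (p ^ (k + 3)) c = (p : ℂ)⁻¹ * sv (p ^ k) c := by
    unfold sv
    rw [S_prime_pow_add_three hp hc]
    push_cast; rw [pow_add]; field_simp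
  rw [this, norm_mul, norm_inv, Complex.norm_natCast, mul_pow]
  congr 1
  rw [zpow_neg, inv_pow]; norm_cast

/-- Each normalised sixth power gains `p⁻⁶`, while the number of residues grows by `p³`. The
recursion starts at exponent `1`, because coprimality to `p ^ 0` is no condition; the step from `0`
to `3` is `A1Term_prime_cube`. -/
lemma A1Term_prime_pow_add_three {p : ℕ} (hp : p.Prime) (k : ℕ) :
    A1Term (p ^ (k + 4)) = (p : ℝ) ^ (-3 : ℤ) * A1Term (p ^ (k + 1)) := by
  have hpr : (p : ℝ) ≠ 0 := by exact_mod_cast hp.ne_zero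
  have hcop : ∀ k c : ℕ, c.Coprime (p ^ (k + 1)) ↔ c.Coprime p := fun k c =>
    Nat.coprime_pow_right_iff (by omega) _ _
  rw [A1Term_eq, A1Term_eq, Finset.sum_filter, Finset.sum_filter]
  have h1 : ∀ c ∈ Icc 1 (p ^ (k + 4)), (if c.Coprime (p ^ (k + 4)) then ‖sv (p ^ (k + 4)) c‖ ^ 6 else 0)
      = (p : ℝ) ^ (-6 : ℤ) * (if c.Coprime (p ^ (k + 1)) then ‖sv (p ^ (k + 1)) c‖ ^ 6 else 0) := by
    intro c _
    rw [if_congr (hcop (k + 3) c) rfl rfl, if_congr (hcop k c) rfl rfl]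
    split_ifs with h
    · exact sv_prime_pow_add_three hp h (k + 1)
    · simp
  rw [Finset.sum_congr rfl h1, ← Finset.mul_sum]
  have hper : ∀ a b : ℕ, a ≡ b [MOD p ^ (k + 1)] →
      (if a.Coprime (p ^ (k + 1)) then ‖sv (p ^ (k + 1)) a‖ ^ 6 else 0)
      = (if b.Coprime (p ^ (k + 1)) then ‖sv (p ^ (k + 1)) b‖ ^ 6 else 0) := by
    intro a b h
    have : a.Coprime (p ^ (k + 1)) ↔ b.Coprime (p ^ (k + 1)) := by
      unfold Nat.Coprime; rw [h.gcd_eq]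
    rw [if_congr this rfl rfl]
    unfold sv
    rw [S_periodic (pow_pos hp.pos _) h]
  rw [sum_Icc_one_eq_sum_range _ _ (hper _ _ (by
      simp only [Nat.ModEq, Nat.zero_mod]; exact Nat.mod_eq_zero_of_dvd (pow_dvd_pow p (by omega)))),
    sum_Icc_one_eq_sum_range _ _ (hper _ _ (by simp [Nat.ModEq])),
    show p ^ (k + 4) = p ^ 3 * p ^ (k + 1) by ring, sum_range_mul_of_periodic _ _ _
      (fun m => hper _ _ (by simp [Nat.ModEq])), nsmul_eq_mul, ← mul_assoc]
  congr 1
  push_cast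
  rw [show (-3 : ℤ) = -6 + 3 by norm_num, zpow_add₀ hpr]; norm_cast

lemma card_coprime_prime_pow {p : ℕ} (hp : p.Prime) (k : ℕ) :
    (((Icc 1 (p ^ (k + 1))).filter (fun c => c.Coprime (p ^ (k + 1)))).card : ℝ)
      = (p : ℝ) ^ k * (p - 1) := by
  have h := Nat.totient_prime_pow_succ hp k
  have h2 : ((Icc 1 (p ^ (k + 1))).filter (fun c => c.Coprime (p ^ (k + 1)))).card
      = p ^ k * (p - 1) := by
    rw [← h, Nat.totient_eq_card_coprime, Finset.card_filter, Finset.card_filter,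
      sum_Icc_one_eq_sum_range]
    · exact Finset.sum_congr rfl fun c _ => by rw [if_congr (Nat.coprime_comm) rfl rfl]
    · simp [Nat.Coprime]
  rw [h2]
  have := hp.one_le
  push_cast [Nat.cast_sub this]; ring

lemma A1Term_prime_cube {p : ℕ} (hp : p.Prime) :
    A1Term (p ^ 3) = (p : ℝ) ^ (-3 : ℤ) - (p : ℝ) ^ (-4 : ℤ) := by
  have hpr : (p : ℝ) ≠ 0 := by exact_mod_cast hp.ne_zero
  rw [A1Term_eq]
  have h1 : ∀ c ∈ (Icc 1 (p ^ 3)).filter (fun c => c.Coprime (p ^ 3)),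
      ‖sv (p ^ 3) c‖ ^ 6 = (p : ℝ) ^ (-6 : ℤ) := by
    intro c hc
    rw [mem_filter] at hc
    have := sv_prime_pow_add_three hp ((Nat.coprime_pow_right_iff (by omega) _ _).1 hc.2) 0
    rw [zero_add, pow_zero, sv_one] at this
    rw [this]; simp
  rw [Finset.sum_congr rfl h1, Finset.sum_const, nsmul_eq_mul, card_coprime_prime_pow hp 2]
  simp only [zpow_neg, zpow_ofNat]
  field_simp

lemma A1Term_prime_sq {p : ℕ} (hp : p.Prime) (hp3 : p ≠ 3) :
    A1Term (p ^ 2) = ((p : ℝ) - 1) * (p : ℝ) ^ (-5 : ℤ) := by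
  have hpr : (p : ℝ) ≠ 0 := by exact_mod_cast hp.ne_zero
  rw [A1Term_eq]
  have h1 : ∀ c ∈ (Icc 1 (p ^ 2)).filter (fun c => c.Coprime (p ^ 2)),
      ‖sv (p ^ 2) c‖ ^ 6 = (p : ℝ) ^ (-6 : ℤ) := by
    intro c hc
    rw [mem_filter] at hc
    have hcp := (Nat.coprime_pow_right_iff (by omega : 0 < 2) _ _).1 hc.2
    unfold sv
    rw [S_prime_sq hp hp3 hcp, norm_div, Complex.norm_natCast, Complex.norm_natCast, zpow_neg, zpow_ofNat]
    push_cast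
    field_simp
  rw [Finset.sum_congr rfl h1, Finset.sum_const, nsmul_eq_mul, card_coprime_prime_pow hp 1]
  simp only [zpow_neg, zpow_ofNat]
  field_simp

/-- Cubing is the identity modulo `3`, so the cubic sum is a complete linear one. -/
lemma A1Term_three : A1Term 3 = 0 := by
  rw [A1Term_eq]
  refine Finset.sum_eq_zero fun c hc => ?_
  rw [mem_filter] at hc
  have h3 : S 3 c = 0 := by
    unfold S
    have h1 : ∀ m ∈ Icc (1 : ℕ) 3, e ((c : ℝ) * (m : ℝ) ^ 3 / (3 : ℕ)) = e ((m : ℝ) * (c : ℤ) / (3 : ℕ)) := by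
      intro m _
      have : m ^ 3 ≡ m [MOD 3] := by
        rw [Nat.ModEq, Nat.pow_mod]
        have : m % 3 < 3 := Nat.mod_lt _ (by norm_num)
        interval_cases m % 3 <;> rfl
      have := e_congr_nat (by norm_num) this c
      rw [show (m : ℝ) * (c : ℤ) / (3 : ℕ) = (c : ℝ) * m / (3 : ℕ) by push_cast; ring, ← this]
      push_cast; rfl
    rw [Finset.sum_congr rfl h1, sum_e_div 3 (by norm_num), if_neg]
    intro h
    have h4 : 3 ∣ c := by exact_mod_cast h
    have := Nat.eq_one_of_dvd_coprimes hc.2 h4 dvd_rfl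
    omega
  unfold sv
  rw [h3]; simp

/-! ### Square-root cancellation in cubic sums to prime modulus. -/

lemma card_cube_roots_le {p c : ℕ} (hp : p.Prime) (hc : c.Coprime p) (a : ℕ) :
    ((range p).filter (fun m => c * m ^ 3 ≡ a [MOD p])).card ≤ 3 := by
  have : Fact p.Prime := ⟨hp⟩
  have hc0 : (c : ZMod p) ≠ 0 := by
    rw [Ne, ZMod.natCast_eq_zero_iff]
    intro h
    exact hp.one_lt.ne' (Nat.eq_one_of_dvd_coprimes hc h dvd_rfl)
  classical
  refine le_trans ?_ ((Multiset.toFinset_card_le _).trans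
    (Polynomial.card_nthRoots 3 ((a : ZMod p) / c)))
  refine Finset.card_le_card_of_injOn (fun m => (m : ZMod p)) ?_ ?_
  · intro m hm
    simp only [Finset.mem_coe, mem_filter, mem_range] at hm
    simp only [Finset.mem_coe, Multiset.mem_toFinset]
    rw [Polynomial.mem_nthRoots (by norm_num)]
    have := (ZMod.natCast_eq_natCast_iff _ _ _).2 hm.2
    push_cast at this
    rw [eq_div_iff hc0, mul_comm]; exact this
  · intro m hm m' hm' h
    simp only [Finset.mem_coe, mem_filter, mem_range] at hm hm'
    have := (ZMod.natCast_eq_natCast_iff' _ _ _).1 h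
    rwa [Nat.mod_eq_of_lt hm.1, Nat.mod_eq_of_lt hm'.1] at this

/-- Parseval for the number of cube roots of a residue, which is at most `3` and has total `p`. -/
lemma sum_norm_S_sq_le {p : ℕ} (hp : p.Prime) : ∑ c ∈ Icc 1 p, ‖S p c‖ ^ 2 ≤ 3 * (p : ℝ) ^ 2 := by
  have hp' : (0 : ℝ) < p := by exact_mod_cast hp.pos
  let F : ℕ → ℝ := fun a => ∑ m ∈ (range p).filter (fun m => m ^ 3 ≡ a [MOD p]), (1 : ℝ)
  have h1 : ∀ c, hat p F c = S p c := by
    intro c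
    have := hat_count p hp.pos (range p) (fun m => m ^ 3) (fun _ => (1 : ℝ)) c
    rw [S_eq_range p c hp.pos]
    simp only [F]
    rw [this]
    simp
  have h2 := parseval_sq p hp.pos F
  simp_rw [h1] at h2
  have h3 : ∑ c ∈ Icc 1 p, ‖S p c‖ ^ 2 = p * ∑ a ∈ Icc 1 p, F a ^ 2 := by
    rw [h2]; field_simp
  have h4 : ∀ a ∈ Icc 1 p, F a ^ 2 ≤ 3 * F a := by
    intro a _
    have : F a ≤ 3 := by
      simp only [F, Finset.sum_const, nsmul_eq_mul, mul_one]
      have := card_cube_roots_le hp (Nat.coprime_one_left p) a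
      simp only [one_mul] at this
      exact_mod_cast this
    have h0 : 0 ≤ F a := Finset.sum_nonneg fun _ _ => by norm_num
    nlinarith
  have h5 : ∑ a ∈ Icc 1 p, F a = p := by
    simp only [F, Finset.sum_filter]
    rw [Finset.sum_comm]
    rw [Finset.sum_congr rfl fun m _ => sum_Icc_ite_modEq hp.pos (m ^ 3) (fun _ => (1 : ℝ))
      (fun _ _ _ => rfl)]
    simp
  rw [h3]
  have := Finset.sum_le_sum h4
  rw [← Finset.mul_sum, h5] at this
  nlinarith

lemma S_mul_cube {p c b : ℕ} (hp : p.Prime) (hb : b.Coprime p) : S p (c * b ^ 3) = S p c := by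
  have : Fact p.Prime := ⟨hp⟩
  have : NeZero p := ⟨hp.ne_zero⟩
  have hb0 : (b : ZMod p) ≠ 0 := by
    rw [Ne, ZMod.natCast_eq_zero_iff]
    intro h
    exact hp.one_lt.ne' (Nat.eq_one_of_dvd_coprimes hb h dvd_rfl)
  let f : ZMod p → ℂ := fun z => e ((c : ℝ) * (z.val ^ 3 : ℕ) / p)
  have hf : ∀ m : ℕ, f (m : ZMod p) = e ((c : ℝ) * (m : ℝ) ^ 3 / p) := by
    intro m
    simp only [f, ZMod.val_natCast]
    have := e_congr_nat hp.pos ((Nat.mod_modEq m p).pow 3) c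
    push_cast at this ⊢
    exact this
  have h1 : S p c = ∑ z : ZMod p, f z := by
    rw [← sum_Icc_zmod]; unfold S
    exact Finset.sum_congr rfl fun m _ => (hf m).symm
  have h2 : S p (c * b ^ 3) = ∑ z : ZMod p, f (b * z) := by
    rw [← sum_Icc_zmod p (fun z => f (b * z))]; unfold S
    refine Finset.sum_congr rfl fun m _ => ?_
    have := hf (b * m)
    push_cast at this
    rw [this]; push_cast; ring_nf
  rw [h1, h2]
  exact Equiv.sum_comp (Equiv.mulLeft₀ (b : ZMod p) hb0) f

/-- The sum is unchanged when `c` is multiplied by a cube, and each residue is `c b³` for at most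
three `b`. Averaging over `b` gives `(p - 1) |S|² ≤ 3 · 3 p²`, an elementary substitute for the
evaluation by cubic characters. -/
lemma norm_S_sq_le {p c : ℕ} (hp : p.Prime) (hc : c.Coprime p) : ‖S p c‖ ^ 2 ≤ 18 * p := by
  have hp' : (2 : ℝ) ≤ p := by exact_mod_cast hp.two_le
  have h1 : ∑ b ∈ (range p).filter (fun b => b.Coprime p), ‖S p (c * b ^ 3)‖ ^ 2
      = ((p : ℝ) - 1) * ‖S p c‖ ^ 2 := by
    rw [Finset.sum_congr rfl (fun b hb => by rw [S_mul_cube hp (mem_filter.1 hb).2]),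
      Finset.sum_const, nsmul_eq_mul]
    congr 1
    have := Nat.totient_prime hp
    rw [Nat.totient_eq_card_coprime] at this
    rw [Finset.filter_congr (fun b _ => Nat.coprime_comm), this, Nat.cast_sub hp.one_le, Nat.cast_one]
  have h2 : ∑ b ∈ (range p).filter (fun b => b.Coprime p), ‖S p (c * b ^ 3)‖ ^ 2
      ≤ ∑ b ∈ range p, ‖S p (c * b ^ 3)‖ ^ 2 :=
    Finset.sum_le_sum_of_subset_of_nonneg (filter_subset _ _) fun _ _ _ => by positivity
  have h3 : ∑ b ∈ range p, ‖S p (c * b ^ 3)‖ ^ 2 ≤ ∑ a ∈ Icc 1 p, 3 * ‖S p a‖ ^ 2 := by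
    rw [Finset.sum_congr rfl fun b _ => (sum_Icc_ite_modEq hp.pos (c * b ^ 3)
      (fun a => ‖S p a‖ ^ 2) (fun a b h => by rw [S_periodic hp.pos h])).symm, Finset.sum_comm]
    refine Finset.sum_le_sum fun a _ => ?_
    rw [← Finset.sum_filter, Finset.sum_const, nsmul_eq_mul]
    apply mul_le_mul_of_nonneg_right _ (by positivity)
    exact_mod_cast card_cube_roots_le hp hc a
  rw [← Finset.mul_sum] at h3
  have h4 := sum_norm_S_sq_le hp
  nlinarith [sq_nonneg ‖S p c‖]

lemma A1Term_prime_le {p : ℕ} (hp : p.Prime) : A1Term p ≤ 5832 * (p : ℝ) ^ (-2 : ℝ) := by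
  have hp' : (0 : ℝ) < p := by exact_mod_cast hp.pos
  rw [A1Term_eq]
  -- `5832 = 18³`, from `norm_S_sq_le`.
  have h1 : ∀ c ∈ (Icc 1 p).filter (fun c => c.Coprime p), ‖sv p c‖ ^ 6 ≤ 5832 / (p : ℝ) ^ 3 := by
    intro c hc
    have h := norm_S_sq_le hp (mem_filter.1 hc).2
    unfold sv
    rw [norm_div, Complex.norm_natCast, div_pow, div_le_div_iff₀ (by positivity) (by positivity)]
    have := pow_le_pow_left₀ (sq_nonneg _) h 3
    calc ‖S p c‖ ^ 6 * (p : ℝ) ^ 3 = (‖S p c‖ ^ 2) ^ 3 * (p : ℝ) ^ 3 := by ring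
      _ ≤ (18 * p) ^ 3 * (p : ℝ) ^ 3 := by gcongr
      _ = 5832 * (p : ℝ) ^ 6 := by ring
  refine (Finset.sum_le_card_nsmul _ _ _ h1).trans ?_
  rw [nsmul_eq_mul]
  have h2 := card_coprime_prime_pow hp 0
  simp only [zero_add, pow_one, pow_zero, one_mul] at h2
  rw [h2, Real.rpow_neg hp'.le, Real.rpow_two, mul_div_assoc', div_le_iff₀ (by positivity)]
  have : (5832 : ℝ) * ((p : ℝ) ^ 2)⁻¹ * (p : ℝ) ^ 3 = 5832 * p := by field_simp
  rw [this]; linarith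

/-! ### Arithmetic functions with prescribed values at prime powers -/

/-- The multiplicative function with value `w p e` at `p ^ e`. -/
def multOf (w : ℕ → ℕ → ℝ) : ArithmeticFunction ℝ :=
  ⟨fun n => if n = 0 then 0 else n.factorization.prod w, by simp⟩

lemma multOf_apply (w : ℕ → ℕ → ℝ) {n : ℕ} (hn : n ≠ 0) :
    multOf w n = n.factorization.prod w := by
  change (if n = 0 then 0 else n.factorization.prod w) = _
  rw [if_neg hn]

lemma multOf_isMultiplicative (w : ℕ → ℕ → ℝ) : (multOf w).IsMultiplicative := by
  refine ⟨?_, fun {m n} h => ?_⟩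
  · rw [multOf_apply _ one_ne_zero]; simp
  · rcases eq_or_ne m 0 with rfl | hm
    · simp
    rcases eq_or_ne n 0 with rfl | hn
    · simp
    rw [multOf_apply _ hm, multOf_apply _ hn, multOf_apply _ (mul_ne_zero hm hn),
      Nat.factorization_mul hm hn]
    exact Finsupp.prod_add_index_of_disjoint h.disjoint_primeFactors w

lemma multOf_prime_pow (w : ℕ → ℕ → ℝ) (hw : ∀ p, w p 0 = 1) {p : ℕ} (hp : p.Prime) (e : ℕ) :
    multOf w (p ^ e) = w p e := by
  rw [multOf_apply _ (pow_pos hp.pos e).ne', hp.factorization_pow,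
    Finsupp.prod_single_index (hw p)]

/-- Local values of the indicator of cubes weighted by `1 / n`. -/
def bLoc (p e : ℕ) : ℝ := if 3 ∣ e then ((p : ℝ) ^ e)⁻¹ else 0

/-- The function `m³ ↦ m⁻³`, zero off the cubes. -/
def bA : ArithmeticFunction ℝ := multOf bLoc

/-- Local values of the remaining factor of `A1Term`. -/
def kLoc (p : ℕ) : ℕ → ℝ
  | 0 => 1
  | 1 => A1Term p
  | 2 => A1Term (p ^ 2)
  | 3 => -((p : ℝ) ^ 4)⁻¹
  | _ => 0

/-- The multiplicative function with `A1Term = bA * kA`. -/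
def kA : ArithmeticFunction ℝ := multOf kLoc

lemma bA_isMultiplicative : bA.IsMultiplicative := multOf_isMultiplicative _
lemma kA_isMultiplicative : kA.IsMultiplicative := multOf_isMultiplicative _

lemma bA_prime_pow {p : ℕ} (hp : p.Prime) (e : ℕ) : bA (p ^ e) = bLoc p e :=
  multOf_prime_pow _ (fun p => by simp [bLoc]) hp e

lemma kA_prime_pow {p : ℕ} (hp : p.Prime) (e : ℕ) : kA (p ^ e) = kLoc p e :=
  multOf_prime_pow _ (fun _ => rfl) hp e

lemma bA_cube {m : ℕ} (hm : m ≠ 0) : bA (m ^ 3) = ((m : ℝ) ^ 3)⁻¹ := by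
  unfold bA
  rw [multOf_apply _ (pow_ne_zero 3 hm), Nat.factorization_pow, Finsupp.prod,
    Finsupp.support_smul_eq (by norm_num)]
  have h1 : ∀ p ∈ m.factorization.support, bLoc p ((3 • m.factorization) p)
      = (((p : ℝ) ^ (m.factorization p)) ^ 3)⁻¹ := by
    intro p _
    simp only [Finsupp.smul_apply, smul_eq_mul, bLoc, dvd_mul_right, if_true]
    rw [← pow_mul, mul_comm]
  rw [Finset.prod_congr rfl h1, Finset.prod_inv_distrib, Finset.prod_pow]
  congr 2
  have := Nat.prod_factorization_pow_eq_self hm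
  rw [Finsupp.prod] at this
  exact_mod_cast this

/-- A nonzero value forces all exponents in the factorisation to be multiples of `3`. -/
lemma exists_cube_of_bA_ne_zero {n : ℕ} (h : bA n ≠ 0) : ∃ m, m ≠ 0 ∧ m ^ 3 = n := by
  have hn : n ≠ 0 := by rintro rfl; simp at h
  unfold bA at h
  rw [multOf_apply _ hn, Finsupp.prod, Finset.prod_ne_zero_iff] at h
  refine ⟨n.factorization.prod fun p e => p ^ (e / 3), ?_, ?_⟩
  · rw [Finsupp.prod, Finset.prod_ne_zero_iff]
    intro p hp
    exact pow_ne_zero _ (Nat.prime_of_mem_primeFactors hp).ne_zero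
  · conv_rhs => rw [← Nat.prod_factorization_pow_eq_self hn]
    rw [Finsupp.prod, Finsupp.prod, ← Finset.prod_pow]
    refine Finset.prod_congr rfl fun p hp => ?_
    rw [← pow_mul]
    congr 1
    have := h p hp
    unfold bLoc at this
    have h3 : 3 ∣ n.factorization p := by
      by_contra hcon; rw [if_neg hcon] at this; exact this rfl
    exact Nat.div_mul_cancel h3

lemma kLoc_eq_zero (p : ℕ) {e : ℕ} (he : 4 ≤ e) : kLoc p e = 0 := by
  obtain ⟨e, rfl⟩ := Nat.exists_eq_add_of_le' he; rfl

lemma bLoc_add_three {p : ℕ} (i : ℕ) : bLoc p (i + 3) = ((p : ℝ) ^ 3)⁻¹ * bLoc p i := by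
  unfold bLoc
  have : 3 ∣ i + 3 ↔ 3 ∣ i := by omega
  rw [if_congr this rfl rfl]
  split_ifs
  · rw [pow_add, mul_inv, mul_comm]
  · simp

lemma mul_prime_pow (f h : ArithmeticFunction ℝ) {p : ℕ} (hp : p.Prime) (e : ℕ) :
    (f * h) (p ^ e) = ∑ i ∈ range (e + 1), h (p ^ i) * f (p ^ (e - i)) := by
  rw [mul_comm, ArithmeticFunction.mul_apply, Nat.sum_divisorsAntidiagonal (fun x y => h x * f y),
    Nat.sum_divisors_prime_pow hp]
  refine Finset.sum_congr rfl fun i hi => ?_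
  rw [mem_range] at hi
  rw [Nat.pow_div (by omega) hp.pos]

/-- By the recursion the local generating series at `p` is rational with denominator `1 - p⁻³ X³`,
which is the part `bA`. The numerator has degree `3`, and its last coefficient is `A1Term (p ^ 3) -
p⁻³ = -p⁻⁴`; these coefficients are `kLoc`. -/
lemma gA_eq : gA = bA * kA := by
  rw [ArithmeticFunction.IsMultiplicative.eq_iff_eq_on_prime_powers _ gA_isMultiplicative _
    (bA_isMultiplicative.mul kA_isMultiplicative)]
  intro p i hp
  have hpr : (p : ℝ) ≠ 0 := by exact_mod_cast hp.ne_zero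
  rw [mul_prime_pow _ _ hp]
  simp_rw [kA_prime_pow hp, bA_prime_pow hp]
  have b0 : bLoc p 0 = 1 := by simp [bLoc]
  have b1 : bLoc p 1 = 0 := by simp [bLoc]
  have b2 : bLoc p 2 = 0 := by simp [bLoc]
  have bs := bLoc_add_three (p := p)
  have hg : gA (p ^ i) = A1Term (p ^ i) := rfl
  rw [hg]
  have hrec := fun k => A1Term_prime_pow_add_three hp k
  have hz : (p : ℝ) ^ (-3 : ℤ) = ((p : ℝ) ^ 3)⁻¹ := by rw [zpow_neg, zpow_ofNat]
  simp only [hz] at hrec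
  have hg3 := A1Term_prime_cube hp
  have hz4 : (p : ℝ) ^ (-4 : ℤ) = ((p : ℝ) ^ 4)⁻¹ := by rw [zpow_neg, zpow_ofNat]
  rw [hz, hz4] at hg3
  induction i using Nat.strong_induction_on with
  | _ i ih =>
    match i, ih with
    | 0, _ => simp [kLoc, b0, A1Term_one]
    | 1, _ => simp [Finset.sum_range_succ, kLoc, b0, b1]
    | 2, _ => simp [Finset.sum_range_succ, kLoc, b0, b1, b2]
    | 3, _ =>
      simp only [Finset.sum_range_succ, range_zero, sum_empty, kLoc, b0, b1, b2]
      have := bs 0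
      rw [b0] at this
      norm_num at this ⊢
      rw [this, hg3]; ring
    | 4, _ =>
      have h := hrec 0
      simp only [Finset.sum_range_succ, range_zero, sum_empty, kLoc]
      norm_num [bs 0, bs 1, b0, b1, b2] at h ⊢
      rw [h]; ring
    | 5, _ =>
      have h := hrec 1
      simp only [Finset.sum_range_succ, range_zero, sum_empty, kLoc]
      norm_num [bs 0, bs 1, bs 2, b0, b1, b2] at h ⊢
      rw [h]; ring
    -- From here on both sides satisfy the same recursion of step three, since only the first four
    -- values of `kLoc` enter.
    | i + 6, ih =>
      have h1 := ih (i + 3) (by omega) rfl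
      rw [show i + 6 = (i + 2) + 4 by ring, hrec (i + 2), show i + 2 + 1 = i + 3 by ring, h1]
      have h4 : ∀ n : ℕ, ∑ x ∈ range (n + 3 + 1), kLoc p x * bLoc p (n + 3 - x)
          = ∑ x ∈ range 4, kLoc p x * bLoc p (n + 3 - x) := by
        intro n
        symm
        apply Finset.sum_subset
        · intro x hx; rw [mem_range] at hx ⊢; omega
        · intro x _ hx
          rw [mem_range] at hx
          rw [kLoc_eq_zero p (by omega), zero_mul]
      rw [show i + 2 + 4 + 1 = (i + 3) + 3 + 1 by ring, show i + 2 + 4 = (i + 3) + 3 by ring, h4, h4,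
        Finset.mul_sum]
      refine Finset.sum_congr rfl fun x hx => ?_
      rw [mem_range] at hx
      rw [show i + 3 + 3 - x = (i + 3 - x) + 3 by omega, bs]
      ring

/-- A multiplicative nonnegative function is summable as soon as its values at prime powers
are dominated by a convergent series. -/
lemma summable_of_prime_pow (f : ArithmeticFunction ℝ) (hf : f.IsMultiplicative)
    (hpos : ∀ n, 0 ≤ f n) (w : ℕ → ℝ) (hw : ∀ n, 0 ≤ w n) (hws : Summable w)
    (hfin : ∀ p : ℕ, p.Prime → ∀ e, 4 ≤ e → f (p ^ e) = 0)
    (hloc : ∀ p : ℕ, p.Prime → f (p ^ 1) + f (p ^ 2) + f (p ^ 3) ≤ w p) : Summable f := by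
  have hprime : ∀ {p : ℕ}, p.Prime → HasSum (fun e => f (p ^ e))
      (1 + (f (p ^ 1) + f (p ^ 2) + f (p ^ 3))) := by
    intro p hp
    have : HasSum (fun e => f (p ^ e)) (∑ e ∈ range 4, f (p ^ e)) := hasSum_sum_of_ne_finset_zero (by
      intro e he; rw [mem_range, not_lt] at he; exact hfin p hp e he)
    simpa [Finset.sum_range_succ, hf.1, add_assoc] using this
  have hnorm : ∀ n, ‖f n‖ = f n := fun n => Real.norm_of_nonneg (hpos n)
  refine summable_of_sum_range_le (c := Real.exp (∑' n, w n)) hpos fun N => ?_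
  have h := EulerProduct.summable_and_hasSum_factoredNumbers_prod_filter_prime_tsum
    (f := f) hf.1 (fun {m n} h => hf.2 h) (fun {p} hp => by
      simp_rw [hnorm]; exact (hprime hp).summable) (range N)
  -- Every nonzero `n < N` has all its prime factors below `N`, so it occurs in the expanded finite
  -- product.
  have h1 : ∑ n ∈ range N, f n ≤ ∏ p ∈ range N with p.Prime, ∑' n : ℕ, f (p ^ n) := by
    have hS : HasSum (fun m : Nat.factoredNumbers (range N) => f m)
      (∏ p ∈ range N with p.Prime, ∑' n : ℕ, f (p ^ n)) := h.2
    rw [← hS.tsum_eq]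
    have hsub : ∑ n ∈ range N, f n = ∑ n ∈ (range N).filter (· ≠ 0), f n := by
      rw [Finset.sum_filter]
      refine Finset.sum_congr rfl fun n _ => ?_
      split_ifs with h0
      · rfl
      · rw [not_not] at h0; rw [h0]; simp
    rw [hsub]
    have hmem : ∀ n ∈ (range N).filter (· ≠ 0), n ∈ Nat.factoredNumbers (range N) := by
      intro n hn
      rw [mem_filter, mem_range] at hn
      rw [Nat.mem_factoredNumbers']
      intro p hp hpn
      rw [mem_range]
      exact lt_of_le_of_lt (Nat.le_of_dvd (Nat.pos_of_ne_zero hn.2) hpn) hn.1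
    rw [← Finset.sum_attach]
    have hinj : Function.Injective (fun n : {n // n ∈ (range N).filter (· ≠ 0)} =>
        (⟨n.1, hmem n.1 n.2⟩ : Nat.factoredNumbers (range N))) := by
      intro a b hab
      simp only [Subtype.mk.injEq] at hab
      exact Subtype.ext hab
    have := hS.summable.sum_le_tsum (s := ((range N).filter (· ≠ 0)).attach.map ⟨_, hinj⟩)
      (fun n _ => hpos _)
    rw [Finset.sum_map] at this
    exact this
  refine h1.trans ?_
  have h2 : ∀ p ∈ (range N).filter Nat.Prime, ∑' n : ℕ, f (p ^ n) ≤ Real.exp (w p) := by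
    intro p hp
    rw [mem_filter] at hp
    rw [(hprime hp.2).tsum_eq]
    have := Real.add_one_le_exp (w p)
    have := hloc p hp.2
    linarith
  refine (Finset.prod_le_prod (fun p _ => tsum_nonneg fun n => hpos _) h2).trans ?_
  rw [← Real.exp_sum]
  exact Real.exp_le_exp.2 (hws.sum_le_tsum _ fun n _ => hw n)

/-! ### Absolute convergence of the Dirichlet series of `kA`. -/

lemma abs_kA_prime_pow_four {p : ℕ} (hp : p.Prime) {e : ℕ} (he : 4 ≤ e) : kA (p ^ e) = 0 := by
  rw [kA_prime_pow hp, kLoc_eq_zero p he]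

/-- The function `|kA n| n ^ σ`. -/
def kAbs (σ : ℝ) : ArithmeticFunction ℝ := ⟨fun n => |kA n| * (n : ℝ) ^ σ, by simp⟩

lemma kAbs_isMultiplicative (σ : ℝ) : (kAbs σ).IsMultiplicative := by
  refine ⟨?_, fun {m n} h => ?_⟩
  · change |kA 1| * ((1 : ℕ) : ℝ) ^ σ = 1
    rw [kA_isMultiplicative.1]; simp
  · change |kA (m * n)| * ((m * n : ℕ) : ℝ) ^ σ = |kA m| * (m : ℝ) ^ σ * (|kA n| * (n : ℝ) ^ σ)
    rw [kA_isMultiplicative.2 h, abs_mul, Nat.cast_mul,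
      Real.mul_rpow (Nat.cast_nonneg m) (Nat.cast_nonneg n)]
    ring

lemma A1Term_prime_sq_le : ∃ C : ℝ, 0 ≤ C ∧ ∀ p : ℕ, p.Prime →
    A1Term (p ^ 2) ≤ C * (p : ℝ) ^ (-4 : ℝ) := by
  refine ⟨1 + A1Term (3 ^ 2) * 3 ^ (4 : ℝ),
    add_nonneg zero_le_one (mul_nonneg (A1Term_nonneg _) (by positivity)), fun p hp => ?_⟩
  have hp' : (0 : ℝ) < p := by exact_mod_cast hp.pos
  by_cases h3 : p = 3
  · subst h3
    have : ((3 : ℕ) : ℝ) ^ (-4 : ℝ) * 3 ^ (4 : ℝ) = 1 := by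
      push_cast; rw [← Real.rpow_add (by norm_num)]; norm_num
    have h0 : 0 ≤ ((3 : ℕ) : ℝ) ^ (-4 : ℝ) := by positivity
    rw [add_mul, mul_assoc, mul_comm ((3 : ℝ) ^ (4 : ℝ)), this]
    linarith
  · rw [A1Term_prime_sq hp h3]
    have e1 : (p : ℝ) ^ (-5 : ℤ) * p = (p : ℝ) ^ (-4 : ℝ) := by
      rw [← Real.rpow_intCast, ← Real.rpow_add_one hp'.ne']; norm_num
    have h0 : 0 ≤ (p : ℝ) ^ (-5 : ℤ) := by positivity
    have h1 : 0 ≤ A1Term (3 ^ 2) * 3 ^ (4 : ℝ) := mul_nonneg (A1Term_nonneg _) (by positivity)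
    have h2 : 0 ≤ (p : ℝ) ^ (-4 : ℝ) := by positivity
    nlinarith

/-- The local terms have orders `p^(σ - 2)`, `p^(2σ - 4)` and `p^(3σ - 4)`, all at most `p^(σ - 2)`.
For `A1Term` itself the third would be `p^(3σ - 3)`, which ceases to converge at `σ = 2/3`; removing
`bA` is what makes the exponents `2/3` and `1 - θ` with `θ > 0` accessible. -/
lemma summable_kAbs (σ : ℝ) (h1 : σ < 1) : Summable (kAbs σ) := by
  obtain ⟨C, hC0, hC⟩ := A1Term_prime_sq_le
  refine summable_of_prime_pow (kAbs σ) (kAbs_isMultiplicative σ)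
    (fun n => mul_nonneg (abs_nonneg _) (by positivity)) (fun n => (5833 + C) * (n : ℝ) ^ (σ - 2))
    (fun n => by positivity)
    (Summable.mul_left _ (Real.summable_nat_rpow.2 (by linarith))) ?_ ?_
  · intro p hp e he
    change |kA (p ^ e)| * _ = 0
    rw [abs_kA_prime_pow_four hp he]; simp
  · intro p hp
    have hp1 : (1 : ℝ) ≤ p := by exact_mod_cast hp.one_le
    have hp' : (0 : ℝ) < p := by linarith
    change |kA (p ^ 1)| * ((p ^ 1 : ℕ) : ℝ) ^ σ + |kA (p ^ 2)| * ((p ^ 2 : ℕ) : ℝ) ^ σ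
      + |kA (p ^ 3)| * ((p ^ 3 : ℕ) : ℝ) ^ σ ≤ _
    rw [kA_prime_pow hp, kA_prime_pow hp, kA_prime_pow hp]
    simp only [kLoc, abs_neg]
    rw [abs_of_nonneg (A1Term_nonneg _), abs_of_nonneg (A1Term_nonneg _), abs_of_nonneg (by positivity)]
    push_cast
    rw [pow_one]
    have a1 : A1Term p * (p : ℝ) ^ σ ≤ 5832 * (p : ℝ) ^ (σ - 2) := by
      refine (mul_le_mul_of_nonneg_right (A1Term_prime_le hp) (by positivity)).trans (le_of_eq ?_)
      rw [mul_assoc, ← Real.rpow_add hp']; ring_nf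
    have hpow : ∀ k : ℕ, ((p : ℝ) ^ k) ^ σ = (p : ℝ) ^ (k * σ) := by
      intro k; rw [← Real.rpow_natCast, ← Real.rpow_mul hp'.le]
    have a2 : A1Term (p ^ 2) * ((p : ℝ) ^ 2) ^ σ ≤ C * (p : ℝ) ^ (σ - 2) := by
      refine (mul_le_mul_of_nonneg_right (hC p hp) (by positivity)).trans ?_
      rw [hpow, mul_assoc, ← Real.rpow_add hp']
      apply mul_le_mul_of_nonneg_left _ hC0
      apply Real.rpow_le_rpow_of_exponent_le hp1
      push_cast; linarith
    have a3 : ((p : ℝ) ^ 4)⁻¹ * ((p : ℝ) ^ 3) ^ σ ≤ (p : ℝ) ^ (σ - 2) := by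
      rw [hpow, ← Real.rpow_natCast, ← Real.rpow_neg hp'.le, ← Real.rpow_add hp']
      apply Real.rpow_le_rpow_of_exponent_le hp1
      push_cast; linarith
    linarith

lemma summable_abs_kA_mul_rpow {σ : ℝ} (h1 : σ < 1) :
    Summable (fun n : ℕ => |kA n| * (n : ℝ) ^ σ) := summable_kAbs σ h1

lemma summable_abs_kA : Summable (fun n : ℕ => |kA n|) := by
  simpa using summable_abs_kA_mul_rpow (σ := 0) (by norm_num)

/-- Summation against `A1Term` unfolded along `A1Term = bA * kA`. -/
lemma hasSum_A1Term_mul (ψ : ℕ → ℝ)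
    (hs : Summable fun x : ℕ × ℕ =>
      (((x.1 + 1 : ℕ) : ℝ) ^ 3)⁻¹ * kA x.2 * ψ ((x.1 + 1) ^ 3 * x.2)) :
    HasSum (fun n => A1Term n * ψ n)
      (∑' x : ℕ × ℕ, (((x.1 + 1 : ℕ) : ℝ) ^ 3)⁻¹ * kA x.2 * ψ ((x.1 + 1) ^ 3 * x.2)) := by
  let F : ℕ × ℕ → ℝ := fun x => bA x.1 * kA x.2 * ψ (x.1 * x.2)
  have hinj : Function.Injective (fun x : ℕ × ℕ => ((x.1 + 1) ^ 3, x.2)) := by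
    rintro ⟨a, b⟩ ⟨a', b'⟩ h
    simp only [Prod.mk.injEq] at h
    have := Nat.pow_left_injective (n := 3) (by norm_num) h.1
    exact Prod.ext (by simpa using this) h.2
  have hF : HasSum F
      (∑' x : ℕ × ℕ, (((x.1 + 1 : ℕ) : ℝ) ^ 3)⁻¹ * kA x.2 * ψ ((x.1 + 1) ^ 3 * x.2)) := by
    rw [← hinj.hasSum_iff]
    · have : F ∘ (fun x : ℕ × ℕ => ((x.1 + 1) ^ 3, x.2)) = fun x : ℕ × ℕ =>
          (((x.1 + 1 : ℕ) : ℝ) ^ 3)⁻¹ * kA x.2 * ψ ((x.1 + 1) ^ 3 * x.2) := by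
        funext x
        simp only [F, Function.comp]
        rw [bA_cube (Nat.succ_ne_zero x.1)]
      rw [this]; exact hs.hasSum
    · rintro ⟨n, d⟩ hx
      simp only [F]
      by_cases hb : bA n = 0
      · rw [hb]; ring
      · obtain ⟨m, hm, rfl⟩ := exists_cube_of_bA_ne_zero hb
        exfalso; apply hx
        exact ⟨(m - 1, d), by simp only [Prod.mk.injEq, and_true]; congr 1; omega⟩
  have h2 := (Equiv.sigmaFiberEquiv (fun x : ℕ × ℕ => x.1 * x.2)).hasSum_iff.2 hF
  refine h2.sigma fun n => ?_
  rcases Nat.eq_zero_or_pos n with rfl | hn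
  · rw [A1Term_zero, zero_mul]
    convert hasSum_zero with x
    obtain ⟨⟨a, b⟩, hx⟩ := x
    simp only [Function.comp, Equiv.sigmaFiberEquiv, Equiv.coe_fn_mk, F]
    rcases mul_eq_zero.1 hx with h | h <;> simp only at h <;> subst h <;> simp
  · have hset : ∀ x : ℕ × ℕ, x.1 * x.2 = n ↔ x ∈ n.divisorsAntidiagonal := by
      intro x; rw [Nat.mem_divisorsAntidiagonal]; simp [hn.ne']
    have h3 : HasSum (fun x : n.divisorsAntidiagonal => F x) (∑ x ∈ n.divisorsAntidiagonal, F x) :=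
      Finset.hasSum _ _
    have h4 : ∑ x ∈ n.divisorsAntidiagonal, F x = A1Term n * ψ n := by
      have : A1Term n = (bA * kA) n := by rw [← gA_eq]; rfl
      rw [this, ArithmeticFunction.mul_apply, Finset.sum_mul]
      refine Finset.sum_congr rfl fun x hx => ?_
      simp only [F]
      rw [(hset x).2 hx]
    rw [h4] at h3
    let eqv : {x : ℕ × ℕ // x.1 * x.2 = n} ≃ n.divisorsAntidiagonal :=
      Equiv.subtypeEquivRight hset
    exact eqv.hasSum_iff.2 h3

lemma summable_inv_cube : Summable (fun m : ℕ => (((m + 1 : ℕ) : ℝ) ^ 3)⁻¹) :=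
  (summable_nat_add_iff 1).2 (Real.summable_nat_pow_inv.2 (by norm_num : 1 < 3))

/-- Convergence of the series in `A₁`. -/
theorem summable_A1Term : Summable A1Term := by
  have h := hasSum_A1Term_mul (fun _ => 1) (by
    simp only [mul_one]
    exact summable_mul_of_summable_norm summable_inv_cube.norm summable_abs_kA)
  simpa using h.summable

lemma Gsum_le (q : ℕ) : Gsum q ≤ ∑' d, A1Term d :=
  summable_A1Term.sum_le_tsum _ fun d _ => A1Term_nonneg d

lemma one_le_tsum_A1Term : 1 ≤ ∑' d, A1Term d := by
  rw [← A1Term_one]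
  exact summable_A1Term.le_tsum 1 fun d _ => A1Term_nonneg d

/-! ### The Euler product -/

/-- The local factor at `p` of `∑ kA n n^{2/3}`. -/
def localFactor (p : ℕ) : ℝ :=
  1 + A1Term p * (p : ℝ) ^ (2 / 3 : ℝ) + A1Term (p ^ 2) * (p : ℝ) ^ (4 / 3 : ℝ) - ((p : ℝ) ^ 2)⁻¹

/-- `n ↦ kA n n^{2/3}`. -/
def kTwist : ArithmeticFunction ℝ := ⟨fun n => kA n * (n : ℝ) ^ (2 / 3 : ℝ), by simp⟩

lemma kTwist_isMultiplicative : kTwist.IsMultiplicative := by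
  refine ⟨?_, fun {m n} h => ?_⟩
  · change kA 1 * ((1 : ℕ) : ℝ) ^ (2 / 3 : ℝ) = 1
    rw [kA_isMultiplicative.1]; simp
  · change kA (m * n) * ((m * n : ℕ) : ℝ) ^ (2 / 3 : ℝ)
      = kA m * (m : ℝ) ^ (2 / 3 : ℝ) * (kA n * (n : ℝ) ^ (2 / 3 : ℝ))
    rw [kA_isMultiplicative.2 h, Nat.cast_mul,
      Real.mul_rpow (Nat.cast_nonneg m) (Nat.cast_nonneg n)]
    ring

lemma summable_norm_kTwist : Summable (fun n => ‖kTwist n‖) := by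
  refine (summable_abs_kA_mul_rpow (σ := 2 / 3) (by norm_num)).congr fun n => ?_
  change _ = ‖kA n * (n : ℝ) ^ (2 / 3 : ℝ)‖
  rw [norm_mul, Real.norm_eq_abs, Real.norm_of_nonneg (by positivity)]

lemma hasProd_localFactor :
    HasProd (fun p : Nat.Primes => localFactor p) (∑' n, kA n * (n : ℝ) ^ (2 / 3 : ℝ)) := by
  have h := kTwist_isMultiplicative.eulerProduct_hasProd summable_norm_kTwist
  suffices hfun : (fun p : Nat.Primes => localFactor p)
      = fun p : Nat.Primes => ∑' e, kTwist ((p : ℕ) ^ e) by rw [hfun]; exact h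
  funext p
  have hp' : (0 : ℝ) < p := by exact_mod_cast p.2.pos
  have h2 : HasSum (fun e => kTwist ((p : ℕ) ^ e)) (∑ e ∈ range 4, kTwist ((p : ℕ) ^ e)) :=
    hasSum_sum_of_ne_finset_zero (by
    intro e he
    rw [mem_range, not_lt] at he
    change kA _ * _ = 0
    rw [abs_kA_prime_pow_four p.2 he, zero_mul])
  rw [h2.tsum_eq]
  have hv : ∀ e, kTwist ((p : ℕ) ^ e) = kLoc p e * (p : ℝ) ^ (e * (2 / 3) : ℝ) := by
    intro e
    change kA _ * _ = _
    rw [kA_prime_pow p.2]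
    push_cast
    rw [← Real.rpow_natCast, ← Real.rpow_mul hp'.le]
  have h3 : ((p : ℝ) ^ 4)⁻¹ * (p : ℝ) ^ (((3 : ℕ) : ℝ) * (2 / 3) : ℝ) = ((p : ℝ) ^ 2)⁻¹ := by
    rw [show (((3 : ℕ) : ℝ) * (2 / 3) : ℝ) = ((2 : ℕ) : ℝ) by norm_num, Real.rpow_natCast]
    field_simp
  simp only [Finset.sum_range_succ, range_zero, sum_empty, hv, kLoc]
  rw [neg_mul, h3]
  unfold localFactor
  norm_num
  ring

lemma one_div_natCast_cpow (p : ℕ) (t : ℝ) :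
    1 / (p : ℂ) ^ (t : ℂ) = (((p : ℝ) ^ (-t) : ℝ) : ℂ) := by
  rw [Real.rpow_neg (Nat.cast_nonneg p), Complex.ofReal_inv,
    Complex.ofReal_cpow (Nat.cast_nonneg p)]
  simp

lemma D0Factor_eq {p : ℕ} (hp : p.Prime) (hp3 : p ≠ 3) :
    D0Factor (-5 / 3) p = (localFactor p : ℂ) := by
  have hp' : (0 : ℝ) < p := by exact_mod_cast hp.pos
  have hg : ∑ c ∈ Icc 1 (p - 1), ((‖S p c‖ ^ 6 : ℝ) : ℂ) = (((p : ℝ) ^ 6 * A1Term p : ℝ) : ℂ) := by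
    rw [← Complex.ofReal_sum]
    congr 1
    unfold A1Term gaussMoment
    rw [← mul_assoc, mul_one_div_cancel (by positivity), one_mul]
    refine Finset.sum_congr ?_ fun _ _ => rfl
    ext c
    simp only [mem_filter, mem_Icc]
    constructor
    · rintro ⟨h1, h2⟩
      exact ⟨⟨h1, by omega⟩, Nat.Coprime.symm ((Nat.Prime.coprime_iff_not_dvd hp).2
        fun h => by have := Nat.le_of_dvd (by omega) h; omega)⟩
    · rintro ⟨⟨h1, h2⟩, h3⟩
      refine ⟨h1, ?_⟩
      have : c ≠ p := by
        rintro rfl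
        rw [Nat.coprime_self] at h3; exact hp.one_lt.ne' h3
      omega
  unfold D0Factor
  rw [hg, show (-5 / 3 + 7 : ℂ) = ((16 / 3 : ℝ) : ℂ) by push_cast; norm_num,
    show (2 * (-5 / 3) + 7 : ℂ) = ((11 / 3 : ℝ) : ℂ) by push_cast; norm_num,
    show (3 * (-5 / 3) + 7 : ℂ) = ((2 : ℝ) : ℂ) by push_cast; norm_num, one_div_natCast_cpow,
    ← mul_one_div ((p : ℂ) - 1), one_div_natCast_cpow, one_div_natCast_cpow]
  unfold localFactor
  rw [A1Term_prime_sq hp hp3]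
  have e1 : (p : ℝ) ^ (-(16 / 3) : ℝ) * (p : ℝ) ^ 6 = (p : ℝ) ^ (2 / 3 : ℝ) := by
    rw [← Real.rpow_natCast, ← Real.rpow_add hp']; norm_num
  have e2 : (p : ℝ) ^ (-5 : ℤ) * (p : ℝ) ^ (4 / 3 : ℝ) = (p : ℝ) ^ (-(11 / 3) : ℝ) := by
    rw [← Real.rpow_intCast, ← Real.rpow_add hp']; norm_num
  have e3 : (p : ℝ) ^ (-2 : ℝ) = ((p : ℝ) ^ 2)⁻¹ := by
    rw [Real.rpow_neg hp'.le, Real.rpow_two]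
  rw [mul_assoc _ _ ((p : ℝ) ^ (4 / 3 : ℝ)), e2, e3, ← e1]
  push_cast
  ring

lemma D0Factor3_eq : D0Factor3 (-5 / 3) = (localFactor 3 : ℂ) := by
  have hg : ∑ c ∈ (Icc 1 9).filter (fun c => c.Coprime 3), ((‖S 9 c‖ ^ 6 : ℝ) : ℂ)
      = (((3 : ℝ) ^ 12 * A1Term 9 : ℝ) : ℂ) := by
    rw [← Complex.ofReal_sum]
    congr 1
    unfold A1Term gaussMoment
    have : (3 : ℝ) ^ 12 * (1 / ((9 : ℕ) : ℝ) ^ 6) = 1 := by norm_num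
    rw [← mul_assoc, this, one_mul]
    refine Finset.sum_congr (Finset.filter_congr fun c _ => ?_) fun _ _ => rfl
    exact (Nat.coprime_pow_right_iff (by norm_num : 0 < 2) c 3).symm
  unfold D0Factor3
  have h3 : (3 : ℂ) = ((3 : ℕ) : ℂ) := by norm_num
  rw [hg, show (2 * (-5 / 3) + 14 : ℂ) = ((32 / 3 : ℝ) : ℂ) by push_cast; norm_num,
    show (3 * (-5 / 3) + 7 : ℂ) = ((2 : ℝ) : ℂ) by push_cast; norm_num, h3, one_div_natCast_cpow,
    one_div_natCast_cpow]
  unfold localFactor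
  rw [A1Term_three]
  have e1 : ((3 : ℕ) : ℝ) ^ (-(32 / 3) : ℝ) * (3 : ℝ) ^ 12 = ((3 : ℕ) : ℝ) ^ (4 / 3 : ℝ) := by
    push_cast
    rw [← Real.rpow_natCast, ← Real.rpow_add (by norm_num)]; norm_num
  have e3 : ((3 : ℕ) : ℝ) ^ (-2 : ℝ) = (((3 : ℕ) : ℝ) ^ 2)⁻¹ := by
    rw [Real.rpow_neg (by positivity), Real.rpow_two]
  rw [e3, ← e1, show (3 : ℕ) ^ 2 = 9 by norm_num]
  push_cast
  ring

/-- Convergence of the Euler product `D₀(-5/3)`. -/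
theorem multipliable_D0Factor :
    Multipliable (fun p : {p : ℕ // p.Prime ∧ p ≠ 3} => D0Factor (-5 / 3) p) := by
  have h : Summable (fun p : {p : ℕ // p.Prime ∧ p ≠ 3} => ‖D0Factor (-5 / 3) p - 1‖) := by
    have h0 : Summable (fun n : ℕ => 5834 * (n : ℝ) ^ (-(4 / 3) : ℝ)) :=
      Summable.mul_left _ (Real.summable_nat_rpow.2 (by norm_num))
    refine Summable.of_nonneg_of_le (fun _ => norm_nonneg _) (fun p => ?_)
      (h0.comp_injective Subtype.val_injective)
    obtain ⟨p, hp, hp3⟩ := p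
    have hp' : (0 : ℝ) < p := by exact_mod_cast hp.pos
    have hp1 : (1 : ℝ) ≤ p := by exact_mod_cast hp.one_le
    simp only [Function.comp]
    rw [D0Factor_eq hp hp3, ← Complex.ofReal_one, ← Complex.ofReal_sub, Complex.norm_real]
    unfold localFactor
    have a1 : A1Term p * (p : ℝ) ^ (2 / 3 : ℝ) ≤ 5832 * (p : ℝ) ^ (-(4 / 3) : ℝ) := by
      refine (mul_le_mul_of_nonneg_right (A1Term_prime_le hp) (by positivity)).trans (le_of_eq ?_)
      rw [mul_assoc, ← Real.rpow_add hp']; norm_num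
    have a1' : 0 ≤ A1Term p * (p : ℝ) ^ (2 / 3 : ℝ) := mul_nonneg (A1Term_nonneg _) (by positivity)
    have a2' : 0 ≤ A1Term (p ^ 2) * (p : ℝ) ^ (4 / 3 : ℝ) :=
      mul_nonneg (A1Term_nonneg _) (by positivity)
    have a2 : A1Term (p ^ 2) * (p : ℝ) ^ (4 / 3 : ℝ) ≤ (p : ℝ) ^ (-(4 / 3) : ℝ) := by
      rw [A1Term_prime_sq hp hp3]
      have e1 : ((p : ℝ) - 1) * (p : ℝ) ^ (-5 : ℤ) * (p : ℝ) ^ (4 / 3 : ℝ)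
          ≤ (p : ℝ) * ((p : ℝ) ^ (-5 : ℤ) * (p : ℝ) ^ (4 / 3 : ℝ)) := by
        rw [mul_assoc]
        exact mul_le_mul_of_nonneg_right (by linarith) (by positivity)
      refine e1.trans ?_
      have e2 : (p : ℝ) * ((p : ℝ) ^ (-5 : ℤ) * (p : ℝ) ^ (4 / 3 : ℝ)) = (p : ℝ) ^ (-(8 / 3) : ℝ) := by
        rw [← Real.rpow_intCast, ← Real.rpow_add hp', mul_comm, ← Real.rpow_add_one hp'.ne']
        norm_num
      rw [e2]
      exact Real.rpow_le_rpow_of_exponent_le hp1 (by norm_num)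
    have a3 : ((p : ℝ) ^ 2)⁻¹ ≤ (p : ℝ) ^ (-(4 / 3) : ℝ) := by
      rw [← Real.rpow_natCast, ← Real.rpow_neg hp'.le]
      exact Real.rpow_le_rpow_of_exponent_le hp1 (by norm_num)
    have a3' : 0 ≤ ((p : ℝ) ^ 2)⁻¹ := by positivity
    rw [Real.norm_eq_abs, abs_le]
    constructor <;> linarith
  have := multipliable_one_add_of_summable h
  simpa using this

/-- The factor at `3` in `D0` lacks a linear term only because `A1Term 3 = 0`. It is therefore
`localFactor 3` and can be put back into the Euler product over all primes. -/
lemma D0_eq : D0 (-5 / 3) = ((∑' n, kA n * (n : ℝ) ^ (2 / 3 : ℝ) : ℝ) : ℂ) := by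
  unfold D0
  rw [D0Factor3_eq]
  have h1 : HasProd (fun p : Nat.Primes => (localFactor p : ℂ))
      ((∑' n, kA n * (n : ℝ) ^ (2 / 3 : ℝ) : ℝ) : ℂ) :=
    hasProd_localFactor.map Complex.ofRealHom Complex.continuous_ofReal
  have h2 := multipliable_D0Factor.hasProd
  have h2' : HasProd ((fun p : ℕ => (localFactor p : ℂ)) ∘
      (Subtype.val : {p : ℕ | p.Prime ∧ p ≠ 3} → ℕ))
      (∏' p : {p : ℕ // p.Prime ∧ p ≠ 3}, D0Factor (-5 / 3) p) := by
    have hfun : (fun p : {p : ℕ // p.Prime ∧ p ≠ 3} => D0Factor (-5 / 3) p)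
        = fun p : {p : ℕ // p.Prime ∧ p ≠ 3} => (localFactor p : ℂ) :=
      funext fun p => D0Factor_eq p.2.1 p.2.2
    have h2'' := h2
    rw [hfun] at h2''
    rw [hfun]
    exact h2''
  have h1' : HasProd ((fun p : ℕ => (localFactor p : ℂ)) ∘ (Subtype.val : {p : ℕ | p.Prime} → ℕ))
      ((∑' n, kA n * (n : ℝ) ^ (2 / 3 : ℝ) : ℝ) : ℂ) := h1
  rw [hasProd_subtype_iff_mulIndicator] at h1' h2'
  have h3 : HasProd (Set.mulIndicator {3} (fun p : ℕ => (localFactor p : ℂ))) (localFactor 3 : ℂ) := by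
    have := hasProd_single (f := Set.mulIndicator {3} (fun p : ℕ => (localFactor p : ℂ))) 3
      (fun b hb => Set.mulIndicator_of_notMem (by simpa using hb) _)
    simpa using this
  have h4 := h2'.mul h3
  refine (h4.unique ?_)
  convert h1' using 1
  funext n
  by_cases hn3 : n = 3
  · subst hn3
    simp [Set.mulIndicator, Nat.prime_three]
  · by_cases hn : n.Prime <;> simp [Set.mulIndicator, hn3, hn]

/-! ### The periodic remainder function -/

/-- Real harmonic numbers. -/
def harm (M : ℕ) : ℝ := ∑ n ∈ Icc 1 M, (1 : ℝ) / n

lemma harm_succ (M : ℕ) : harm (M + 1) = harm M + 1 / ((M : ℝ) + 1) := by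
  unfold harm; rw [Finset.sum_Icc_succ_top (by omega)]; push_cast; rfl

lemma harm_eq_harmonic (M : ℕ) : harm M = (harmonic M : ℝ) := by
  rw [harmonic_eq_sum_Icc]; unfold harm; push_cast; simp

lemma tendsto_harm_sub_log :
    Tendsto (fun M : ℕ => harm M - Real.log M) atTop (nhds eulerMascheroniConstant) := by
  simp_rw [harm_eq_harmonic]; exact Real.tendsto_harmonic_sub_log

/-- This is `u ≤ sinh u` at `u = log (1 + x)`. -/
lemma log_one_add_le {x : ℝ} (hx : 0 ≤ x) : Real.log (1 + x) ≤ x * (2 + x) / (2 * (1 + x)) := by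
  have h1 : 0 ≤ Real.log (1 + x) := Real.log_nonneg (by linarith)
  have h2 := Real.self_le_sinh_iff.2 h1
  rw [Real.sinh_log (by linarith)] at h2
  refine h2.trans (le_of_eq ?_)
  field_simp; ring

lemma tendsto_harm_corrected :
    Tendsto (fun M : ℕ => harm (M + 1) - Real.log ((M : ℝ) + 1) - 1 / (2 * ((M : ℝ) + 1))) atTop
      (nhds eulerMascheroniConstant) := by
  have h1 := (tendsto_add_atTop_iff_nat 1).2 tendsto_harm_sub_log
  have h2 : Tendsto (fun M : ℕ => (1 / 2 : ℝ) * (1 / ((M : ℝ) + 1))) atTop (nhds ((1 / 2) * 0)) :=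
    tendsto_one_div_add_atTop_nhds_zero_nat.const_mul _
  have h3 := h1.sub h2
  simp only [mul_zero, sub_zero] at h3
  refine h3.congr fun M => ?_
  push_cast
  field_simp

lemma harm_step (M : ℕ) : harm (M + 1 + 1) - Real.log ((M : ℝ) + 1 + 1) - 1 / (2 * ((M : ℝ) + 1 + 1))
      - (harm (M + 1) - Real.log ((M : ℝ) + 1) - 1 / (2 * ((M : ℝ) + 1)))
    = 1 / (2 * ((M : ℝ) + 1)) + 1 / (2 * ((M : ℝ) + 2)) - Real.log (1 + 1 / ((M : ℝ) + 1)) := by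
  have hM : (0 : ℝ) < (M : ℝ) + 1 := by positivity
  have e1 : Real.log ((M : ℝ) + 1 + 1) = Real.log ((M : ℝ) + 1) + Real.log (1 + 1 / ((M : ℝ) + 1)) := by
    rw [← Real.log_mul hM.ne' (by positivity)]; congr 1; field_simp
  rw [harm_succ (M + 1), e1]
  push_cast
  rw [show (M : ℝ) + 1 + 1 = M + 2 by ring]
  field_simp; ring

/-- The sequence `harm M - log M - 1/(2M)` increases to Euler's constant, while the same sequence
plus `1/M²` decreases to it. Both monotonicities come from two-sided bounds for `log (1 + 1/M)`. -/
lemma abs_harm_sub_le (M : ℕ) (hM : 1 ≤ M) :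
    |harm M - Real.log M - eulerMascheroniConstant - 1 / (2 * (M : ℝ))| ≤ 1 / (M : ℝ) ^ 2 := by
  obtain ⟨k, rfl⟩ := Nat.exists_eq_add_of_le' hM
  have hmono : Monotone (fun M : ℕ =>
      harm (M + 1) - Real.log ((M : ℝ) + 1) - 1 / (2 * ((M : ℝ) + 1))) := by
    refine monotone_nat_of_le_succ fun M => ?_
    have h := harm_step M
    push_cast
    have hlog := log_one_add_le (x := 1 / ((M : ℝ) + 1)) (by positivity)
    have : 1 / ((M : ℝ) + 1) * (2 + 1 / ((M : ℝ) + 1)) / (2 * (1 + 1 / ((M : ℝ) + 1)))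
        = 1 / (2 * ((M : ℝ) + 1)) + 1 / (2 * ((M : ℝ) + 2)) := by field_simp; ring
    linarith
  have hanti : Antitone (fun M : ℕ =>
      harm (M + 1) - Real.log ((M : ℝ) + 1) - 1 / (2 * ((M : ℝ) + 1)) + 1 / ((M : ℝ) + 1) ^ 2) := by
    refine antitone_nat_of_succ_le fun M => ?_
    have h := harm_step M
    push_cast
    have hlog := Real.le_log_one_add_of_nonneg (x := 1 / ((M : ℝ) + 1)) (by positivity)
    have e1 : 2 * (1 / ((M : ℝ) + 1)) / (1 / ((M : ℝ) + 1) + 2) = 2 / (2 * M + 3) := by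
      field_simp; ring
    rw [e1] at hlog
    have key : 1 / (2 * ((M : ℝ) + 1)) + 1 / (2 * ((M : ℝ) + 2)) - 2 / (2 * M + 3)
        ≤ 1 / ((M : ℝ) + 1) ^ 2 - 1 / ((M : ℝ) + 1 + 1) ^ 2 := by
      rw [show (M : ℝ) + 1 + 1 = M + 2 by ring]
      have hm : (0 : ℝ) ≤ M := Nat.cast_nonneg M
      have e2 : 1 / (2 * ((M : ℝ) + 1)) + 1 / (2 * ((M : ℝ) + 2)) - 2 / (2 * M + 3)
          = 1 / (2 * (M + 1) * (M + 2) * (2 * M + 3)) := by field_simp; ring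
      have e3 : 1 / ((M : ℝ) + 1) ^ 2 - 1 / ((M : ℝ) + 2) ^ 2
          = (2 * M + 3) / ((M + 1) ^ 2 * (M + 2) ^ 2) := by field_simp; ring
      rw [e2, e3, div_le_div_iff₀ (by positivity) (by positivity), ← sub_nonneg]
      have : (2 * (M : ℝ) + 3) * (2 * (M + 1) * (M + 2) * (2 * M + 3)) - 1 * ((M + 1) ^ 2 * (M + 2) ^ 2)
          = (M + 1) * (M + 2) * (7 * M ^ 2 + 21 * M + 16) := by ring
      rw [this]; positivity
    linarith
  have h1 := hmono.ge_of_tendsto tendsto_harm_corrected k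
  have h0 : Tendsto (fun M : ℕ => 1 / ((M : ℝ) + 1) ^ 2) atTop (nhds 0) := by
    have := (tendsto_one_div_add_atTop_nhds_zero_nat (𝕜 := ℝ)).pow 2
    simpa using this
  have h2 := hanti.le_of_tendsto (by simpa using tendsto_harm_corrected.add h0) k
  push_cast
  rw [abs_le]
  constructor <;> linarith

/-- `∑_{n ≤ t} (t - n)² / n`. -/
def PP (t : ℝ) : ℝ := ∑ n ∈ Icc 1 ⌊t⌋₊, (t - n) ^ 2 / n

/-- The constant `γ - 3/2`. -/
def cJ : ℝ := eulerMascheroniConstant - 3 / 2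

/-- The remainder in the asymptotic expansion of `PP`. -/
def J (t : ℝ) : ℝ := PP t - t ^ 2 * Real.log t - cJ * t ^ 2 - t

/-- The derivative of `J`. -/
def J1 (t : ℝ) : ℝ :=
  2 * ∑ n ∈ Icc 1 ⌊t⌋₊, (t - n) / n - 2 * t * Real.log t - t - 2 * cJ * t - 1

lemma abs_cJ_le : |cJ| ≤ 1 := by
  have h1 := Real.one_half_lt_eulerMascheroniConstant
  have h2 := Real.eulerMascheroniConstant_lt_two_thirds
  unfold cJ; rw [abs_le]; constructor <;> linarith

lemma sum_sub_div (t : ℝ) (M : ℕ) : ∑ n ∈ Icc 1 M, (t - n) / n = t * harm M - M := by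
  unfold harm
  rw [Finset.mul_sum]
  have : ∀ n ∈ Icc 1 M, (t - n) / (n : ℝ) = t * (1 / n) - 1 := by
    intro n hn
    rw [mem_Icc] at hn
    have : (n : ℝ) ≠ 0 := by exact_mod_cast (by omega : n ≠ 0)
    field_simp
  rw [Finset.sum_congr rfl this, Finset.sum_sub_distrib]
  simp

lemma sum_sub_sq_div (t : ℝ) (M : ℕ) : ∑ n ∈ Icc 1 M, (t - n) ^ 2 / n
    = t ^ 2 * harm M - 2 * t * M + M * (M + 1) / 2 := by
  induction M with
  | zero => simp [harm]
  | succ M ih =>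
    rw [Finset.sum_Icc_succ_top (by omega), ih, harm_succ]
    push_cast
    field_simp; ring

/-- The sums over `n ≤ t` involve `n` only through `harm ⌊t⌋`. Write `t = M + s` with `M = ⌊t⌋`, and
let `η` be the error of `harm M - log t` against `γ + (1 - 2s)/(2M)`. The factor `t²` in `J` makes
an error of order `1/M²` necessary; it makes `J` and `t J1 t` bounded. -/
lemma J_expansion {t : ℝ} (ht : 1 ≤ t) : ∃ M s η : ℝ, 1 ≤ M ∧ 0 ≤ s ∧ s ≤ 1 ∧ t = M + s ∧
    |η| ≤ 2 / M ^ 2 ∧ J t = -s ^ 2 / 2 + s ^ 2 * (1 - 2 * s) / (2 * M) + t ^ 2 * η ∧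
    J1 t = s * (1 - 2 * s) / M + 2 * t * η := by
  have hM1 : 1 ≤ ⌊t⌋₊ := (Nat.one_le_floor_iff t).2 ht
  set M := ⌊t⌋₊ with hM
  have hMr : (1 : ℝ) ≤ M := by exact_mod_cast hM1
  have hM0 : (0 : ℝ) < M := by linarith
  have hfl := Nat.floor_le (by linarith : 0 ≤ t)
  have hfl2 := Nat.lt_floor_add_one t
  rw [← hM] at hfl hfl2
  set s := t - M with hs
  have hlog : Real.log t = Real.log M + Real.log (1 + s / M) := by
    rw [← Real.log_mul hM0.ne' (by have : 0 ≤ s / M := div_nonneg (by linarith) hM0.le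
                                   positivity)]
    congr 1; field_simp; rw [hs]; ring
  have hs0 : 0 ≤ s := by linarith
  have hs1 : s ≤ 1 := by linarith
  have hsM : 0 ≤ s / M := by positivity
  have hl1 : Real.log (1 + s / M) ≤ s / M := by
    have := Real.log_le_sub_one_of_pos (by positivity : 0 < 1 + s / M); linarith
  have hl2 : s / M - 1 / (M : ℝ) ^ 2 ≤ Real.log (1 + s / M) := by
    have h := Real.le_log_one_add_of_nonneg hsM
    refine le_trans ?_ h
    have e1 : s / M - 2 * (s / M) / (s / M + 2) = (s / M) ^ 2 / (s / M + 2) := by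
      field_simp; ring
    have e2 : (s / M) ^ 2 / (s / M + 2) ≤ 1 / (M : ℝ) ^ 2 := by
      have : (s / M) ^ 2 ≤ 1 / (M : ℝ) ^ 2 := by
        rw [div_pow]; gcongr; nlinarith
      refine le_trans ?_ this
      exact div_le_self (by positivity) (by linarith)
    linarith
  have hh := abs_harm_sub_le M hM1
  refine ⟨M, s, harm M - Real.log t - eulerMascheroniConstant - (1 - 2 * s) / (2 * M),
    hMr, hs0, hs1, by rw [hs]; ring, ?_, ?_, ?_⟩
  · have : harm M - Real.log t - eulerMascheroniConstant - (1 - 2 * s) / (2 * M)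
        = (harm M - Real.log M - eulerMascheroniConstant - 1 / (2 * (M : ℝ)))
          + (s / M - Real.log (1 + s / M)) := by
      rw [hlog]; field_simp; ring
    rw [this]
    have h3 : |s / M - Real.log (1 + s / M)| ≤ 1 / (M : ℝ) ^ 2 := by
      rw [abs_le]; constructor
      · have : 0 ≤ 1 / (M : ℝ) ^ 2 := by positivity
        linarith
      · linarith
    refine (abs_add_le _ _).trans ((add_le_add hh h3).trans (le_of_eq (by ring)))
  · unfold J PP cJ
    rw [← hM, sum_sub_sq_div]
    have ht' : t = M + s := by rw [hs]; ring
    rw [ht']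
    field_simp
    ring
  · unfold J1 cJ
    rw [← hM, sum_sub_div]
    have ht' : t = M + s := by rw [hs]; ring
    rw [ht']
    field_simp
    ring

lemma J_bounds_large {t : ℝ} (ht : 1 ≤ t) : |J t| ≤ 18 ∧ |t * J1 t| ≤ 18 := by
  obtain ⟨M, s, η, hM, hs0, hs1, hts, hη, hJ, hJ1⟩ := J_expansion ht
  have hM0 : 0 < M := by linarith
  have ht2 : t ≤ 2 * M := by linarith
  have hη' : |η| * M ^ 2 ≤ 2 := by
    rwa [le_div_iff₀ (by positivity)] at hη
  have hη2 : |t ^ 2 * η| ≤ 8 := by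
    rw [abs_mul, abs_of_nonneg (by positivity)]
    have : t ^ 2 ≤ 4 * M ^ 2 := by nlinarith
    nlinarith [abs_nonneg η]
  have hq : |s * (1 - 2 * s)| ≤ 1 := by rw [abs_le]; constructor <;> nlinarith
  constructor
  · rw [hJ]
    have h1 : |-s ^ 2 / 2| ≤ 1 := by rw [abs_le]; constructor <;> nlinarith
    have h2 : |s ^ 2 * (1 - 2 * s) / (2 * M)| ≤ 1 := by
      rw [abs_div, abs_of_pos (by positivity : 0 < 2 * M), div_le_one (by positivity), pow_two,
        mul_assoc, abs_mul, abs_of_nonneg hs0]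
      nlinarith [abs_nonneg (s * (1 - 2 * s))]
    have := abs_add_three (-s ^ 2 / 2) (s ^ 2 * (1 - 2 * s) / (2 * M)) (t ^ 2 * η)
    linarith
  · rw [hJ1, mul_add]
    have h1 : |t * (s * (1 - 2 * s) / M)| ≤ 2 := by
      rw [mul_div_assoc', abs_div, abs_of_pos hM0, div_le_iff₀ hM0, abs_mul,
        abs_of_pos (by linarith : 0 < t)]
      nlinarith [abs_nonneg (s * (1 - 2 * s))]
    have h2 : t * (2 * t * η) = 2 * (t ^ 2 * η) := by ring
    rw [h2]
    have h3 : |2 * (t ^ 2 * η)| ≤ 16 := by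
      rw [abs_mul, abs_of_pos (by norm_num : (0:ℝ) < 2)]; linarith
    have := abs_add_le (t * (s * (1 - 2 * s) / M)) (2 * (t ^ 2 * η))
    linarith

lemma PP_eq_zero {t : ℝ} (ht : t < 1) : PP t = 0 := by
  unfold PP; rw [Nat.floor_eq_zero.2 ht]; simp

lemma J_bounds_small {t : ℝ} (h0 : 0 < t) (ht : t < 1) : |J t| ≤ 18 * t ∧ |t * J1 t| ≤ 18 * t := by
  have hl := (Real.abs_log_mul_self_lt t h0 ht.le).le
  have hc := abs_cJ_le
  rw [abs_le] at hl hc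
  constructor
  · unfold J
    rw [PP_eq_zero ht]
    have : 0 - t ^ 2 * Real.log t - cJ * t ^ 2 - t = t * (-(Real.log t * t) - cJ * t - 1) := by ring
    rw [this, abs_mul, abs_of_pos h0, mul_comm]
    apply mul_le_mul_of_nonneg_right _ h0.le
    rw [abs_le]; constructor <;> nlinarith
  · rw [abs_mul, abs_of_pos h0, mul_comm]
    apply mul_le_mul_of_nonneg_right _ h0.le
    unfold J1
    rw [Nat.floor_eq_zero.2 ht]
    simp only [Icc_eq_empty_of_lt (zero_lt_one), sum_empty]
    rw [abs_le]; constructor <;> nlinarith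

/-- `min 1 t ≤ t ^ θ` for `θ` in `[0, 1]`. The freedom in `θ` provides integrability near `0` and
summability at infinity from one estimate. -/
lemma le_rpow_of_le_min {a C t θ : ℝ} (hC : 0 ≤ C) (ht : 0 < t) (hθ0 : 0 ≤ θ) (hθ1 : θ ≤ 1)
    (h1 : 1 ≤ t → a ≤ C) (h2 : t < 1 → a ≤ C * t) : a ≤ C * t ^ θ := by
  rcases le_or_gt 1 t with h | h
  · refine (h1 h).trans ?_
    have := Real.one_le_rpow h hθ0
    nlinarith
  · refine (h2 h).trans (mul_le_mul_of_nonneg_left ?_ hC)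
    have := Real.rpow_le_rpow_of_exponent_ge ht h.le hθ1
    rwa [Real.rpow_one] at this

lemma abs_J_le {t θ : ℝ} (ht : 0 < t) (hθ0 : 0 ≤ θ) (hθ1 : θ ≤ 1) : |J t| ≤ 18 * t ^ θ :=
  le_rpow_of_le_min (by norm_num) ht hθ0 hθ1 (fun h => (J_bounds_large h).1)
    (fun h => (J_bounds_small ht h).1)

lemma abs_mul_J1_le {t θ : ℝ} (ht : 0 < t) (hθ0 : 0 ≤ θ) (hθ1 : θ ≤ 1) :
    |t * J1 t| ≤ 18 * t ^ θ :=
  le_rpow_of_le_min (by norm_num) ht hθ0 hθ1 (fun h => (J_bounds_large h).2)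
    (fun h => (J_bounds_small ht h).2)

/-- A truncated square is continuously differentiable across its kink. This makes `J` differentiable
even at the integers, where new terms enter `PP`. -/
lemma hasDerivAt_max_sq (u : ℝ) : HasDerivAt (fun u : ℝ => max u 0 ^ 2) (2 * max u 0) u := by
  rcases lt_trichotomy u 0 with h | h | h
  · rw [max_eq_right h.le, mul_zero]
    refine (hasDerivAt_const u (0 : ℝ)).congr_of_eventuallyEq ?_
    filter_upwards [Iio_mem_nhds h] with v hv
    rw [max_eq_right (le_of_lt hv)]; norm_num
  · subst h
    rw [max_self, mul_zero, hasDerivAt_iff_isLittleO_nhds_zero]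
    have h1 : (fun v : ℝ => v ^ 2) =o[nhds 0] fun v : ℝ => v := by
      simpa using Asymptotics.isLittleO_pow_id (𝕜 := ℝ) (n := 2) (by norm_num)
    refine Asymptotics.IsBigO.trans_isLittleO ?_ h1
    refine Asymptotics.IsBigO.of_bound 1 (Eventually.of_forall fun v => ?_)
    simp only [zero_add, smul_zero, sub_zero, max_self, norm_pow, one_mul, Real.norm_eq_abs, sq_abs]
    norm_num
    rcases le_total v 0 with h | h
    · rw [max_eq_right h]; nlinarith [sq_nonneg v]
    · rw [max_eq_left h]
  · rw [max_eq_left h.le]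
    have : HasDerivAt (fun v : ℝ => v ^ 2) (2 * u) u := by simpa using hasDerivAt_pow 2 u
    refine this.congr_of_eventuallyEq ?_
    filter_upwards [Ioi_mem_nhds h] with v hv
    rw [max_eq_left (le_of_lt hv)]

lemma PP_eq_max {t : ℝ} (K : ℕ) (ht0 : 0 ≤ t) (hK : t < K + 1) :
    PP t = ∑ n ∈ Icc 1 K, max (t - n) 0 ^ 2 / n := by
  unfold PP
  have hsub : Icc 1 ⌊t⌋₊ ⊆ Icc 1 K := by
    apply Icc_subset_Icc_right
    have : ⌊t⌋₊ < K + 1 := (Nat.floor_lt ht0).2 (by push_cast; exact hK)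
    omega
  rw [← Finset.sum_subset hsub]
  · refine Finset.sum_congr rfl fun n hn => ?_
    rw [mem_Icc] at hn
    have := (Nat.le_floor_iff ht0).1 hn.2
    rw [max_eq_left (by linarith)]
  · intro n hn hn'
    rw [mem_Icc] at hn hn'
    have : t < n := (Nat.floor_lt ht0).1 (by omega)
    rw [max_eq_right (by linarith)]; norm_num

lemma hasDerivAt_J {t : ℝ} (ht : 0 < t) : HasDerivAt J (J1 t) t := by
  set K := ⌊t⌋₊ with hK
  have hlt := Nat.lt_floor_add_one t
  rw [← hK] at hlt
  have h1 : HasDerivAt (fun u : ℝ => ∑ n ∈ Icc 1 K, max (u - n) 0 ^ 2 / n)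
      (∑ n ∈ Icc 1 K, 2 * max (t - n) 0 * 1 / n) t := by
    apply HasDerivAt.fun_sum
    intro n _
    apply HasDerivAt.div_const
    exact (hasDerivAt_max_sq (t - n)).comp t ((hasDerivAt_id t).sub_const (n : ℝ))
  have h2 : HasDerivAt PP (2 * ∑ n ∈ Icc 1 K, (t - n) / n) t := by
    have : (∑ n ∈ Icc 1 K, 2 * max (t - n) 0 * 1 / n) = 2 * ∑ n ∈ Icc 1 K, (t - n) / n := by
      rw [Finset.mul_sum]
      refine Finset.sum_congr rfl fun n hn => ?_
      rw [mem_Icc] at hn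
      have := (Nat.le_floor_iff ht.le).1 hn.2
      rw [max_eq_left (by linarith)]; ring
    rw [← this]
    refine h1.congr_of_eventuallyEq ?_
    filter_upwards [Ioo_mem_nhds ht hlt] with u hu
    exact PP_eq_max K hu.1.le hu.2
  have h3 : HasDerivAt (fun u : ℝ => u ^ 2 * Real.log u) (2 * t * Real.log t + t) t := by
    have := (hasDerivAt_pow 2 t).mul (Real.hasDerivAt_log ht.ne')
    refine this.congr_deriv ?_
    field_simp; norm_num; ring
  have h4 : HasDerivAt (fun u : ℝ => cJ * u ^ 2) (cJ * (2 * t)) t := by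
    have := (hasDerivAt_pow 2 t).const_mul cJ
    simpa using this
  refine (((h2.sub h3).sub h4).sub (hasDerivAt_id t)).congr_deriv ?_
  unfold J1
  rw [← hK]; ring

lemma continuousOn_J : ContinuousOn J (Set.Ioi 0) := fun _ ht =>
  (hasDerivAt_J ht).continuousAt.continuousWithinAt

/-! ### Comparison of a sum with an integral -/

/-- The integral of `J(v⁻³)` over the positive half line. -/
def intJ : ℝ := ∫ v in Set.Ioi (0 : ℝ), J (1 / v ^ 3)

lemma inv_cube_rpow {u Y : ℝ} (hu : 0 < u) (hY : 0 < Y) (θ : ℝ) :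
    (1 / (u ^ 3 * Y)) ^ θ = Y ^ (-θ) * u ^ (-(3 * θ)) := by
  rw [one_div, Real.inv_rpow (by positivity), Real.mul_rpow (by positivity) hY.le,
    ← Real.rpow_natCast u 3, ← Real.rpow_mul hu.le, mul_inv, Real.rpow_neg hY.le,
    Real.rpow_neg hu.le, mul_comm]
  norm_num

lemma abs_J_cube_le {u Y θ : ℝ} (hu : 0 < u) (hY : 0 < Y) (h0 : 0 ≤ θ) (h1 : θ ≤ 1) :
    |J (1 / (u ^ 3 * Y))| ≤ 18 * (Y ^ (-θ) * u ^ (-(3 * θ))) := by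
  rw [← inv_cube_rpow hu hY]
  exact abs_J_le (by positivity) h0 h1

lemma hasDerivAt_J_cube {u Y : ℝ} (hu : 0 < u) (hY : 0 < Y) :
    HasDerivAt (fun u => J (1 / (u ^ 3 * Y)))
      (-3 * (1 / (u ^ 3 * Y) * J1 (1 / (u ^ 3 * Y))) / u) u := by
  have h1 : HasDerivAt (fun u : ℝ => 1 / (u ^ 3 * Y)) (-3 * (1 / (u ^ 3 * Y)) / u) u := by
    have := ((hasDerivAt_pow 3 u).mul_const Y).inv (by positivity)
    simp only [one_div]
    refine this.congr_deriv ?_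
    field_simp; norm_num; ring
  have h2 := (hasDerivAt_J (t := 1 / (u ^ 3 * Y)) (by positivity)).comp u h1
  refine h2.congr_deriv ?_
  ring

lemma continuousOn_J_cube {Y : ℝ} (hY : 0 < Y) :
    ContinuousOn (fun u => J (1 / (u ^ 3 * Y))) (Set.Ioi 0) := fun _ hu =>
  (hasDerivAt_J_cube hu hY).continuousAt.continuousWithinAt

open MeasureTheory in
lemma integrableOn_J_cube_Ioc {Y : ℝ} (hY : 0 < Y) :
    IntegrableOn (fun u => J (1 / (u ^ 3 * Y))) (Set.Ioc 0 1) := by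
  have h1 : IntegrableOn (fun _ : ℝ => (18 : ℝ)) (Set.Ioc 0 1) := by simp
  refine Integrable.mono' h1 ?_ ?_
  · exact ((continuousOn_J_cube hY).mono Set.Ioc_subset_Ioi_self).aestronglyMeasurable
      measurableSet_Ioc
  · refine (ae_restrict_iff' measurableSet_Ioc).2 (Eventually.of_forall fun u hu => ?_)
    have := abs_J_cube_le hu.1 hY le_rfl zero_le_one
    simpa using this

open MeasureTheory in
lemma integrableOn_J_cube_Ioi_one {Y : ℝ} (hY : 0 < Y) :
    IntegrableOn (fun u => J (1 / (u ^ 3 * Y))) (Set.Ioi 1) := by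
  have h1 : IntegrableOn (fun u : ℝ => 18 * (Y ^ (-1 : ℝ) * u ^ (-(3 * 1) : ℝ))) (Set.Ioi 1) :=
    ((integrableOn_Ioi_rpow_of_lt (by norm_num) zero_lt_one).const_mul _).const_mul _
  refine Integrable.mono' h1 ?_ ?_
  · exact ((continuousOn_J_cube hY).mono (Set.Ioi_subset_Ioi zero_le_one)).aestronglyMeasurable
      measurableSet_Ioi
  · refine (ae_restrict_iff' measurableSet_Ioi).2 (Eventually.of_forall fun u hu => ?_)
    exact abs_J_cube_le (zero_lt_one.trans hu) hY zero_le_one le_rfl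

open MeasureTheory in
lemma integral_J_cube {Y : ℝ} (hY : 0 < Y) :
    ∫ u in Set.Ioi (0 : ℝ), J (1 / (u ^ 3 * Y)) = Y ^ (-(1 / 3) : ℝ) * intJ := by
  have hb : 0 < Y ^ (1 / 3 : ℝ) := by positivity
  have := integral_comp_mul_left_Ioi (fun v => J (1 / v ^ 3)) 0 hb
  rw [mul_zero] at this
  unfold intJ
  rw [Real.rpow_neg hY.le, ← smul_eq_mul, ← this]
  congr 1; ext u
  congr 2
  rw [mul_pow, ← Real.rpow_natCast (Y ^ (1 / 3 : ℝ)) 3, ← Real.rpow_mul hY.le]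
  norm_num; ring

lemma summable_J_cube {Y : ℝ} (hY : 0 < Y) :
    Summable fun m : ℕ => J (1 / (((m : ℝ) + 1) ^ 3 * Y)) := by
  have h1 : Summable fun m : ℕ => 18 * (Y ^ (-1 : ℝ) * ((m : ℝ) + 1) ^ (-(3 * 1) : ℝ)) := by
    apply Summable.mul_left
    apply Summable.mul_left
    have := (summable_nat_add_iff 1).2 (Real.summable_nat_rpow.2 (by norm_num : -(3 * 1 : ℝ) < -1))
    simpa using this
  refine Summable.of_norm_bounded h1 fun m => ?_
  exact abs_J_cube_le (by positivity) hY zero_le_one le_rfl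

/-- Mean value inequality. The constant is `54 = 3 · 18`: the exponent of `u⁻³` times the bound for
`t J1 t`. -/
lemma abs_J_cube_sub_le {Y θ u v : ℝ} (hY : 0 < Y) (h0 : 0 ≤ θ) (h1 : θ ≤ 1) (hv : 0 < v)
    (huv : v ≤ u) (hu : u ≤ v + 1) :
    |J (1 / (u ^ 3 * Y)) - J (1 / (v ^ 3 * Y))| ≤ 54 * (Y ^ (-θ) * v ^ (-1 - 3 * θ)) := by
  have hb : ∀ w ∈ Set.Icc v u, ‖-3 * (1 / (w ^ 3 * Y) * J1 (1 / (w ^ 3 * Y))) / w‖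
      ≤ 54 * (Y ^ (-θ) * v ^ (-1 - 3 * θ)) := by
    intro w hw
    have hw0 : 0 < w := hv.trans_le hw.1
    have h2 := abs_mul_J1_le (t := 1 / (w ^ 3 * Y)) (by positivity) h0 h1
    rw [inv_cube_rpow hw0 hY] at h2
    rw [Real.norm_eq_abs, abs_div, abs_mul, abs_of_pos hw0, div_le_iff₀ hw0]
    have h3 : w ^ (-(3 * θ)) = w ^ (-1 - 3 * θ) * w := by
      rw [← Real.rpow_add_one hw0.ne']; congr 1; ring
    have h4 : w ^ (-1 - 3 * θ) ≤ v ^ (-1 - 3 * θ) :=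
      Real.rpow_le_rpow_of_nonpos hv hw.1 (by linarith)
    have h5 : Y ^ (-θ) * w ^ (-1 - 3 * θ) * w ≤ Y ^ (-θ) * v ^ (-1 - 3 * θ) * w := by gcongr
    rw [h3] at h2
    have : |(-3 : ℝ)| = 3 := by norm_num
    rw [this]
    nlinarith
  have := Convex.norm_image_sub_le_of_norm_hasDerivWithin_le (f := fun w => J (1 / (w ^ 3 * Y)))
    (s := Set.Icc v u) (fun w hw => (hasDerivAt_J_cube (hv.trans_le hw.1) hY).hasDerivWithinAt) hb
    (convex_Icc v u) (Set.left_mem_Icc.2 huv) (Set.right_mem_Icc.2 huv)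
  rw [Real.norm_eq_abs, Real.norm_eq_abs, abs_of_nonneg (by linarith : 0 ≤ u - v)] at this
  refine this.trans ?_
  have hp : 0 ≤ 54 * (Y ^ (-θ) * v ^ (-1 - 3 * θ)) := by positivity
  nlinarith

-- Each term is compared with the integral over the next unit interval. The discrepancies are of
-- order `m^(-1 - 3θ)` and summable for `θ > 0`. The integral over `(0, 1]` has no matching term and
-- is bounded by that of `u^(-3θ)`, finite for `θ < 1/3`; this is the source of the range of `δ`.
open MeasureTheory in
lemma exists_abs_sum_J_cube_sub_le {θ : ℝ} (h0 : 0 < θ) (h1 : θ < 1 / 3) :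
    ∃ C : ℝ, 0 ≤ C ∧ ∀ Y : ℝ, 0 < Y →
      |∑' m : ℕ, J (1 / (((m : ℝ) + 1) ^ 3 * Y)) - Y ^ (-(1 / 3) : ℝ) * intJ| ≤ C * Y ^ (-θ) := by
  have hs : Summable fun m : ℕ => ((m : ℝ) + 1) ^ (-1 - 3 * θ) := by
    have := (summable_nat_add_iff 1).2 (Real.summable_nat_rpow.2 (by linarith : -1 - 3 * θ < -1))
    simpa using this
  have hsn : 0 ≤ ∑' m : ℕ, ((m : ℝ) + 1) ^ (-1 - 3 * θ) := tsum_nonneg fun m => by positivity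
  have hi : 0 < 1 - 3 * θ := by linarith
  refine ⟨54 * (∑' m : ℕ, ((m : ℝ) + 1) ^ (-1 - 3 * θ)) + 18 / (1 - 3 * θ), by positivity,
    fun Y hY => ?_⟩
  set f : ℝ → ℝ := fun u => J (1 / (u ^ 3 * Y)) with hf
  have hint : ∀ a b : ℝ, 0 < a → 0 < b → IntervalIntegrable f volume a b := by
    intro a b ha hb
    refine ((continuousOn_J_cube hY).mono ?_).intervalIntegrable
    intro u hu
    exact (lt_min ha hb).trans_le hu.1
  have hstep : ∀ m : ℕ, |f ((m : ℝ) + 1) - ∫ u in ((m : ℝ) + 1)..((m : ℝ) + 1 + 1), f u|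
      ≤ 54 * (Y ^ (-θ) * ((m : ℝ) + 1) ^ (-1 - 3 * θ)) := by
    intro m
    have hm : (0 : ℝ) < (m : ℝ) + 1 := by positivity
    have e1 : f ((m : ℝ) + 1) = ∫ u in ((m : ℝ) + 1)..((m : ℝ) + 1 + 1), f ((m : ℝ) + 1) := by
      simp
    rw [e1, ← intervalIntegral.integral_sub (by simp) (hint _ _ hm (by positivity)),
      ← Real.norm_eq_abs]
    refine (intervalIntegral.norm_integral_le_of_norm_le_const
      (C := 54 * (Y ^ (-θ) * ((m : ℝ) + 1) ^ (-1 - 3 * θ))) ?_).trans (by simp)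
    intro u hu
    rw [Set.uIoc_of_le (by linarith)] at hu
    rw [Real.norm_eq_abs, abs_sub_comm]
    exact abs_J_cube_sub_le hY h0.le (by linarith) hm hu.1.le hu.2
  have hpart : ∀ N : ℕ, |∑ m ∈ range N, f ((m : ℝ) + 1) - ∫ u in (1 : ℝ)..((N : ℝ) + 1), f u|
      ≤ 54 * (∑' m : ℕ, ((m : ℝ) + 1) ^ (-1 - 3 * θ)) * Y ^ (-θ) := by
    intro N
    have e1 : ∫ u in (1 : ℝ)..((N : ℝ) + 1), f u
        = ∑ m ∈ range N, ∫ u in ((m : ℝ) + 1)..((m : ℝ) + 1 + 1), f u := by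
      have := intervalIntegral.sum_integral_adjacent_intervals (f := f) (μ := volume)
        (a := fun m : ℕ => (m : ℝ) + 1) (n := N)
        (fun k _ => hint _ _ (by positivity) (by positivity))
      simp only [Nat.cast_zero, zero_add] at this
      rw [← this]
      refine Finset.sum_congr rfl fun m _ => ?_
      push_cast; rfl
    rw [e1, ← Finset.sum_sub_distrib]
    refine (Finset.abs_sum_le_sum_abs _ _).trans ((Finset.sum_le_sum fun m _ => hstep m).trans ?_)
    rw [← Finset.mul_sum, ← Finset.mul_sum, mul_assoc, mul_comm (∑' m : ℕ, _)]
    have := hs.sum_le_tsum (range N) (fun m _ => by positivity)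
    gcongr
  have hlim1 : Tendsto (fun N : ℕ => ∑ m ∈ range N, f ((m : ℝ) + 1)) atTop
      (nhds (∑' m : ℕ, J (1 / (((m : ℝ) + 1) ^ 3 * Y)))) := (summable_J_cube hY).hasSum.tendsto_sum_nat
  have hlim2 : Tendsto (fun N : ℕ => ∫ u in (1 : ℝ)..((N : ℝ) + 1), f u) atTop
      (nhds (∫ u in Set.Ioi 1, f u)) :=
    intervalIntegral_tendsto_integral_Ioi 1 (integrableOn_J_cube_Ioi_one hY)
      (tendsto_atTop_add_const_right _ _ tendsto_natCast_atTop_atTop)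
  have hA := le_of_tendsto (hlim1.sub hlim2).abs (Eventually.of_forall hpart)
  have hB : |∫ u in Set.Ioc 0 1, f u| ≤ 18 / (1 - 3 * θ) * Y ^ (-θ) := by
    have hI : IntervalIntegrable (fun u : ℝ => 18 * (Y ^ (-θ) * u ^ (-(3 * θ)))) volume 0 1 :=
      ((intervalIntegral.intervalIntegrable_rpow' (by linarith)).const_mul _).const_mul _
    have h2 : ∫ u in (0 : ℝ)..1, 18 * (Y ^ (-θ) * u ^ (-(3 * θ))) = 18 / (1 - 3 * θ) * Y ^ (-θ) := by
      rw [intervalIntegral.integral_const_mul, intervalIntegral.integral_const_mul,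
        integral_rpow (Or.inl (by linarith))]
      rw [Real.one_rpow, Real.zero_rpow (by linarith), show -(3 * θ) + 1 = 1 - 3 * θ by ring]
      field_simp; ring
    rw [← h2, intervalIntegral.integral_of_le zero_le_one, ← Real.norm_eq_abs]
    refine norm_integral_le_of_norm_le ?_ ?_
    · exact (intervalIntegrable_iff_integrableOn_Ioc_of_le zero_le_one).1 hI
    · refine (ae_restrict_iff' measurableSet_Ioc).2 (Eventually.of_forall fun u hu => ?_)
      exact abs_J_cube_le hu.1 hY h0.le (by linarith)
  have hsplit : ∫ u in Set.Ioi (0 : ℝ), f u = (∫ u in Set.Ioc 0 1, f u) + ∫ u in Set.Ioi 1, f u := by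
    rw [← Set.Ioc_union_Ioi_eq_Ioi zero_le_one, setIntegral_union (Set.Ioc_disjoint_Ioi le_rfl)
      measurableSet_Ioi (integrableOn_J_cube_Ioc hY) (integrableOn_J_cube_Ioi_one hY)]
  rw [← integral_J_cube hY]
  have := abs_sub (∑' m : ℕ, J (1 / (((m : ℝ) + 1) ^ 3 * Y)) - ∫ u in Set.Ioi 1, f u)
    (∫ u in Set.Ioc 0 1, f u)
  change |_ - ∫ u in Set.Ioi (0 : ℝ), f u| ≤ _
  rw [hsplit, add_comm (∫ u in Set.Ioc 0 1, f u), ← sub_sub, add_mul]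
  linarith

/-! ### Evaluation of the constant `intJ` -/

section Mellin
open MeasureTheory Set

/-- The indicator function of `(1, ∞)`. -/
def indHi : ℝ → ℂ := indicator (Ioi 1) (fun _ => 1)

/-- The indicator function of `(0, 1]`. -/
def indLo : ℝ → ℂ := indicator (Ioc 0 1) (fun _ => 1)

lemma locallyIntegrableOn_indHi : LocallyIntegrableOn indHi (Ioi 0) := by
  apply LocallyIntegrable.locallyIntegrableOn
  have : LocallyIntegrable (fun _ : ℝ => (1 : ℂ)) := locallyIntegrable_const 1
  exact this.indicator measurableSet_Ioi

lemma locallyIntegrableOn_indLo : LocallyIntegrableOn indLo (Ioi 0) := by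
  apply LocallyIntegrable.locallyIntegrableOn
  have : LocallyIntegrable (fun _ : ℝ => (1 : ℂ)) := locallyIntegrable_const 1
  exact this.indicator measurableSet_Ioc

lemma isBigO_zero_bot {f : ℝ → ℂ} (hf : ∀ t < 1, f t = 0) (b : ℝ) :
    f =O[nhdsWithin 0 (Ioi 0)] (fun t : ℝ => t ^ (-b)) := by
  have : f =ᶠ[nhdsWithin 0 (Ioi 0)] fun _ => (0 : ℂ) := by
    filter_upwards [mem_nhdsWithin_of_mem_nhds (Iio_mem_nhds (zero_lt_one (α := ℝ)))] with t ht
    exact hf t ht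
  exact this.trans_isBigO (Asymptotics.isBigO_zero _ _)

lemma indHi_of_lt (t : ℝ) (ht : t < 1) : indHi t = 0 :=
  indicator_of_notMem (by simpa using ht.le) _

lemma indHi_isBigO_top : indHi =O[atTop] (fun t : ℝ => t ^ (-(0 : ℝ))) := by
  refine Asymptotics.IsBigO.of_bound 1 (Eventually.of_forall fun t => ?_)
  simp only [neg_zero, Real.rpow_zero, norm_one, mul_one]
  unfold indHi indicator; split_ifs <;> simp

lemma indLo_isBigO_top (a : ℝ) : indLo =O[atTop] (fun t : ℝ => t ^ (-a)) := by
  have : indLo =ᶠ[atTop] fun _ => (0 : ℂ) := by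
    filter_upwards [eventually_gt_atTop 1] with t ht
    exact indicator_of_notMem (by simp [ht]) _
  exact this.trans_isBigO (Asymptotics.isBigO_zero _ _)

lemma indLo_isBigO_bot : indLo =O[nhdsWithin 0 (Ioi 0)] (fun t : ℝ => t ^ (-(0 : ℝ))) := by
  refine Asymptotics.IsBigO.of_bound 1 (Eventually.of_forall fun t => ?_)
  simp only [neg_zero, Real.rpow_zero, norm_one, mul_one]
  unfold indLo indicator; split_ifs <;> simp

lemma hasMellin_indHi {s : ℂ} (hs : s.re < 0) : HasMellin indHi s (-1 / s) := by
  refine ⟨mellinConvergent_of_isBigO_rpow locallyIntegrableOn_indHi indHi_isBigO_top (by simpa)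
    (isBigO_zero_bot indHi_of_lt (s.re - 1)) (by linarith), ?_⟩
  have h1 : mellin indHi s = ∫ t in Ioi (1 : ℝ), (t : ℂ) ^ (s - 1) := by
    unfold mellin
    have e1 : (fun t : ℝ => (t : ℂ) ^ (s - 1) • indHi t)
        = indicator (Ioi 1) (fun t : ℝ => (t : ℂ) ^ (s - 1)) := by
      ext t; unfold indHi indicator; split_ifs <;> simp
    rw [e1, setIntegral_indicator measurableSet_Ioi, Ioi_inter_Ioi]
    simp
  rw [h1, integral_Ioi_cpow_of_lt (by simp; linarith) zero_lt_one]
  simp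

lemma hasMellin_log_indHi {s : ℂ} (hs : s.re < 0) :
    HasMellin (fun t => Real.log t • indHi t) s (1 / s ^ 2) := by
  obtain ⟨h1, h2⟩ := mellin_hasDerivAt_of_isBigO_rpow locallyIntegrableOn_indHi indHi_isBigO_top
    (by simpa) (isBigO_zero_bot indHi_of_lt (s.re - 1)) (by linarith)
  refine ⟨h1, h2.unique ?_⟩
  have hs0 : s ≠ 0 := by rintro rfl; simp at hs
  have h3 : HasDerivAt (fun z : ℂ => -1 / z) (1 / s ^ 2) s := by
    have := (hasDerivAt_inv hs0).const_mul (-1)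
    simp only [div_eq_mul_inv]
    refine this.congr_deriv ?_
    ring
  refine h3.congr_of_eventuallyEq ?_
  filter_upwards [(isOpen_lt Complex.continuous_re continuous_const).mem_nhds hs] with z hz
  exact (hasMellin_indHi hz).2

lemma hasMellin_log_indLo {s : ℂ} (hs : 0 < s.re) :
    HasMellin (fun t => Real.log t • indLo t) s (-1 / s ^ 2) := by
  obtain ⟨h1, h2⟩ := mellin_hasDerivAt_of_isBigO_rpow locallyIntegrableOn_indLo
    (indLo_isBigO_top (s.re + 1)) (by linarith) indLo_isBigO_bot hs
  refine ⟨h1, h2.unique ?_⟩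
  have hs0 : s ≠ 0 := by rintro rfl; simp at hs
  have h3 : HasDerivAt (fun z : ℂ => 1 / z) (-1 / s ^ 2) s := by
    have := hasDerivAt_inv hs0
    simp only [one_div]
    refine this.congr_deriv ?_
    ring
  refine h3.congr_of_eventuallyEq ?_
  filter_upwards [(isOpen_lt continuous_const Complex.continuous_re).mem_nhds hs] with z hz
  exact (hasMellin_one_Ioc hz).2

lemma _root_.HasMellin.cpow_smul {f : ℝ → ℂ} {s a m : ℂ} (h : HasMellin f (s + a) m) :
    HasMellin (fun t => (t : ℂ) ^ a • f t) s m :=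
  ⟨MellinConvergent.cpow_smul.2 h.1, by rw [mellin_cpow_smul, h.2]⟩

lemma _root_.HasMellin.sub' {f g : ℝ → ℂ} {s m n : ℂ} (hf : HasMellin f s m) (hg : HasMellin g s n) :
    HasMellin (fun t => f t - g t) s (m - n) := by
  have := hasMellin_sub hf.1 hg.1
  rwa [hf.2, hg.2] at this

lemma _root_.HasMellin.add' {f g : ℝ → ℂ} {s m n : ℂ} (hf : HasMellin f s m) (hg : HasMellin g s n) :
    HasMellin (fun t => f t + g t) s (m + n) := by
  have := hasMellin_add hf.1 hg.1
  rwa [hf.2, hg.2] at this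

lemma _root_.HasMellin.const_smul' {f : ℝ → ℂ} {s m : ℂ} (hf : HasMellin f s m) (c : ℂ) :
    HasMellin (fun t => c • f t) s (c • m) := by
  have := hasMellin_const_smul hf.1 c
  rwa [hf.2] at this

lemma _root_.HasMellin.congr' {f g : ℝ → ℂ} {s m : ℂ} (hf : HasMellin f s m)
    (h : ∀ t, 0 < t → g t = f t) : HasMellin g s m := by
  have h' : ∀ t ∈ Ioi (0 : ℝ), (t : ℂ) ^ (s - 1) • f t = (t : ℂ) ^ (s - 1) • g t :=
    fun t ht => by rw [h t ht]
  refine ⟨IntegrableOn.congr_fun hf.1 h' measurableSet_Ioi, ?_⟩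
  rw [← hf.2]
  exact (setIntegral_congr_fun measurableSet_Ioi h').symm

/-- `(t - 1)₊²` as a complex valued function. -/
def sqHi (t : ℝ) : ℂ := ((max (t - 1) 0 ^ 2 : ℝ) : ℂ)

lemma re_add_two {s : ℂ} (hs : s.re < -2) : (s + 2).re < 0 ∧ (s + 1).re < 0 ∧ s.re < 0 := by
  simp; refine ⟨by linarith, by linarith, by linarith⟩

lemma hasMellin_sqHi {s : ℂ} (hs : s.re < -2) :
    HasMellin sqHi s (-2 / (s * (s + 1) * (s + 2))) := by
  obtain ⟨h2, h1, h0⟩ := re_add_two hs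
  have n2 : s + 2 ≠ 0 := by intro h; rw [h] at h2; simp at h2
  have n1 : s + 1 ≠ 0 := by intro h; rw [h] at h1; simp at h1
  have n0 : s ≠ 0 := by intro h; rw [h] at h0; simp at h0
  have := ((hasMellin_indHi h2).cpow_smul.sub'
    ((hasMellin_indHi h1).cpow_smul.const_smul' 2)).add' (hasMellin_indHi h0)
  have e : -1 / (s + 2) - (2 : ℂ) • (-1 / (s + 1)) + -1 / s = -2 / (s * (s + 1) * (s + 2)) := by
    rw [smul_eq_mul]; field_simp; ring
  rw [e] at this
  refine this.congr' fun t ht => ?_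
  unfold sqHi indHi indicator
  simp only [Set.mem_Ioi]
  split_ifs with h
  · rw [max_eq_left (by linarith)]
    simp
    ring
  · rw [max_eq_right (by linarith)]; simp

lemma norm_cpow_smul_scale (s : ℂ) {t : ℝ} (ht : 0 < t) (m : ℕ) :
    (t : ℂ) ^ (s - 1) • ((max (t - ((m : ℝ) + 1)) 0 ^ 2 / ((m : ℝ) + 1) : ℝ) : ℂ)
      = ((m : ℂ) + 1) ^ s • ((((m : ℝ) + 1)⁻¹ * t : ℝ) : ℂ) ^ (s - 1) • sqHi (((m : ℝ) + 1)⁻¹ * t) := by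
  have hm : (0 : ℝ) < (m : ℝ) + 1 := by positivity
  have hmc : (m : ℂ) + 1 ≠ 0 := by exact_mod_cast hm.ne'
  have e1 : max (((m : ℝ) + 1)⁻¹ * t - 1) 0 = ((m : ℝ) + 1)⁻¹ * max (t - ((m : ℝ) + 1)) 0 := by
    rw [mul_max_of_nonneg _ _ (by positivity), mul_zero]
    congr 1; field_simp
  have e2 : (((((m : ℝ) + 1)⁻¹ * t : ℝ)) : ℂ) ^ (s - 1)
      = (((m : ℂ) + 1) ^ s)⁻¹ * ((m : ℂ) + 1) * (t : ℂ) ^ (s - 1) := by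
    rw [Complex.ofReal_mul, Complex.mul_cpow_ofReal_nonneg (by positivity) ht.le]
    congr 1
    push_cast
    rw [Complex.inv_cpow, ← Complex.cpow_neg, neg_sub, Complex.cpow_sub _ _ hmc, Complex.cpow_one]
    · field_simp
    · have : ((m : ℂ) + 1) = (((m + 1 : ℕ)) : ℂ) := by push_cast; rfl
      rw [this, Complex.natCast_arg]
      exact Real.pi_pos.ne
  have h3 : ((m : ℂ) + 1) ^ s ≠ 0 := by
    rw [Complex.cpow_def_of_ne_zero hmc]; exact Complex.exp_ne_zero _
  unfold sqHi
  rw [e1, e2]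
  simp only [smul_eq_mul]
  push_cast
  field_simp

/-! ### Mellin transforms of `PP` and of its remainder. -/

lemma hasMellin_PP_term {s : ℂ} (hs : s.re < -2) (m : ℕ) :
    IntegrableOn (fun t : ℝ => (t : ℂ) ^ (s - 1) •
      ((max (t - ((m : ℝ) + 1)) 0 ^ 2 / ((m : ℝ) + 1) : ℝ) : ℂ)) (Ioi 0) ∧
    ∫ t in Ioi (0 : ℝ), (t : ℂ) ^ (s - 1) •
      ((max (t - ((m : ℝ) + 1)) 0 ^ 2 / ((m : ℝ) + 1) : ℝ) : ℂ)
      = ((m : ℂ) + 1) ^ (s + 1) * mellin sqHi s ∧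
    ∫ t in Ioi (0 : ℝ), ‖(t : ℂ) ^ (s - 1) •
      ((max (t - ((m : ℝ) + 1)) 0 ^ 2 / ((m : ℝ) + 1) : ℝ) : ℂ)‖
      = ((m : ℝ) + 1) ^ (s.re + 1) * ∫ t in Ioi (0 : ℝ), ‖(t : ℂ) ^ (s - 1) • sqHi t‖ := by
  have hm : (0 : ℝ) < (m : ℝ) + 1 := by positivity
  have hmc : (m : ℂ) + 1 ≠ 0 := by exact_mod_cast hm.ne'
  have hc : ∀ t ∈ Ioi (0 : ℝ), (t : ℂ) ^ (s - 1) •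
      ((max (t - ((m : ℝ) + 1)) 0 ^ 2 / ((m : ℝ) + 1) : ℝ) : ℂ)
      = ((m : ℂ) + 1) ^ s • ((fun u : ℝ => (u : ℂ) ^ (s - 1) • sqHi u) (((m : ℝ) + 1)⁻¹ * t)) :=
    fun t ht => norm_cpow_smul_scale s ht m
  have hint := (hasMellin_sqHi hs).1
  refine ⟨?_, ?_, ?_⟩
  · refine IntegrableOn.congr_fun ?_ (fun t ht => (hc t ht).symm) measurableSet_Ioi
    refine Integrable.smul (((m : ℂ) + 1) ^ s) (f := fun t : ℝ =>
      (fun u : ℝ => (u : ℂ) ^ (s - 1) • sqHi u) (((m : ℝ) + 1)⁻¹ * t)) ?_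
    have := (integrableOn_Ioi_comp_mul_left_iff (fun u : ℝ => (u : ℂ) ^ (s - 1) • sqHi u) 0
      (inv_pos.2 hm)).2
    rw [mul_zero] at this
    exact this hint
  · rw [setIntegral_congr_fun measurableSet_Ioi hc, integral_smul,
      integral_comp_mul_left_Ioi (fun u : ℝ => (u : ℂ) ^ (s - 1) • sqHi u) _ (inv_pos.2 hm),
      mul_zero, inv_inv]
    unfold mellin
    rw [Complex.cpow_add _ _ hmc, Complex.cpow_one, smul_eq_mul, mul_assoc]
    congr 1
    rw [Complex.real_smul]; push_cast; rfl
  · have hc' : ∀ t ∈ Ioi (0 : ℝ), ‖(t : ℂ) ^ (s - 1) •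
        ((max (t - ((m : ℝ) + 1)) 0 ^ 2 / ((m : ℝ) + 1) : ℝ) : ℂ)‖
        = ((m : ℝ) + 1) ^ s.re * ((fun u : ℝ => ‖(u : ℂ) ^ (s - 1) • sqHi u‖) (((m : ℝ) + 1)⁻¹ * t)) := by
      intro t ht
      rw [hc t ht, norm_smul]
      congr 1
      have := Complex.norm_cpow_eq_rpow_re_of_pos hm s
      push_cast at this
      exact this
    rw [setIntegral_congr_fun measurableSet_Ioi hc', integral_const_mul,
      integral_comp_mul_left_Ioi (fun u : ℝ => ‖(u : ℂ) ^ (s - 1) • sqHi u‖) _ (inv_pos.2 hm),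
      mul_zero, inv_inv, Real.rpow_add hm, Real.rpow_one, smul_eq_mul, mul_assoc]

lemma hasSum_PP {t : ℝ} (ht : 0 < t) :
    HasSum (fun m : ℕ => max (t - ((m : ℝ) + 1)) 0 ^ 2 / ((m : ℝ) + 1)) (PP t) := by
  have h1 : PP t = ∑ m ∈ Finset.range ⌊t⌋₊, max (t - ((m : ℝ) + 1)) 0 ^ 2 / ((m : ℝ) + 1) := by
    rw [PP_eq_max ⌊t⌋₊ ht.le (Nat.lt_floor_add_one t), Finset.range_eq_Ico,
      Finset.sum_Ico_add' (fun m : ℕ => max (t - (m : ℝ)) 0 ^ 2 / (m : ℝ)) 0 ⌊t⌋₊ 1 |>.symm.trans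
      (Finset.sum_congr rfl fun m _ => by push_cast; rfl) |>.symm]
    congr 1
  rw [h1]
  apply hasSum_sum_of_ne_finset_zero
  intro m hm
  rw [Finset.mem_range, not_lt] at hm
  have h2 := Nat.lt_floor_add_one t
  have h3 : (⌊t⌋₊ : ℝ) ≤ m := by exact_mod_cast hm
  rw [max_eq_right (by linarith)]; norm_num

lemma PP_eq_zero_of_le {t : ℝ} (h : t ≤ 1) : PP t = 0 := by
  rcases h.lt_or_eq with h | h
  · exact PP_eq_zero h
  · rw [h]; simp [PP]

/-- The restriction of `J` to `(1, ∞)`. -/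
def JHi : ℝ → ℂ := indicator (Ioi 1) (fun t => (J t : ℂ))

lemma locallyIntegrableOn_J : LocallyIntegrableOn (fun t => (J t : ℂ)) (Ioi 0) := by
  apply ContinuousOn.locallyIntegrableOn _ measurableSet_Ioi
  exact Complex.continuous_ofReal.comp_continuousOn continuousOn_J

lemma locallyIntegrableOn_JHi : LocallyIntegrableOn JHi (Ioi 0) := by
  intro x hx
  obtain ⟨u, hu, hi⟩ := locallyIntegrableOn_J x hx
  exact ⟨u, hu, hi.indicator measurableSet_Ioi⟩

lemma JHi_isBigO_top : JHi =O[atTop] (fun t : ℝ => t ^ (-(0 : ℝ))) := by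
  refine Asymptotics.IsBigO.of_bound 18 (Eventually.of_forall fun t => ?_)
  simp only [neg_zero, Real.rpow_zero, norm_one, mul_one]
  unfold JHi indicator
  split_ifs with h
  · rw [Complex.norm_real]; exact (J_bounds_large (le_of_lt h)).1
  · simp

lemma JHi_of_lt (t : ℝ) (ht : t < 1) : JHi t = 0 :=
  indicator_of_notMem (by simpa using ht.le) _

/-- On `(1, ∞)`, `PP` is the bounded function `J` plus elementary terms whose transforms are known;
below `1` it vanishes. -/
lemma mellinConvergent_PP {s : ℂ} (hs : s.re < -2) : MellinConvergent (fun t => (PP t : ℂ)) s := by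
  obtain ⟨h2, h1, h0⟩ := re_add_two hs
  have hJ : HasMellin JHi s (mellin JHi s) :=
    ⟨mellinConvergent_of_isBigO_rpow locallyIntegrableOn_JHi JHi_isBigO_top h0
      (isBigO_zero_bot JHi_of_lt (s.re - 1)) (by linarith), rfl⟩
  refine (((hJ.add' (hasMellin_log_indHi h2).cpow_smul).add'
    ((hasMellin_indHi h2).cpow_smul.const_smul' cJ)).add' (hasMellin_indHi h1).cpow_smul).congr'
    (g := fun t => (PP t : ℂ)) (fun t ht => ?_) |>.1
  unfold JHi indHi indicator
  simp only [Set.mem_Ioi]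
  split_ifs with h
  · unfold J; simp; ring
  · simp [PP_eq_zero_of_le (not_lt.1 h)]

/-- `PP` is a sum of dilates of `(t - 1)₊²`. The `n`-th dilate multiplies the transform by `n^(s +
1)`, and for real part below `-2` these factors sum absolutely to `ζ(-1 - s)`. -/
lemma hasMellin_PP {s : ℂ} (hs : s.re < -2) :
    HasMellin (fun t => (PP t : ℂ)) s (-2 * riemannZeta (-1 - s) / (s * (s + 1) * (s + 2))) := by
  set F : ℕ → ℝ → ℂ := fun m t => (t : ℂ) ^ (s - 1) •
      ((max (t - ((m : ℝ) + 1)) 0 ^ 2 / ((m : ℝ) + 1) : ℝ) : ℂ) with hF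
  have hsummable : Summable fun m : ℕ => ((m : ℝ) + 1) ^ (s.re + 1) := by
    have := (summable_nat_add_iff 1).2 (Real.summable_nat_rpow.2 (by linarith : s.re + 1 < -1))
    simpa using this
  have hsum : Summable fun m => ∫ t in Ioi (0 : ℝ), ‖F m t‖ := by
    simp only [hF, (hasMellin_PP_term hs _).2.2]
    exact hsummable.mul_right _
  have hpt : ∀ t ∈ Ioi (0 : ℝ), ∑' m, F m t = (t : ℂ) ^ (s - 1) • (PP t : ℂ) := by
    intro t ht
    have := (Complex.hasSum_ofReal.2 (hasSum_PP ht)).const_smul ((t : ℂ) ^ (s - 1))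
    exact this.tsum_eq
  have h1 : HasSum (fun m => ∫ t in Ioi (0 : ℝ), F m t) (∫ t in Ioi (0 : ℝ), ∑' m, F m t) :=
    hasSum_integral_of_summable_integral_norm (fun m => (hasMellin_PP_term hs m).1) hsum
  refine ⟨mellinConvergent_PP hs, ?_⟩
  · unfold mellin
    rw [← setIntegral_congr_fun measurableSet_Ioi hpt, ← h1.tsum_eq]
    simp only [hF, (hasMellin_PP_term hs _).2.1]
    rw [tsum_mul_right, (hasMellin_sqHi hs).2, zeta_eq_tsum_one_div_nat_add_one_cpow (by simp; linarith)]
    have : ∀ m : ℕ, 1 / ((m : ℂ) + 1) ^ (-1 - s) = ((m : ℂ) + 1) ^ (s + 1) := by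
      intro m
      rw [one_div, ← Complex.cpow_neg]; congr 1; ring
    simp only [this]
    ring

/-- The Mellin transform of `JHi`. -/
def mellinJHi (s : ℂ) : ℂ := -2 * riemannZeta (-1 - s) / (s * (s + 1) * (s + 2))
  - 1 / (s + 2) ^ 2 + cJ / (s + 2) + 1 / (s + 1)

lemma hasMellin_JHi {s : ℂ} (hs : s.re < -2) : HasMellin JHi s (mellinJHi s) := by
  obtain ⟨h2, h1, h0⟩ := re_add_two hs
  have := (((hasMellin_PP hs).sub' (hasMellin_log_indHi h2).cpow_smul).sub'
    ((hasMellin_indHi h2).cpow_smul.const_smul' cJ)).sub' (hasMellin_indHi h1).cpow_smul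
  have e : -2 * riemannZeta (-1 - s) / (s * (s + 1) * (s + 2)) - 1 / (s + 2) ^ 2
      - (cJ : ℂ) • (-1 / (s + 2)) - -1 / (s + 1) = mellinJHi s := by
    unfold mellinJHi; rw [smul_eq_mul]; ring
  rw [e] at this
  refine this.congr' fun t ht => ?_
  unfold JHi indHi indicator
  simp only [Set.mem_Ioi]
  split_ifs with h
  · unfold J; simp
  · simp [PP_eq_zero_of_le (not_lt.1 h)]

lemma differentiableAt_mellin_JHi {s : ℂ} (hs : s.re < 0) : DifferentiableAt ℂ (mellin JHi) s :=
  mellin_differentiableAt_of_isBigO_rpow locallyIntegrableOn_JHi JHi_isBigO_top hs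
    (isBigO_zero_bot JHi_of_lt (s.re - 1)) (by linarith)

lemma differentiableAt_mellinJHi {s : ℂ} (h0 : s ≠ 0) (h1 : s + 1 ≠ 0) (h2 : s + 2 ≠ 0) :
    DifferentiableAt ℂ mellinJHi s := by
  have hz : DifferentiableAt ℂ (fun s : ℂ => riemannZeta (-1 - s)) s := by
    refine DifferentiableAt.comp s (differentiableAt_riemannZeta ?_) (by fun_prop)
    intro h; apply h2; linear_combination -h
  have hd : s * (s + 1) * (s + 2) ≠ 0 := by simp [h0, h1, h2]
  have d1 : DifferentiableAt ℂ (fun s : ℂ => -2 * riemannZeta (-1 - s) / (s * (s + 1) * (s + 2))) s :=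
    (hz.const_mul _).div (by fun_prop) hd
  have d2 : DifferentiableAt ℂ (fun s : ℂ => 1 / (s + 2) ^ 2) s :=
    (differentiableAt_const _).div (by fun_prop) (pow_ne_zero 2 h2)
  have d3 : DifferentiableAt ℂ (fun s : ℂ => (cJ : ℂ) / (s + 2)) s :=
    (differentiableAt_const _).div (by fun_prop) h2
  have d4 : DifferentiableAt ℂ (fun s : ℂ => 1 / (s + 1)) s :=
    (differentiableAt_const _).div (by fun_prop) h1
  exact ((d1.sub d2).add d3).add d4

/-- `JHi` is bounded and vanishes below `1`, so its transform is holomorphic for negative real part.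
The closed formula, known for real part below `-2`, extends by the identity theorem. The open
quadrant is connected and avoids the points `-1` and `-2`, where the formula is singular as written.
-/
lemma mellin_JHi_eq_of_im_pos {s : ℂ} (hs : s.re < 0) (hi : 0 < s.im) :
    mellin JHi s = mellinJHi s := by
  set U : Set ℂ := {z | z.re < 0} ∩ {z | 0 < z.im} with hU
  have hUo : IsOpen U := (isOpen_lt Complex.continuous_re continuous_const).inter
    (isOpen_lt continuous_const Complex.continuous_im)
  have hUc : IsPreconnected U :=
    ((convex_halfSpace_re_lt 0).inter (convex_halfSpace_im_gt 0)).isPreconnected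
  have hA : AnalyticOnNhd ℂ (mellin JHi) U := DifferentiableOn.analyticOnNhd
    (fun z hz => (differentiableAt_mellin_JHi hz.1).differentiableWithinAt) hUo
  have hB : AnalyticOnNhd ℂ mellinJHi U := by
    refine DifferentiableOn.analyticOnNhd (fun z hz => ?_) hUo
    have him : 0 < z.im := hz.2
    refine (differentiableAt_mellinJHi ?_ ?_ ?_).differentiableWithinAt
    all_goals
      intro h
      have := congrArg Complex.im h
      simp at this
      linarith
  have hz0 : (⟨-3, 1⟩ : ℂ) ∈ U := by constructor <;> norm_num
  refine hA.eqOn_of_preconnected_of_eventuallyEq hB hUc hz0 ?_ ⟨hs, hi⟩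
  have : {z : ℂ | z.re < -2} ∈ nhds (⟨-3, 1⟩ : ℂ) :=
    (isOpen_lt Complex.continuous_re continuous_const).mem_nhds (by norm_num)
  filter_upwards [this] with z hz
  exact (hasMellin_JHi hz).2

/-- Limit of the previous identity from the upper half plane, both sides being continuous at `r`. -/
lemma mellin_JHi_eq {r : ℝ} (h0 : r < 0) (h1 : r ≠ -1) (h2 : r ≠ -2) :
    mellin JHi r = mellinJHi r := by
  have hlim : Tendsto (fun n : ℕ => (r : ℂ) + ((1 / ((n : ℝ) + 1) : ℝ) : ℂ) * Complex.I) atTop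
      (nhds (r : ℂ)) := by
    have h := (Complex.continuous_ofReal.tendsto 0).comp
      (tendsto_one_div_add_atTop_nhds_zero_nat (𝕜 := ℝ))
    have := (h.mul_const Complex.I).const_add (r : ℂ)
    simpa using this
  have hA := (differentiableAt_mellin_JHi (s := r) (by simpa)).continuousAt.tendsto.comp hlim
  have hB := (differentiableAt_mellinJHi (s := r) (by exact_mod_cast h0.ne)
    (by intro h; apply h1; have : r + 1 = 0 := by exact_mod_cast h
        linarith) (by intro h; apply h2; have : r + 2 = 0 := by exact_mod_cast h
                      linarith)).continuousAt.tendsto.comp hlim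
  refine tendsto_nhds_unique (hA.congr fun n => ?_) hB
  apply mellin_JHi_eq_of_im_pos
  · simpa using h0
  · have : (0 : ℝ) < (n : ℝ) + 1 := by positivity
    simp only [Complex.add_im, Complex.ofReal_im, Complex.mul_im, Complex.ofReal_re, Complex.I_im,
      Complex.I_re]
    simp
    exact_mod_cast this

lemma hasMellin_JLo {s : ℂ} (hs : -1 < s.re) :
    HasMellin (indicator (Ioc 0 1) fun t => (J t : ℂ)) s
      (1 / (s + 2) ^ 2 - cJ / (s + 2) - 1 / (s + 1)) := by
  have h2 : 0 < (s + 2).re := by simp; linarith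
  have h1 : 0 < (s + 1).re := by simp; linarith
  have := (((hasMellin_log_indLo h2).cpow_smul.const_smul' (-1)).sub'
    ((hasMellin_one_Ioc h2).cpow_smul.const_smul' cJ)).sub' (hasMellin_one_Ioc h1).cpow_smul
  have e : (-1 : ℂ) • (-1 / (s + 2) ^ 2) - (cJ : ℂ) • (1 / (s + 2)) - 1 / (s + 1)
      = 1 / (s + 2) ^ 2 - cJ / (s + 2) - 1 / (s + 1) := by
    simp only [smul_eq_mul]; ring
  rw [e] at this
  refine this.congr' fun t ht => ?_
  unfold indLo indicator
  split_ifs with h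
  · simp [J, PP_eq_zero_of_le h.2]
  · simp

/-- On `(0, 1]` the function `J` is elementary, and its transform, valid for real part above `-1`,
cancels the explicit terms of `mellinJHi`. What remains is `-2 ζ(-1 - s) / (s (s + 1) (s + 2))`, and
the denominator at `s = -1/3` is `-10/27`. -/
lemma mellin_J_eq : mellin (fun t => (J t : ℂ)) ((-1 / 3 : ℝ) : ℂ)
    = 27 / 5 * riemannZeta (-2 / 3) := by
  have hlo := hasMellin_JLo (s := ((-1 / 3 : ℝ) : ℂ)) (by rw [Complex.ofReal_re]; norm_num)
  have hhi : HasMellin JHi ((-1 / 3 : ℝ) : ℂ) (mellinJHi ((-1 / 3 : ℝ) : ℂ)) :=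
    ⟨mellinConvergent_of_isBigO_rpow locallyIntegrableOn_JHi JHi_isBigO_top
      (by rw [Complex.ofReal_re]; norm_num) (isBigO_zero_bot JHi_of_lt (-2))
      (by rw [Complex.ofReal_re]; norm_num),
      mellin_JHi_eq (by norm_num) (by norm_num) (by norm_num)⟩
  have := (hlo.add' hhi).congr' (g := fun t => (J t : ℂ)) fun t ht => by
    unfold JHi indicator
    simp only [Set.mem_Ioc, Set.mem_Ioi]
    rcases le_or_gt t 1 with h | h
    · simp [h, ht, not_lt.2 h]
    · simp [h, not_le.2 h]
  rw [this.2]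
  unfold mellinJHi
  push_cast
  rw [show (-1 : ℂ) - -1 / 3 = -2 / 3 by norm_num]
  ring_nf

lemma intJ_eq : (intJ : ℂ) = 9 / 5 * riemannZeta (-2 / 3) := by
  have h1 : intJ = ∫ y in Ioi (0 : ℝ), 1 / 3 * (y ^ (-4 / 3 : ℝ) * J y) := by
    -- Substitution `y = v⁻³`; its Jacobian supplies the factor `1/3`.
    rw [← integral_comp_rpow_Ioi _ (by norm_num : (-3 : ℝ) ≠ 0)]
    unfold intJ
    refine setIntegral_congr_fun measurableSet_Ioi fun v hv => ?_
    have hv0 : (0 : ℝ) < v := hv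
    have e1 : v ^ (-3 : ℝ) = 1 / v ^ 3 := by
      rw [Real.rpow_neg hv0.le, one_div, ← Real.rpow_natCast v 3]; norm_num
    have e2 : (v ^ (-3 : ℝ)) ^ (-4 / 3 : ℝ) = v ^ (4 : ℝ) := by
      rw [← Real.rpow_mul hv0.le]; norm_num
    have e3 : v ^ (-3 - 1 : ℝ) * v ^ (4 : ℝ) = 1 := by
      rw [← Real.rpow_add hv0]; norm_num
    simp only [smul_eq_mul]
    rw [e2, e1]
    have : |(-3 : ℝ)| = 3 := by norm_num
    rw [this]
    linear_combination (-J (1 / v ^ 3)) * e3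
  rw [h1, integral_const_mul]
  have h2 : ((∫ y in Ioi (0 : ℝ), y ^ (-4 / 3 : ℝ) * J y : ℝ) : ℂ)
      = mellin (fun t => (J t : ℂ)) ((-1 / 3 : ℝ) : ℂ) := by
    unfold mellin
    rw [← integral_complex_ofReal]
    refine setIntegral_congr_fun measurableSet_Ioi fun v hv => ?_
    have hv0 : (0 : ℝ) < v := hv
    simp only [smul_eq_mul]
    rw [Complex.ofReal_mul, Complex.ofReal_cpow hv0.le]
    congr 2
    push_cast; norm_num
  push_cast
  rw [show ((∫ y in Ioi (0 : ℝ), y ^ (-4 / 3 : ℝ) * J y : ℝ) : ℂ) = _ from h2, mellin_J_eq]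
  ring

end Mellin

/-! ### Asymptotics of the main terms -/

lemma sum_Icc_sum_divisors {α : Type*} [AddCommMonoid α] (N : ℕ) (f : ℕ → ℕ → α) :
    ∑ h ∈ Icc 1 N, ∑ d ∈ h.divisors, f d (h / d) = ∑ d ∈ Icc 1 N, ∑ n ∈ Icc 1 (N / d), f d n := by
  rw [Finset.sum_sigma', Finset.sum_sigma']
  refine Finset.sum_bij' (fun p _ => ⟨p.2, p.1 / p.2⟩) (fun p _ => ⟨p.1 * p.2, p.1⟩) ?_ ?_ ?_ ?_ ?_
  · rintro ⟨h, d⟩ hp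
    simp only [mem_sigma, mem_Icc, Nat.mem_divisors] at hp ⊢
    obtain ⟨⟨h1, h2⟩, hd, h0⟩ := hp
    have hd0 : 0 < d := Nat.pos_of_dvd_of_pos hd (by omega)
    exact ⟨⟨hd0, (Nat.le_of_dvd (by omega) hd).trans h2⟩,
      Nat.div_pos (Nat.le_of_dvd (by omega) hd) hd0, Nat.div_le_div_right h2⟩
  · rintro ⟨d, n⟩ hp
    simp only [mem_sigma, mem_Icc, Nat.mem_divisors] at hp ⊢
    obtain ⟨⟨h1, h2⟩, h3, h4⟩ := hp
    have := (Nat.le_div_iff_mul_le (by omega)).1 h4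
    have hp : 0 < d * n := Nat.mul_pos (by omega) (by omega)
    exact ⟨⟨hp, by rw [mul_comm]; exact this⟩, Dvd.intro _ rfl, by omega⟩
  · rintro ⟨h, d⟩ hp
    simp only [mem_sigma, mem_Icc, Nat.mem_divisors] at hp
    simp only
    rw [Nat.mul_div_cancel' hp.2.1]
  · rintro ⟨d, n⟩ hp
    simp only [mem_sigma, mem_Icc] at hp
    simp only
    rw [Nat.mul_div_cancel_left _ (by omega)]
  · rintro ⟨h, d⟩ hp
    rfl

lemma sum_Gsum_div_mul (N : ℕ) (φ : ℕ → ℝ) :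
    ∑ h ∈ Icc 1 N, Gsum h / h * φ h
      = ∑ d ∈ Icc 1 N, A1Term d / d * ∑ n ∈ Icc 1 (N / d), φ (d * n) / n := by
  have h1 := sum_Icc_sum_divisors N (fun d n => A1Term d / d * (φ (d * n) / n))
  simp only [← Finset.mul_sum] at h1
  rw [← h1]
  refine Finset.sum_congr rfl fun h hh => ?_
  rw [mem_Icc] at hh
  unfold Gsum
  rw [Finset.sum_div, Finset.sum_mul]
  refine Finset.sum_congr rfl fun d hd => ?_
  have hd' := Nat.dvd_of_mem_divisors hd
  have hd0 : (d : ℝ) ≠ 0 := by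
    have := Nat.pos_of_mem_divisors hd
    exact_mod_cast this.ne'
  have hh0 : (h : ℝ) ≠ 0 := by exact_mod_cast (by omega : h ≠ 0)
  rw [Nat.mul_div_cancel' hd', Nat.cast_div hd' hd0]
  field_simp

/-- For `t < 1` the harmonic sum is empty, but `1 / t` dominates `|log t|`. Divisors `d > M` thus
need no separate treatment in `exists_abs_Phi_sub_le`. -/
lemma abs_harm_floor_sub_le {t : ℝ} (ht : 0 < t) :
    |harm ⌊t⌋₊ - Real.log t - eulerMascheroniConstant| ≤ 5 / t := by
  have hγ1 := Real.one_half_lt_eulerMascheroniConstant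
  have hγ2 := Real.eulerMascheroniConstant_lt_two_thirds
  rcases le_or_gt 1 t with h | h
  · have hM1 : 1 ≤ ⌊t⌋₊ := (Nat.one_le_floor_iff t).2 h
    have hh := abs_harm_sub_le _ hM1
    have hfl := Nat.floor_le ht.le
    have hfl2 := Nat.lt_floor_add_one t
    set M := ⌊t⌋₊
    have hMr : (1 : ℝ) ≤ M := by exact_mod_cast hM1
    have hM0 : (0 : ℝ) < M := by linarith
    have h1 : Real.log t ≤ Real.log M + 1 / M := by
      have e : Real.log t = Real.log M + Real.log (t / M) := by
        rw [Real.log_div ht.ne' hM0.ne']; ring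
      have := Real.log_le_sub_one_of_pos (div_pos ht hM0)
      have h2 : t / M - 1 ≤ 1 / M := by
        rw [div_sub_one hM0.ne']; gcongr; linarith
      linarith
    have h2 : Real.log M ≤ Real.log t := Real.log_le_log hM0 hfl
    have h3 : 1 / (M : ℝ) ^ 2 ≤ 1 / M := by
      apply one_div_le_one_div_of_le hM0; nlinarith
    have h4 : (5 / 2) * (1 / (M : ℝ)) ≤ 5 / t := by
      rw [mul_one_div, div_div, div_le_div_iff₀ (by positivity) ht]; nlinarith
    have h5 : 1 / (2 * (M : ℝ)) = 1 / 2 * (1 / M) := by field_simp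
    have h6 : 0 < 1 / (M : ℝ) := by positivity
    rw [h5] at hh
    rw [abs_le] at hh ⊢
    constructor <;> linarith
  · rw [Nat.floor_eq_zero.2 h]
    have h1 : Real.log t < 0 := Real.log_neg ht h
    have h2 : -Real.log t ≤ 1 / t := by
      have := Real.log_le_sub_one_of_pos (inv_pos.2 ht)
      rw [Real.log_inv] at this
      rw [one_div]; linarith
    have h3 : 1 ≤ 1 / t := (one_le_div ht).2 h.le
    have h4 : 5 / t = 5 * (1 / t) := by ring
    simp only [harm, Icc_eq_empty_of_lt (zero_lt_one), sum_empty]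
    rw [h4, abs_le]; constructor <;> linarith

/-- The main term in the variance, as a function of the number of moduli. -/
def Phi (x : ℝ) (M : ℕ) : ℝ :=
  ∑ h ∈ Icc 1 ⌊x⌋₊, Gsum h / h * max (x - M * h) 0 ^ 2 + x ^ 2 * ∑ q ∈ Icc 1 M, Gsum q / q

/-- The part of `Phi x M` that does not depend on `M`. -/
def Phi0 (x : ℝ) : ℝ :=
  ∑' d : ℕ, A1Term d / d * (x ^ 2 * (Real.log x - 2 * Real.log d + cJ + eulerMascheroniConstant))

/-- With `h = d n`, the inner sum over `n` is `PP` at `x / (M d)` after scaling. It is empty for `d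
> x`, so the sum over `d` may be extended to a series. -/
lemma sum_Gsum_max_eq {x : ℝ} (hx : 0 < x) {M : ℕ} (hM : 1 ≤ M) :
    HasSum (fun d : ℕ => A1Term d / d * ((M * d) ^ 2 * PP (x / (M * d))))
      (∑ h ∈ Icc 1 ⌊x⌋₊, Gsum h / h * max (x - M * h) 0 ^ 2) := by
  have hMr : (1 : ℝ) ≤ M := by exact_mod_cast hM
  rw [sum_Gsum_div_mul]
  have h1 : ∀ d ∈ Icc 1 ⌊x⌋₊, A1Term d / d * ∑ n ∈ Icc 1 (⌊x⌋₊ / d),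
      max (x - M * ((d * n : ℕ) : ℝ)) 0 ^ 2 / n = A1Term d / d * ((M * d) ^ 2 * PP (x / (M * d))) := by
    intro d hd
    rw [mem_Icc] at hd
    have hd1 : (1 : ℝ) ≤ d := by exact_mod_cast hd.1
    have hMd : (0 : ℝ) < M * d := by positivity
    congr 1
    rw [PP_eq_max (⌊x⌋₊ / d) (by positivity), Finset.mul_sum]
    · refine Finset.sum_congr rfl fun n _ => ?_
      have : max (x - M * ((d * n : ℕ) : ℝ)) 0 = M * d * max (x / (M * d) - n) 0 := by
        rw [mul_max_of_nonneg _ _ hMd.le, mul_zero]; congr 1; push_cast; field_simp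
      rw [this]; ring
    · have h2 := Nat.lt_floor_add_one (x / d)
      rw [Nat.floor_div_natCast] at h2
      refine lt_of_le_of_lt ?_ h2
      apply div_le_div_of_nonneg_left hx.le (by positivity)
      nlinarith
  rw [Finset.sum_congr rfl h1]
  apply hasSum_sum_of_ne_finset_zero
  intro d hd
  rcases Nat.eq_zero_or_pos d with rfl | hd0
  · simp
  · have : x < d := (Nat.floor_lt hx.le).1 (by rw [mem_Icc] at hd; omega)
    have hd1 : (1 : ℝ) ≤ d := by exact_mod_cast hd0
    rw [PP_eq_zero]
    · simp
    · rw [div_lt_one (by positivity)]; nlinarith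

lemma sum_Gsum_div_eq (M : ℕ) :
    HasSum (fun d : ℕ => A1Term d / d * harm (M / d)) (∑ q ∈ Icc 1 M, Gsum q / q) := by
  have h1 := sum_Gsum_div_mul M (fun _ => 1)
  simp only [mul_one] at h1
  rw [h1]
  apply hasSum_sum_of_ne_finset_zero
  intro d hd
  rcases Nat.eq_zero_or_pos d with rfl | hd0
  · simp
  · have : M / d = 0 := Nat.div_eq_of_lt (by rw [mem_Icc] at hd; omega)
    rw [this]; simp [harm]

/-! ### The secondary term of order `Q^(5/3) x^(1/3)`. -/

lemma summable_A1Term_mul_rpow_J {y : ℝ} (hy : 0 < y) :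
    Summable fun z : ℕ × ℕ => (((z.1 + 1 : ℕ) : ℝ) ^ 3)⁻¹ * kA z.2
      * (((z.1 + 1) ^ 3 * z.2 : ℕ) * J (1 / (((z.1 + 1) ^ 3 * z.2 : ℕ) * y))) := by
  have h1 : Summable fun m : ℕ => ((m : ℝ) + 1) ^ (-(3 * (2 / 3)) : ℝ) := by
    have := (summable_nat_add_iff 1).2 (Real.summable_nat_rpow.2 (by norm_num : -(3 * (2 / 3) : ℝ) < -1))
    simpa using this
  have h2 := summable_abs_kA_mul_rpow (σ := 1 / 3) (by norm_num)
  have h3 := (h1.mul_of_nonneg h2 (fun m => by positivity) (fun m => by positivity)).mul_left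
    (18 * y ^ (-(2 / 3) : ℝ))
  refine Summable.of_norm_bounded h3 fun z => ?_
  rcases Nat.eq_zero_or_pos z.2 with h0 | h0
  · rw [h0]; simp
  · have hd : (0 : ℝ) < z.2 := by exact_mod_cast h0
    have hm : (0 : ℝ) < (z.1 : ℝ) + 1 := by positivity
    -- With `θ = 2/3` both `∑ m^(-3θ)` and `∑ |kA d| d^(1 - θ)` converge.
    have hJ := abs_J_cube_le (u := (z.1 : ℝ) + 1) (Y := z.2 * y) hm (by positivity)
      (θ := 2 / 3) (by norm_num) (by norm_num)
    rw [Real.mul_rpow hd.le hy.le] at hJ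
    have e : (z.2 : ℝ) * (z.2 : ℝ) ^ (-(2 / 3) : ℝ) = (z.2 : ℝ) ^ (1 / 3 : ℝ) := by
      rw [← Real.rpow_one_add' hd.le (by norm_num)]; norm_num
    push_cast
    rw [mul_assoc (((z.1 : ℝ) + 1) ^ 3) (z.2 : ℝ) y, Real.norm_eq_abs]
    have e2 : (((z.1 : ℝ) + 1) ^ 3)⁻¹ * kA z.2 * (((z.1 : ℝ) + 1) ^ 3 * z.2
        * J (1 / (((z.1 : ℝ) + 1) ^ 3 * (z.2 * y))))
        = kA z.2 * z.2 * J (1 / (((z.1 : ℝ) + 1) ^ 3 * (z.2 * y))) := by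
      field_simp
    rw [e2, abs_mul, abs_mul, abs_of_pos hd]
    refine (mul_le_mul_of_nonneg_left hJ (by positivity)).trans (le_of_eq ?_)
    rw [← e]; ring

/-- Along `A1Term = bA * kA` the index is `m³ n`, and the weight `m³ n` cancels the `m⁻³` of `bA`.
The sum over `m` is then exactly the one compared with an integral, at `Y = n y`. The errors carry
`|kA n| n^(1 - θ)`, summable because `θ > 0`. -/
lemma exists_abs_tsum_A1Term_J_sub_le {θ : ℝ} (h0 : 0 < θ) (h1 : θ < 1 / 3) :
    ∃ C : ℝ, 0 ≤ C ∧ ∀ y : ℝ, 0 < y →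
      Summable (fun d : ℕ => A1Term d * (d * J (1 / (d * y)))) ∧
      |∑' d : ℕ, A1Term d * (d * J (1 / (d * y)))
        - intJ * (∑' n : ℕ, kA n * (n : ℝ) ^ (2 / 3 : ℝ)) * y ^ (-(1 / 3) : ℝ)| ≤ C * y ^ (-θ) := by
  obtain ⟨C, hC0, hC⟩ := exists_abs_sum_J_cube_sub_le h0 h1
  have hk1 := summable_abs_kA_mul_rpow (σ := 1 - θ) (by linarith)
  have hk2 := summable_abs_kA_mul_rpow (σ := 2 / 3) (by norm_num)
  have hk2' : Summable fun n : ℕ => kA n * (n : ℝ) ^ (2 / 3 : ℝ) := by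
    refine Summable.of_norm_bounded hk2 fun n => ?_
    rw [Real.norm_eq_abs, abs_mul, abs_of_nonneg (by positivity : (0 : ℝ) ≤ (n : ℝ) ^ (2 / 3 : ℝ))]
  refine ⟨C * ∑' n : ℕ, |kA n| * (n : ℝ) ^ (1 - θ),
    mul_nonneg hC0 (tsum_nonneg fun n => by positivity), fun y hy => ?_⟩
  have hs := summable_A1Term_mul_rpow_J hy
  have hh := hasSum_A1Term_mul (fun n : ℕ => (n : ℝ) * J (1 / (n * y))) hs
  refine ⟨hh.summable, ?_⟩
  set F : ℕ × ℕ → ℝ := fun z => (((z.1 + 1 : ℕ) : ℝ) ^ 3)⁻¹ * kA z.2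
      * (((z.1 + 1) ^ 3 * z.2 : ℕ) * J (1 / (((z.1 + 1) ^ 3 * z.2 : ℕ) * y))) with hF
  have hs' : Summable fun z : ℕ × ℕ => F z.swap := (Equiv.prodComm ℕ ℕ).summable_iff.2 hs
  have hin : ∀ d : ℕ, ∑' m : ℕ, F (m, d)
      = kA d * d * ∑' m : ℕ, J (1 / (((m : ℝ) + 1) ^ 3 * (d * y))) := by
    intro d
    rw [← tsum_mul_left]
    refine tsum_congr fun m => ?_
    simp only [hF]
    push_cast
    rw [mul_assoc (((m : ℝ) + 1) ^ 3) (d : ℝ) y]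
    field_simp
  have e1 : ∑' z : ℕ × ℕ, F z
      = ∑' d : ℕ, kA d * d * ∑' m : ℕ, J (1 / (((m : ℝ) + 1) ^ 3 * (d * y))) := by
    calc ∑' z : ℕ × ℕ, F z = ∑' z : ℕ × ℕ, F z.swap := ((Equiv.prodComm ℕ ℕ).tsum_eq F).symm
      _ = ∑' d : ℕ, ∑' m : ℕ, F (m, d) := hs'.tsum_prod
      _ = _ := tsum_congr hin
  have hsd : Summable fun d : ℕ => kA d * d * ∑' m : ℕ, J (1 / (((m : ℝ) + 1) ^ 3 * (d * y))) := by
    exact hs'.prod.congr hin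
  rw [hh.tsum_eq, e1]
  have hsm : Summable fun d : ℕ => intJ * (kA d * (d : ℝ) ^ (2 / 3 : ℝ)) * y ^ (-(1 / 3) : ℝ) :=
    (hk2'.mul_left _).mul_right _
  rw [← tsum_mul_left, ← tsum_mul_right, ← hsd.tsum_sub hsm, mul_assoc, ← tsum_mul_right,
    ← tsum_mul_left, ← Real.norm_eq_abs]
  refine tsum_of_norm_bounded ((hk1.mul_right _).mul_left _).hasSum fun d => ?_
  rcases Nat.eq_zero_or_pos d with rfl | hd0
  · simp
  have hd : (0 : ℝ) < d := by exact_mod_cast hd0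
  have := hC (d * y) (by positivity)
  rw [Real.mul_rpow hd.le hy.le, Real.mul_rpow hd.le hy.le] at this
  have e3 : (d : ℝ) * (d : ℝ) ^ (-(1 / 3) : ℝ) = (d : ℝ) ^ (2 / 3 : ℝ) := by
    rw [← Real.rpow_one_add' hd.le (by norm_num)]; norm_num
  have e4 : (d : ℝ) * (d : ℝ) ^ (-θ) = (d : ℝ) ^ (1 - θ) := by
    rw [← Real.rpow_one_add' hd.le (by linarith)]; ring_nf
  rw [← e3, ← e4, Real.norm_eq_abs]
  have e5 : kA d * d * ∑' m : ℕ, J (1 / (((m : ℝ) + 1) ^ 3 * (d * y)))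
      - intJ * (kA d * (d * (d : ℝ) ^ (-(1 / 3) : ℝ))) * y ^ (-(1 / 3) : ℝ)
      = kA d * d * (∑' m : ℕ, J (1 / (((m : ℝ) + 1) ^ 3 * (d * y)))
        - (d : ℝ) ^ (-(1 / 3) : ℝ) * y ^ (-(1 / 3) : ℝ) * intJ) := by ring
  rw [e5, abs_mul, abs_mul, abs_of_pos hd]
  refine (mul_le_mul_of_nonneg_left this (by positivity)).trans (le_of_eq ?_)
  ring

/-- For each `d` insert the expansion of `PP` at `t = x / (M d)`. The part `t² log t` contains `-log
M`, which cancels against `harm (M / d)` from the second sum in `Phi` up to `O(x² / M)`. The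
logarithmic and quadratic remnants go into `Phi0`, the term `t` gives the linear main term, and `J`
gives the secondary term. -/
theorem exists_abs_Phi_sub_le {δ : ℝ} (h0 : 0 < δ) (h1 : δ < 1 / 3) :
    ∃ C : ℝ, 0 ≤ C ∧ ∀ (x : ℝ) (M : ℕ), 0 < x → 1 ≤ M →
      |Phi x M - (Phi0 x + (∑' d, A1Term d) * M * x
        + intJ * (∑' n : ℕ, kA n * (n : ℝ) ^ (2 / 3 : ℝ)) * ((M : ℝ) ^ (5 / 3 : ℝ) * x ^ (1 / 3 : ℝ)))|
      ≤ C * ((M : ℝ) ^ (2 - δ) * x ^ δ + x ^ 2 / M) := by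
  obtain ⟨C, hC0, hC⟩ := exists_abs_tsum_A1Term_J_sub_le h0 h1
  set g1 := ∑' d, A1Term d with hg1
  have hg0 : 0 ≤ g1 := tsum_nonneg A1Term_nonneg
  refine ⟨C + 5 * g1, by positivity, fun x M hx hM => ?_⟩
  have hMr : (1 : ℝ) ≤ M := by exact_mod_cast hM
  have hM0 : (0 : ℝ) < M := by linarith
  obtain ⟨hs3, hb3⟩ := hC (M / x) (by positivity)
  have hA := sum_Gsum_max_eq hx hM
  have hB := (sum_Gsum_div_eq M).mul_left (x ^ 2)
  have hS0 : Summable fun d : ℕ => A1Term d / d *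
      (x ^ 2 * (Real.log x - 2 * Real.log d + cJ + eulerMascheroniConstant)) := by
    refine Summable.of_norm_bounded (summable_A1Term.mul_left
      (x ^ 2 * (|Real.log x| + 2 + |cJ| + |eulerMascheroniConstant|))) fun d => ?_
    rcases Nat.eq_zero_or_pos d with rfl | hd0
    · simp [A1Term_zero]
    have hd : (1 : ℝ) ≤ d := by exact_mod_cast hd0
    have hd' : (0 : ℝ) < d := by linarith
    have hl1 := Real.log_nonneg hd
    have hl2 := Real.log_le_sub_one_of_pos hd'
    rw [Real.norm_eq_abs, abs_mul, abs_mul, abs_of_nonneg (div_nonneg (A1Term_nonneg d) hd'.le),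
      abs_of_nonneg (sq_nonneg x)]
    have hb : |Real.log x - 2 * Real.log d + cJ + eulerMascheroniConstant|
        ≤ (|Real.log x| + 2 + |cJ| + |eulerMascheroniConstant|) * d := by
      have t1 := abs_add_le (Real.log x - 2 * Real.log d + cJ) eulerMascheroniConstant
      have t2 := abs_add_le (Real.log x - 2 * Real.log d) cJ
      have t3 := abs_sub (Real.log x) (2 * Real.log d)
      rw [abs_of_nonneg (by positivity : 0 ≤ 2 * Real.log d)] at t3
      nlinarith [abs_nonneg (Real.log x), abs_nonneg cJ, abs_nonneg eulerMascheroniConstant]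
    have hp : 0 ≤ A1Term d / d * x ^ 2 := by have := A1Term_nonneg d; positivity
    calc _ = A1Term d / d * x ^ 2 * |Real.log x - 2 * Real.log d + cJ + eulerMascheroniConstant| := by
          ring
      _ ≤ A1Term d / d * x ^ 2 * ((|Real.log x| + 2 + |cJ| + |eulerMascheroniConstant|) * d) :=
          mul_le_mul_of_nonneg_left hb hp
      _ = _ := by field_simp
  have hS2 : HasSum (fun d : ℕ => A1Term d * (M * x)) (g1 * (M * x)) :=
    summable_A1Term.hasSum.mul_right _
  have hS3 := hs3.hasSum.mul_left ((M : ℝ) ^ 2)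
  have hE := (hA.add hB).sub ((hS0.hasSum.add hS2).add hS3)
  have hbd : ∀ d : ℕ, ‖A1Term d / d * ((M * d) ^ 2 * PP (x / (M * d)))
      + x ^ 2 * (A1Term d / d * harm (M / d))
      - (A1Term d / d * (x ^ 2 * (Real.log x - 2 * Real.log d + cJ + eulerMascheroniConstant))
        + A1Term d * (M * x) + (M : ℝ) ^ 2 * (A1Term d * (d * J (1 / (d * (M / x))))))‖
      ≤ 5 * (x ^ 2 / M) * A1Term d := by
    intro d
    rcases Nat.eq_zero_or_pos d with rfl | hd0
    · simp [A1Term_zero]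
    have hd' : (0 : ℝ) < d := by exact_mod_cast hd0
    have ht : 1 / ((d : ℝ) * (M / x)) = x / (M * d) := by field_simp
    have hJ : PP (x / (M * d)) = J (x / (M * d)) + (x / (M * d)) ^ 2 * Real.log (x / (M * d))
        + cJ * (x / (M * d)) ^ 2 + x / (M * d) := by unfold J; ring
    have hl : Real.log (x / (M * d)) = Real.log x - Real.log M - Real.log d := by
      rw [Real.log_div hx.ne' (by positivity), Real.log_mul hM0.ne' hd'.ne']; ring
    have hr := abs_harm_floor_sub_le (t := (M : ℝ) / d) (by positivity)
    rw [Nat.floor_div_eq_div, Real.log_div hM0.ne' hd'.ne'] at hr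
    rw [ht, hJ, hl]
    have e : A1Term d / d * ((M * d) ^ 2 * (J (x / (M * d))
        + (x / (M * d)) ^ 2 * (Real.log x - Real.log M - Real.log d)
        + cJ * (x / (M * d)) ^ 2 + x / (M * d)))
      + x ^ 2 * (A1Term d / d * harm (M / d))
      - (A1Term d / d * (x ^ 2 * (Real.log x - 2 * Real.log d + cJ + eulerMascheroniConstant))
        + A1Term d * (M * x) + (M : ℝ) ^ 2 * (A1Term d * (d * J (x / (M * d)))))
      = A1Term d * x ^ 2 / d * (harm (M / d) - (Real.log M - Real.log d) - eulerMascheroniConstant) := by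
      field_simp; ring
    have hp : 0 ≤ A1Term d * x ^ 2 / d := by have := A1Term_nonneg d; positivity
    rw [e, Real.norm_eq_abs, abs_mul, abs_of_nonneg hp]
    refine (mul_le_mul_of_nonneg_left hr hp).trans (le_of_eq ?_)
    field_simp
  have hfin := tsum_of_norm_bounded (summable_A1Term.hasSum.mul_left (5 * (x ^ 2 / M))) hbd
  rw [hE.tsum_eq, Real.norm_eq_abs] at hfin
  have hy1 : (M : ℝ) ^ 2 * ((M : ℝ) / x) ^ (-(1 / 3) : ℝ) = (M : ℝ) ^ (5 / 3 : ℝ) * x ^ (1 / 3 : ℝ) := by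
    rw [Real.div_rpow hM0.le hx.le, Real.rpow_neg hx.le, div_inv_eq_mul, ← mul_assoc,
      ← Real.rpow_natCast, ← Real.rpow_add hM0]; norm_num
  have hy2 : (M : ℝ) ^ 2 * ((M : ℝ) / x) ^ (-δ) = (M : ℝ) ^ (2 - δ) * x ^ δ := by
    rw [Real.div_rpow hM0.le hx.le, Real.rpow_neg hx.le, div_inv_eq_mul, ← mul_assoc,
      ← Real.rpow_natCast, ← Real.rpow_add hM0]; norm_num [sub_eq_add_neg]
  have hb3' := mul_le_mul_of_nonneg_left hb3 (sq_nonneg (M : ℝ))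
  rw [← abs_of_nonneg (sq_nonneg (M : ℝ)), ← abs_mul, abs_of_nonneg (sq_nonneg (M : ℝ)), mul_sub] at hb3'
  have tri := abs_add_le (Phi x M - (Phi0 x + g1 * (M * x)
      + (M : ℝ) ^ 2 * ∑' d : ℕ, A1Term d * (d * J (1 / (d * (M / x))))))
    ((M : ℝ) ^ 2 * (∑' d : ℕ, A1Term d * (d * J (1 / (d * (M / x)))))
      - (M : ℝ) ^ 2 * (intJ * (∑' n : ℕ, kA n * (n : ℝ) ^ (2 / 3 : ℝ)) * ((M : ℝ) / x) ^ (-(1 / 3) : ℝ)))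
  have e6 : (M : ℝ) ^ 2 * (intJ * (∑' n : ℕ, kA n * (n : ℝ) ^ (2 / 3 : ℝ)) * ((M : ℝ) / x) ^ (-(1 / 3) : ℝ))
      = intJ * (∑' n : ℕ, kA n * (n : ℝ) ^ (2 / 3 : ℝ)) * ((M : ℝ) ^ (5 / 3 : ℝ) * x ^ (1 / 3 : ℝ)) := by
    rw [← hy1]; ring
  have e7 : (M : ℝ) ^ 2 * (C * ((M : ℝ) / x) ^ (-δ)) = C * ((M : ℝ) ^ (2 - δ) * x ^ δ) := by
    rw [← hy2]; ring
  rw [e6] at tri hb3'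
  rw [e7] at hb3'
  have e8 : Phi x M - (Phi0 x + g1 * M * x
        + intJ * (∑' n : ℕ, kA n * (n : ℝ) ^ (2 / 3 : ℝ)) * ((M : ℝ) ^ (5 / 3 : ℝ) * x ^ (1 / 3 : ℝ)))
      = Phi x M - (Phi0 x + g1 * (M * x)
        + (M : ℝ) ^ 2 * ∑' d : ℕ, A1Term d * (d * J (1 / (d * (M / x)))))
      + ((M : ℝ) ^ 2 * (∑' d : ℕ, A1Term d * (d * J (1 / (d * (M / x)))))
      - intJ * (∑' n : ℕ, kA n * (n : ℝ) ^ (2 / 3 : ℝ)) * ((M : ℝ) ^ (5 / 3 : ℝ) * x ^ (1 / 3 : ℝ))) := by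
    ring
  rw [e8]
  refine tri.trans ((add_le_add hfin hb3').trans ?_)
  have hp1 : 0 ≤ C * (x ^ 2 / M) := by positivity
  have hp2 : 0 ≤ 5 * g1 * ((M : ℝ) ^ (2 - δ) * x ^ δ) := by positivity
  nlinarith

/-! ### Switching to the complementary divisor -/

/-- `r₃(m)` restricted to a residue class. -/
def r3Mod (q a m : ℕ) : ℝ := if m ≡ a [MOD q] then (r3 m : ℝ) else 0

/-- Deviation of `r3Mod` from its average. -/
def devMod (q a m : ℕ) : ℝ := r3Mod q a m - kap q a

/-- `(u - Mh)₊ - (u - (M+K)h)₊`. -/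
def trap (M K h u : ℕ) : ℝ := ((u - M * h : ℕ) : ℝ) - ((u - (M + K) * h : ℕ) : ℝ)

lemma upsilon_natCast (j q a : ℕ) : upsilon j q a = ∑ m ∈ Icc 1 j, r3Mod q a m := by
  unfold upsilon r3Mod
  rw [Nat.floor_natCast, Finset.sum_filter]

lemma upsilon_floor (x : ℝ) (q a : ℕ) : upsilon (⌊x⌋₊ : ℝ) q a = upsilon x q a := by
  unfold upsilon; rw [Nat.floor_natCast]

lemma sum_devMod (j q a : ℕ) : ∑ m ∈ Icc 1 j, devMod q a m = En j q a := by
  unfold devMod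
  rw [Finset.sum_sub_distrib, ← upsilon_natCast, En_eq]
  simp

lemma sum_r3Mod_mul (q : ℕ) (hq : 0 < q) (N : ℕ) (Z : ℕ → ℝ) :
    ∑ a ∈ Icc 1 q, ∑ m ∈ Icc 1 N, ∑ n ∈ Icc 1 N, r3Mod q a m * r3Mod q a n * Z (n - m)
      = ∑ m ∈ Icc 1 N, ∑ n ∈ Icc 1 N,
        if m ≡ n [MOD q] then (r3 m : ℝ) * r3 n * Z (n - m) else 0 := by
  rw [Finset.sum_comm]
  refine Finset.sum_congr rfl fun m _ => ?_
  rw [Finset.sum_comm]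
  refine Finset.sum_congr rfl fun n _ => ?_
  have h := sum_Icc_ite_modEq hq m
    (fun a => if n ≡ a [MOD q] then (r3 m : ℝ) * r3 n * Z (n - m) else 0) (fun a b hab => by
      have : n ≡ a [MOD q] ↔ n ≡ b [MOD q] := ⟨fun h => h.trans hab, fun h => h.trans hab.symm⟩
      simp only [this])
  have e : (m ≡ n [MOD q]) ↔ (n ≡ m [MOD q]) := ⟨Nat.ModEq.symm, Nat.ModEq.symm⟩
  simp only [e]
  rw [← h]
  refine Finset.sum_congr rfl fun a _ => ?_
  unfold r3Mod
  split_ifs <;> simp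

/-- The truncated difference counts the integers `j` with `m + T ≤ j < n`. This separates the
variables `m` and `n`. -/
lemma natSub_eq_sum (N m n T : ℕ) (hm : 1 ≤ m) (hn : n ≤ N) :
    ((n - m - T : ℕ) : ℝ) = ∑ j ∈ range N,
      (if m ∈ Icc 1 (j - T) then (1 : ℝ) else 0) * (if n ∈ Icc (j + 1) N then 1 else 0) := by
  have : ∀ j ∈ range N, (if m ∈ Icc 1 (j - T) then (1 : ℝ) else 0) *
      (if n ∈ Icc (j + 1) N then 1 else 0) = if j ∈ Ico (m + T) n then 1 else 0 := by
    intro j hj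
    simp only [mem_Icc, mem_Ico]
    split_ifs <;> first | (exfalso; omega) | simp
  rw [Finset.sum_congr rfl this, ← Finset.sum_filter]
  have h2 : (range N).filter (fun j => j ∈ Ico (m + T) n) = Ico (m + T) n := by
    ext j; simp only [mem_filter, mem_range, mem_Ico]; omega
  rw [h2]
  simp only [sum_const, Nat.card_Ico, nsmul_eq_mul, mul_one]
  congr 1; omega

/-- Partial summation in both variables. For `e` and `f` equal to `devMod` only error terms in
progressions remain. -/
lemma sum_sum_mul_natSub (e f : ℕ → ℝ) (N T : ℕ) :
    ∑ m ∈ Icc 1 N, ∑ n ∈ Icc 1 N, e m * f n * ((n - m - T : ℕ) : ℝ)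
      = ∑ j ∈ range N, (∑ m ∈ Icc 1 (j - T), e m) *
        ((∑ n ∈ Icc 1 N, f n) - ∑ n ∈ Icc 1 j, f n) := by
  have h1 : ∀ m ∈ Icc 1 N, ∀ n ∈ Icc 1 N, e m * f n * ((n - m - T : ℕ) : ℝ)
      = ∑ j ∈ range N, (if m ∈ Icc 1 (j - T) then e m else 0) *
        (if n ∈ Icc (j + 1) N then f n else 0) := by
    intro m hm n hn
    rw [natSub_eq_sum N m n T (mem_Icc.1 hm).1 (mem_Icc.1 hn).2, Finset.mul_sum]
    refine Finset.sum_congr rfl fun j _ => ?_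
    split_ifs <;> simp
  rw [Finset.sum_congr rfl fun m hm => Finset.sum_congr rfl (h1 m hm)]
  rw [Finset.sum_congr rfl fun m _ => Finset.sum_comm, Finset.sum_comm]
  refine Finset.sum_congr rfl fun j hj => ?_
  rw [mem_range] at hj
  have h2 : ∑ m ∈ Icc 1 (j - T), e m = ∑ m ∈ Icc 1 N, if m ∈ Icc 1 (j - T) then e m else 0 := by
    rw [← Finset.sum_filter]
    refine Finset.sum_congr ?_ fun _ _ => rfl
    ext m; simp only [mem_filter, mem_Icc]; omega
  have h3 : (∑ n ∈ Icc 1 N, f n) - ∑ n ∈ Icc 1 j, f n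
      = ∑ n ∈ Icc 1 N, if n ∈ Icc (j + 1) N then f n else 0 := by
    rw [sub_eq_iff_eq_add, ← Finset.sum_filter, add_comm]
    have : (Icc 1 N).filter (fun n => n ∈ Icc (j + 1) N) = Icc (j + 1) N := by
      ext n; simp only [mem_filter, mem_Icc]; omega
    rw [this, ← Finset.sum_union]
    · refine Finset.sum_congr ?_ fun _ _ => rfl
      ext n; simp only [mem_union, mem_Icc]; omega
    · rw [Finset.disjoint_left]; intro n hn; simp only [mem_Icc] at hn ⊢; omega
  rw [h2, h3, Finset.sum_mul_sum]

/-- When `f` is constant the shift `T` can be moved from the partial sum onto the weight.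
Differences over two shifts then produce `trap`, which is at most `K h`, in place of the tail `N -
j`. -/
lemma sum_sum_mul_natSub' (e : ℕ → ℝ) (N T : ℕ) :
    ∑ m ∈ Icc 1 N, ∑ n ∈ Icc 1 N, e m * ((n - m - T : ℕ) : ℝ)
      = ∑ i ∈ range N, (∑ m ∈ Icc 1 i, e m) * ((N - i - T : ℕ) : ℝ) := by
  have h := sum_sum_mul_natSub e (fun _ => 1) N T
  simp only [mul_one] at h
  rw [h]
  have h1 : ∀ j ∈ range N, (∑ m ∈ Icc 1 (j - T), e m) *
      ((∑ _n ∈ Icc 1 N, (1 : ℝ)) - ∑ _n ∈ Icc 1 j, (1 : ℝ))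
      = ∑ k ∈ Icc (j + 1) N, ∑ m ∈ Icc 1 (j - T), e m := by
    intro j hj
    rw [mem_range] at hj
    simp only [sum_const, Nat.card_Icc, nsmul_eq_mul, add_tsub_cancel_right, mul_one]
    rw [mul_comm, ← Nat.cast_sub hj.le]
    congr 2; omega
  have h2 : ∀ i ∈ range N, (∑ m ∈ Icc 1 i, e m) * ((N - i - T : ℕ) : ℝ)
      = ∑ k ∈ Icc (i + T + 1) N, ∑ m ∈ Icc 1 i, e m := by
    intro i _
    rw [Finset.sum_const, nsmul_eq_mul, Nat.card_Icc, mul_comm]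
    congr 2; omega
  rw [Finset.sum_congr rfl h1, Finset.sum_congr rfl h2]
  have hE0 : ∑ m ∈ Icc 1 0, e m = 0 := by simp
  obtain ⟨E, hE⟩ : ∃ E : ℕ → ℝ, ∀ i, ∑ m ∈ Icc 1 i, e m = E i := ⟨_, fun _ => rfl⟩
  simp only [hE] at hE0 ⊢
  rw [Finset.sum_sigma', Finset.sum_sigma']
  symm
  -- Shift by `T`; the indices not reached have `j ≤ T` and hence an empty partial sum.
  refine Finset.sum_of_injOn (fun p => ⟨p.1 + T, p.2⟩) ?_ ?_ ?_ ?_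
  · rintro ⟨i, k⟩ _ ⟨i', k'⟩ _ h
    simp only [Sigma.mk.injEq, heq_eq_eq] at h ⊢
    omega
  · rintro ⟨i, k⟩ h
    simp only [mem_coe, mem_sigma, mem_range, mem_Icc] at h ⊢
    omega
  · rintro ⟨j, k⟩ h h'
    simp only [mem_sigma, mem_range, mem_Icc, Set.mem_image, mem_coe, not_exists, not_and,
      Sigma.forall] at h h'
    have : j - T = 0 := by
      by_contra hne
      refine h' (j - T) k (by omega) ?_
      simp only [Sigma.mk.injEq, heq_eq_eq, and_true]
      omega
    rw [this]; exact hE0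
  · rintro ⟨i, k⟩ _
    simp

lemma trap_nonneg (M K h u : ℕ) : 0 ≤ trap M K h u := by
  unfold trap
  rw [sub_nonneg]
  have : M * h ≤ (M + K) * h := Nat.mul_le_mul_right _ (by omega)
  exact_mod_cast (by omega : u - (M + K) * h ≤ u - M * h)

lemma trap_le (M K h u : ℕ) : trap M K h u ≤ K * h := by
  unfold trap
  rw [sub_le_iff_le_add]
  have : (M + K) * h = M * h + K * h := by ring
  have h2 : u - M * h ≤ K * h + (u - (M + K) * h) := by rw [this]; omega
  exact_mod_cast h2

lemma trap_zero (M K h : ℕ) : trap M K h 0 = 0 := by simp [trap]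

lemma sum_sum_mul_trap (e f : ℕ → ℝ) (N M K h : ℕ) :
    ∑ m ∈ Icc 1 N, ∑ n ∈ Icc 1 N, e m * f n * trap M K h (n - m)
      = ∑ j ∈ range N, ((∑ m ∈ Icc 1 (j - M * h), e m) - ∑ m ∈ Icc 1 (j - (M + K) * h), e m) *
        ((∑ n ∈ Icc 1 N, f n) - ∑ n ∈ Icc 1 j, f n) := by
  unfold trap
  simp only [mul_sub, sub_mul, Finset.sum_sub_distrib]
  have h1 := sum_sum_mul_natSub e f N (M * h)
  have h2 := sum_sum_mul_natSub e f N ((M + K) * h)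
  simp only [mul_sub, Finset.sum_sub_distrib] at h1 h2
  rw [h1, h2]; ring

lemma sum_sum_mul_trap' (e : ℕ → ℝ) (N M K h : ℕ) :
    ∑ m ∈ Icc 1 N, ∑ n ∈ Icc 1 N, e m * trap M K h (n - m)
      = ∑ i ∈ range N, (∑ m ∈ Icc 1 i, e m) * trap M K h (N - i) := by
  unfold trap
  simp only [mul_sub, Finset.sum_sub_distrib]
  rw [sum_sum_mul_natSub', sum_sum_mul_natSub']

lemma abs_mul_le_of_sq (a b : ℝ) : |a * b| ≤ (a ^ 2 + b ^ 2) / 2 := by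
  rw [abs_le]; constructor <;> nlinarith [sq_nonneg (a + b), sq_nonneg (a - b)]

/-- The deviation-deviation part of the switched sum. -/
lemma abs_sum_dev_dev_le {N M K h : ℕ} {B : ℝ}
    (hB : ∀ j ≤ N, ∑ a ∈ Icc 1 h, En (j : ℝ) h a ^ 2 ≤ B) :
    |∑ a ∈ Icc 1 h, ∑ m ∈ Icc 1 N, ∑ n ∈ Icc 1 N, devMod h a m * devMod h a n * trap M K h (n - m)|
      ≤ N * (4 * B) := by
  simp only [sum_sum_mul_trap, sum_devMod]
  rw [Finset.sum_comm]
  refine (Finset.abs_sum_le_sum_abs _ _).trans ?_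
  have : ∀ j ∈ range N, |∑ a ∈ Icc 1 h, (En ((j - M * h : ℕ) : ℝ) h a
      - En ((j - (M + K) * h : ℕ) : ℝ) h a) * (En (N : ℝ) h a - En (j : ℝ) h a)| ≤ 4 * B := by
    intro j hj
    rw [mem_range] at hj
    have b1 := hB (j - M * h) (by omega)
    have b2 := hB (j - (M + K) * h) (by omega)
    have b3 := hB N le_rfl
    have b4 := hB j hj.le
    refine (Finset.abs_sum_le_sum_abs _ _).trans ?_
    have : ∀ a ∈ Icc 1 h, |(En ((j - M * h : ℕ) : ℝ) h a
      - En ((j - (M + K) * h : ℕ) : ℝ) h a) * (En (N : ℝ) h a - En (j : ℝ) h a)|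
      ≤ En ((j - M * h : ℕ) : ℝ) h a ^ 2 + En ((j - (M + K) * h : ℕ) : ℝ) h a ^ 2
        + En (N : ℝ) h a ^ 2 + En (j : ℝ) h a ^ 2 := by
      intro a _
      refine (abs_mul_le_of_sq _ _).trans ?_
      nlinarith [sq_nonneg (En ((j - M * h : ℕ) : ℝ) h a + En ((j - (M + K) * h : ℕ) : ℝ) h a),
        sq_nonneg (En (N : ℝ) h a + En (j : ℝ) h a)]
    refine (Finset.sum_le_sum this).trans ?_
    simp only [Finset.sum_add_distrib]
    linarith
  refine (Finset.sum_le_sum this).trans ?_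
  simp

/-- The two mixed parts of the switched sum. -/
lemma abs_sum_kap_dev_le {N M K h : ℕ} {X : ℝ}
    (hX : ∀ j ≤ N, |crossSum (j : ℝ) h| ≤ X) :
    |∑ a ∈ Icc 1 h, ∑ m ∈ Icc 1 N, ∑ n ∈ Icc 1 N, kap h a * devMod h a n * trap M K h (n - m)|
      ≤ N * (2 * X * (K * h)) := by
  simp only [sum_sum_mul_trap, sum_devMod]
  rw [Finset.sum_comm]
  refine (Finset.abs_sum_le_sum_abs _ _).trans ?_
  have : ∀ j ∈ range N, |∑ a ∈ Icc 1 h, ((∑ _m ∈ Icc 1 (j - M * h), kap h a)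
      - ∑ _m ∈ Icc 1 (j - (M + K) * h), kap h a) * (En (N : ℝ) h a - En (j : ℝ) h a)|
      ≤ 2 * X * (K * h) := by
    intro j hj
    rw [mem_range] at hj
    have e : ∑ a ∈ Icc 1 h, ((∑ _m ∈ Icc 1 (j - M * h), kap h a)
      - ∑ _m ∈ Icc 1 (j - (M + K) * h), kap h a) * (En (N : ℝ) h a - En (j : ℝ) h a)
      = trap M K h j * (crossSum N h - crossSum j h) := by
      unfold crossSum trap
      rw [← Finset.sum_sub_distrib, Finset.mul_sum]
      refine Finset.sum_congr rfl fun a _ => ?_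
      simp only [sum_const, Nat.card_Icc, nsmul_eq_mul, add_tsub_cancel_right]
      ring
    rw [e, abs_mul, abs_of_nonneg (trap_nonneg _ _ _ _), mul_comm]
    have b3 := hX N le_rfl
    have b4 := hX j hj.le
    have := abs_sub (crossSum N h) (crossSum j h)
    exact mul_le_mul (by linarith) (trap_le _ _ _ _) (trap_nonneg _ _ _ _)
      (by have := abs_nonneg (crossSum (N : ℝ) h); linarith)
  refine (Finset.sum_le_sum this).trans ?_
  simp

lemma abs_sum_dev_kap_le {N M K h : ℕ} {X : ℝ}
    (hX : ∀ j ≤ N, |crossSum (j : ℝ) h| ≤ X) :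
    |∑ a ∈ Icc 1 h, ∑ m ∈ Icc 1 N, ∑ n ∈ Icc 1 N, devMod h a m * kap h a * trap M K h (n - m)|
      ≤ N * (X * (K * h)) := by
  have e0 : ∀ a, ∑ m ∈ Icc 1 N, ∑ n ∈ Icc 1 N, devMod h a m * kap h a * trap M K h (n - m)
      = kap h a * ∑ i ∈ range N, En (i : ℝ) h a * trap M K h (N - i) := by
    intro a
    have := sum_sum_mul_trap' (devMod h a) N M K h
    simp only [sum_devMod] at this
    rw [← this, Finset.mul_sum]
    refine Finset.sum_congr rfl fun m _ => ?_
    rw [Finset.mul_sum]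
    refine Finset.sum_congr rfl fun n _ => ?_
    ring
  simp only [e0, Finset.mul_sum]
  rw [Finset.sum_comm]
  refine (Finset.abs_sum_le_sum_abs _ _).trans ?_
  have : ∀ i ∈ range N, |∑ a ∈ Icc 1 h, kap h a * (En (i : ℝ) h a * trap M K h (N - i))|
      ≤ X * (K * h) := by
    intro i hi
    rw [mem_range] at hi
    have e : ∑ a ∈ Icc 1 h, kap h a * (En (i : ℝ) h a * trap M K h (N - i))
        = crossSum i h * trap M K h (N - i) := by
      unfold crossSum
      rw [Finset.sum_mul]
      refine Finset.sum_congr rfl fun a _ => ?_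
      ring
    rw [e, abs_mul, abs_of_nonneg (trap_nonneg _ _ _ _)]
    have b4 := hX i hi.le
    exact mul_le_mul b4 (trap_le _ _ _ _) (trap_nonneg _ _ _ _) ((abs_nonneg _).trans b4)
  refine (Finset.sum_le_sum this).trans ?_
  simp

/-! ### The ramp as a sum of step functions. -/

lemma trap_succ (M K h u : ℕ) :
    trap M (K + 1) h u = trap M K h u + trap (M + K) 1 h u := by
  unfold trap; rw [add_assoc M K 1]; ring

/-- Each unit of the ramp, of height `h`, is replaced by a jump at its left end. Completed units
agree exactly and units not yet begun vanish, so the discrepancy comes from at most one unit and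
lies in `[0, h]`. The third clause, exactness past the end, drives the induction. -/
lemma trap_approx (M K h u : ℕ) (hh : 0 < h) :
    (0 ≤ h * ∑ k ∈ range K, (if (M + k) * h < u then (1 : ℝ) else 0) - trap M K h u) ∧
    (h * ∑ k ∈ range K, (if (M + k) * h < u then (1 : ℝ) else 0) - trap M K h u ≤ h) ∧
    ((M + K) * h ≤ u →
      h * ∑ k ∈ range K, (if (M + k) * h < u then (1 : ℝ) else 0) - trap M K h u = 0) := by
  induction K with
  | zero => simp [trap]
  | succ K ih =>
    obtain ⟨h1, h2, h3⟩ := ih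
    rw [trap_succ, Finset.sum_range_succ, mul_add]
    have e : (M + (K + 1)) * h = (M + K) * h + h := by ring
    have e' : (M + K + 1) * h = (M + K) * h + h := by ring
    by_cases hu : (M + K) * h < u
    · have h0 := h3 hu.le
      rw [if_pos hu]
      have t1 := trap_nonneg (M + K) 1 h u
      have t2 := trap_le (M + K) 1 h u
      simp only [Nat.cast_one, one_mul] at t2
      refine ⟨by linarith, by linarith, fun h4 => ?_⟩
      have : trap (M + K) 1 h u = h := by
        unfold trap
        rw [e'] 
        rw [e] at h4
        rw [sub_eq_iff_eq_add]
        have : u - (M + K) * h = h + (u - ((M + K) * h + h)) := by omega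
        exact_mod_cast this
      linarith
    · rw [if_neg hu]
      have : trap (M + K) 1 h u = 0 := by
        unfold trap
        have a1 : u - (M + K) * h = 0 := by omega
        have a2 : u - (M + K + 1) * h = 0 := by rw [e']; omega
        rw [a1, a2]; simp
      rw [this]
      refine ⟨by linarith, by linarith, fun h4 => ?_⟩
      rw [e] at h4; omega

lemma sum_range_natSub (L : ℕ) : ∀ N, L ≤ N → ∑ m ∈ Icc 1 N, ((L - m : ℕ) : ℝ) = L * (L - 1) / 2 := by
  induction L with
  | zero => intro N _; simp
  | succ L ih =>
    intro N hN
    obtain ⟨N, rfl⟩ := Nat.exists_eq_add_of_le' (by omega : 1 ≤ N)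
    have h1 := ih N (by omega)
    have e : ∑ m ∈ Icc 1 (N + 1), ((L + 1 - m : ℕ) : ℝ) = ∑ m ∈ range (N + 1), ((L - m : ℕ) : ℝ) := by
      refine Finset.sum_bij' (fun m _ => m - 1) (fun m _ => m + 1) ?_ ?_ ?_ ?_ ?_
      all_goals
        intro m hm
        simp only [mem_Icc, mem_range] at hm ⊢
      · omega
      · omega
      · omega
      · omega
      · congr 1; omega
    rw [e, Finset.range_eq_Ico, Finset.sum_eq_sum_Ico_succ_bot (by omega)]
    have e2 : Ico (0 + 1) (N + 1) = Icc 1 N := by ext; simp only [mem_Ico, mem_Icc]; omega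
    rw [e2, h1]
    push_cast; simp; ring

lemma sum_sum_ite_lt_sub (N T : ℕ) :
    ∑ m ∈ Icc 1 N, ∑ n ∈ Icc 1 N, (if T < n - m then (1 : ℝ) else 0)
      = ((N - T : ℕ) : ℝ) * (((N - T : ℕ) : ℝ) - 1) / 2 := by
  rw [← sum_range_natSub (N - T) N (by omega)]
  refine Finset.sum_congr rfl fun m _ => ?_
  rw [← Finset.sum_filter]
  have : (Icc 1 N).filter (fun n => T < n - m) = Ioc (m + T) N := by
    ext n; simp only [mem_filter, mem_Icc, mem_Ioc]; omega
  rw [this, Finset.sum_const, Nat.card_Ioc, nsmul_eq_mul, mul_one]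
  congr 1; omega

lemma abs_natSub_mul_sub_le {x : ℝ} (hx : 1 ≤ x) (T : ℕ) :
    |((⌊x⌋₊ - T : ℕ) : ℝ) * (((⌊x⌋₊ - T : ℕ) : ℝ) - 1) / 2 - max (x - T) 0 ^ 2 / 2| ≤ 2 * x := by
  have h1 := Nat.floor_le (by linarith : 0 ≤ x)
  have h2 := Nat.lt_floor_add_one x
  rcases le_or_gt T ⌊x⌋₊ with h | h
  · rw [Nat.cast_sub h]
    have hT : (T : ℝ) ≤ ⌊x⌋₊ := by exact_mod_cast h
    have hT0 : (0 : ℝ) ≤ T := Nat.cast_nonneg T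
    rw [max_eq_left (by linarith), abs_le]
    set N : ℝ := (⌊x⌋₊ : ℝ)
    set u := N - (T : ℝ) with hu
    have hu0 : 0 ≤ u := by linarith
    have e : x - T = u + (x - N) := by rw [hu]; ring
    rw [e]
    constructor <;> nlinarith
  · have : ⌊x⌋₊ - T = 0 := by omega
    have hT : (⌊x⌋₊ : ℝ) + 1 ≤ T := by exact_mod_cast h
    rw [this, max_eq_right (by linarith)]
    norm_num; linarith

/-- Passing from the ramp to steps costs at most `h` for each of the at most `x²` pairs. The number
of pairs with `n - m > T` is a triangular number, equal to `(x - T)₊² / 2` up to `O(x)`. -/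
lemma abs_sum_trap_sub_le {x : ℝ} (hx : 1 ≤ x) (M K h : ℕ) (hh : 0 < h) :
    |∑ m ∈ Icc 1 ⌊x⌋₊, ∑ n ∈ Icc 1 ⌊x⌋₊, trap M K h (n - m)
      - h * ∑ k ∈ range K, max (x - ((M + k : ℕ) : ℝ) * h) 0 ^ 2 / 2|
      ≤ h * x ^ 2 + h * (K * (2 * x)) := by
  set N := ⌊x⌋₊ with hN
  have hNx : (N : ℝ) ≤ x := Nat.floor_le (by linarith)
  set c : ℕ → ℝ := fun u => h * ∑ k ∈ range K, (if (M + k) * h < u then (1 : ℝ) else 0) with hc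
  have hA : |∑ m ∈ Icc 1 N, ∑ n ∈ Icc 1 N, trap M K h (n - m) - ∑ m ∈ Icc 1 N, ∑ n ∈ Icc 1 N, c (n - m)|
      ≤ h * x ^ 2 := by
    rw [← Finset.sum_sub_distrib]
    simp only [← Finset.sum_sub_distrib]
    refine (Finset.abs_sum_le_sum_abs _ _).trans ?_
    have : ∀ m ∈ Icc 1 N, |∑ n ∈ Icc 1 N, (trap M K h (n - m) - c (n - m))| ≤ N * h := by
      intro m _
      refine (Finset.abs_sum_le_sum_abs _ _).trans ?_
      have : ∀ n ∈ Icc 1 N, |trap M K h (n - m) - c (n - m)| ≤ (h : ℝ) := by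
        intro n _
        obtain ⟨h1, h2, -⟩ := trap_approx M K h (n - m) hh
        rw [abs_sub_comm, abs_of_nonneg h1]
        exact h2
      refine (Finset.sum_le_sum this).trans ?_
      simp
    refine (Finset.sum_le_sum this).trans ?_
    rw [Finset.sum_const, nsmul_eq_mul, Nat.card_Icc, add_tsub_cancel_right]
    have : (N : ℝ) * N ≤ x ^ 2 := by nlinarith [Nat.cast_nonneg (α := ℝ) N]
    nlinarith [Nat.cast_nonneg (α := ℝ) h]
  have hB : ∑ m ∈ Icc 1 N, ∑ n ∈ Icc 1 N, c (n - m)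
      = h * ∑ k ∈ range K, ((N - (M + k) * h : ℕ) : ℝ) * (((N - (M + k) * h : ℕ) : ℝ) - 1) / 2 := by
    simp only [hc, ← Finset.mul_sum]
    congr 1
    rw [Finset.sum_congr rfl fun m _ => Finset.sum_comm, Finset.sum_comm]
    exact Finset.sum_congr rfl fun k _ => sum_sum_ite_lt_sub N _
  have hC : |∑ m ∈ Icc 1 N, ∑ n ∈ Icc 1 N, c (n - m)
      - h * ∑ k ∈ range K, max (x - ((M + k : ℕ) : ℝ) * h) 0 ^ 2 / 2| ≤ h * (K * (2 * x)) := by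
    rw [hB, ← mul_sub, abs_mul, Nat.abs_cast, ← Finset.sum_sub_distrib]
    refine mul_le_mul_of_nonneg_left ?_ (Nat.cast_nonneg _)
    refine (Finset.abs_sum_le_sum_abs _ _).trans ?_
    refine (Finset.sum_le_sum fun k _ => ?_).trans (b := ∑ _k ∈ range K, 2 * x) (by simp)
    have := abs_natSub_mul_sub_le hx ((M + k) * h)
    rwa [Nat.cast_mul] at this
  have := abs_sub_le (∑ m ∈ Icc 1 N, ∑ n ∈ Icc 1 N, trap M K h (n - m))
    (∑ m ∈ Icc 1 N, ∑ n ∈ Icc 1 N, c (n - m))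
    (h * ∑ k ∈ range K, max (x - ((M + k : ℕ) : ℝ) * h) 0 ^ 2 / 2)
  linarith

/-- Sum over congruent pairs weighted by `trap`. -/
def trapSum (N M K h : ℕ) : ℝ := ∑ m ∈ Icc 1 N, ∑ n ∈ Icc 1 N,
  if m ≡ n [MOD h] then (r3 m : ℝ) * r3 n * trap M K h (n - m) else 0

/-- In each class `r3Mod` is its mean `kap` plus `devMod`. The product of means gives the main term;
the two mixed products reduce to `crossSum`, and the product of deviations to the mean square error.
-/
lemma abs_trapSum_sub_le {x : ℝ} (hx : 1 ≤ x) {M K h : ℕ} (hh : 0 < h) {B X : ℝ}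
    (hB : ∀ j ≤ ⌊x⌋₊, ∑ a ∈ Icc 1 h, En (j : ℝ) h a ^ 2 ≤ B)
    (hX : ∀ j ≤ ⌊x⌋₊, |crossSum (j : ℝ) h| ≤ X) :
    |trapSum ⌊x⌋₊ M K h
      - m0 ^ 2 * Gsum h * ∑ k ∈ range K, max (x - ((M + k : ℕ) : ℝ) * h) 0 ^ 2 / 2|
      ≤ m0 ^ 2 * Gsum h * (x ^ 2 + K * (2 * x)) + x * (3 * X * (K * h)) + x * (4 * B) := by
  set N := ⌊x⌋₊ with hN
  have hNx : (N : ℝ) ≤ x := Nat.floor_le (by linarith)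
  have hX0 : 0 ≤ X := (abs_nonneg _).trans (hX 0 (Nat.zero_le _))
  have hB0 : 0 ≤ B := (Finset.sum_nonneg fun _ _ => sq_nonneg _).trans (hB 0 (Nat.zero_le _))
  have hexp : trapSum N M K h
      = (∑ a ∈ Icc 1 h, kap h a ^ 2) * (∑ m ∈ Icc 1 N, ∑ n ∈ Icc 1 N, trap M K h (n - m))
      + (∑ a ∈ Icc 1 h, ∑ m ∈ Icc 1 N, ∑ n ∈ Icc 1 N, kap h a * devMod h a n * trap M K h (n - m))
      + (∑ a ∈ Icc 1 h, ∑ m ∈ Icc 1 N, ∑ n ∈ Icc 1 N, devMod h a m * kap h a * trap M K h (n - m))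
      + ∑ a ∈ Icc 1 h, ∑ m ∈ Icc 1 N, ∑ n ∈ Icc 1 N,
          devMod h a m * devMod h a n * trap M K h (n - m) := by
    unfold trapSum
    rw [← sum_r3Mod_mul h hh N (trap M K h), Finset.sum_mul]
    simp only [Finset.mul_sum, ← Finset.sum_add_distrib]
    refine Finset.sum_congr rfl fun a _ => Finset.sum_congr rfl fun m _ =>
      Finset.sum_congr rfl fun n _ => ?_
    unfold devMod; ring
  have h1 := abs_sum_kap_dev_le (N := N) (M := M) (K := K) hX
  have h2 := abs_sum_dev_kap_le (N := N) (M := M) (K := K) hX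
  have h3 := abs_sum_dev_dev_le (N := N) (M := M) (K := K) hB
  have h4 := abs_sum_trap_sub_le hx M K h hh
  rw [← hN] at h4
  rw [hexp, sum_kap_sq h hh]
  set P := ∑ m ∈ Icc 1 N, ∑ n ∈ Icc 1 N, trap M K h (n - m)
  set P1 := ∑ a ∈ Icc 1 h, ∑ m ∈ Icc 1 N, ∑ n ∈ Icc 1 N, kap h a * devMod h a n * trap M K h (n - m)
  set P2 := ∑ a ∈ Icc 1 h, ∑ m ∈ Icc 1 N, ∑ n ∈ Icc 1 N, devMod h a m * kap h a * trap M K h (n - m)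
  set P3 := ∑ a ∈ Icc 1 h, ∑ m ∈ Icc 1 N, ∑ n ∈ Icc 1 N,
    devMod h a m * devMod h a n * trap M K h (n - m)
  set Q := ∑ k ∈ range K, max (x - ((M + k : ℕ) : ℝ) * h) 0 ^ 2 / 2
  have hh' : (0 : ℝ) < h := by exact_mod_cast hh
  have hG : 0 ≤ m0 ^ 2 * (Gsum h / h) := by have := Gsum_nonneg h; positivity
  have h5 : |m0 ^ 2 * (Gsum h / h) * (P - h * Q)| ≤ m0 ^ 2 * Gsum h * (x ^ 2 + K * (2 * x)) := by
    rw [abs_mul, abs_of_nonneg hG]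
    refine (mul_le_mul_of_nonneg_left h4 hG).trans (le_of_eq ?_)
    field_simp
  have e : m0 ^ 2 * (Gsum h / h) * P + P1 + P2 + P3 - m0 ^ 2 * Gsum h * Q
      = m0 ^ 2 * (Gsum h / h) * (P - h * Q) + P1 + P2 + P3 := by field_simp; ring
  rw [e]
  have t1 := abs_add_le (m0 ^ 2 * (Gsum h / h) * (P - h * Q) + P1 + P2) P3
  have t2 := abs_add_three (m0 ^ 2 * (Gsum h / h) * (P - h * Q)) P1 P2
  have n1 : (N : ℝ) * (2 * X * (K * h)) ≤ x * (2 * X * (K * h)) := by gcongr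
  have n2 : (N : ℝ) * (X * (K * h)) ≤ x * (X * (K * h)) := by gcongr
  have n3 : (N : ℝ) * (4 * B) ≤ x * (4 * B) := by gcongr
  linarith

/-! ### The divisor switch and the expanded variance. -/

lemma sum_range_ite_lt (M K q : ℕ) :
    ∑ k ∈ range K, (if M + k < q then (1 : ℝ) else 0) = trap M K 1 q := by
  induction K with
  | zero => simp [trap]
  | succ K ih =>
    rw [Finset.sum_range_succ, ih, trap_succ]
    congr 1
    unfold trap
    split_ifs with h
    · rw [eq_sub_iff_add_eq]
      have : 1 + (q - (M + K + 1) * 1) = q - (M + K) * 1 := by omega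
      exact_mod_cast this
    · have a1 : q - (M + K) * 1 = 0 := by omega
      have a2 : q - (M + K + 1) * 1 = 0 := by omega
      rw [a1, a2]; simp

lemma trap_one_div {M K h v : ℕ} (hh : 0 < h) (hd : h ∣ v) :
    trap M K 1 (v / h) = trap M K h v / h := by
  obtain ⟨c, rfl⟩ := hd
  rw [Nat.mul_div_cancel_left c hh]
  unfold trap
  have e : ∀ T, h * c - T * h = h * (c - T * 1) := fun T => by
    rw [Nat.mul_sub, mul_one, mul_comm T h]
  rw [e, e]
  have : (h : ℝ) ≠ 0 := by exact_mod_cast hh.ne'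
  push_cast
  field_simp

/-- Divisors up to `M + k` are all divisors except those beyond `M + k`. Averaging over `k` gives
the excluded divisor `q` the ramp weight `trap M K 1 q`, which in terms of `h = v / q` is `trap M K
h v / h`. That weight vanishes for `h > L`, because then `v ≤ M h`. -/
lemma sum_dvd_switch {M K L v : ℕ} (hv : 0 < v) (hL : v ≤ M * L) :
    ∑ k ∈ range K, ∑ q ∈ Icc 1 (M + k), (if q ∣ v then (1 : ℝ) else 0)
      = K * v.divisors.card - ∑ h ∈ Icc 1 L, if h ∣ v then trap M K h v / h else 0 := by
  have h1 : ∀ k ∈ range K, ∑ q ∈ Icc 1 (M + k), (if q ∣ v then (1 : ℝ) else 0)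
      = v.divisors.card - ∑ q ∈ v.divisors, if M + k < q then (1 : ℝ) else 0 := by
    intro k _
    rw [eq_sub_iff_add_eq, ← Finset.sum_filter]
    have e1 : (Icc 1 (M + k)).filter (fun q => q ∣ v) = v.divisors.filter (fun q => ¬ (M + k < q)) := by
      ext q
      simp only [mem_filter, mem_Icc, Nat.mem_divisors, not_lt]
      constructor
      · rintro ⟨⟨h1, h2⟩, h3⟩; exact ⟨⟨h3, hv.ne'⟩, h2⟩
      · rintro ⟨⟨h1, h2⟩, h3⟩; exact ⟨⟨Nat.pos_of_dvd_of_pos h1 hv, h3⟩, h1⟩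
    rw [e1, ← Finset.sum_filter, add_comm, Finset.sum_filter_add_sum_filter_not]
    simp
  rw [Finset.sum_congr rfl h1, Finset.sum_sub_distrib, Finset.sum_comm]
  simp only [sum_range_ite_lt]
  rw [← Nat.sum_div_divisors v (fun q => trap M K 1 q)]
  simp only [sum_const, card_range, nsmul_eq_mul]
  congr 1
  rw [← Finset.sum_filter]
  have hsub : (Icc 1 L).filter (fun h => h ∣ v) ⊆ v.divisors := by
    intro h hh
    rw [mem_filter] at hh
    exact Nat.mem_divisors.2 ⟨hh.2, hv.ne'⟩
  symm
  rw [← Finset.sum_subset hsub (f := fun h => trap M K 1 (v / h))]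
  · refine Finset.sum_congr rfl fun h hh => ?_
    rw [mem_filter, mem_Icc] at hh
    rw [trap_one_div (by omega) hh.2]
  · intro h hh hn
    have hd := Nat.dvd_of_mem_divisors hh
    have hp := Nat.pos_of_mem_divisors hh
    have hlt : L < h := by
      by_contra hcon
      exact hn (mem_filter.2 ⟨mem_Icc.2 ⟨hp, by omega⟩, hd⟩)
    rw [trap_one_div hp hd]
    have h2 : M * L ≤ M * h := Nat.mul_le_mul_left _ hlt.le
    have h3 : M * h ≤ (M + K) * h := Nat.mul_le_mul_right _ (by omega)
    unfold trap
    have a1 : v - M * h = 0 := by omega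
    have a2 : v - (M + K) * h = 0 := by omega
    rw [a1, a2]; simp

/-- Off-diagonal pairs congruent modulo `q`. -/
def offDiag (N q : ℕ) : ℝ := ∑ m ∈ Icc 1 N, ∑ n ∈ Icc 1 N,
  if m < n ∧ m ≡ n [MOD q] then (r3 m : ℝ) * r3 n else 0

/-- Off-diagonal pairs weighted by the divisor function. -/
def divSum (N : ℕ) : ℝ := ∑ m ∈ Icc 1 N, ∑ n ∈ Icc 1 N,
  if m < n then (r3 m : ℝ) * r3 n * (n - m).divisors.card else 0

lemma sum_upsilon_sq (x : ℝ) {q : ℕ} (hq : 0 < q) :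
    ∑ a ∈ Icc 1 q, upsilon x q a ^ 2 = r3SqSum x + 2 * offDiag ⌊x⌋₊ q := by
  set N := ⌊x⌋₊ with hN
  have h1 : ∀ a ∈ Icc 1 q, upsilon x q a ^ 2
      = ∑ m ∈ Icc 1 N, ∑ n ∈ Icc 1 N, r3Mod q a m * r3Mod q a n * (fun _ => (1 : ℝ)) (n - m) := by
    intro a _
    rw [← upsilon_floor, upsilon_natCast, ← hN, pow_two, Finset.sum_mul_sum]
    simp
  rw [Finset.sum_congr rfl h1, sum_r3Mod_mul q hq N (fun _ => 1)]
  have h2 : offDiag N q = ∑ m ∈ Icc 1 N, ∑ n ∈ Icc 1 N,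
      if n < m ∧ m ≡ n [MOD q] then (r3 m : ℝ) * r3 n else 0 := by
    unfold offDiag
    rw [Finset.sum_comm]
    refine Finset.sum_congr rfl fun m _ => Finset.sum_congr rfl fun n _ => ?_
    have : (n ≡ m [MOD q]) ↔ (m ≡ n [MOD q]) := ⟨Nat.ModEq.symm, Nat.ModEq.symm⟩
    simp only [this]; rw [mul_comm (r3 n : ℝ)]
  have h3 : r3SqSum x = ∑ m ∈ Icc 1 N, ∑ n ∈ Icc 1 N, if m = n then (r3 m : ℝ) * r3 n else 0 := by
    unfold r3SqSum
    refine Finset.sum_congr rfl fun m hm => ?_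
    rw [Finset.sum_ite_eq, if_pos hm, pow_two]
  rw [two_mul]
  nth_rewrite 2 [h2]
  rw [h3]
  unfold offDiag
  simp only [← Finset.sum_add_distrib]
  refine Finset.sum_congr rfl fun m _ => Finset.sum_congr rfl fun n _ => ?_
  rcases lt_trichotomy m n with h | h | h
  · by_cases hc : m ≡ n [MOD q] <;> simp [h, h.ne, h.not_gt, hc]
  · subst h; simp [Nat.ModEq.refl]
  · by_cases hc : m ≡ n [MOD q] <;> simp [h, h.ne', h.not_gt, hc]

lemma sum_offDiag_eq {N M K L : ℕ} (hL : N ≤ M * L) :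
    ∑ k ∈ range K, ∑ q ∈ Icc 1 (M + k), offDiag N q
      = K * divSum N - ∑ h ∈ Icc 1 L, trapSum N M K h / h := by
  have h0 : ∀ m ∈ Icc 1 N, ∀ n ∈ Icc 1 N,
      ∑ k ∈ range K, ∑ q ∈ Icc 1 (M + k),
        (if m < n ∧ m ≡ n [MOD q] then (r3 m : ℝ) * r3 n else 0)
      = K * (if m < n then (r3 m : ℝ) * r3 n * (n - m).divisors.card else 0)
        - ∑ h ∈ Icc 1 L,
          (if m ≡ n [MOD h] then (r3 m : ℝ) * r3 n * trap M K h (n - m) else 0) / h := by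
    intro m hm n hn
    rw [mem_Icc] at hm hn
    by_cases hmn : m < n
    · have h1 := sum_dvd_switch (K := K) (v := n - m) (M := M) (L := L) (by omega) (by omega)
      have h2 : ∀ q, (m ≡ n [MOD q]) ↔ q ∣ n - m := fun q => Nat.modEq_iff_dvd' hmn.le
      simp only [hmn, true_and, if_true, h2]
      have h3 := congrArg (fun z => (r3 m : ℝ) * r3 n * z) h1
      simp only [mul_sub, Finset.mul_sum, mul_ite, mul_one, mul_zero] at h3
      rw [h3]
      congr 1
      · ring
      · refine Finset.sum_congr rfl fun h _ => ?_
        split_ifs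
        · ring
        · simp
    · have : n - m = 0 := by omega
      simp [hmn, this, trap_zero]
  unfold offDiag divSum trapSum
  calc ∑ k ∈ range K, ∑ q ∈ Icc 1 (M + k), ∑ m ∈ Icc 1 N, ∑ n ∈ Icc 1 N,
        (if m < n ∧ m ≡ n [MOD q] then (r3 m : ℝ) * r3 n else 0)
      = ∑ m ∈ Icc 1 N, ∑ n ∈ Icc 1 N, ∑ k ∈ range K, ∑ q ∈ Icc 1 (M + k),
        (if m < n ∧ m ≡ n [MOD q] then (r3 m : ℝ) * r3 n else 0) := by
        have sw : ∀ (s : Finset ℕ) (F : ℕ → ℕ → ℕ → ℝ),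
            ∑ a ∈ s, ∑ m ∈ Icc 1 N, ∑ n ∈ Icc 1 N, F a m n
              = ∑ m ∈ Icc 1 N, ∑ n ∈ Icc 1 N, ∑ a ∈ s, F a m n := by
          intro s F
          rw [Finset.sum_comm]
          exact Finset.sum_congr rfl fun m _ => Finset.sum_comm
        rw [Finset.sum_congr rfl fun k _ => sw (Icc 1 (M + k)) _, sw]
    _ = ∑ m ∈ Icc 1 N, ∑ n ∈ Icc 1 N,
        (K * (if m < n then (r3 m : ℝ) * r3 n * (n - m).divisors.card else 0)
        - ∑ h ∈ Icc 1 L,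
          (if m ≡ n [MOD h] then (r3 m : ℝ) * r3 n * trap M K h (n - m) else 0) / h) :=
        Finset.sum_congr rfl fun m hm => Finset.sum_congr rfl fun n hn => h0 m hm n hn
    _ = _ := by
        simp only [Finset.sum_sub_distrib, ← Finset.mul_sum, Finset.sum_div]
        congr 1
        rw [Finset.sum_congr rfl fun m _ => Finset.sum_comm, Finset.sum_comm]

/-- The sum of `K` consecutive variances. -/
def VSum (x : ℝ) (M K : ℕ) : ℝ := ∑ k ∈ range K, V x ((M + k : ℕ) : ℝ)

/-- The mixed term is written with `En` instead of `upsilon`, so that it is an error term; this is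
why the density square appears with a minus sign. -/
lemma sum_En_sq_eq (x : ℝ) {q : ℕ} (hq : 0 < q) :
    ∑ a ∈ Icc 1 q, En x q a ^ 2
      = r3SqSum x + 2 * offDiag ⌊x⌋₊ q - 2 * x * crossSum x q - m0 ^ 2 * x ^ 2 * (Gsum q / q) := by
  have h1 : ∀ a ∈ Icc 1 q, En x q a ^ 2
      = upsilon x q a ^ 2 - 2 * x * (kap q a * En x q a) - x ^ 2 * kap q a ^ 2 := by
    intro a _
    rw [En_eq]; ring
  rw [Finset.sum_congr rfl h1, Finset.sum_sub_distrib, Finset.sum_sub_distrib, ← Finset.mul_sum,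
    ← Finset.mul_sum, sum_kap_sq q hq, sum_upsilon_sq x hq]
  unfold crossSum; ring

/-- Terms with `(M + k) h ≥ x` vanish, and this covers every `h` beyond `L` as well as beyond `x`.
-/
lemma sum_Gsum_max_range {x : ℝ} {M L k : ℕ} (hM : 1 ≤ M) (hL : ⌊x⌋₊ ≤ M * L) :
    ∑ h ∈ Icc 1 ⌊x⌋₊, Gsum h / h * max (x - ((M + k : ℕ) : ℝ) * h) 0 ^ 2
      = ∑ h ∈ Icc 1 L, Gsum h / h * max (x - ((M + k : ℕ) : ℝ) * h) 0 ^ 2 := by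
  have hM' : (1 : ℝ) ≤ M := by exact_mod_cast hM
  have hMk : (M : ℝ) ≤ ((M + k : ℕ) : ℝ) := by exact_mod_cast (by omega : M ≤ M + k)
  have hlt := Nat.lt_floor_add_one x
  have h1 : Icc 1 ⌊x⌋₊ ⊆ Icc 1 (max ⌊x⌋₊ L) := Icc_subset_Icc_right (le_max_left _ _)
  have h2 : Icc 1 L ⊆ Icc 1 (max ⌊x⌋₊ L) := Icc_subset_Icc_right (le_max_right _ _)
  rw [Finset.sum_subset h1, Finset.sum_subset h2]
  · intro h _ hn
    rcases Nat.eq_zero_or_pos h with rfl | h0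
    · simp
    have hLh : L + 1 ≤ h := by rw [mem_Icc] at hn; omega
    have : ⌊x⌋₊ + 1 ≤ M * h := by
      calc ⌊x⌋₊ + 1 ≤ M * L + M := by omega
        _ = M * (L + 1) := by ring
        _ ≤ M * h := Nat.mul_le_mul_left _ hLh
    have h3 : (⌊x⌋₊ : ℝ) + 1 ≤ M * h := by exact_mod_cast this
    have h4 : (M : ℝ) * h ≤ ((M + k : ℕ) : ℝ) * h := by gcongr
    rw [max_eq_right (by linarith)]; simp
  · intro h _ hn
    rcases Nat.eq_zero_or_pos h with rfl | h0
    · simp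
    have hLh : ⌊x⌋₊ + 1 ≤ h := by rw [mem_Icc] at hn; omega
    have h3 : (⌊x⌋₊ : ℝ) + 1 ≤ h := by exact_mod_cast hLh
    have h4 : (1 : ℝ) * h ≤ ((M + k : ℕ) : ℝ) * h := by
      gcongr; linarith
    rw [max_eq_right (by linarith)]; simp

/-- Combines the expanded square, the divisor switch and the evaluation of `trapSum`. The
contribution of `divSum` stays unevaluated: apart from the factor `K` it depends only on `x`, and it
disappears when two values of `M` are compared. -/
theorem abs_VSum_sub_le {x : ℝ} (hx : 1 ≤ x) {M K L : ℕ} (hM : 1 ≤ M) (hL : ⌊x⌋₊ ≤ M * L)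
    {B X : ℕ → ℝ} (hB : ∀ h ∈ Icc 1 L, ∀ j ≤ ⌊x⌋₊, ∑ a ∈ Icc 1 h, En (j : ℝ) h a ^ 2 ≤ B h)
    (hX : ∀ h ∈ Icc 1 L, ∀ j ≤ ⌊x⌋₊, |crossSum (j : ℝ) h| ≤ X h) :
    |VSum x M K - (∑ k ∈ range K, (((M + k : ℕ) : ℝ) * r3SqSum x - m0 ^ 2 * Phi x (M + k))
        + 2 * (K * divSum ⌊x⌋₊))|
      ≤ 2 * x * (∑ k ∈ range K, ∑ q ∈ Icc 1 (M + k), |crossSum x q|)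
        + 2 * ∑ h ∈ Icc 1 L, (m0 ^ 2 * Gsum h * (x ^ 2 + K * (2 * x))
            + x * (3 * X h * (K * h)) + x * (4 * B h)) / h := by
  have hV : ∀ k, V x ((M + k : ℕ) : ℝ) = ((M + k : ℕ) : ℝ) * r3SqSum x
      + 2 * ∑ q ∈ Icc 1 (M + k), offDiag ⌊x⌋₊ q - 2 * x * ∑ q ∈ Icc 1 (M + k), crossSum x q
      - m0 ^ 2 * x ^ 2 * ∑ q ∈ Icc 1 (M + k), Gsum q / q := by
    intro k
    rw [V_eq, Nat.floor_natCast, Finset.sum_congr rfl fun q hq => sum_En_sq_eq x (mem_Icc.1 hq).1]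
    simp only [Finset.sum_sub_distrib, Finset.sum_add_distrib, ← Finset.mul_sum]
    simp
  have hPhi : ∀ k, Phi x (M + k) = ∑ h ∈ Icc 1 L, Gsum h / h * max (x - ((M + k : ℕ) : ℝ) * h) 0 ^ 2
      + x ^ 2 * ∑ q ∈ Icc 1 (M + k), Gsum q / q := by
    intro k
    unfold Phi
    rw [sum_Gsum_max_range hM hL]
  have hcomm : ∑ k ∈ range K, ∑ h ∈ Icc 1 L, Gsum h / h * max (x - ((M + k : ℕ) : ℝ) * h) 0 ^ 2
      = ∑ h ∈ Icc 1 L, 2 * (Gsum h * ∑ k ∈ range K, max (x - ((M + k : ℕ) : ℝ) * h) 0 ^ 2 / 2) / h := by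
    rw [Finset.sum_comm]
    refine Finset.sum_congr rfl fun h _ => ?_
    rw [Finset.mul_sum, Finset.mul_sum, Finset.sum_div]
    refine Finset.sum_congr rfl fun k _ => ?_
    ring
  have hoff := sum_offDiag_eq (K := K) hL
  have key : VSum x M K - (∑ k ∈ range K, (((M + k : ℕ) : ℝ) * r3SqSum x - m0 ^ 2 * Phi x (M + k))
        + 2 * (K * divSum ⌊x⌋₊))
      = -(2 * x * (∑ k ∈ range K, ∑ q ∈ Icc 1 (M + k), crossSum x q))
        - 2 * ∑ h ∈ Icc 1 L, (trapSum ⌊x⌋₊ M K h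
          - m0 ^ 2 * Gsum h * ∑ k ∈ range K, max (x - ((M + k : ℕ) : ℝ) * h) 0 ^ 2 / 2) / h := by
    unfold VSum
    simp only [hV, hPhi, Finset.sum_add_distrib, Finset.sum_sub_distrib, ← Finset.mul_sum]
    simp only [mul_add]
    rw [hoff, hcomm]
    have : ∑ h ∈ Icc 1 L, (trapSum ⌊x⌋₊ M K h
          - m0 ^ 2 * Gsum h * ∑ k ∈ range K, max (x - ((M + k : ℕ) : ℝ) * h) 0 ^ 2 / 2) / h
        = ∑ h ∈ Icc 1 L, trapSum ⌊x⌋₊ M K h / h - m0 ^ 2 / 2 * ∑ h ∈ Icc 1 L,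
          2 * (Gsum h * ∑ k ∈ range K, max (x - ((M + k : ℕ) : ℝ) * h) 0 ^ 2 / 2) / h := by
      rw [Finset.mul_sum, ← Finset.sum_sub_distrib]
      refine Finset.sum_congr rfl fun h _ => ?_
      ring
    rw [this]
    ring
  rw [key]
  refine (abs_sub _ _).trans (add_le_add ?_ ?_)
  · rw [abs_neg, abs_mul, abs_of_nonneg (by linarith : 0 ≤ 2 * x)]
    refine mul_le_mul_of_nonneg_left ?_ (by linarith)
    exact (Finset.abs_sum_le_sum_abs _ _).trans
      (Finset.sum_le_sum fun k _ => Finset.abs_sum_le_sum_abs _ _)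
  · rw [abs_mul, abs_of_pos (by norm_num : (0 : ℝ) < 2)]
    refine mul_le_mul_of_nonneg_left ?_ (by norm_num)
    refine (Finset.abs_sum_le_sum_abs _ _).trans (Finset.sum_le_sum fun h hh => ?_)
    rw [abs_div, Nat.abs_cast]
    exact div_le_div_of_nonneg_right (abs_trapSum_sub_le hx (mem_Icc.1 hh).1 (hB h hh) (hX h hh))
      (Nat.cast_nonneg _)

/-! ### Estimates for the error terms -/

section Abel

variable {a : ℕ → ℝ} {A B : ℝ} {L : ℕ}

lemma sum_Ioc_le_of_sum_Icc (ha : ∀ d, 0 ≤ a d)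
    (hS : ∀ D : ℕ, ∑ d ∈ Icc 1 D, a d ≤ A + B * (D : ℝ) ^ 2) (D : ℕ) :
    ∑ d ∈ Ioc L D, a d ≤ A + B * (D : ℝ) ^ 2 := by
  refine le_trans (Finset.sum_le_sum_of_subset_of_nonneg ?_ fun d _ _ => ha d) (hS D)
  intro d hd
  rw [mem_Ioc] at hd
  rw [mem_Icc]; omega

lemma sum_Ioc_succ {Z : ℕ} (h : L ≤ Z) (f : ℕ → ℝ) :
    ∑ d ∈ Ioc L (Z + 1), f d = ∑ d ∈ Ioc L Z, f d + f (Z + 1) :=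
  Finset.sum_Ioc_succ_top h f

/-- Partial summation in the form of an induction on `Z`: the quantity in `key` grows at each step
by at least the new term, because the partial sums are at most `A + B Z²`. -/
lemma sum_Ioc_div_le (ha : ∀ d, 0 ≤ a d) (hA : 0 ≤ A) (hB : 0 ≤ B) (hL : 1 ≤ L)
    (hS : ∀ D : ℕ, ∑ d ∈ Icc 1 D, a d ≤ A + B * (D : ℝ) ^ 2) (Z : ℕ) :
    ∑ d ∈ Ioc L Z, a d / d ≤ 2 * A / L + 2 * B * Z := by
  have hL' : (0 : ℝ) < L := by exact_mod_cast hL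
  rcases lt_or_ge Z L with h | h
  · rw [Ioc_eq_empty_of_le h.le]; simp; positivity
  have key : ∑ d ∈ Ioc L Z, a d / d
      ≤ (∑ d ∈ Ioc L Z, a d) / Z + A * (1 / L - 1 / Z) + B * (Z - L) := by
    induction Z, h using Nat.le_induction with
    | base => simp
    | succ Z hZ ih =>
      have hZ' : (0 : ℝ) < Z := by exact_mod_cast (by omega : 0 < Z)
      rw [sum_Ioc_succ hZ, sum_Ioc_succ hZ]
      have hs := sum_Ioc_le_of_sum_Icc (L := L) ha hS Z
      set S := ∑ d ∈ Ioc L Z, a d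
      push_cast
      have e : S / Z + A * (1 / L - 1 / Z) + B * (Z - L) + a (Z + 1) / (Z + 1)
          - ((S + a (Z + 1)) / (Z + 1) + A * (1 / L - 1 / (Z + 1)) + B * (Z + 1 - L))
          = (S - A) / (Z * (Z + 1)) - B := by field_simp; ring
      have h2 : (S - A) / (Z * (Z + 1)) ≤ B := by
        rw [div_le_iff₀ (by positivity)]; nlinarith
      linarith
  have hs := sum_Ioc_le_of_sum_Icc (L := L) ha hS Z
  have hLZ : (L : ℝ) ≤ Z := by exact_mod_cast h
  have hZ' : (0 : ℝ) < Z := hL'.trans_le hLZ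
  have h3 : (∑ d ∈ Ioc L Z, a d) / Z ≤ A / Z + B * Z := by
    rw [div_le_iff₀ hZ']
    have : (A / Z + B * Z) * Z = A + B * (Z : ℝ) ^ 2 := by field_simp
    rw [this]; exact hs
  have e1 : A * (1 / (L : ℝ) - 1 / Z) = A / L - A / Z := by ring
  have e2 : 2 * A / (L : ℝ) = A / L + A / L := by ring
  have h5 : 0 ≤ A / (L : ℝ) := by positivity
  nlinarith

lemma sum_Ioc_div_sq_le (ha : ∀ d, 0 ≤ a d) (hA : 0 ≤ A) (hB : 0 ≤ B) (hL : 1 ≤ L)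
    (hS : ∀ D : ℕ, ∑ d ∈ Icc 1 D, a d ≤ A + B * (D : ℝ) ^ 2) (Z : ℕ) :
    ∑ d ∈ Ioc L Z, a d / (d : ℝ) ^ 2 ≤ 2 * A / (L : ℝ) ^ 2 + B * (1 + 2 * harm Z) := by
  have hL' : (0 : ℝ) < L := by exact_mod_cast hL
  have hh0 : ∀ M, 0 ≤ harm M := fun M => Finset.sum_nonneg fun _ _ => by positivity
  rcases lt_or_ge Z L with h | h
  · rw [Ioc_eq_empty_of_le h.le]; have := hh0 Z; simp; positivity
  have key : ∑ d ∈ Ioc L Z, a d / (d : ℝ) ^ 2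
      ≤ (∑ d ∈ Ioc L Z, a d) / (Z : ℝ) ^ 2 + A * (1 / (L : ℝ) ^ 2 - 1 / (Z : ℝ) ^ 2)
        + 2 * B * (harm Z - harm L) := by
    induction Z, h using Nat.le_induction with
    | base => simp
    | succ Z hZ ih =>
      have hZ' : (0 : ℝ) < Z := by exact_mod_cast (by omega : 0 < Z)
      rw [sum_Ioc_succ hZ, sum_Ioc_succ hZ, harm_succ]
      have hs := sum_Ioc_le_of_sum_Icc (L := L) ha hS Z
      set S := ∑ d ∈ Ioc L Z, a d
      push_cast
      have e : S / (Z : ℝ) ^ 2 + A * (1 / (L : ℝ) ^ 2 - 1 / (Z : ℝ) ^ 2) + 2 * B * (harm Z - harm L)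
            + a (Z + 1) / ((Z : ℝ) + 1) ^ 2
          - ((S + a (Z + 1)) / ((Z : ℝ) + 1) ^ 2 + A * (1 / (L : ℝ) ^ 2 - 1 / ((Z : ℝ) + 1) ^ 2)
            + 2 * B * (harm Z + 1 / (Z + 1) - harm L))
          = (S - A) * (2 * Z + 1) / ((Z : ℝ) ^ 2 * (Z + 1) ^ 2) - 2 * B / (Z + 1) := by
        field_simp; ring
      have h2 : (S - A) * (2 * Z + 1) / ((Z : ℝ) ^ 2 * (Z + 1) ^ 2) ≤ 2 * B / (Z + 1) := by
        rw [div_le_div_iff₀ (by positivity) (by positivity)]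
        have h6 : (S - A) * (2 * Z + 1) ≤ B * (Z : ℝ) ^ 2 * (2 * (Z + 1)) := by
          have : (S - A) * (2 * Z + 1) ≤ B * (Z : ℝ) ^ 2 * (2 * Z + 1) := by gcongr; linarith
          have h7 : 0 ≤ B * (Z : ℝ) ^ 2 := by positivity
          nlinarith
        have h8 : (0 : ℝ) < (Z : ℝ) + 1 := by positivity
        nlinarith [mul_le_mul_of_nonneg_right h6 h8.le]
      linarith
  have hs := sum_Ioc_le_of_sum_Icc (L := L) ha hS Z
  have hLZ : (L : ℝ) ≤ Z := by exact_mod_cast h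
  have hZ' : (0 : ℝ) < Z := hL'.trans_le hLZ
  have h3 : (∑ d ∈ Ioc L Z, a d) / (Z : ℝ) ^ 2 ≤ A / (Z : ℝ) ^ 2 + B := by
    rw [div_le_iff₀ (by positivity)]
    have : (A / (Z : ℝ) ^ 2 + B) * (Z : ℝ) ^ 2 = A + B * (Z : ℝ) ^ 2 := by field_simp
    rw [this]; exact hs
  have e1 : A * (1 / (L : ℝ) ^ 2 - 1 / (Z : ℝ) ^ 2) = A / (L : ℝ) ^ 2 - A / (Z : ℝ) ^ 2 := by ring
  have e2 : 2 * A / (L : ℝ) ^ 2 = A / (L : ℝ) ^ 2 + A / (L : ℝ) ^ 2 := by ring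
  have h5 : 0 ≤ A / (L : ℝ) ^ 2 := by positivity
  have h6 := mul_nonneg hB (hh0 L)
  nlinarith

end Abel

/-! ### Bounds for cross terms and variance, split at the denominator `L`. -/

lemma harm_nonneg (M : ℕ) : 0 ≤ harm M := Finset.sum_nonneg fun _ _ => by positivity

lemma harm_mono {M N : ℕ} (h : M ≤ N) : harm M ≤ harm N :=
  Finset.sum_le_sum_of_subset_of_nonneg (Icc_subset_Icc_right h) fun _ _ _ => by positivity

lemma harm_le {M : ℕ} {x : ℝ} (hx : 1 ≤ x) (hM : (M : ℝ) ≤ x) : harm M ≤ 1 + Real.log x := by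
  rcases Nat.eq_zero_or_pos M with rfl | h
  · have := Real.log_nonneg hx
    simp [harm]; linarith
  · rw [harm_eq_harmonic]
    refine (harmonic_le_one_add_log M).trans ?_
    have : (0 : ℝ) < M := by exact_mod_cast h
    have := Real.log_le_log this hM
    linarith

lemma sum_div_sum_divisors_le (a : ℕ → ℝ) (ha : ∀ d, 0 ≤ a d) (Z : ℕ) :
    ∑ q ∈ Icc 1 Z, 1 / (q : ℝ) * ∑ d ∈ q.divisors, a d ≤ harm Z * ∑ d ∈ Icc 1 Z, a d / d := by
  have h1 := sum_Icc_sum_divisors Z (fun d n => a d / d * (1 / (n : ℝ)))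
  have h2 : ∀ q ∈ Icc 1 Z, 1 / (q : ℝ) * ∑ d ∈ q.divisors, a d
      = ∑ d ∈ q.divisors, a d / d * (1 / ((q / d : ℕ) : ℝ)) := by
    intro q hq
    rw [mem_Icc] at hq
    rw [Finset.mul_sum]
    refine Finset.sum_congr rfl fun d hd => ?_
    have hd' := Nat.dvd_of_mem_divisors hd
    have hd0 : (d : ℝ) ≠ 0 := by
      have := Nat.pos_of_mem_divisors hd
      exact_mod_cast this.ne'
    have hq0 : (q : ℝ) ≠ 0 := by exact_mod_cast (by omega : q ≠ 0)
    rw [Nat.cast_div hd' hd0]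
    field_simp
  rw [Finset.sum_congr rfl h2, h1, Finset.mul_sum]
  refine Finset.sum_le_sum fun d _ => ?_
  rw [← Finset.mul_sum, mul_comm]
  have : ∑ n ∈ Icc 1 (Z / d), 1 / (n : ℝ) ≤ harm Z := harm_mono (Nat.div_le_self _ _)
  exact mul_le_mul_of_nonneg_right this (div_nonneg (ha d) (Nat.cast_nonneg _))

/-- The sum of the series `A1Term`. -/
def gTot : ℝ := ∑' d, A1Term d

lemma one_le_gTot : 1 ≤ gTot := one_le_tsum_A1Term

lemma sum_A1Term_le (s : Finset ℕ) : ∑ d ∈ s, A1Term d ≤ gTot :=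
  summable_A1Term.sum_le_tsum _ fun d _ => A1Term_nonneg d

lemma sum_sq_En_le {y z : ℝ} (hy : 0 ≤ y) (hz : 0 ≤ z) (hzy : z ≤ y ^ 3) {q : ℕ} (hq : 0 < q) :
    ∑ a ∈ Icc 1 q, En z q a ^ 2 ≤ 9 * gTot * q * (y + q) ^ 4 := by
  refine (sum_En_sq_le z hz q hq).trans ?_
  have h1 : z ^ (1 / 3 : ℝ) ≤ y := by
    calc z ^ (1 / 3 : ℝ) ≤ (y ^ 3) ^ (1 / 3 : ℝ) := Real.rpow_le_rpow hz hzy (by norm_num)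
      _ = y := by rw [← Real.rpow_natCast, ← Real.rpow_mul hy]; norm_num
  have h2 : 0 ≤ z ^ (1 / 3 : ℝ) := by positivity
  have h3 := Gsum_le q
  have h4 := Gsum_nonneg q
  have h5 := one_le_gTot
  unfold gTot at *
  gcongr

lemma sqrt_Dd_le {y z : ℝ} (hy : 0 ≤ y) (hz : 0 ≤ z) (hzy : z ≤ y ^ 3) {d : ℕ} (hd : 0 < d) :
    Dd z d ≤ 9 * gTot * (d : ℝ) ^ 2 * (y + d) ^ 4 ∧ √(Dd z d) ≤ 3 * √gTot * d * (y + d) ^ 2 := by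
  have h1 : Dd z d ≤ 9 * gTot * (d : ℝ) ^ 2 * (y + d) ^ 4 := by
    refine (Dd_le z d hd).trans ?_
    have := mul_le_mul_of_nonneg_left (sum_sq_En_le hy hz hzy hd) (Nat.cast_nonneg (α := ℝ) d)
    refine this.trans (le_of_eq ?_)
    ring
  refine ⟨h1, Real.sqrt_le_iff.2 ⟨by positivity, h1.trans (le_of_eq ?_)⟩⟩
  have := Real.sq_sqrt (show 0 ≤ gTot by have := one_le_gTot; linarith)
  calc _ = 9 * (√gTot) ^ 2 * (d : ℝ) ^ 2 * (y + d) ^ 4 := by rw [this]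
    _ = _ := by ring

lemma sum_sqrt_A1Term_le (L : ℕ) : ∑ d ∈ Icc 1 L, √(A1Term d) ≤ √gTot * √L := by
  have h := Real.sum_sqrt_mul_sqrt_le (Icc 1 L) (f := A1Term) (g := fun _ => (1 : ℝ))
    A1Term_nonneg (fun _ => zero_le_one)
  simp only [Real.sqrt_one, mul_one, sum_const, Nat.card_Icc, add_tsub_cancel_right,
    nsmul_eq_mul] at h
  refine h.trans ?_
  gcongr
  exact sum_A1Term_le _

lemma sum_low_le {y : ℝ} (hy : 0 ≤ y) (L : ℕ) :
    ∑ d ∈ Icc 1 L, √(A1Term d) * (3 * √gTot * d * (y + d) ^ 2) / d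
      ≤ 3 * gTot * (y + L) ^ 2 * √L := by
  have h1 : ∀ d ∈ Icc 1 L, √(A1Term d) * (3 * √gTot * d * (y + d) ^ 2) / d
      ≤ 3 * √gTot * (y + L) ^ 2 * √(A1Term d) := by
    intro d hd
    rw [mem_Icc] at hd
    have hd0 : (0 : ℝ) < d := by exact_mod_cast hd.1
    have hdL : (d : ℝ) ≤ L := by exact_mod_cast hd.2
    have : √(A1Term d) * (3 * √gTot * d * (y + d) ^ 2) / d
        = 3 * √gTot * (y + d) ^ 2 * √(A1Term d) := by field_simp
    rw [this]
    gcongr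
  refine (Finset.sum_le_sum h1).trans ?_
  rw [← Finset.mul_sum]
  refine (mul_le_mul_of_nonneg_left (sum_sqrt_A1Term_le L) (by positivity)).trans (le_of_eq ?_)
  have := Real.mul_self_sqrt (show 0 ≤ gTot by have := one_le_gTot; linarith)
  linear_combination (3 * (y + L) ^ 2 * √L) * this

/-- An upper bound for `|crossSum j h|`, uniform for `j ≤ y³`. -/
def crossBound (y : ℝ) (h : ℕ) : ℝ :=
  m0 * (1 / (h : ℝ) * ∑ d ∈ h.divisors, √(A1Term d) * (3 * √gTot * d * (y + d) ^ 2))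

lemma abs_crossSum_le_crossBound {y z : ℝ} (hy : 0 ≤ y) (hz : 0 ≤ z) (hzy : z ≤ y ^ 3) {h : ℕ}
    (hh : 0 < h) : |crossSum z h| ≤ crossBound y h := by
  refine (abs_crossSum_le z h hh).trans ?_
  unfold crossBound
  rw [div_eq_mul_one_div, mul_assoc]
  have := m0_pos
  gcongr with d hd
  exact (sqrt_Dd_le hy hz hzy (Nat.pos_of_mem_divisors hd)).2

lemma sum_crossBound_le {y : ℝ} (hy : 0 ≤ y) (L : ℕ) :
    ∑ h ∈ Icc 1 L, crossBound y h ≤ m0 * (harm L * (3 * gTot * (y + L) ^ 2 * √L)) := by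
  unfold crossBound
  rw [← Finset.mul_sum]
  have h1 := sum_div_sum_divisors_le (fun d => √(A1Term d) * (3 * √gTot * d * (y + d) ^ 2))
    (fun d => by positivity) L
  have := m0_pos
  have h2 := harm_nonneg L
  have h3 := sum_low_le hy L
  gcongr
  exact h1.trans (mul_le_mul_of_nonneg_left h3 h2)

lemma sum_Icc_le_add_Ioc (L Z : ℕ) (f : ℕ → ℝ) (hf : ∀ d, 0 ≤ f d) :
    ∑ d ∈ Icc 1 Z, f d ≤ ∑ d ∈ Icc 1 L, f d + ∑ d ∈ Ioc L Z, f d := by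
  have hdis : Disjoint (Icc 1 L) (Ioc L Z) := by
    rw [Finset.disjoint_left]; intro d hd; simp only [mem_Icc, mem_Ioc] at hd ⊢; omega
  rw [← Finset.sum_union hdis]
  refine Finset.sum_le_sum_of_subset_of_nonneg ?_ fun d _ _ => hf d
  intro d hd
  simp only [mem_union, mem_Icc, mem_Ioc] at hd ⊢; omega

lemma sum_Ioc_A1Term_div_le {L : ℕ} (hL : 1 ≤ L) (Z : ℕ) :
    ∑ d ∈ Ioc L Z, A1Term d / d ≤ gTot / L := by
  have hL' : (0 : ℝ) < L := by exact_mod_cast hL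
  have h1 : ∀ d ∈ Ioc L Z, A1Term d / d ≤ A1Term d / L := by
    intro d hd
    rw [mem_Ioc] at hd
    have : (L : ℝ) ≤ d := by exact_mod_cast hd.1.le
    exact div_le_div_of_nonneg_left (A1Term_nonneg d) hL' this
  refine (Finset.sum_le_sum h1).trans ?_
  rw [← Finset.sum_div]
  have := sum_A1Term_le (Ioc L Z)
  gcongr

/-- The constant in the large sieve inequality. -/
def lsC : ℝ := Real.exp (2 * π) ^ 2

lemma lsC_pos : 0 < lsC := by unfold lsC; positivity

lemma r3SqSum_nonneg (x : ℝ) : 0 ≤ r3SqSum x := Finset.sum_nonneg fun _ _ => sq_nonneg _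

lemma sum_Ld_le' {x : ℝ} (hx : 0 ≤ x) (D : ℕ) :
    ∑ d ∈ Icc 1 D, Ld x d ≤ lsC * x * r3SqSum x + lsC * r3SqSum x * (D : ℝ) ^ 2 :=
  (sum_Ld_le x hx D).trans (le_of_eq (by unfold lsC; ring))

/-- Cauchy–Schwarz over `d` separates the singular series coefficients from the exponential sums.
The latter are handled by the large sieve and partial summation against `d⁻²`. The last summand
comes from the main term contained in `Dd`. -/
lemma sum_Ioc_cross_le {x : ℝ} (hx : 0 ≤ x) {L : ℕ} (hL : 1 ≤ L) (Z : ℕ) :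
    ∑ d ∈ Ioc L Z, √(A1Term d) * √(Dd x d) / d
      ≤ 2 * √gTot * √(2 * (lsC * x * r3SqSum x) / (L : ℝ) ^ 2 + lsC * r3SqSum x * (1 + 2 * harm Z))
        + 2 * m0 * x * (gTot / L) := by
  have hm := m0_pos
  have h1 : ∀ d ∈ Ioc L Z, √(A1Term d) * √(Dd x d) / d
      ≤ 2 * (√(A1Term d) * √(Ld x d / (d : ℝ) ^ 2)) + 2 * m0 * x * (A1Term d / d) := by
    intro d hd
    rw [mem_Ioc] at hd
    have hd0 : (0 : ℝ) < d := by exact_mod_cast (by omega : 0 < d)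
    have hs : √(Dd x d) ≤ 2 * √(Ld x d) + 2 * m0 * x * √(A1Term d) := by
      refine Real.sqrt_le_iff.2 ⟨by positivity, (Dd_le_Ld x d).trans ?_⟩
      have e1 := Real.sq_sqrt (Ld_nonneg x d)
      have e2 := Real.sq_sqrt (A1Term_nonneg d)
      have e3 : 0 ≤ √(Ld x d) * (m0 * x * √(A1Term d)) := by positivity
      have e4 : 0 ≤ m0 ^ 2 * x ^ 2 * A1Term d := by have := A1Term_nonneg d; positivity
      have e5 := Ld_nonneg x d
      have e6 : (2 * √(Ld x d) + 2 * m0 * x * √(A1Term d)) ^ 2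
          = 4 * (√(Ld x d)) ^ 2 + 8 * (√(Ld x d) * (m0 * x * √(A1Term d)))
            + 4 * (m0 ^ 2 * x ^ 2 * (√(A1Term d)) ^ 2) := by ring
      rw [e6, e1, e2]; linarith
    rw [Real.sqrt_div' _ (by positivity), Real.sqrt_sq hd0.le]
    have e7 := Real.mul_self_sqrt (A1Term_nonneg d)
    calc √(A1Term d) * √(Dd x d) / d
        ≤ √(A1Term d) * (2 * √(Ld x d) + 2 * m0 * x * √(A1Term d)) / d := by gcongr
      _ = 2 * (√(A1Term d) * (√(Ld x d) / d)) + 2 * m0 * x * ((√(A1Term d) * √(A1Term d)) / d) := by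
          ring
      _ = _ := by rw [e7]
  refine (Finset.sum_le_sum h1).trans ?_
  rw [Finset.sum_add_distrib, ← Finset.mul_sum, ← Finset.mul_sum]
  have h2 := Real.sum_sqrt_mul_sqrt_le (Ioc L Z) (f := A1Term) (g := fun d => Ld x d / (d : ℝ) ^ 2)
    A1Term_nonneg (fun d => div_nonneg (Ld_nonneg x d) (by positivity))
  have hR := r3SqSum_nonneg x
  have hl := lsC_pos
  have h3 := sum_Ioc_div_sq_le (L := L) (Ld_nonneg x) (by positivity) (by positivity) hL
    (sum_Ld_le' hx) Z
  have h4 := sum_Ioc_A1Term_div_le hL Z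
  have h5 := sum_A1Term_le (Ioc L Z)
  have h6 : √(∑ d ∈ Ioc L Z, A1Term d) * √(∑ d ∈ Ioc L Z, Ld x d / (d : ℝ) ^ 2)
      ≤ √gTot * √(2 * (lsC * x * r3SqSum x) / (L : ℝ) ^ 2 + lsC * r3SqSum x * (1 + 2 * harm Z)) :=
    mul_le_mul (Real.sqrt_le_sqrt h5) (Real.sqrt_le_sqrt h3) (Real.sqrt_nonneg _) (Real.sqrt_nonneg _)
  have h7 : 2 * m0 * x * ∑ d ∈ Ioc L Z, A1Term d / d ≤ 2 * m0 * x * (gTot / L) :=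
    mul_le_mul_of_nonneg_left h4 (by positivity)
  linarith [h2.trans h6]

lemma sum_abs_crossSum_le {y : ℝ} (hy : 0 ≤ y) {L : ℕ} (hL : 1 ≤ L) (Z : ℕ) :
    ∑ q ∈ Icc 1 Z, |crossSum (y ^ 3) q| ≤ m0 * (harm Z * (3 * gTot * (y + L) ^ 2 * √L
      + (2 * √gTot * √(2 * (lsC * y ^ 3 * r3SqSum (y ^ 3)) / (L : ℝ) ^ 2
          + lsC * r3SqSum (y ^ 3) * (1 + 2 * harm Z)) + 2 * m0 * y ^ 3 * (gTot / L)))) := by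
  have hx : 0 ≤ y ^ 3 := by positivity
  have hm := m0_pos
  have h1 : ∀ q ∈ Icc 1 Z, |crossSum (y ^ 3) q|
      ≤ m0 * (1 / (q : ℝ) * ∑ d ∈ q.divisors, √(A1Term d) * √(Dd (y ^ 3) d)) := by
    intro q hq
    refine (abs_crossSum_le _ q (mem_Icc.1 hq).1).trans (le_of_eq ?_)
    ring
  refine (Finset.sum_le_sum h1).trans ?_
  rw [← Finset.mul_sum]
  refine mul_le_mul_of_nonneg_left ?_ hm.le
  refine (sum_div_sum_divisors_le _ (fun d => by positivity) Z).trans ?_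
  refine mul_le_mul_of_nonneg_left ?_ (harm_nonneg Z)
  refine (sum_Icc_le_add_Ioc L Z _ fun d => by positivity).trans ?_
  refine add_le_add ?_ (sum_Ioc_cross_le hx hL Z)
  refine le_trans (Finset.sum_le_sum fun d hd => ?_) (sum_low_le hy L)
  have := (sqrt_Dd_le hy hx le_rfl (mem_Icc.1 hd).1).2
  gcongr

/-- Denominators up to `L` are treated by lattice points, the others by the large sieve and partial
summation. -/
lemma V_le {y : ℝ} (hy : 0 ≤ y) {L : ℕ} (hL : 1 ≤ L) (Z : ℕ) :
    V (y ^ 3) Z ≤ harm Z * (9 * gTot * (L : ℝ) ^ 2 * (y + L) ^ 4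
      + (2 * (2 * (lsC * y ^ 3 * r3SqSum (y ^ 3)) / L + 2 * (lsC * r3SqSum (y ^ 3)) * Z)
        + 2 * m0 ^ 2 * (y ^ 3) ^ 2 * (gTot / L))) := by
  have hx : 0 ≤ y ^ 3 := by positivity
  have hg := one_le_gTot
  rw [V_eq, Nat.floor_natCast, Finset.sum_congr rfl fun q hq => sum_En_sq _ q (mem_Icc.1 hq).1]
  refine (sum_div_sum_divisors_le _ (Dd_nonneg _) Z).trans ?_
  refine mul_le_mul_of_nonneg_left ?_ (harm_nonneg Z)
  refine (sum_Icc_le_add_Ioc L Z _ fun d => div_nonneg (Dd_nonneg _ d) (Nat.cast_nonneg _)).trans ?_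
  refine add_le_add ?_ ?_
  · have h1 : ∀ d ∈ Icc 1 L, Dd (y ^ 3) d / d ≤ 9 * gTot * L * (y + L) ^ 4 := by
      intro d hd
      rw [mem_Icc] at hd
      have hd0 : (0 : ℝ) < d := by exact_mod_cast hd.1
      have hdL : (d : ℝ) ≤ L := by exact_mod_cast hd.2
      rw [div_le_iff₀ hd0]
      refine (sqrt_Dd_le hy hx le_rfl hd.1).1.trans ?_
      calc 9 * gTot * (d : ℝ) ^ 2 * (y + d) ^ 4 = 9 * gTot * d * (y + d) ^ 4 * d := by ring
        _ ≤ 9 * gTot * L * (y + L) ^ 4 * d := by gcongr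
    refine (Finset.sum_le_sum h1).trans (le_of_eq ?_)
    simp; ring
  · have h1 : ∀ d ∈ Ioc L Z, Dd (y ^ 3) d / d
        ≤ 2 * (Ld (y ^ 3) d / d) + 2 * m0 ^ 2 * (y ^ 3) ^ 2 * (A1Term d / d) := by
      intro d _
      have := div_le_div_of_nonneg_right (Dd_le_Ld (y ^ 3) d) (Nat.cast_nonneg (α := ℝ) d)
      refine this.trans (le_of_eq ?_)
      ring
    refine (Finset.sum_le_sum h1).trans ?_
    rw [Finset.sum_add_distrib, ← Finset.mul_sum, ← Finset.mul_sum]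
    have hR := r3SqSum_nonneg (y ^ 3)
    have hl := lsC_pos
    have h3 := sum_Ioc_div_le (L := L) (Ld_nonneg (y ^ 3)) (by positivity) (by positivity) hL
      (sum_Ld_le' hx) Z
    have h4 := sum_Ioc_A1Term_div_le hL Z
    have h5 : 2 * m0 ^ 2 * (y ^ 3) ^ 2 * ∑ d ∈ Ioc L Z, A1Term d / d
      ≤ 2 * m0 ^ 2 * (y ^ 3) ^ 2 * (gTot / L) := mul_le_mul_of_nonneg_left h4 (by positivity)
    linarith

/-! ### Error estimates at the chosen scale -/

/-- Relations between `y = x^{1/3}` and `w`, where `w⁶ y = ∑ r₃(n)²`. -/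
structure Scale (c y w Λ : ℝ) : Prop where
  one_le_y : 1 ≤ y
  one_le_w : 1 ≤ w
  one_le_Λ : 1 ≤ Λ
  y_le : y ≤ c * w ^ 3
  w_sq_le : w ^ 2 ≤ y * Λ
  w_sq_le_cube : w ^ 2 ≤ y ^ 3
  r3SqSum_eq : r3SqSum (y ^ 3) = w ^ 6 * y

/-- The logarithmic factor. -/
def logFactor (y : ℝ) : ℝ := 1 + Real.log (4 * y ^ 3)

/-- The number of averaged moduli. -/
def avgLen (y w : ℝ) : ℕ := ⌈y ^ 3 / w ^ 2⌉₊

/-- The number of complementary divisors. -/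
def coLen (w : ℝ) : ℕ := ⌈w ^ 2⌉₊

/-- The size of the error terms. -/
def errSize (y w Λ : ℝ) : ℝ := logFactor y ^ 2 * Λ ^ 4 * (y ^ 4 * w ^ 4)

namespace Scale

variable {c y w Λ : ℝ}

lemma y_pos (hs : Scale c y w Λ) : 0 < y := zero_lt_one.trans_le hs.one_le_y
lemma w_pos (hs : Scale c y w Λ) : 0 < w := zero_lt_one.trans_le hs.one_le_w

lemma one_le_cube (hs : Scale c y w Λ) : 1 ≤ y ^ 3 := one_le_pow₀ hs.one_le_y

lemma c_pos (hs : Scale c y w Λ) : 0 < c := by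
  have h := hs.y_pos.trans_le hs.y_le
  have := hs.w_pos
  exact pos_of_mul_pos_left h (by positivity)

lemma one_le_logFactor (hs : Scale c y w Λ) : 1 ≤ logFactor y := by
  have := Real.log_nonneg (show 1 ≤ 4 * y ^ 3 by linarith [hs.one_le_cube])
  unfold logFactor; linarith

lemma harm_le (hs : Scale c y w Λ) {Z : ℕ} (hZ : (Z : ℝ) ≤ 4 * y ^ 3) : harm Z ≤ logFactor y :=
  CubeVariance.harm_le (by linarith [hs.one_le_cube]) hZ

lemma coLen_bounds (hs : Scale c y w Λ) :
    1 ≤ coLen w ∧ w ^ 2 ≤ coLen w ∧ (coLen w : ℝ) ≤ 2 * w ^ 2 := by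
  have h1 : 1 ≤ w ^ 2 := one_le_pow₀ hs.one_le_w
  have h2 := Nat.ceil_lt_add_one (show 0 ≤ w ^ 2 by positivity)
  have h3 := Nat.le_ceil (w ^ 2)
  refine ⟨Nat.one_le_ceil_iff.2 (by linarith), h3, ?_⟩
  unfold coLen; linarith

lemma avgLen_bounds (hs : Scale c y w Λ) :
    1 ≤ avgLen y w ∧ y ^ 3 ≤ avgLen y w * w ^ 2 ∧ (avgLen y w : ℝ) * w ^ 2 ≤ 2 * y ^ 3 := by
  have hw : 0 < w ^ 2 := by have := hs.w_pos; positivity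
  have h1 : 1 ≤ y ^ 3 / w ^ 2 := (one_le_div hw).2 hs.w_sq_le_cube
  have h2 := Nat.ceil_lt_add_one (show 0 ≤ y ^ 3 / w ^ 2 by linarith)
  have h3 := Nat.le_ceil (y ^ 3 / w ^ 2)
  refine ⟨Nat.one_le_ceil_iff.2 (by linarith), (div_le_iff₀ hw).1 h3, ?_⟩
  rw [← le_div_iff₀ hw, mul_div_assoc]
  unfold avgLen; linarith

lemma avgLen_le (hs : Scale c y w Λ) : (avgLen y w : ℝ) ≤ 2 * y ^ 3 := by
  obtain ⟨-, -, h⟩ := hs.avgLen_bounds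
  have h1 : 1 ≤ w ^ 2 := one_le_pow₀ hs.one_le_w
  nlinarith [Nat.cast_nonneg (α := ℝ) (avgLen y w)]

lemma floor_le (hs : Scale c y w Λ) {M : ℕ} (hM : avgLen y w ≤ M) : ⌊y ^ 3⌋₊ ≤ M * coLen w := by
  obtain ⟨-, h1, -⟩ := hs.avgLen_bounds
  obtain ⟨-, h2, -⟩ := hs.coLen_bounds
  have h3 : y ^ 3 ≤ ((M * coLen w : ℕ) : ℝ) := by
    push_cast
    have : (avgLen y w : ℝ) ≤ M := by exact_mod_cast hM
    calc y ^ 3 ≤ avgLen y w * w ^ 2 := h1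
      _ ≤ M * coLen w := by gcongr
  exact Nat.floor_le_of_le h3

lemma y_add_le (hs : Scale c y w Λ) : y + coLen w ≤ 3 * (y * Λ) := by
  obtain ⟨-, -, h⟩ := hs.coLen_bounds
  have h1 := hs.w_sq_le
  have : y ≤ y * Λ := le_mul_of_one_le_right hs.y_pos.le hs.one_le_Λ
  linarith

/-- `y⁵ w` is the order of the cross terms from small denominators. The condition `y ≤ c w³`, which
expresses `R ≫ x`, absorbs it. -/
lemma y_pow_five (hs : Scale c y w Λ) : y ^ 5 * w ≤ c * (y ^ 4 * w ^ 4) := by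
  have hy := hs.y_pos
  have hw := hs.w_pos
  calc y ^ 5 * w = y ^ 4 * w * y := by ring
    _ ≤ y ^ 4 * w * (c * w ^ 3) := by gcongr; exact hs.y_le
    _ = _ := by ring

lemma y_pow_six (hs : Scale c y w Λ) : y ^ 6 / w ^ 2 ≤ c ^ 2 * (y ^ 4 * w ^ 4) := by
  have hy := hs.y_pos
  have hw := hs.w_pos
  rw [div_le_iff₀ (by positivity)]
  calc y ^ 6 = y ^ 4 * y ^ 2 := by ring
    _ ≤ y ^ 4 * (c * w ^ 3) ^ 2 := by gcongr; exact hs.y_le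
    _ = _ := by ring

/-- The lattice point bound for denominators up to `coLen w`, where `w² ≤ y Λ` keeps `y + d`
comparable with `y` apart from the factor `Λ`. -/
lemma low_le (hs : Scale c y w Λ) : y ^ 3 * (3 * gTot * (y + coLen w) ^ 2 * √(coLen w))
    ≤ 54 * gTot * c * (Λ ^ 2 * (y ^ 4 * w ^ 4)) := by
  have hy := hs.y_pos
  have hw := hs.w_pos
  have hΛ := hs.one_le_Λ
  have hg := one_le_gTot
  obtain ⟨-, -, hL⟩ := hs.coLen_bounds
  have h1 : √(coLen w) ≤ 2 * w := by
    refine Real.sqrt_le_iff.2 ⟨by positivity, hL.trans ?_⟩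
    nlinarith [sq_nonneg w]
  have h2 := hs.y_add_le
  have h3 := hs.y_pow_five
  calc y ^ 3 * (3 * gTot * (y + coLen w) ^ 2 * √(coLen w))
      ≤ y ^ 3 * (3 * gTot * (3 * (y * Λ)) ^ 2 * (2 * w)) := by gcongr
    _ = 54 * gTot * Λ ^ 2 * (y ^ 5 * w) := by ring
    _ ≤ 54 * gTot * Λ ^ 2 * (c * (y ^ 4 * w ^ 4)) := by gcongr
    _ = _ := by ring

lemma mid_le (hs : Scale c y w Λ) {Z : ℕ} (hZ : (Z : ℝ) ≤ 4 * y ^ 3) :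
    y ^ 3 * (2 * √gTot * √(2 * (lsC * y ^ 3 * r3SqSum (y ^ 3)) / (coLen w : ℝ) ^ 2
          + lsC * r3SqSum (y ^ 3) * (1 + 2 * harm Z)))
    ≤ 2 * √gTot * √(3 * lsC) * (c + 1) * (logFactor y * (y ^ 4 * w ^ 4)) := by
  have hy := hs.y_pos
  have hw := hs.w_pos
  have hl := lsC_pos
  have hP := hs.one_le_logFactor
  have hP0 : 0 ≤ logFactor y := by linarith
  have hh := hs.harm_le hZ
  obtain ⟨-, hL, -⟩ := hs.coLen_bounds
  have h5 := hs.y_pow_five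
  have hy1 := hs.one_le_y
  have hw1 := hs.one_le_w
  rw [hs.r3SqSum_eq]
  have ha : 2 * (lsC * y ^ 3 * (w ^ 6 * y)) / (coLen w : ℝ) ^ 2 ≤ 2 * lsC * (y ^ 2 * w) ^ 2 := by
    have h0 : (w ^ 2) ^ 2 ≤ (coLen w : ℝ) ^ 2 := by gcongr
    rw [div_le_iff₀ (lt_of_lt_of_le (by positivity) h0)]
    calc 2 * (lsC * y ^ 3 * (w ^ 6 * y)) = 2 * lsC * (y ^ 2 * w) ^ 2 * (w ^ 2) ^ 2 := by ring
      _ ≤ _ := by gcongr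
  have hb : lsC * (w ^ 6 * y) * (1 + 2 * harm Z) ≤ lsC * (w ^ 3 * y) ^ 2 * (3 * logFactor y) := by
    have h0 : w ^ 6 * y ≤ (w ^ 3 * y) ^ 2 := by
      calc w ^ 6 * y = w ^ 6 * y * 1 := by ring
        _ ≤ w ^ 6 * y * y := by gcongr
        _ = _ := by ring
    have h1 : 1 + 2 * harm Z ≤ 3 * logFactor y := by linarith
    have h2 : 0 ≤ 1 + 2 * harm Z := by have := harm_nonneg Z; linarith
    gcongr
  have hsum : √(2 * (lsC * y ^ 3 * (w ^ 6 * y)) / (coLen w : ℝ) ^ 2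
      + lsC * (w ^ 6 * y) * (1 + 2 * harm Z)) ≤ √(3 * lsC) * logFactor y * (y ^ 2 * w + w ^ 3 * y) := by
    refine Real.sqrt_le_iff.2 ⟨by positivity, (add_le_add ha hb).trans ?_⟩
    have e0 : (√(3 * lsC) * logFactor y * (y ^ 2 * w + w ^ 3 * y)) ^ 2
        = 3 * lsC * logFactor y ^ 2 * (y ^ 2 * w + w ^ 3 * y) ^ 2 := by
      rw [mul_pow, mul_pow, Real.sq_sqrt (by positivity)]
    rw [e0]
    have h1 : 2 * lsC * (y ^ 2 * w) ^ 2 ≤ 3 * lsC * logFactor y ^ 2 * (y ^ 2 * w) ^ 2 := by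
      have : 1 ≤ logFactor y ^ 2 := one_le_pow₀ hP
      have : 2 * lsC ≤ 3 * lsC * logFactor y ^ 2 := by nlinarith
      gcongr
    have h2 : lsC * (w ^ 3 * y) ^ 2 * (3 * logFactor y) ≤ 3 * lsC * logFactor y ^ 2 * (w ^ 3 * y) ^ 2 := by
      have : logFactor y ≤ logFactor y ^ 2 := by nlinarith
      calc lsC * (w ^ 3 * y) ^ 2 * (3 * logFactor y) = 3 * lsC * logFactor y * (w ^ 3 * y) ^ 2 := by ring
        _ ≤ _ := by gcongr
    have h3 : 0 ≤ 3 * lsC * logFactor y ^ 2 * (2 * (y ^ 2 * w) * (w ^ 3 * y)) := by positivity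
    calc _ ≤ _ := add_le_add h1 h2
      _ ≤ 3 * lsC * logFactor y ^ 2 * (y ^ 2 * w) ^ 2 + 3 * lsC * logFactor y ^ 2 * (w ^ 3 * y) ^ 2
          + 3 * lsC * logFactor y ^ 2 * (2 * (y ^ 2 * w) * (w ^ 3 * y)) := by linarith
      _ = _ := by ring
  calc _ ≤ y ^ 3 * (2 * √gTot * (√(3 * lsC) * logFactor y * (y ^ 2 * w + w ^ 3 * y))) := by gcongr
    _ = 2 * √gTot * √(3 * lsC) * logFactor y * (y ^ 5 * w + y ^ 4 * w ^ 3 * 1) := by ring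
    _ ≤ 2 * √gTot * √(3 * lsC) * logFactor y * (c * (y ^ 4 * w ^ 4) + y ^ 4 * w ^ 3 * w) := by gcongr
    _ = _ := by ring

lemma high_le (hs : Scale c y w Λ) :
    y ^ 3 * (2 * m0 * y ^ 3 * (gTot / coLen w)) ≤ 2 * m0 * gTot * c ^ 2 * (y ^ 4 * w ^ 4) := by
  have hy := hs.y_pos
  have hw := hs.w_pos
  have hm := m0_pos
  have hg := one_le_gTot
  obtain ⟨-, hL, -⟩ := hs.coLen_bounds
  calc y ^ 3 * (2 * m0 * y ^ 3 * (gTot / coLen w))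
      ≤ y ^ 3 * (2 * m0 * y ^ 3 * (gTot / w ^ 2)) := by gcongr
    _ = 2 * m0 * gTot * (y ^ 6 / w ^ 2) := by ring
    _ ≤ 2 * m0 * gTot * (c ^ 2 * (y ^ 4 * w ^ 4)) := by gcongr; exact hs.y_pow_six
    _ = _ := by ring

lemma errSize_ge (hs : Scale c y w Λ) :
    logFactor y * Λ ^ 2 * (y ^ 4 * w ^ 4) * logFactor y ≤ errSize y w Λ ∧
    logFactor y * Λ ^ 2 * (y ^ 4 * w ^ 4) ≤ errSize y w Λ ∧
    logFactor y * Λ ^ 4 * (y ^ 4 * w ^ 4) ≤ errSize y w Λ ∧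
    logFactor y * (y ^ 4 * w ^ 4) ≤ errSize y w Λ := by
  have hy := hs.y_pos
  have hw := hs.w_pos
  have hΛ := hs.one_le_Λ
  have hP := hs.one_le_logFactor
  have hP0 : 0 ≤ logFactor y := by linarith
  have h1 : Λ ^ 2 ≤ Λ ^ 4 := pow_le_pow_right₀ hΛ (by norm_num)
  have h2 : logFactor y ≤ logFactor y ^ 2 := by nlinarith
  have h3 : 1 ≤ Λ ^ 4 := one_le_pow₀ hΛ
  unfold errSize
  refine ⟨?_, ?_, ?_, ?_⟩
  · calc _ = logFactor y ^ 2 * Λ ^ 2 * (y ^ 4 * w ^ 4) := by ring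
      _ ≤ _ := by gcongr
  · gcongr
  · gcongr
  · calc _ = logFactor y * 1 * (y ^ 4 * w ^ 4) := by ring
      _ ≤ _ := by gcongr

/-- The constant in the bound for the sum of the cross terms. -/
def crossC (c : ℝ) : ℝ :=
  54 * gTot * c + 2 * √gTot * √(3 * lsC) * (c + 1) + 2 * m0 * gTot * c ^ 2

lemma cross_total_le (hs : Scale c y w Λ) {Z : ℕ} (hZ : (Z : ℝ) ≤ 4 * y ^ 3) :
    y ^ 3 * ∑ q ∈ Icc 1 Z, |crossSum (y ^ 3) q| ≤ m0 * crossC c * errSize y w Λ := by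
  have hy := hs.y_pos
  have hw := hs.w_pos
  have hΛ := hs.one_le_Λ
  have hm := m0_pos
  have hg := one_le_gTot
  have hc := hs.c_pos
  have hP := hs.one_le_logFactor
  have hP0 : 0 ≤ logFactor y := by linarith
  have hh := hs.harm_le hZ
  obtain ⟨hL1, -, -⟩ := hs.coLen_bounds
  have h0 := sum_abs_crossSum_le hy.le hL1 Z
  have h1 := hs.low_le
  have h2 := hs.mid_le hZ
  have h3 := hs.high_le
  set T1 := 3 * gTot * (y + coLen w) ^ 2 * √(coLen w)
  set T2 := 2 * √gTot * √(2 * (lsC * y ^ 3 * r3SqSum (y ^ 3)) / (coLen w : ℝ) ^ 2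
          + lsC * r3SqSum (y ^ 3) * (1 + 2 * harm Z))
  set T3 := 2 * m0 * y ^ 3 * (gTot / coLen w)
  have ht : 0 ≤ T1 + (T2 + T3) := by positivity
  set E := logFactor y * Λ ^ 2 * (y ^ 4 * w ^ 4) with hE
  have hΛ2 : 1 ≤ Λ ^ 2 := one_le_pow₀ hΛ
  have e1 : Λ ^ 2 * (y ^ 4 * w ^ 4) ≤ E := by
    rw [hE, mul_assoc]; exact le_mul_of_one_le_left (by positivity) hP
  have e2 : logFactor y * (y ^ 4 * w ^ 4) ≤ E := by
    rw [hE]; gcongr; exact le_mul_of_one_le_right hP0 hΛ2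
  have e3 : y ^ 4 * w ^ 4 ≤ E := (le_mul_of_one_le_left (by positivity) hP).trans e2
  have hsum : y ^ 3 * (T1 + (T2 + T3)) ≤ crossC c * E := by
    unfold crossC
    have f1 := h1.trans (mul_le_mul_of_nonneg_left e1 (by positivity))
    have f2 := h2.trans (mul_le_mul_of_nonneg_left e2 (by positivity))
    have f3 := h3.trans (mul_le_mul_of_nonneg_left e3 (by positivity))
    linarith
  have hcc : 0 ≤ crossC c := by unfold crossC; positivity
  calc y ^ 3 * ∑ q ∈ Icc 1 Z, |crossSum (y ^ 3) q|
      ≤ y ^ 3 * (m0 * (harm Z * (T1 + (T2 + T3)))) := by gcongr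
    _ ≤ y ^ 3 * (m0 * (logFactor y * (T1 + (T2 + T3)))) := by gcongr
    _ = m0 * logFactor y * (y ^ 3 * (T1 + (T2 + T3))) := by ring
    _ ≤ m0 * logFactor y * (crossC c * E) := by gcongr
    _ = m0 * crossC c * (E * logFactor y) := by ring
    _ ≤ m0 * crossC c * errSize y w Λ := by gcongr; exact hs.errSize_ge.1

lemma cross_low_le (hs : Scale c y w Λ) :
    y ^ 3 * ∑ h ∈ Icc 1 (coLen w), crossBound y h ≤ m0 * (54 * gTot * c) * errSize y w Λ := by
  have hy := hs.y_pos
  have hm := m0_pos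
  have hg := one_le_gTot
  have hc := hs.c_pos
  have hP := hs.one_le_logFactor
  have hP0 : 0 ≤ logFactor y := by linarith
  obtain ⟨hL1, -, hL2⟩ := hs.coLen_bounds
  have hh := hs.harm_le (Z := coLen w) (by linarith [hs.w_sq_le_cube, hs.one_le_cube])
  have h0 := sum_crossBound_le hy.le (coLen w)
  have h1 := hs.low_le
  set T1 := 3 * gTot * (y + coLen w) ^ 2 * √(coLen w)
  have ht : 0 ≤ T1 := by positivity
  calc y ^ 3 * ∑ h ∈ Icc 1 (coLen w), crossBound y h
      ≤ y ^ 3 * (m0 * (harm (coLen w) * T1)) := by gcongr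
    _ ≤ y ^ 3 * (m0 * (logFactor y * T1)) := by gcongr
    _ = m0 * logFactor y * (y ^ 3 * T1) := by ring
    _ ≤ m0 * logFactor y * (54 * gTot * c * (Λ ^ 2 * (y ^ 4 * w ^ 4))) := by gcongr
    _ = m0 * (54 * gTot * c) * (logFactor y * Λ ^ 2 * (y ^ 4 * w ^ 4)) := by ring
    _ ≤ _ := by gcongr; exact hs.errSize_ge.2.1

/-- The constant in the bound for the error in the switched sum. -/
def switchC (c : ℝ) : ℝ :=
  2 * (m0 * crossC c) + 2 * (5 * (m0 ^ 2 * gTot) + 3 * (m0 * (54 * gTot * c)) + 5832 * gTot)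

/-- After division by `K` each error is at most of order `y⁴ w⁴`, apart from logarithms and powers
of `Λ`. The critical one comes from products of deviations: `x ∑ (y + h)⁴` over `h ≤ 2 w²` is about
`y⁷ w²`, that is `K y⁴ w⁴`. -/
theorem abs_VSum_sub_le (hs : Scale c y w Λ) {M : ℕ} (hM : avgLen y w ≤ M) (hMx : (M : ℝ) ≤ y ^ 3) :
    |VSum (y ^ 3) M (avgLen y w)
      - (∑ k ∈ range (avgLen y w), (((M + k : ℕ) : ℝ) * r3SqSum (y ^ 3) - m0 ^ 2 * Phi (y ^ 3) (M + k))
        + 2 * (avgLen y w * divSum ⌊y ^ 3⌋₊))| ≤ switchC c * (avgLen y w * errSize y w Λ) := by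
  have hy := hs.y_pos
  have hw := hs.w_pos
  have hm := m0_pos
  have hg := one_le_gTot
  have hc := hs.c_pos
  have hΛ := hs.one_le_Λ
  have hP := hs.one_le_logFactor
  have hP0 : 0 ≤ logFactor y := by linarith
  have hx1 := hs.one_le_cube
  obtain ⟨hL1, hLw, hL2⟩ := hs.coLen_bounds
  obtain ⟨hK1, hK2, hK3⟩ := hs.avgLen_bounds
  have hK4 := hs.avgLen_le
  have hfl := hs.floor_le hM
  have hyΛ := hs.y_add_le
  obtain ⟨-, -, hE3, hE4⟩ := hs.errSize_ge
  have hhL := hs.harm_le (Z := coLen w) (by linarith [hs.w_sq_le_cube])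
  have hX := hs.cross_low_le
  set K := avgLen y w
  set L := coLen w
  have hjle : ∀ j ≤ ⌊y ^ 3⌋₊, (j : ℝ) ≤ y ^ 3 := fun j hj =>
    (Nat.le_floor_iff (by positivity)).1 hj
  refine (CubeVariance.abs_VSum_sub_le hx1 (hK1.trans hM) hfl
    (B := fun h => 9 * gTot * h * (y + h) ^ 4) (X := crossBound y)
    (fun h hh j hj => sum_sq_En_le hy.le (Nat.cast_nonneg _) (hjle j hj) (mem_Icc.1 hh).1)
    (fun h hh j hj => abs_crossSum_le_crossBound hy.le (Nat.cast_nonneg _) (hjle j hj)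
      (mem_Icc.1 hh).1)).trans ?_
  set T := errSize y w Λ
  have hT0 : 0 ≤ T := le_trans (by positivity) hE4
  have h1 : 2 * y ^ 3 * ∑ k ∈ range K, ∑ q ∈ Icc 1 (M + k), |crossSum (y ^ 3) q|
      ≤ 2 * (m0 * crossC c) * (K * T) := by
    have : ∀ k ∈ range K, 2 * (y ^ 3 * ∑ q ∈ Icc 1 (M + k), |crossSum (y ^ 3) q|)
        ≤ 2 * (m0 * crossC c * T) := by
      intro k hk
      rw [mem_range] at hk
      have hk' : (k : ℝ) ≤ K := by exact_mod_cast hk.le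
      have := hs.cross_total_le (Z := M + k) (by push_cast; linarith)
      linarith
    have h2 := Finset.sum_le_sum this
    rw [Finset.sum_const, card_range, nsmul_eq_mul, ← Finset.mul_sum, ← Finset.mul_sum] at h2
    linarith
  have h2 : ∑ h ∈ Icc 1 L, (m0 ^ 2 * Gsum h * ((y ^ 3) ^ 2 + K * (2 * y ^ 3))
            + y ^ 3 * (3 * crossBound y h * (K * h)) + y ^ 3 * (4 * (9 * gTot * h * (y + h) ^ 4))) / h
      ≤ (5 * (m0 ^ 2 * gTot) + 3 * (m0 * (54 * gTot * c)) + 5832 * gTot) * (K * T) := by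
    have ht : ∀ h ∈ Icc 1 L, (m0 ^ 2 * Gsum h * ((y ^ 3) ^ 2 + K * (2 * y ^ 3))
            + y ^ 3 * (3 * crossBound y h * (K * h)) + y ^ 3 * (4 * (9 * gTot * h * (y + h) ^ 4))) / h
        ≤ m0 ^ 2 * gTot * ((y ^ 3) ^ 2 + K * (2 * y ^ 3)) * (1 / h)
          + 3 * K * (y ^ 3 * crossBound y h) + 36 * gTot * y ^ 3 * (3 * (y * Λ)) ^ 4 := by
      intro h hh
      rw [mem_Icc] at hh
      have hh0 : (0 : ℝ) < h := by exact_mod_cast hh.1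
      have hhL : (h : ℝ) ≤ L := by exact_mod_cast hh.2
      have hG : Gsum h ≤ gTot := Gsum_le h
      have hyh : y + h ≤ 3 * (y * Λ) := by linarith
      have e : (m0 ^ 2 * Gsum h * ((y ^ 3) ^ 2 + K * (2 * y ^ 3))
            + y ^ 3 * (3 * crossBound y h * (K * h)) + y ^ 3 * (4 * (9 * gTot * h * (y + h) ^ 4))) / h
          = m0 ^ 2 * Gsum h * ((y ^ 3) ^ 2 + K * (2 * y ^ 3)) * (1 / h)
          + 3 * K * (y ^ 3 * crossBound y h) + 36 * gTot * y ^ 3 * (y + h) ^ 4 := by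
        field_simp; ring
      rw [e]
      gcongr
    refine (Finset.sum_le_sum ht).trans ?_
    rw [Finset.sum_add_distrib, Finset.sum_add_distrib, ← Finset.mul_sum, ← Finset.mul_sum,
      ← Finset.mul_sum, Finset.sum_const, nsmul_eq_mul, Nat.card_Icc, add_tsub_cancel_right]
    change m0 ^ 2 * gTot * ((y ^ 3) ^ 2 + K * (2 * y ^ 3)) * harm L + _ + _ ≤ _
    have hw2 : 1 ≤ w ^ 2 := one_le_pow₀ hs.one_le_w
    have hyw : y ^ 3 * w ^ 2 ≤ y ^ 4 * w ^ 4 := by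
      calc y ^ 3 * w ^ 2 = y ^ 3 * 1 * (w ^ 2 * 1) := by ring
        _ ≤ y ^ 3 * y * (w ^ 2 * w ^ 2) := by gcongr; exact hs.one_le_y
        _ = _ := by ring
    have g1 : (y ^ 3) ^ 2 + K * (2 * y ^ 3) ≤ 3 * (K * (y ^ 4 * w ^ 4)) := by
      have a1 : (y ^ 3) ^ 2 ≤ K * (y ^ 3 * w ^ 2) := by
        calc (y ^ 3) ^ 2 = y ^ 3 * y ^ 3 := by ring
          _ ≤ y ^ 3 * (K * w ^ 2) := by gcongr
          _ = _ := by ring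
      have a2 : (K : ℝ) * y ^ 3 ≤ K * (y ^ 3 * w ^ 2) := by
        gcongr; exact le_mul_of_one_le_right (by positivity) hw2
      have a3 : (K : ℝ) * (y ^ 3 * w ^ 2) ≤ K * (y ^ 4 * w ^ 4) := by gcongr
      linarith
    have b1 : m0 ^ 2 * gTot * ((y ^ 3) ^ 2 + K * (2 * y ^ 3)) * harm L
        ≤ 5 * (m0 ^ 2 * gTot) * (K * T) := by
      calc m0 ^ 2 * gTot * ((y ^ 3) ^ 2 + K * (2 * y ^ 3)) * harm L
          ≤ m0 ^ 2 * gTot * (3 * (K * (y ^ 4 * w ^ 4))) * logFactor y := by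
            have := harm_nonneg L
            gcongr
        _ = 3 * (m0 ^ 2 * gTot) * (K * (logFactor y * (y ^ 4 * w ^ 4))) := by ring
        _ ≤ 5 * (m0 ^ 2 * gTot) * (K * T) := by gcongr; norm_num
    have b2 : 3 * (K : ℝ) * (y ^ 3 * ∑ h ∈ Icc 1 L, crossBound y h)
        ≤ 3 * (m0 * (54 * gTot * c)) * (K * T) := by
      calc 3 * (K : ℝ) * (y ^ 3 * ∑ h ∈ Icc 1 L, crossBound y h)
          ≤ 3 * K * (m0 * (54 * gTot * c) * T) := by gcongr
        _ = _ := by ring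
    -- Uses `y³ ≤ K w²` to produce the factor `K`; the constant is `2 · 36 · 3⁴ = 5832`.
    have b3 : (L : ℝ) * (36 * gTot * y ^ 3 * (3 * (y * Λ)) ^ 4) ≤ 5832 * gTot * (K * T) := by
      calc (L : ℝ) * (36 * gTot * y ^ 3 * (3 * (y * Λ)) ^ 4)
          ≤ (2 * w ^ 2) * (36 * gTot * (K * w ^ 2) * (3 * (y * Λ)) ^ 4) := by gcongr
        _ = 5832 * gTot * (K * (1 * Λ ^ 4 * (y ^ 4 * w ^ 4))) := by ring
        _ ≤ 5832 * gTot * (K * (logFactor y * Λ ^ 4 * (y ^ 4 * w ^ 4))) := by gcongr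
        _ ≤ 5832 * gTot * (K * T) := by gcongr
    linarith
  unfold switchC
  linarith

/-- The constant in the bound for the variance over a short initial range. -/
def initC (c : ℝ) : ℝ := 2916 * gTot + 20 * lsC + 2 * m0 ^ 2 * gTot * c ^ 2

/-- At `Q = 2K` no asymptotics are needed: with `L ≈ w²`, the terms `L² y⁴`, `x R / L` and `R K` are
all of order `y⁴ w⁴`, and `x² / L` is absorbed by `y ≤ c w³`. -/
theorem V_two_mul_avgLen_le (hs : Scale c y w Λ) :
    V (y ^ 3) ((2 * avgLen y w : ℕ) : ℝ) ≤ initC c * errSize y w Λ := by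
  have hy := hs.y_pos
  have hw := hs.w_pos
  have hm := m0_pos
  have hg := one_le_gTot
  have hl := lsC_pos
  have hΛ := hs.one_le_Λ
  have hP := hs.one_le_logFactor
  have hP0 : 0 ≤ logFactor y := by linarith
  obtain ⟨hL1, hLw, hL2⟩ := hs.coLen_bounds
  obtain ⟨hK1, hK2, hK3⟩ := hs.avgLen_bounds
  have hK4 := hs.avgLen_le
  have hyΛ := hs.y_add_le
  obtain ⟨-, -, hE3, hE4⟩ := hs.errSize_ge
  refine (V_le hy.le hL1 _).trans ?_
  have hZ : ((2 * avgLen y w : ℕ) : ℝ) ≤ 4 * y ^ 3 := by push_cast; linarith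
  have hh := hs.harm_le hZ
  rw [hs.r3SqSum_eq]
  set K := avgLen y w
  set L := coLen w
  have a1 : 9 * gTot * (L : ℝ) ^ 2 * (y + L) ^ 4 ≤ 2916 * gTot * (Λ ^ 4 * (y ^ 4 * w ^ 4)) := by
    calc 9 * gTot * (L : ℝ) ^ 2 * (y + L) ^ 4
        ≤ 9 * gTot * (2 * w ^ 2) ^ 2 * (3 * (y * Λ)) ^ 4 := by gcongr
      _ = _ := by ring
  have a2 : lsC * y ^ 3 * (w ^ 6 * y) / L ≤ lsC * (y ^ 4 * w ^ 4) := by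
    rw [div_le_iff₀ (lt_of_lt_of_le (by positivity) hLw)]
    calc lsC * y ^ 3 * (w ^ 6 * y) = lsC * (y ^ 4 * w ^ 4) * w ^ 2 := by ring
      _ ≤ _ := by gcongr
  have a3 : lsC * (w ^ 6 * y) * ((2 * K : ℕ) : ℝ) ≤ 4 * lsC * (y ^ 4 * w ^ 4) := by
    push_cast
    calc lsC * (w ^ 6 * y) * (2 * K) = 2 * lsC * (w ^ 4 * y) * (K * w ^ 2) := by ring
      _ ≤ 2 * lsC * (w ^ 4 * y) * (2 * y ^ 3) := by gcongr
      _ = _ := by ring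
  have a4 : 2 * m0 ^ 2 * (y ^ 3) ^ 2 * (gTot / L) ≤ 2 * m0 ^ 2 * gTot * c ^ 2 * (y ^ 4 * w ^ 4) := by
    have := mul_le_mul_of_nonneg_left hs.high_le hm.le
    calc _ = m0 * (y ^ 3 * (2 * m0 * y ^ 3 * (gTot / L))) := by ring
      _ ≤ _ := this
      _ = _ := by ring
  have hΛ4 : 1 ≤ Λ ^ 4 := one_le_pow₀ hΛ
  have a5 : y ^ 4 * w ^ 4 ≤ Λ ^ 4 * (y ^ 4 * w ^ 4) := le_mul_of_one_le_left (by positivity) hΛ4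
  set U := Λ ^ 4 * (y ^ 4 * w ^ 4) with hU
  have hU0 : 0 ≤ U := by positivity
  have hsum : 9 * gTot * (L : ℝ) ^ 2 * (y + L) ^ 4
      + (2 * (2 * (lsC * y ^ 3 * (w ^ 6 * y)) / L + 2 * (lsC * (w ^ 6 * y)) * ((2 * K : ℕ) : ℝ))
        + 2 * m0 ^ 2 * (y ^ 3) ^ 2 * (gTot / L)) ≤ initC c * U := by
    have e : 2 * (lsC * y ^ 3 * (w ^ 6 * y)) / (L : ℝ) = 2 * (lsC * y ^ 3 * (w ^ 6 * y) / L) := by ring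
    rw [e]
    have b1 : lsC * (y ^ 4 * w ^ 4) ≤ lsC * U := by gcongr
    have b2 : 2 * m0 ^ 2 * gTot * c ^ 2 * (y ^ 4 * w ^ 4) ≤ 2 * m0 ^ 2 * gTot * c ^ 2 * U := by gcongr
    unfold initC
    linarith
  have hi : 0 ≤ initC c := by unfold initC; positivity
  have hnn : 0 ≤ harm (2 * K) := harm_nonneg _
  calc _ ≤ harm (2 * K) * (initC c * U) := by gcongr
    _ ≤ logFactor y * (initC c * U) := by gcongr
    _ = initC c * (logFactor y * Λ ^ 4 * (y ^ 4 * w ^ 4)) := by rw [hU]; ring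
    _ ≤ _ := by gcongr

end Scale

/-! ### The asymptotic formula for the variance -/

/-- The coefficient of `Q^{5/3} x^{1/3}` in `Phi`. -/
def secC : ℝ := intJ * ∑' n : ℕ, kA n * (n : ℝ) ^ (2 / 3 : ℝ)

/-- The expected value of the variance. -/
def mainTerm (x t : ℝ) : ℝ :=
  t * r3SqSum x - m0 ^ 2 * (gTot * t * x + secC * (t ^ (5 / 3 : ℝ) * x ^ (1 / 3 : ℝ)))

lemma V_mono (x : ℝ) {M N : ℕ} (h : M ≤ N) : V x M ≤ V x N := by
  rw [V_eq, V_eq, Nat.floor_natCast, Nat.floor_natCast]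
  exact Finset.sum_le_sum_of_subset_of_nonneg (Icc_subset_Icc_right h)
    fun _ _ _ => Finset.sum_nonneg fun _ _ => sq_nonneg _

lemma V_floor (x Q : ℝ) : V x ((⌊Q⌋₊ : ℕ) : ℝ) = V x Q := by
  rw [V_eq, V_eq, Nat.floor_natCast]

lemma V_nonneg (x Q : ℝ) : 0 ≤ V x Q := by
  rw [V_eq]; exact Finset.sum_nonneg fun _ _ => Finset.sum_nonneg fun _ _ => sq_nonneg _

/-! ### Variation of the main term over short ranges. -/

lemma abs_rpow_five_thirds_sub_le {s t b : ℝ} (hs : 0 ≤ s) (ht : 0 ≤ t) (hsb : s ≤ b) (htb : t ≤ b) :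
    |s ^ (5 / 3 : ℝ) - t ^ (5 / 3 : ℝ)| ≤ 5 / 3 * b ^ (2 / 3 : ℝ) * |s - t| := by
  have h := Convex.norm_image_sub_le_of_norm_hasDerivWithin_le (f := fun u : ℝ => u ^ (5 / 3 : ℝ))
    (f' := fun u => 5 / 3 * u ^ (5 / 3 - 1 : ℝ)) (s := Set.Icc 0 b) (C := 5 / 3 * b ^ (2 / 3 : ℝ))
    (x := t) (y := s)
    (fun u _ => (Real.hasDerivAt_rpow_const (Or.inr (by norm_num))).hasDerivWithinAt)
    (fun u hu => by
      rw [Real.norm_eq_abs, abs_of_nonneg (by have := hu.1; positivity)]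
      have : u ^ (5 / 3 - 1 : ℝ) ≤ b ^ (2 / 3 : ℝ) := by
        rw [show (5 / 3 - 1 : ℝ) = 2 / 3 by norm_num]
        exact Real.rpow_le_rpow hu.1 hu.2 (by norm_num)
      linarith)
    (convex_Icc 0 b) ⟨ht, htb⟩ ⟨hs, hsb⟩
  simpa using h

lemma abs_mainTerm_sub_le {x s t : ℝ} (hx : 0 ≤ x) (hs : 0 ≤ s) (ht : 0 ≤ t) (hsb : s ≤ 3 * x)
    (htb : t ≤ 3 * x) :
    |mainTerm x s - mainTerm x t| ≤ (r3SqSum x + m0 ^ 2 * (gTot + 5 * |secC|) * x) * |s - t| := by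
  have h1 := abs_rpow_five_thirds_sub_le hs ht hsb htb
  have hg := one_le_gTot
  have hR := r3SqSum_nonneg x
  have h2 : (3 * x) ^ (2 / 3 : ℝ) * x ^ (1 / 3 : ℝ) ≤ 3 * x := by
    calc (3 * x) ^ (2 / 3 : ℝ) * x ^ (1 / 3 : ℝ) ≤ (3 * x) ^ (2 / 3 : ℝ) * (3 * x) ^ (1 / 3 : ℝ) := by
          gcongr; linarith
      _ = 3 * x := by
          rw [← Real.rpow_add' (by positivity) (by norm_num)]; norm_num
  have h3 : |s ^ (5 / 3 : ℝ) - t ^ (5 / 3 : ℝ)| * x ^ (1 / 3 : ℝ) ≤ 5 * x * |s - t| := by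
    calc _ ≤ 5 / 3 * (3 * x) ^ (2 / 3 : ℝ) * |s - t| * x ^ (1 / 3 : ℝ) := by gcongr
      _ = 5 / 3 * ((3 * x) ^ (2 / 3 : ℝ) * x ^ (1 / 3 : ℝ)) * |s - t| := by ring
      _ ≤ 5 / 3 * (3 * x) * |s - t| := by gcongr
      _ = _ := by ring
  have e : mainTerm x s - mainTerm x t = r3SqSum x * (s - t)
      - (m0 ^ 2 * gTot * x * (s - t)
        + m0 ^ 2 * secC * ((s ^ (5 / 3 : ℝ) - t ^ (5 / 3 : ℝ)) * x ^ (1 / 3 : ℝ))) := by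
    unfold mainTerm; ring
  rw [e]
  refine (abs_sub _ _).trans ?_
  have t1 := abs_add_le (m0 ^ 2 * gTot * x * (s - t))
    (m0 ^ 2 * secC * ((s ^ (5 / 3 : ℝ) - t ^ (5 / 3 : ℝ)) * x ^ (1 / 3 : ℝ)))
  have t2 : |r3SqSum x * (s - t)| = r3SqSum x * |s - t| := by rw [abs_mul, abs_of_nonneg hR]
  have t3 : |m0 ^ 2 * gTot * x * (s - t)| = m0 ^ 2 * gTot * x * |s - t| := by
    rw [abs_mul, abs_of_nonneg (by positivity)]
  have t4 : |m0 ^ 2 * secC * ((s ^ (5 / 3 : ℝ) - t ^ (5 / 3 : ℝ)) * x ^ (1 / 3 : ℝ))|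
      ≤ m0 ^ 2 * |secC| * (5 * x * |s - t|) := by
    rw [abs_mul, abs_mul, abs_of_nonneg (sq_nonneg m0), abs_mul,
      abs_of_nonneg (Real.rpow_nonneg hx _)]
    gcongr
  linarith

lemma mainTerm_zero (x : ℝ) : mainTerm x 0 = 0 := by
  unfold mainTerm; rw [Real.zero_rpow (by norm_num)]; ring

namespace Scale

variable {c y w Λ : ℝ}

/-- The constant in the Lipschitz bound for the main term. -/
def lipC (c : ℝ) : ℝ := 2 + 2 * m0 ^ 2 * (gTot + 5 * |secC|) * c ^ 2

lemma lipC_nonneg (c : ℝ) : 0 ≤ lipC c := by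
  have hg := one_le_gTot
  unfold lipC; positivity

lemma four_le_errSize (hs : Scale c y w Λ) : y ^ 4 * w ^ 4 ≤ errSize y w Λ := by
  have hy := hs.y_pos
  have hw := hs.w_pos
  exact (le_mul_of_one_le_left (by positivity) hs.one_le_logFactor).trans hs.errSize_ge.2.2.2

lemma errSize_nonneg (hs : Scale c y w Λ) : 0 ≤ errSize y w Λ := by
  have hy := hs.y_pos
  have hw := hs.w_pos
  exact le_trans (by positivity) hs.four_le_errSize

/-- Undoing the averaging shifts `Q` by `O(K)`. The resulting change of order `R K` limits the
length of the average. -/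
lemma lip_le (hs : Scale c y w Λ) :
    (r3SqSum (y ^ 3) + m0 ^ 2 * (gTot + 5 * |secC|) * y ^ 3) * avgLen y w
      ≤ lipC c * errSize y w Λ := by
  have hy := hs.y_pos
  have hw := hs.w_pos
  have hg := one_le_gTot
  have h6 := hs.y_pow_six
  obtain ⟨-, -, hK⟩ := hs.avgLen_bounds
  have hK2 : (avgLen y w : ℝ) ≤ 2 * y ^ 3 / w ^ 2 := by rwa [le_div_iff₀ (by positivity)]
  have a1 : w ^ 6 * y * avgLen y w ≤ 2 * (y ^ 4 * w ^ 4) := by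
    calc w ^ 6 * y * avgLen y w = w ^ 4 * y * (avgLen y w * w ^ 2) := by ring
      _ ≤ w ^ 4 * y * (2 * y ^ 3) := by gcongr
      _ = _ := by ring
  have a2 : y ^ 3 * avgLen y w ≤ 2 * c ^ 2 * (y ^ 4 * w ^ 4) := by
    calc y ^ 3 * (avgLen y w : ℝ) ≤ y ^ 3 * (2 * y ^ 3 / w ^ 2) := by gcongr
      _ = 2 * (y ^ 6 / w ^ 2) := by ring
      _ ≤ 2 * (c ^ 2 * (y ^ 4 * w ^ 4)) := by gcongr
      _ = _ := by ring
  have a3 : (r3SqSum (y ^ 3) + m0 ^ 2 * (gTot + 5 * |secC|) * y ^ 3) * avgLen y w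
      ≤ lipC c * (y ^ 4 * w ^ 4) := by
    rw [hs.r3SqSum_eq]
    unfold lipC
    have := mul_le_mul_of_nonneg_left a2 (show 0 ≤ m0 ^ 2 * (gTot + 5 * |secC|) by positivity)
    linarith
  exact a3.trans (mul_le_mul_of_nonneg_left hs.four_le_errSize (lipC_nonneg c))

lemma abs_mainTerm_sub_le (hs : Scale c y w Λ) {s t : ℝ} (h0 : 0 ≤ s) (ht : 0 ≤ t)
    (hsb : s ≤ 3 * y ^ 3) (htb : t ≤ 3 * y ^ 3) {n : ℕ} (hst : |s - t| ≤ n * avgLen y w) :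
    |mainTerm (y ^ 3) s - mainTerm (y ^ 3) t| ≤ n * (lipC c * errSize y w Λ) := by
  have hy := hs.y_pos
  have hg := one_le_gTot
  have hR := r3SqSum_nonneg (y ^ 3)
  refine (CubeVariance.abs_mainTerm_sub_le (by positivity) h0 ht hsb htb).trans ?_
  calc _ ≤ (r3SqSum (y ^ 3) + m0 ^ 2 * (gTot + 5 * |secC|) * y ^ 3) * (n * avgLen y w) := by gcongr
    _ = n * ((r3SqSum (y ^ 3) + m0 ^ 2 * (gTot + 5 * |secC|) * y ^ 3) * avgLen y w) := by ring
    _ ≤ _ := mul_le_mul_of_nonneg_left hs.lip_le (Nat.cast_nonneg n)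

/-- Averaged variance up to a quantity independent of the range. -/
lemma exists_abs_VSum_sub_le (c : ℝ) {δ : ℝ} (h0 : 0 < δ) (h1 : δ < 1 / 3) :
    ∃ C : ℝ, 0 ≤ C ∧ ∀ y w Λ : ℝ, Scale c y w Λ → ∃ Y : ℝ, ∀ (Q : ℝ) (M : ℕ), avgLen y w ≤ M →
      (M : ℝ) ≤ y ^ 3 → (M : ℝ) + avgLen y w ≤ 2 * Q →
      |VSum (y ^ 3) M (avgLen y w) - ∑ k ∈ range (avgLen y w), mainTerm (y ^ 3) ((M + k : ℕ) : ℝ) - Y|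
        ≤ avgLen y w * (C * (errSize y w Λ + Q ^ (2 - δ) * (y ^ 3) ^ δ)) := by
  obtain ⟨C, hC0, hC⟩ := exists_abs_Phi_sub_le h0 h1
  have hm := m0_pos
  refine ⟨|switchC c| + 4 * (m0 ^ 2 * C), by positivity, fun y w Λ hs => ?_⟩
  -- Everything that does not depend on `M`: the full divisor sum and the constant part of `Phi`.
  refine ⟨avgLen y w * (2 * divSum ⌊y ^ 3⌋₊ - m0 ^ 2 * Phi0 (y ^ 3)), fun Q M hM hMx hMQ => ?_⟩
  have hy := hs.y_pos
  have hw := hs.w_pos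
  have hx : 0 < y ^ 3 := by positivity
  have hS := hs.abs_VSum_sub_le hM hMx
  obtain ⟨hK1, hK2, hK3⟩ := hs.avgLen_bounds
  have hT := hs.errSize_nonneg
  have hT4 := hs.four_le_errSize
  set K := avgLen y w
  set T := errSize y w Λ
  have hK0 : (0 : ℝ) < K := by exact_mod_cast hK1
  have hKM : (K : ℝ) ≤ M := by exact_mod_cast hM
  have hQ0 : 0 ≤ Q := by linarith
  have hphi : ∀ k ∈ range K, |((M + k : ℕ) : ℝ) * r3SqSum (y ^ 3) - m0 ^ 2 * Phi (y ^ 3) (M + k)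
      - (mainTerm (y ^ 3) ((M + k : ℕ) : ℝ) - m0 ^ 2 * Phi0 (y ^ 3))|
      ≤ 4 * (m0 ^ 2 * C) * (T + Q ^ (2 - δ) * (y ^ 3) ^ δ) := by
    intro k hk
    rw [mem_range] at hk
    have hk' : (k : ℝ) ≤ K := by exact_mod_cast hk.le
    have h := hC (y ^ 3) (M + k) hx (by omega)
    have e : ((M + k : ℕ) : ℝ) * r3SqSum (y ^ 3) - m0 ^ 2 * Phi (y ^ 3) (M + k)
      - (mainTerm (y ^ 3) ((M + k : ℕ) : ℝ) - m0 ^ 2 * Phi0 (y ^ 3))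
      = -(m0 ^ 2 * (Phi (y ^ 3) (M + k) - (Phi0 (y ^ 3) + (∑' d, A1Term d) * ((M + k : ℕ) : ℝ) * y ^ 3
        + intJ * (∑' n : ℕ, kA n * (n : ℝ) ^ (2 / 3 : ℝ)) *
          (((M + k : ℕ) : ℝ) ^ (5 / 3 : ℝ) * (y ^ 3) ^ (1 / 3 : ℝ))))) := by
      unfold mainTerm secC gTot; ring
    rw [e, abs_neg, abs_mul, abs_of_nonneg (sq_nonneg m0)]
    have hMk1 : (K : ℝ) ≤ ((M + k : ℕ) : ℝ) := by push_cast; have := Nat.cast_nonneg (α := ℝ) k; linarith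
    have hMk2 : ((M + k : ℕ) : ℝ) ≤ 2 * Q := by push_cast; linarith
    have b1 : ((M + k : ℕ) : ℝ) ^ (2 - δ) ≤ 4 * Q ^ (2 - δ) := by
      calc ((M + k : ℕ) : ℝ) ^ (2 - δ) ≤ (2 * Q) ^ (2 - δ) :=
            Real.rpow_le_rpow (Nat.cast_nonneg _) hMk2 (by linarith)
        _ = 2 ^ (2 - δ) * Q ^ (2 - δ) := Real.mul_rpow (by norm_num) hQ0
        _ ≤ 2 ^ (2 : ℝ) * Q ^ (2 - δ) := by
            gcongr
            · norm_num
            · linarith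
        _ = _ := by norm_num
    -- `x² / K ≤ x w²`, which is below `y⁴ w⁴`.
    have b2 : (y ^ 3) ^ 2 / ((M + k : ℕ) : ℝ) ≤ T := by
      rw [div_le_iff₀ (hK0.trans_le hMk1)]
      have hw2 : 1 ≤ w ^ 2 := one_le_pow₀ hs.one_le_w
      calc (y ^ 3) ^ 2 = y ^ 3 * y ^ 3 := by ring
        _ ≤ y ^ 3 * (K * w ^ 2) := by gcongr
        _ = y ^ 3 * 1 * (w ^ 2 * 1) * K := by ring
        _ ≤ y ^ 3 * y * (w ^ 2 * w ^ 2) * K := by gcongr; exact hs.one_le_y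
        _ = (y ^ 4 * w ^ 4) * K := by ring
        _ ≤ T * ((M + k : ℕ) : ℝ) := by gcongr
    have b3 : ((M + k : ℕ) : ℝ) ^ (2 - δ) * (y ^ 3) ^ δ + (y ^ 3) ^ 2 / ((M + k : ℕ) : ℝ)
        ≤ 4 * (T + Q ^ (2 - δ) * (y ^ 3) ^ δ) := by
      have := mul_le_mul_of_nonneg_right b1 (show 0 ≤ (y ^ 3) ^ δ by positivity)
      linarith
    calc _ ≤ m0 ^ 2 * (C * (((M + k : ℕ) : ℝ) ^ (2 - δ) * (y ^ 3) ^ δ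
          + (y ^ 3) ^ 2 / ((M + k : ℕ) : ℝ))) := by gcongr
      _ ≤ m0 ^ 2 * (C * (4 * (T + Q ^ (2 - δ) * (y ^ 3) ^ δ))) := by gcongr
      _ = _ := by ring
  have hsum : |∑ k ∈ range K, (((M + k : ℕ) : ℝ) * r3SqSum (y ^ 3) - m0 ^ 2 * Phi (y ^ 3) (M + k))
      - (∑ k ∈ range K, mainTerm (y ^ 3) ((M + k : ℕ) : ℝ) - K * (m0 ^ 2 * Phi0 (y ^ 3)))|
      ≤ K * (4 * (m0 ^ 2 * C) * (T + Q ^ (2 - δ) * (y ^ 3) ^ δ)) := by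
    have e : ∑ k ∈ range K, (((M + k : ℕ) : ℝ) * r3SqSum (y ^ 3) - m0 ^ 2 * Phi (y ^ 3) (M + k))
      - (∑ k ∈ range K, mainTerm (y ^ 3) ((M + k : ℕ) : ℝ) - K * (m0 ^ 2 * Phi0 (y ^ 3)))
      = ∑ k ∈ range K, (((M + k : ℕ) : ℝ) * r3SqSum (y ^ 3) - m0 ^ 2 * Phi (y ^ 3) (M + k)
        - (mainTerm (y ^ 3) ((M + k : ℕ) : ℝ) - m0 ^ 2 * Phi0 (y ^ 3))) := by
      rw [Finset.sum_sub_distrib, Finset.sum_sub_distrib, Finset.sum_sub_distrib]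
      simp
    rw [e]
    refine (Finset.abs_sum_le_sum_abs _ _).trans ((Finset.sum_le_sum hphi).trans ?_)
    simp
  set S1 := ∑ k ∈ range K, (((M + k : ℕ) : ℝ) * r3SqSum (y ^ 3) - m0 ^ 2 * Phi (y ^ 3) (M + k))
  set S2 := ∑ k ∈ range K, mainTerm (y ^ 3) ((M + k : ℕ) : ℝ)
  have e2 : VSum (y ^ 3) M K - S2 - K * (2 * divSum ⌊y ^ 3⌋₊ - m0 ^ 2 * Phi0 (y ^ 3))
      = (VSum (y ^ 3) M K - (S1 + 2 * (K * divSum ⌊y ^ 3⌋₊)))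
        + (S1 - (S2 - K * (m0 ^ 2 * Phi0 (y ^ 3)))) := by ring
  rw [e2]
  refine (abs_add_le _ _).trans ((add_le_add hS hsum).trans ?_)
  have hQx : 0 ≤ Q ^ (2 - δ) * (y ^ 3) ^ δ := by positivity
  have c1 : switchC c * (K * T) ≤ |switchC c| * (K * (T + Q ^ (2 - δ) * (y ^ 3) ^ δ)) := by
    calc switchC c * (K * T) ≤ |switchC c| * (K * T) := by gcongr; exact le_abs_self _
      _ ≤ _ := by gcongr; linarith
  linarith

/-- Below `2K` the variance and its main term are each of the size of the error. Beyond, the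
averaged formula at `M = K` has a small left side, which bounds the unknown constant `Y`; the
formula at `M` then determines the average there. By monotonicity `V` at `n = ⌊Q⌋` lies between the
averages that start at `n - K` and at `n`. -/
theorem exists_abs_V_sub_mainTerm_le (c : ℝ) {δ : ℝ} (h0 : 0 < δ) (h1 : δ < 1 / 3) :
    ∃ C : ℝ, 0 ≤ C ∧ ∀ y w Λ Q : ℝ, Scale c y w Λ → 0 ≤ Q → Q ≤ y ^ 3 →
      |V (y ^ 3) Q - mainTerm (y ^ 3) Q| ≤ C * (errSize y w Λ + Q ^ (2 - δ) * (y ^ 3) ^ δ) := by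
  obtain ⟨C, hC0, hC⟩ := exists_abs_VSum_sub_le c h0 h1
  refine ⟨2 * C + 6 * lipC c + |initC c|, by have := lipC_nonneg c; positivity,
    fun y w Λ Q hs hQ0 hQx => ?_⟩
  obtain ⟨Y, hY⟩ := hC y w Λ hs
  have hy := hs.y_pos
  have hx : 0 < y ^ 3 := by positivity
  obtain ⟨hK1, hK2, hK3⟩ := hs.avgLen_bounds
  have hKx := hs.avgLen_le
  have hT := hs.errSize_nonneg
  have hin := hs.V_two_mul_avgLen_le
  have hL0 := lipC_nonneg c
  have hfl := Nat.floor_le hQ0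
  have hfl2 := Nat.lt_floor_add_one Q
  set K := avgLen y w
  set T := errSize y w Λ
  set n := ⌊Q⌋₊ with hn
  have hK0 : (0 : ℝ) < K := by exact_mod_cast hK1
  have hK1' : (1 : ℝ) ≤ K := by exact_mod_cast hK1
  have hE0 : 0 ≤ Q ^ (2 - δ) * (y ^ 3) ^ δ := by positivity
  have hin' : V (y ^ 3) ((2 * K : ℕ) : ℝ) ≤ |initC c| * T :=
    hin.trans (mul_le_mul_of_nonneg_right (le_abs_self _) hT)
  rw [← V_floor, ← hn]
  rcases lt_or_ge n (2 * K) with hlt | hge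
  · have a1 : V (y ^ 3) n ≤ |initC c| * T := (V_mono _ hlt.le).trans hin'
    have a2 := V_nonneg (y ^ 3) n
    have hn2 : (n : ℝ) + 1 ≤ 2 * K := by exact_mod_cast hlt
    have a3 := hs.abs_mainTerm_sub_le (s := Q) (t := 0) (n := 2) hQ0 le_rfl (by linarith) (by linarith)
      (by rw [sub_zero, abs_of_nonneg hQ0]; push_cast; linarith)
    rw [mainTerm_zero, sub_zero] at a3
    refine (abs_sub _ _).trans ?_
    rw [abs_of_nonneg a2]
    have b1 : (2 : ℕ) * (lipC c * T) ≤ 6 * lipC c * (T + Q ^ (2 - δ) * (y ^ 3) ^ δ) := by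
      push_cast
      have : lipC c * T ≤ lipC c * (T + Q ^ (2 - δ) * (y ^ 3) ^ δ) := by gcongr; linarith
      have h3 : 0 ≤ lipC c * (T + Q ^ (2 - δ) * (y ^ 3) ^ δ) := by positivity
      linarith
    have b2 : |initC c| * T ≤ |initC c| * (T + Q ^ (2 - δ) * (y ^ 3) ^ δ) := by gcongr; linarith
    have b3 : 0 ≤ 2 * C * (T + Q ^ (2 - δ) * (y ^ 3) ^ δ) := by positivity
    linarith
  · have hge' : (2 : ℝ) * K ≤ n := by exact_mod_cast hge
    have hVK0 : 0 ≤ VSum (y ^ 3) K K := Finset.sum_nonneg fun _ _ => V_nonneg _ _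
    have hVK1 : VSum (y ^ 3) K K ≤ K * (|initC c| * T) := by
      unfold VSum
      refine (Finset.sum_le_sum fun k hk => (V_mono (y ^ 3) (N := 2 * K) ?_).trans hin').trans ?_
      · rw [mem_range] at hk; omega
      · simp
    -- The formula at `M = K` is used only to bound `Y`.
    have hYK := hY Q K le_rfl (by linarith) (by linarith)
    have hmK : |∑ k ∈ range K, mainTerm (y ^ 3) ((K + k : ℕ) : ℝ)| ≤ K * (2 * (lipC c * T)) := by
      refine (Finset.abs_sum_le_sum_abs _ _).trans ?_
      refine (Finset.sum_le_sum fun k hk => ?_).trans (b := ∑ _k ∈ range K, 2 * (lipC c * T)) (by simp)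
      rw [mem_range] at hk
      have hk' : (k : ℝ) ≤ K := by exact_mod_cast hk.le
      have a3 := hs.abs_mainTerm_sub_le (s := ((K + k : ℕ) : ℝ)) (t := 0) (n := 2) (Nat.cast_nonneg _)
        le_rfl (by push_cast; linarith) (by linarith)
        (by rw [sub_zero, Nat.abs_cast]; push_cast; linarith)
      rw [mainTerm_zero, sub_zero] at a3
      exact_mod_cast a3
    have hM : ∀ M : ℕ, K ≤ M → (M : ℝ) ≤ Q → (n : ℝ) ≤ M + K →
        |VSum (y ^ 3) M K - K * mainTerm (y ^ 3) Q|
          ≤ K * ((2 * C + 6 * lipC c + |initC c|) * (T + Q ^ (2 - δ) * (y ^ 3) ^ δ)) := by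
      intro M hM1 hM2 hM3
      have hYM := hY Q M hM1 (by linarith) (by linarith)
      have hmM : |∑ k ∈ range K, mainTerm (y ^ 3) ((M + k : ℕ) : ℝ) - K * mainTerm (y ^ 3) Q|
          ≤ K * (2 * (lipC c * T)) := by
        have e : ∑ k ∈ range K, mainTerm (y ^ 3) ((M + k : ℕ) : ℝ) - K * mainTerm (y ^ 3) Q
            = ∑ k ∈ range K, (mainTerm (y ^ 3) ((M + k : ℕ) : ℝ) - mainTerm (y ^ 3) Q) := by
          rw [Finset.sum_sub_distrib]; simp
        rw [e]
        refine (Finset.abs_sum_le_sum_abs _ _).trans ?_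
        refine (Finset.sum_le_sum fun k hk => ?_).trans (b := ∑ _k ∈ range K, 2 * (lipC c * T))
          (by simp)
        rw [mem_range] at hk
        have hk' : (k : ℝ) ≤ K := by exact_mod_cast hk.le
        have hk0 : (0 : ℝ) ≤ k := Nat.cast_nonneg k
        have a3 := hs.abs_mainTerm_sub_le (s := ((M + k : ℕ) : ℝ)) (t := Q) (n := 2) (Nat.cast_nonneg _)
          hQ0 (by push_cast; linarith) (by linarith)
          (by rw [abs_le]; push_cast; constructor <;> linarith)
        exact_mod_cast a3
      have tri : |VSum (y ^ 3) M K - K * mainTerm (y ^ 3) Q|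
          ≤ |VSum (y ^ 3) M K - ∑ k ∈ range K, mainTerm (y ^ 3) ((M + k : ℕ) : ℝ) - Y|
          + |∑ k ∈ range K, mainTerm (y ^ 3) ((M + k : ℕ) : ℝ) - K * mainTerm (y ^ 3) Q|
          + |VSum (y ^ 3) K K - ∑ k ∈ range K, mainTerm (y ^ 3) ((K + k : ℕ) : ℝ) - Y|
          + |∑ k ∈ range K, mainTerm (y ^ 3) ((K + k : ℕ) : ℝ)| + VSum (y ^ 3) K K := by
        rw [abs_le]
        have u1 := abs_le.1 (le_refl |VSum (y ^ 3) M K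
          - ∑ k ∈ range K, mainTerm (y ^ 3) ((M + k : ℕ) : ℝ) - Y|)
        have u2 := abs_le.1 (le_refl |∑ k ∈ range K, mainTerm (y ^ 3) ((M + k : ℕ) : ℝ)
          - K * mainTerm (y ^ 3) Q|)
        have u3 := abs_le.1 (le_refl |VSum (y ^ 3) K K
          - ∑ k ∈ range K, mainTerm (y ^ 3) ((K + k : ℕ) : ℝ) - Y|)
        have u4 := abs_le.1 (le_refl |∑ k ∈ range K, mainTerm (y ^ 3) ((K + k : ℕ) : ℝ)|)
        constructor <;> linarith [u1.1, u1.2, u2.1, u2.2, u3.1, u3.2, u4.1, u4.2]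
      have b1 : K * (lipC c * T) ≤ K * (lipC c * (T + Q ^ (2 - δ) * (y ^ 3) ^ δ)) := by
        gcongr; linarith
      have b2 : K * (|initC c| * T) ≤ K * (|initC c| * (T + Q ^ (2 - δ) * (y ^ 3) ^ δ)) := by
        gcongr; linarith
      have b3 : 0 ≤ K * (lipC c * (T + Q ^ (2 - δ) * (y ^ 3) ^ δ)) := by positivity
      linarith
    have hup := hM n (by omega) hfl (by linarith)
    have hlo := hM (n - K) (by omega)
      (by rw [Nat.cast_sub (by omega)]; linarith) (by rw [Nat.cast_sub (by omega)]; linarith)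
    have hV1 : K * V (y ^ 3) n ≤ VSum (y ^ 3) n K := by
      unfold VSum
      calc (K : ℝ) * V (y ^ 3) n = ∑ _k ∈ range K, V (y ^ 3) n := by simp
        _ ≤ _ := Finset.sum_le_sum fun k _ => V_mono _ (by omega)
    have hV2 : VSum (y ^ 3) (n - K) K ≤ K * V (y ^ 3) n := by
      unfold VSum
      calc _ ≤ ∑ _k ∈ range K, V (y ^ 3) n := Finset.sum_le_sum fun k hk => V_mono _ (by
            rw [mem_range] at hk; omega)
        _ = _ := by simp
    rw [abs_le] at hup hlo
    have hfin : |K * (V (y ^ 3) n - mainTerm (y ^ 3) Q)|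
        ≤ K * ((2 * C + 6 * lipC c + |initC c|) * (T + Q ^ (2 - δ) * (y ^ 3) ^ δ)) := by
      rw [abs_le, mul_sub]; constructor <;> linarith [hup.1, hup.2, hlo.1, hlo.2]
    rw [abs_mul, Nat.abs_cast] at hfin
    exact le_of_mul_le_mul_left hfin hK0

end Scale

/-! ### Bounds for `r₃` -/

lemma add_one_le_mul_pow_rpow {η : ℝ} (hη : 0 < η) {p : ℕ} (hp : 2 ≤ p) (a : ℕ) :
    (a : ℝ) + 1 ≤ (1 + 1 / (η * Real.log 2)) * ((p : ℝ) ^ a) ^ η := by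
  have hl : 0 < Real.log 2 := Real.log_pos (by norm_num)
  have h2 : (2 : ℝ) ≤ p := by exact_mod_cast hp
  have h1 : 1 + a * (η * Real.log 2) ≤ ((2 : ℝ) ^ a) ^ η := by
    rw [Real.rpow_def_of_pos (by positivity), Real.log_pow]
    have := Real.add_one_le_exp (a * Real.log 2 * η)
    linarith
  have h3 : ((2 : ℝ) ^ a) ^ η ≤ ((p : ℝ) ^ a) ^ η := by gcongr
  have hpos : 0 < η * Real.log 2 := by positivity
  calc (a : ℝ) + 1 ≤ (1 + 1 / (η * Real.log 2)) * (1 + a * (η * Real.log 2)) := by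
        have : (1 + 1 / (η * Real.log 2)) * (1 + a * (η * Real.log 2))
          = a + 1 + (a * (η * Real.log 2) + 1 / (η * Real.log 2)) := by field_simp; ring
        rw [this]
        have : 0 ≤ a * (η * Real.log 2) + 1 / (η * Real.log 2) := by positivity
        linarith
    _ ≤ _ := by gcongr; exact h1.trans h3

lemma add_one_le_pow_rpow {η : ℝ} (hη : 0 < η) {p : ℕ} (hp : (2 : ℝ) ^ (1 / η) ≤ p) (a : ℕ) :
    (a : ℝ) + 1 ≤ ((p : ℝ) ^ a) ^ η := by
  have h0 : (a : ℝ) + 1 ≤ 2 ^ a := by exact_mod_cast Nat.lt_two_pow_self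
  have h1 : (2 : ℝ) ^ a = (((2 : ℝ) ^ (1 / η)) ^ a) ^ η := by
    rw [← Real.rpow_natCast, ← Real.rpow_natCast, ← Real.rpow_mul (by positivity),
      ← Real.rpow_mul (by positivity)]
    congr 1
    field_simp
  rw [h1] at h0
  exact h0.trans (by gcongr)

/-- The divisor bound. -/
lemma exists_card_divisors_le {η : ℝ} (hη : 0 < η) :
    ∃ C : ℝ, 0 ≤ C ∧ ∀ n : ℕ, 1 ≤ n → (n.divisors.card : ℝ) ≤ C * (n : ℝ) ^ η := by
  -- Primes `p ≥ 2^(1/η)` satisfy `a + 1 ≤ 2^a ≤ p^(aη)` without loss; each of the finitely many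
  -- smaller primes costs at most `C₀`.
  set B := ⌈(2 : ℝ) ^ (1 / η)⌉₊
  set C₀ := 1 + 1 / (η * Real.log 2)
  have hl : 0 < Real.log 2 := Real.log_pos (by norm_num)
  have hC₀ : 1 ≤ C₀ := le_add_of_nonneg_right (by positivity)
  refine ⟨C₀ ^ B, by positivity, fun n hn => ?_⟩
  have hn0 : n ≠ 0 := by omega
  have h1 : ∀ p ∈ n.primeFactors, ((n.factorization p : ℝ) + 1)
      ≤ (if p < B then C₀ else 1) * (((p : ℝ) ^ n.factorization p) ^ η) := by
    intro p hp
    split_ifs with h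
    · exact add_one_le_mul_pow_rpow hη (Nat.prime_of_mem_primeFactors hp).two_le _
    · rw [one_mul]
      exact add_one_le_pow_rpow hη (Nat.ceil_le.1 (not_lt.1 h)) _
  have h2 : (n : ℝ) ^ η = ∏ p ∈ n.primeFactors, ((p : ℝ) ^ n.factorization p) ^ η := by
    rw [Real.finsetProd_rpow _ _ (fun _ _ => by positivity)]
    congr 1
    conv_lhs => rw [← Nat.prod_factorization_pow_eq_self hn0]
    rw [Finsupp.prod, Nat.support_factorization]
    push_cast
    rfl
  have h3 : ∏ p ∈ n.primeFactors, (if p < B then C₀ else 1) ≤ C₀ ^ B := by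
    rw [← Finset.prod_filter, Finset.prod_const]
    refine pow_le_pow_right₀ hC₀ ?_
    calc _ ≤ (range B).card := Finset.card_le_card fun p hp => by
          rw [mem_filter] at hp; exact mem_range.2 hp.2
      _ = B := card_range B
  rw [Nat.card_divisors hn0, h2]
  push_cast
  calc _ ≤ ∏ p ∈ n.primeFactors, (if p < B then C₀ else 1) * (((p : ℝ) ^ n.factorization p) ^ η) :=
        Finset.prod_le_prod (fun _ _ => by positivity) h1
    _ = _ := Finset.prod_mul_distrib
    _ ≤ _ := by gcongr

/-- Representations as a sum of two positive cubes. -/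
lemma card_two_cubes_le (N m : ℕ) (hm : m ≠ 0) :
    ((Icc 1 N ×ˢ Icc 1 N).filter fun t : ℕ × ℕ => t.1 ^ 3 + t.2 ^ 3 = m).card
      ≤ 2 * m.divisors.card := by
  have : (m.divisors ×ˢ (Finset.univ : Finset Bool)).card = 2 * m.divisors.card := by
    rw [Finset.card_product]; simp [mul_comm]
  rw [← this]
  -- The sum `a + b` divides `a³ + b³` and, together with `m`, determines `a b`, hence the unordered
  -- pair. The Boolean records the order.
  refine Finset.card_le_card_of_injOn (fun t => (t.1 + t.2, decide (t.1 < t.2))) ?_ ?_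
  · rintro ⟨a, b⟩ h
    simp only [coe_filter, Set.mem_ofPred_eq] at h
    simp only [coe_product, Set.mem_prod, mem_coe, Nat.mem_divisors, Finset.mem_univ, and_true]
    refine ⟨?_, hm⟩
    rw [← h.2]
    exact Odd.nat_add_dvd_pow_add_pow a b (by decide)
  · rintro ⟨a, b⟩ h ⟨c, d⟩ h' heq
    simp only [coe_filter, Set.mem_ofPred_eq, mem_product, mem_Icc] at h h'
    simp only [Prod.mk.injEq, decide_eq_decide] at heq
    obtain ⟨hs, hlt⟩ := heq
    have hs' : (a : ℤ) + b = c + d := by exact_mod_cast hs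
    have hc : (a : ℤ) ^ 3 + b ^ 3 = c ^ 3 + d ^ 3 := by exact_mod_cast h.2.trans h'.2.symm
    have hpos : (0 : ℤ) < a + b := by have := h.1.1.1; omega
    have hab : (a : ℤ) * b = c * d := by
      have : 3 * ((a : ℤ) + b) * (a * b) = 3 * ((a : ℤ) + b) * (c * d) := by
        have e1 : 3 * ((a : ℤ) + b) * (a * b) = (a + b) ^ 3 - (a ^ 3 + b ^ 3) := by ring
        have e2 : 3 * ((c : ℤ) + d) * (c * d) = (c + d) ^ 3 - (c ^ 3 + d ^ 3) := by ring
        rw [e1, hc, hs', e2]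
      exact mul_left_cancel₀ (by positivity) this
    have hz : ((a : ℤ) - c) * (a - d) = 0 := by
      have hb : (b : ℤ) = c + d - a := by linarith
      rw [hb] at hab
      linear_combination (-1 : ℤ) * hab
    rcases mul_eq_zero.1 hz with h0 | h0
    · have : a = c := by omega
      subst this
      simp only [Prod.mk.injEq, true_and]; omega
    · have : a = d := by omega
      subst this
      simp only [Prod.mk.injEq]; omega

/-- The first root has at most `n^(1/3)` values, and for each the remaining number is a sum of two
cubes in `O(n^η)` ways by the divisor bound. -/
lemma exists_r3_le {η : ℝ} (hη : 0 < η) :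
    ∃ C : ℝ, 0 ≤ C ∧ ∀ n : ℕ, (r3 n : ℝ) ≤ C * (n : ℝ) ^ (1 / 3 + η) := by
  obtain ⟨C, hC, h⟩ := exists_card_divisors_le hη
  refine ⟨2 * C, by positivity, fun n => ?_⟩
  rcases Nat.eq_zero_or_pos n with rfl | hn
  · simpa [r3] using by positivity
  have hn' : (0 : ℝ) < n := by exact_mod_cast hn
  set K := ⌊2 * C * (n : ℝ) ^ η⌋₊ with hK
  set k := ⌊(n : ℝ) ^ (1 / 3 : ℝ)⌋₊ with hk
  have key : r3 n ≤ K * (Icc 1 k).card := by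
    unfold r3
    refine Finset.card_le_mul_card_image_of_maps_to (f := fun t : ℕ × ℕ × ℕ => t.1) ?_ _ ?_
    · rintro ⟨a, b, c⟩ ht
      simp only [mem_filter, mem_product, mem_Icc] at ht ⊢
      refine ⟨ht.1.1.1, Nat.le_floor ?_⟩
      have h3 : a ^ 3 ≤ n := by rw [← ht.2]; omega
      have h4 : (a : ℝ) ^ 3 ≤ n := by exact_mod_cast h3
      calc (a : ℝ) = ((a : ℝ) ^ 3) ^ (1 / 3 : ℝ) := by
            rw [← Real.rpow_natCast, ← Real.rpow_mul (by positivity)]; norm_num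
        _ ≤ _ := by gcongr
    · intro b _
      rcases le_or_gt n (b ^ 3) with hb | hb
      · have : (((Icc 1 n ×ˢ Icc 1 n ×ˢ Icc 1 n).filter
            fun t : ℕ × ℕ × ℕ => t.1 ^ 3 + t.2.1 ^ 3 + t.2.2 ^ 3 = n).filter
            fun t => t.1 = b) = ∅ := by
          refine Finset.eq_empty_of_forall_notMem ?_
          rintro ⟨a, c, d⟩ ht
          simp only [mem_filter, mem_product, mem_Icc] at ht
          obtain ⟨⟨ht, hs⟩, rfl⟩ := ht
          have : 0 < c ^ 3 := pow_pos (by omega) 3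
          omega
        rw [this]; simp
      · have hm : n - b ^ 3 ≠ 0 := by omega
        have h1 : (((Icc 1 n ×ˢ Icc 1 n ×ˢ Icc 1 n).filter
            fun t : ℕ × ℕ × ℕ => t.1 ^ 3 + t.2.1 ^ 3 + t.2.2 ^ 3 = n).filter
            fun t => t.1 = b).card ≤ 2 * (n - b ^ 3).divisors.card := by
          refine le_trans ?_ (card_two_cubes_le n (n - b ^ 3) hm)
          refine Finset.card_le_card_of_injOn (fun t => t.2) ?_ ?_
          · rintro ⟨a, c, d⟩ ht
            simp only [coe_filter, Set.mem_ofPred_eq, mem_filter, mem_product] at ht ⊢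
            obtain ⟨⟨ht, hs⟩, rfl⟩ := ht
            exact ⟨ht.2, by omega⟩
          · rintro ⟨a, c, d⟩ ht ⟨a', c', d'⟩ ht' he
            simp only [coe_filter, Set.mem_ofPred_eq, mem_filter] at ht ht'
            simp only at he
            rw [ht.2, ht'.2, he]
        refine h1.trans (Nat.le_floor ?_)
        push_cast
        have h2 := h (n - b ^ 3) (by omega)
        have h3 : ((n - b ^ 3 : ℕ) : ℝ) ≤ n := by exact_mod_cast Nat.sub_le _ _
        calc (2 : ℝ) * ((n - b ^ 3).divisors.card : ℝ) ≤ 2 * (C * (n : ℝ) ^ η) := by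
              gcongr
              exact h2.trans (by gcongr)
          _ = _ := by ring
  have h1 : (r3 n : ℝ) ≤ K * k := by
    rw [Nat.card_Icc, Nat.add_sub_cancel] at key
    exact_mod_cast key
  calc (r3 n : ℝ) ≤ K * k := h1
    _ ≤ (2 * C * (n : ℝ) ^ η) * (n : ℝ) ^ (1 / 3 : ℝ) := by
      gcongr
      · exact Nat.floor_le (by positivity)
      · exact Nat.floor_le (by positivity)
    _ = _ := by rw [Real.rpow_add hn']; ring

/-- `∑_{n ≤ x} r₃(n)`. -/
def r3Sum (x : ℝ) : ℝ := ∑ n ∈ Icc 1 ⌊x⌋₊, (r3 n : ℝ)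

/-- The lattice point estimate for the trivial modulus; `12 = 3 · 2²` since `y + 1 ≤ 2y`. -/
lemma abs_r3Sum_sub_le {x : ℝ} (hx : 1 ≤ x) :
    |r3Sum x - m0 * x| ≤ 12 * x ^ (2 / 3 : ℝ) := by
  have hx0 : 0 ≤ x := by linarith
  set y := x ^ (1 / 3 : ℝ) with hy
  have hy1 : 1 ≤ y := Real.one_le_rpow hx (by norm_num)
  have hyx : y ^ 3 = x := by
    rw [hy, ← Real.rpow_natCast, ← Real.rpow_mul hx0]; norm_num
  have hy2 : x ^ (2 / 3 : ℝ) = y ^ 2 := by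
    rw [hy, ← Real.rpow_natCast, ← Real.rpow_mul hx0]; norm_num
  have h := abs_En_le y (by linarith) 1 1 one_pos
  have hr : rho 1 1 = 1 := by
    unfold rho; simp [Nat.ModEq, Nat.mod_one]
  have hu : upsilon x 1 1 = r3Sum x := by
    unfold upsilon r3Sum
    rw [Finset.filter_true_of_mem fun n _ => Nat.modEq_one]
  unfold En at h
  rw [hr, hyx, hu] at h
  norm_num at h
  rw [hy2]
  refine h.trans ?_
  nlinarith

/-! ### Growth of the mean square of `r₃`. -/

lemma r3SqSum_le_r3Sum {x K : ℝ} (hK : ∀ n ∈ Icc 1 ⌊x⌋₊, (r3 n : ℝ) ≤ K) :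
    r3SqSum x ≤ K * r3Sum x := by
  unfold r3SqSum r3Sum
  rw [Finset.mul_sum]
  refine Finset.sum_le_sum fun n hn => ?_
  rw [sq]
  exact mul_le_mul_of_nonneg_right (hK n hn) (Nat.cast_nonneg _)

lemma r3Sum_sq_le {x : ℝ} (hx : 0 ≤ x) : r3Sum x ^ 2 ≤ x * r3SqSum x := by
  have h := sq_sum_le_card_mul_sum_sq (s := Icc 1 ⌊x⌋₊) (f := fun n => (r3 n : ℝ))
  rw [Nat.card_Icc, Nat.add_sub_cancel] at h
  exact h.trans (mul_le_mul_of_nonneg_right (Nat.floor_le hx) (r3SqSum_nonneg x))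

/-- Cauchy–Schwarz against the asymptotically linear first moment. -/
lemma exists_mul_le_r3SqSum : ∃ c : ℝ, 0 < c ∧ ∀ᶠ x : ℝ in atTop, c * x ≤ r3SqSum x := by
  have hm := m0_pos
  refine ⟨m0 ^ 2 / 4, by positivity, ?_⟩
  have ht : Tendsto (fun x : ℝ => x ^ (1 / 3 : ℝ)) atTop atTop := tendsto_rpow_atTop (by norm_num)
  filter_upwards [eventually_ge_atTop 1, ht.eventually_ge_atTop (24 / m0)] with x hx hx2
  have hx0 : 0 < x := by linarith
  have h1 := (abs_le.1 (abs_r3Sum_sub_le hx)).1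
  have h2 : 12 * x ^ (2 / 3 : ℝ) ≤ m0 * x / 2 := by
    have e : x = x ^ (2 / 3 : ℝ) * x ^ (1 / 3 : ℝ) := by
      rw [← Real.rpow_add hx0]; norm_num
    have h3 : 24 ≤ m0 * x ^ (1 / 3 : ℝ) := by rw [div_le_iff₀ hm] at hx2; linarith
    have h4 : 0 < x ^ (2 / 3 : ℝ) := by positivity
    calc 12 * x ^ (2 / 3 : ℝ) = x ^ (2 / 3 : ℝ) * 24 / 2 := by ring
      _ ≤ x ^ (2 / 3 : ℝ) * (m0 * x ^ (1 / 3 : ℝ)) / 2 := by gcongr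
      _ = m0 * (x ^ (2 / 3 : ℝ) * x ^ (1 / 3 : ℝ)) / 2 := by ring
      _ = _ := by rw [← e]
  have h3 : m0 * x / 2 ≤ r3Sum x := by linarith
  have h4 : (m0 * x / 2) ^ 2 ≤ x * r3SqSum x :=
    (pow_le_pow_left₀ (by positivity) h3 2).trans (r3Sum_sq_le hx0.le)
  have : x * (m0 ^ 2 / 4 * x) ≤ x * r3SqSum x := by linarith
  exact le_of_mul_le_mul_left this hx0

lemma eventually_r3SqSum_le {η : ℝ} (hη : 0 < η) :
    ∀ᶠ x : ℝ in atTop, r3SqSum x ≤ x ^ (4 / 3 + η) := by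
  obtain ⟨C, hC, h⟩ := exists_r3_le (half_pos hη)
  have hm := m0_pos
  have ht : Tendsto (fun x : ℝ => x ^ (η / 2)) atTop atTop := tendsto_rpow_atTop (by positivity)
  filter_upwards [eventually_ge_atTop 1, ht.eventually_ge_atTop (C * (m0 + 12))] with x hx hx2
  have hx0 : 0 < x := by linarith
  have h1 : r3Sum x ≤ (m0 + 12) * x := by
    have := (abs_le.1 (abs_r3Sum_sub_le hx)).2
    have h2 : x ^ (2 / 3 : ℝ) ≤ x := by
      conv_rhs => rw [← Real.rpow_one x]
      exact Real.rpow_le_rpow_of_exponent_le hx (by norm_num)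
    linarith
  have h2 := r3SqSum_le_r3Sum (x := x) (K := C * x ^ (1 / 3 + η / 2)) fun n hn => by
    rw [mem_Icc] at hn
    have : (n : ℝ) ≤ x := (Nat.cast_le.2 hn.2).trans (Nat.floor_le hx0.le)
    exact (h n).trans (by gcongr)
  calc r3SqSum x ≤ C * x ^ (1 / 3 + η / 2) * r3Sum x := h2
    _ ≤ C * x ^ (1 / 3 + η / 2) * ((m0 + 12) * x) := by gcongr
    _ = C * (m0 + 12) * (x ^ (1 / 3 + η / 2) * x ^ (1 : ℝ)) := by rw [Real.rpow_one]; ring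
    _ ≤ x ^ (η / 2) * (x ^ (1 / 3 + η / 2) * x ^ (1 : ℝ)) := by gcongr
    _ = _ := by
      rw [← Real.rpow_add hx0, ← Real.rpow_add hx0]; congr 1; ring

lemma eventually_r3SqSum_le_upperExponent {η : ℝ} (hη : 0 < η) :
    ∀ᶠ x : ℝ in atTop, r3SqSum x ≤ x ^ (upperExponent + η) := by
  obtain ⟨c, hc, hlow⟩ := exists_mul_le_r3SqSum
  -- A real `limsup` controls eventual values only for a function bounded above; the pointwise bound
  -- for `r₃` supplies this.
  have hb : IsBoundedUnder (· ≤ ·) atTop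
      (fun x : ℝ => Real.log (r3SqSum x) / Real.log x) := by
    refine ⟨4 / 3 + 1, ?_⟩
    rw [eventually_map]
    filter_upwards [eventually_gt_atTop 1, eventually_r3SqSum_le one_pos, hlow] with x hx h1 h2
    have hx0 : 0 < x := by linarith
    have hl := Real.log_pos hx
    rw [div_le_iff₀ hl, ← Real.log_rpow hx0]
    exact Real.log_le_log (lt_of_lt_of_le (by positivity) h2) h1
  have hlt := eventually_lt_of_limsup_lt (f := atTop) (b := upperExponent + η)
    (u := fun x : ℝ => Real.log (r3SqSum x) / Real.log x) (by
      change upperExponent < _; linarith) hb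
  filter_upwards [hlt, eventually_gt_atTop 1, hlow] with x h hx h2
  have hx0 : 0 < x := by linarith
  have hR : 0 < r3SqSum x := lt_of_lt_of_le (by positivity) h2
  have hl := Real.log_pos hx
  rw [div_lt_iff₀ hl, ← Real.log_rpow hx0] at h
  exact ((Real.log_lt_log_iff hR (by positivity)).1 h).le

/-! ### The theorem in terms of the mean square -/

lemma logFactor_le {x η : ℝ} (hη : 0 < η) (hx : 1 ≤ x) :
    logFactor (x ^ (1 / 3 : ℝ)) ≤ (1 + 4 ^ η / η) * x ^ η := by
  have hx0 : 0 ≤ x := by linarith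
  have h : (x ^ (1 / 3 : ℝ)) ^ 3 = x := by
    rw [← Real.rpow_natCast, ← Real.rpow_mul hx0]; norm_num
  unfold logFactor
  rw [h]
  have h1 := Real.log_le_rpow_div (show 0 ≤ 4 * x by linarith) hη
  have h2 : 1 ≤ x ^ η := Real.one_le_rpow hx hη.le
  rw [Real.mul_rpow (by norm_num) hx0] at h1
  calc 1 + Real.log (4 * x) ≤ x ^ η + 4 ^ η * x ^ η / η := by linarith
    _ = _ := by ring

/-- `y⁴ = x^(4/3)` and `w⁴ = R^(2/3) x^(-2/9)`, and `4/3 - 2/9 = 10/9`. -/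
lemma errSize_eq {x R η : ℝ} (hx : 0 < x) (hR : 0 < R) :
    errSize (x ^ (1 / 3 : ℝ)) ((R / x ^ (1 / 3 : ℝ)) ^ (1 / 6 : ℝ)) (x ^ η)
      = logFactor (x ^ (1 / 3 : ℝ)) ^ 2 * (x ^ (10 / 9 + 4 * η) * R ^ (2 / 3 : ℝ)) := by
  have h1 : (x ^ (1 / 3 : ℝ)) ^ 4 = x ^ (4 / 3 : ℝ) := by
    rw [← Real.rpow_natCast, ← Real.rpow_mul hx.le]; norm_num
  have h2 : ((R / x ^ (1 / 3 : ℝ)) ^ (1 / 6 : ℝ)) ^ 4 = R ^ (2 / 3 : ℝ) / x ^ (2 / 9 : ℝ) := by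
    rw [← Real.rpow_natCast, ← Real.rpow_mul (by positivity),
      Real.div_rpow hR.le (by positivity), ← Real.rpow_mul hx.le]
    norm_num
  have h3 : (x ^ η) ^ 4 = x ^ (4 * η) := by
    rw [← Real.rpow_natCast, ← Real.rpow_mul hx.le]; congr 1; push_cast; ring
  have h4 : x ^ (4 / 3 : ℝ) = x ^ (10 / 9 : ℝ) * x ^ (2 / 9 : ℝ) := by
    rw [← Real.rpow_add hx]; norm_num
  unfold errSize
  rw [h1, h2, h3, h4, Real.rpow_add hx]
  have : x ^ (2 / 9 : ℝ) ≠ 0 := by positivity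
  field_simp

lemma exists_scale {η : ℝ} (hη : 0 < η) : ∃ c : ℝ, ∀ᶠ x : ℝ in atTop,
    Scale c (x ^ (1 / 3 : ℝ)) ((r3SqSum x / x ^ (1 / 3 : ℝ)) ^ (1 / 6 : ℝ)) (x ^ η) := by
  obtain ⟨c, hc, hlow⟩ := exists_mul_le_r3SqSum
  refine ⟨(1 / c) ^ (1 / 2 : ℝ), ?_⟩
  have ht : Tendsto (fun x : ℝ => x ^ (2 / 3 : ℝ)) atTop atTop := tendsto_rpow_atTop (by norm_num)
  filter_upwards [hlow, eventually_ge_atTop 1, ht.eventually_ge_atTop (1 / c),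
    eventually_r3SqSum_le (show 0 < 3 * η by positivity), eventually_r3SqSum_le one_pos]
    with x h1 hx h2 h3 h4
  have hx0 : 0 < x := by linarith
  set R := r3SqSum x with hRdef
  have hR : 0 < R := lt_of_lt_of_le (by positivity) h1
  set y := x ^ (1 / 3 : ℝ) with hy
  have hy0 : 0 < y := by positivity
  have hyx : y ^ 3 = x := by
    rw [hy, ← Real.rpow_natCast, ← Real.rpow_mul hx0.le]; norm_num
  set w := (R / y) ^ (1 / 6 : ℝ) with hw
  have hw0 : 0 < w := by positivity
  have hw6 : w ^ 6 = R / y := by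
    rw [hw, ← Real.rpow_natCast, ← Real.rpow_mul (by positivity)]; norm_num
  have hw6y : w ^ 6 * y = R := by rw [hw6]; field_simp
  have hyR : y ≤ R := by
    have e : x = y * x ^ (2 / 3 : ℝ) := by rw [hy, ← Real.rpow_add hx0]; norm_num
    have : y * (c * (1 / c)) ≤ y * (c * x ^ (2 / 3 : ℝ)) := by gcongr
    rw [mul_one_div_cancel hc.ne'] at this
    calc y ≤ y * (c * x ^ (2 / 3 : ℝ)) := by linarith
      _ = c * (y * x ^ (2 / 3 : ℝ)) := by ring
      _ ≤ R := by rw [← e]; exact h1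
  refine ⟨Real.one_le_rpow hx (by norm_num), Real.one_le_rpow ((one_le_div hy0).2 hyR) (by norm_num),
    Real.one_le_rpow hx hη.le, ?_, ?_, ?_, ?_⟩
  -- Squared, the claim `y ≤ c w³` is the lower bound `R ≫ x`.
  · refine (pow_le_pow_iff_left₀ hy0.le (by positivity) (two_ne_zero)).1 ?_
    have e : ((1 / c) ^ (1 / 2 : ℝ)) ^ 2 = 1 / c := by
      rw [← Real.rpow_natCast, ← Real.rpow_mul (by positivity)]; norm_num
    rw [mul_pow, e, ← pow_mul, hw6, one_div_mul_eq_div, div_div, le_div_iff₀ (by positivity)]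
    calc y ^ 2 * (y * c) = c * y ^ 3 := by ring
      _ ≤ R := by rw [hyx]; exact h1
  -- Cubed, the claim `w² ≤ y Λ` is `R ≤ x^(4/3 + 3η)`.
  · refine (pow_le_pow_iff_left₀ (by positivity) (by positivity) three_ne_zero).1 ?_
    rw [← pow_mul, hw6, div_le_iff₀ hy0]
    refine h3.trans (le_of_eq ?_)
    rw [hy, ← Real.rpow_add hx0, ← Real.rpow_natCast, ← Real.rpow_mul hx0.le, ← Real.rpow_add hx0]
    congr 1; push_cast; ring
  · refine (pow_le_pow_iff_left₀ (by positivity) (by positivity) three_ne_zero).1 ?_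
    rw [← pow_mul, hw6, div_le_iff₀ hy0, hyx]
    refine h4.trans ?_
    rw [hy, ← Real.rpow_natCast, ← Real.rpow_add hx0]
    exact Real.rpow_le_rpow_of_exponent_le hx (by norm_num)
  · rw [hyx, hw6y]

/-- The variance in terms of the mean square of `r₃`. -/
lemma exists_abs_V_sub_mainTerm_le {ε δ : ℝ} (hε : 0 < ε) (h0 : 0 < δ) (h1 : δ < 1 / 3) :
    ∃ C : ℝ, 0 ≤ C ∧ ∀ᶠ x : ℝ in atTop, ∀ Q : ℝ, 0 ≤ Q → Q ≤ x → |V x Q - mainTerm x Q|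
      ≤ C * (x ^ (10 / 9 + ε) * r3SqSum x ^ (2 / 3 : ℝ) + Q ^ (2 - δ) * x ^ δ) := by
  -- The square of the logarithmic factor costs two powers of `x^(ε/6)` and `Λ⁴` costs four.
  have hη : 0 < ε / 6 := by positivity
  obtain ⟨c, hc⟩ := exists_scale hη
  obtain ⟨C, hC, hV⟩ := Scale.exists_abs_V_sub_mainTerm_le c h0 h1
  obtain ⟨c', hc', hlow⟩ := exists_mul_le_r3SqSum
  set K := 1 + 4 ^ (ε / 6) / (ε / 6) with hK
  have hK1 : 1 ≤ K := le_add_of_nonneg_right (by positivity)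
  refine ⟨C * K ^ 2, by positivity, ?_⟩
  filter_upwards [hc, hlow, eventually_ge_atTop 1] with x hs h2 hx Q hQ hQx
  have hx0 : 0 < x := by linarith
  have hR : 0 < r3SqSum x := lt_of_lt_of_le (by positivity) h2
  have hyx : (x ^ (1 / 3 : ℝ)) ^ 3 = x := by
    rw [← Real.rpow_natCast, ← Real.rpow_mul hx0.le]; norm_num
  have h3 := hV _ _ _ Q hs hQ (by rw [hyx]; exact hQx)
  rw [hyx, errSize_eq hx0 hR] at h3
  refine h3.trans ?_
  have h4 : logFactor (x ^ (1 / 3 : ℝ)) ^ 2 ≤ (K * x ^ (ε / 6)) ^ 2 :=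
    pow_le_pow_left₀ (by linarith [hs.one_le_logFactor]) (logFactor_le hη hx) 2
  have h5 : (x ^ (ε / 6)) ^ 2 * x ^ (10 / 9 + 4 * (ε / 6)) = x ^ (10 / 9 + ε) := by
    rw [← Real.rpow_natCast, ← Real.rpow_mul hx0.le, ← Real.rpow_add hx0]
    congr 1; push_cast; ring
  have h6 : logFactor (x ^ (1 / 3 : ℝ)) ^ 2 * (x ^ (10 / 9 + 4 * (ε / 6)) * r3SqSum x ^ (2 / 3 : ℝ))
      ≤ K ^ 2 * (x ^ (10 / 9 + ε) * r3SqSum x ^ (2 / 3 : ℝ)) := by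
    calc _ ≤ (K * x ^ (ε / 6)) ^ 2 * (x ^ (10 / 9 + 4 * (ε / 6)) * r3SqSum x ^ (2 / 3 : ℝ)) := by
          gcongr
      _ = _ := by rw [← h5]; ring
  have h7 : Q ^ (2 - δ) * x ^ δ ≤ K ^ 2 * (Q ^ (2 - δ) * x ^ δ) :=
    le_mul_of_one_le_left (by positivity) (one_le_pow₀ hK1)
  rw [mul_assoc]
  gcongr
  linarith

lemma A1_eq : A1 = m0 ^ 2 * gTot := by
  unfold A1 m0 gTot; ring

lemma A2_eq : A2 = -((m0 ^ 2 * secC : ℝ) : ℂ) := by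
  unfold A2 secC m0
  rw [D0_eq]
  have h := intJ_eq
  push_cast at h ⊢
  rw [h]
  ring_nf

lemma norm_U0 (x Q : ℝ) : ‖U0 x Q‖ = |V x Q - mainTerm x Q| := by
  have : U0 x Q = ((V x Q - mainTerm x Q : ℝ) : ℂ) := by
    unfold U0 mainTerm
    rw [A1_eq, A2_eq]
    push_cast
    ring
  rw [this, Complex.norm_real, Real.norm_eq_abs]

lemma exists_norm_U0_le {ε δ : ℝ} (hε : 0 < ε) (h0 : 0 < δ) (h1 : δ < 1 / 3) :
    ∃ C x₀ : ℝ, ∀ x Q : ℝ, x₀ ≤ x → x ^ (1 / 2 : ℝ) * Real.log x ≤ Q → Q ≤ x →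
      ‖U0 x Q‖ ≤ C * (x ^ (10 / 9 + ε) * r3SqSum x ^ (2 / 3 : ℝ) + Q ^ (2 - δ) * x ^ δ) := by
  obtain ⟨C, -, h⟩ := exists_abs_V_sub_mainTerm_le hε h0 h1
  obtain ⟨x₀, hx₀⟩ := eventually_atTop.1 (h.and (eventually_ge_atTop 1))
  refine ⟨C, x₀, fun x Q hx hQ hQx => ?_⟩
  obtain ⟨hV, h1⟩ := hx₀ x hx
  rw [norm_U0]
  exact hV Q (le_trans (mul_nonneg (by positivity) (Real.log_nonneg h1)) hQ) hQx

lemma exists_norm_U0_le_upperExponent {ε δ : ℝ} (hε : 0 < ε) (h0 : 0 < δ) (h1 : δ < 1 / 3) :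
    ∃ C x₀ : ℝ, ∀ x Q : ℝ, x₀ ≤ x → x ^ (1 / 2 : ℝ) * Real.log x ≤ Q → Q ≤ x →
      ‖U0 x Q‖ ≤ C * (x ^ (10 / 9 + 2 / 3 * upperExponent + ε) + Q ^ (2 - δ) * x ^ δ) := by
  obtain ⟨C, hC, h⟩ := exists_abs_V_sub_mainTerm_le (half_pos hε) h0 h1
  -- The loss `3/4 ε` in the exponent of `R` becomes `ε/2` under the power `2/3`; the other `ε/2` is
  -- spent in the bound for the variance.
  obtain ⟨x₀, hx₀⟩ := eventually_atTop.1 (h.and ((eventually_ge_atTop 1).and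
    (eventually_r3SqSum_le_upperExponent (show 0 < 3 / 4 * ε by positivity))))
  refine ⟨C, x₀, fun x Q hx hQ hQx => ?_⟩
  obtain ⟨hV, h1, h2⟩ := hx₀ x hx
  have hx0 : 0 < x := by linarith
  rw [norm_U0]
  refine (hV Q (le_trans (mul_nonneg (by positivity) (Real.log_nonneg h1)) hQ) hQx).trans ?_
  have h3 : x ^ (10 / 9 + ε / 2) * r3SqSum x ^ (2 / 3 : ℝ)
      ≤ x ^ (10 / 9 + 2 / 3 * upperExponent + ε) := by
    calc _ ≤ x ^ (10 / 9 + ε / 2) * (x ^ (upperExponent + 3 / 4 * ε)) ^ (2 / 3 : ℝ) := by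
          gcongr
          exact r3SqSum_nonneg x
      _ = _ := by
          rw [← Real.rpow_mul hx0.le, ← Real.rpow_add hx0]; congr 1; ring
  gcongr

end CubeVariance

end

theorem theorem1 :
    -- the series in `A₁` and the Euler product `D₀(-5/3)` in `A₂` converge
    Summable CubeVariance.A1Term ∧
    Multipliable (fun p : {p : ℕ // p.Prime ∧ p ≠ 3} => CubeVariance.D0Factor (-5 / 3) p) ∧
    ∀ ε δ : ℝ, 0 < ε → 0 < δ → δ < 1 / 3 →
      (∃ C x₀ : ℝ, ∀ x Q : ℝ, x₀ ≤ x → x ^ (1 / 2 : ℝ) * Real.log x ≤ Q → Q ≤ x →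
        ‖CubeVariance.U0 x Q‖ ≤
          C * (x ^ (10 / 9 + 2 / 3 * CubeVariance.upperExponent + ε) + Q ^ (2 - δ) * x ^ δ)) ∧
      (CubeVariance.lowerExponent = CubeVariance.upperExponent →
        ∃ C x₀ : ℝ, ∀ x Q : ℝ, x₀ ≤ x → x ^ (1 / 2 : ℝ) * Real.log x ≤ Q → Q ≤ x →
          ‖CubeVariance.U0 x Q‖ ≤
            C * (x ^ (10 / 9 + ε) * CubeVariance.r3SqSum x ^ (2 / 3 : ℝ)
              + Q ^ (2 - δ) * x ^ δ)) := by
  refine ⟨CubeVariance.summable_A1Term, CubeVariance.multipliable_D0Factor, fun ε δ hε h0 h1 =>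
    ⟨CubeVariance.exists_norm_U0_le_upperExponent hε h0 h1, fun _ =>
      CubeVariance.exists_norm_U0_le hε h0 h1⟩⟩
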